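/- **Setting.** Let $n\ge 1$, let $W\in\mathbb C[x]$ be such that $W'$ is monic of degree $n$, and let $f\in\mathbb C[x]$ have degree $n-1$ with leading coefficient $-4t$ (so $t\neq0$). Let $y^2=W'(x)^2+f(x)=\prod_{i=1}^n(x-a_i^-)(x-a_i^+)$ with $2n$ distinct branch points, let $\Sigma$ be the corresponding hyperelliptic Riemann surface, $Q,Q'$ its two points at infinity (upper and lower sheet) and $\hat\Sigma=\Sigma\setminus\{Q,Q'\}$. Let $\gamma:\mathbb R\to\mathbb C$ be a smooth regular path without self-intersections, tending to infinity in both directions, with $\gamma(s)=s$ for all large $s$, that passes through $a_1^-,a_1^+,\dots,a_n^-,a_n^+$ in this order; the cut $\mathcal C_i$ is the part of $\gamma$ from $a_i^-$ to $a_i^+$. Let $y_0$ be the branch of $y$ that is holomorphic on $\mathbb C\setminus\bigcup_i\mathcal C_i$ with $y_0\sim+W'$ at infinity; it is the value of $y$ on the upper sheet, and $-y_0$ is its value on the lower sheet. Put $\zeta=y\,dx$ and $\omega_0=(W'-y_0)/(2t)$, and let $$\rho_0(s)=\dot\gamma(s)\lim_{\epsilon\to0^+}\frac1{2\pi i}\big[\omega_0(\gamma(s)-i\epsilon\dot\gamma(s))-\omega_0(\gamma(s)+i\epsilon\dot\gamma(s))\big],$$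 $$S_i=t\int_{\gamma^{-1}(\mathcal C_i)}\rho_0\,ds,\qquad \tilde S_i=S_1+\dots+S_i\quad(1\le i\le n-1),$$ $$\mathcal F_0=t^2\,\mathcal P\!\!\iint\ln(\gamma(s)-\gamma(s'))\rho_0(s)\rho_0(s')\,ds\,ds'-t\int W(\gamma(s))\rho_0(s)\,ds ,$$ where $\ln(x-\gamma(s'))$ is cut along the part of $\gamma$ preceding $\gamma(s')$, is asymptotic to the real logarithm $\ln x$ for $x\to+\infty$, and $\mathcal P$ denotes the average of the boundary values on the two sides of $\gamma$. For fixed $W$, $\mathcal F_0$ is regarded as a function of the local coordinates $(t,\tilde S)=(t,\tilde S_1,\dots,\tilde S_{n-1})$: one takes any parametrisation of curves by $(t,\tilde S)$ in an open set, with the coefficients of $f$ holomorphic and the marked path $\gamma$ smooth in the parameters (the parameter values of $\gamma$ at the branch points being constant, and $\gamma(s)=s$ for $s\ge s_0$ with $s_0$ independent of the parameters). For large real $\Lambda_0$, let $\hat\beta=\hat\beta_{\Lambda_0}$ be the class of the path on $\hat\Sigma$ that runs from the point $\Lambda_0'$ over $x=\Lambda_0$ on the lower sheet backwards along $\gamma$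 to $a_n^+$ and then along $\gamma$ on the upper sheet to the point $\Lambda_0$. It is represented by $C^1$ paths on $\hat\Sigma$ with the same end points that avoid the branch points and are homotopic to this path on $\hat\Sigma$ with fixed end points. Let $R\in\mathbb C[x]$ be an arbitrary polynomial of degree at most $n-1$ and $$\varphi=\frac{P(x)}{y},\qquad P=WW'-\frac{2t}{n+1}x^n+R,\qquad \langle\hat\beta,\zeta\rangle:=\int_{\hat\beta}(\zeta-d\varphi).$$ **Claims.** 1. At $Q$ and at $Q'$ the form $\zeta-d\varphi$ has a simple pole: in the coordinate $u=1/x$ it is $(\pm 2t/u+\text{holomorphic})\,du$ (upper sign at $Q$). Moreover $\varphi=\pm W(x)+O(1/x)$ there, the error being holomorphic in $u$. 2. Let $\rho$ be holomorphic on $\hat\Sigma$ and $\tilde\zeta=\zeta+d\rho$. Then $\tilde\zeta-d(\varphi+\rho)$ has the same polar parts at $Q,Q'$, and $\int_{\hat\beta}(\tilde\zeta-d(\varphi+\rho))=\langle\hat\beta,\zeta\rangle$. More generally, let $\tilde\varphi$ be holomorphic on $\hat\Sigma$ outside a finite set and such that $\tilde\zeta-d\tilde\varphi$ has at most simple poles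 at $Q$ and $Q'$. Then $\tilde\varphi-\varphi-\rho$ has finite limits $c_Q,c_{Q'}$ at $Q,Q'$, and, for representatives of $\hat\beta$ that avoid the singularities of $\tilde\varphi$, $$\int_{\hat\beta}(\tilde\zeta-d\tilde\varphi)=\langle\hat\beta,\zeta\rangle-(c_Q-c_{Q'})+O(1/\Lambda_0).$$ So, once the integration constants are fixed ($c_Q=c_{Q'}$), the pairing depends only on the class $[\zeta]\in H^1(\hat\Sigma)$, up to $O(1/\Lambda_0)$. 3. The partial derivative $\partial\mathcal F_0/\partial t$ at fixed $\tilde S$ exists (as a complex derivative), and, as $\Lambda_0\to\infty$, uniformly over the representatives of $\hat\beta$, $$\tfrac12\langle\hat\beta,\zeta\rangle=\frac{\partial\mathcal F_0(t,\tilde S)}{\partial t}-t\log\Lambda_0^2+O(1/\Lambda_0).$$ 4. Let $X_{def}=\{(v,w,x,z)\in\mathbb C^4: W'(x)^2+f(x)+v^2+w^2+z^2=0\}$ and $\Omega=\dfrac{dx\wedge dv\wedge dw}{2z}$, and let $\Gamma_{\hat\beta}$ be $-\frac12$ times the fibration over $\hat\beta$ (a path in $\hat\Sigma$) by the two-spheres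 $\{(v,w,z)=iy\,u:\ u\in S^2\}$ over $(x,y)$, which lie in $X_{def}$ (the factor accounts for the segment in the $x$-plane being covered once on each sheet, the sign is the choice of orientation). Let $$\Phi=\frac{P(x)}{W'(x)^2+f(x)}\cdot\frac{v\,dw\wedge dz+w\,dz\wedge dv+z\,dv\wedge dw}{2(v^2+w^2+z^2)},$$ whose restriction to each fibre $x=\mathrm{const}$ of $X_{def}$ is, where $z\ne0$, $\frac{P(x)}{W'(x)^2+f(x)}\cdot\frac{dv\wedge dw}{2z}$. Then $$\int_{\Gamma_{\hat\beta}}\Omega=-i\pi\int_{\hat\beta}\zeta,\qquad \int_{\Gamma_{\hat\beta}}d\Phi=-i\pi\int_{\hat\beta}d\varphi,$$ $$\langle\Gamma_{\hat\beta},\Omega\rangle:=\int_{\Gamma_{\hat\beta}}(\Omega-d\Phi)=-i\pi\int_{\hat\beta}(\zeta-d\varphi),$$ $$-\frac1{2\pi i}\langle\Gamma_{\hat\beta},\Omega\rangle=\frac{\partial\mathcal F_0(t,\tilde S)}{\partial t}-t\log\Lambda_0^2+O(1/\Lambda_0).$$ -/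

import Mathlib

open Polynomial Filter Topology
open scoped ContDiff

noncomputable section

/-! ### The hyperelliptic curve, its cuts, and the branch on the upper sheet -/

/-- A hyperelliptic curve `y² = W'(x)² + f(x)` of genus `g` (so `n = g + 1` cuts), together with a
path `γ : ℝ → ℂ` in the `x`-plane carrying the cuts: the `i`-th cut is `γ [left i, right i]`. -/
structure MarkedCurve (g : ℕ) where
  W : ℂ[X]
  f : ℂ[X]
  path : ℝ → ℂ
  left : Fin (g + 1) → ℝ
  right : Fin (g + 1) → ℝ

namespace MarkedCurve

variable {g : ℕ} (C : MarkedCurve g)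

/-- The polynomial `y² = W'² + f`. -/
def ySq : ℂ[X] := derivative C.W ^ 2 + C.f

/-- The standing assumptions: `W'` is monic of degree `n = g + 1`; `f` has degree `n - 1 = g`;
the path is smooth, regular, without self-intersections, goes to infinity in both directions and
finally runs along the positive real axis; the `2n` distinct points
`a_i^- = γ (left i)`, `a_i^+ = γ (right i)`, passed in the order `a_1^-, a_1^+, …, a_n^-, a_n^+`,
are the branch points of the curve. -/
structure IsValid : Prop where
  monic_deriv : (derivative C.W).Monic
  natDegree_deriv : (derivative C.W).natDegree = g + 1
  degree_f : C.f.degree = g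
  path_smooth : ContDiff ℝ ∞ C.path
  path_regular : ∀ s, deriv C.path s ≠ 0
  path_injective : Function.Injective C.path
  path_atBot : Tendsto C.path atBot (cocompact ℂ)
  path_atTop : ∀ᶠ s : ℝ in atTop, C.path s = (s : ℂ)
  left_lt_right : ∀ i, C.left i < C.right i
  right_lt_left : ∀ i j, i < j → C.right i < C.left j
  branch : C.ySq = ∏ i, (X - Polynomial.C (C.path (C.left i))) * (X - Polynomial.C (C.path (C.right i)))

/-- The parameter `t`: the leading coefficient of `f` is `-4t`. -/
def t : ℂ := -(C.f.coeff g) / 4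

/-- The affine curve, i.e. the Riemann surface with the two points at infinity removed. -/
def affine : Set (ℂ × ℂ) := {q | q.2 ^ 2 = C.ySq.eval q.1}

/-- The union of the cuts. -/
def cuts : Set ℂ := ⋃ i, C.path '' Set.Icc (C.left i) (C.right i)

/-- `y` is the branch of `√(W'² + f)` on the upper sheet: holomorphic outside the cuts and
asymptotic to `+W'` at infinity. These conditions determine `y` outside the cuts. -/
structure IsUpperBranch (y : ℂ → ℂ) : Prop where
  sq : ∀ x, y x ^ 2 = C.ySq.eval x
  holo : DifferentiableOn ℂ y C.cutsᶜ
  asymp : Tendsto (fun x => y x / (derivative C.W).eval x) (cocompact ℂ) (𝓝 1)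

/-- The branch on the upper sheet; the branch on the lower sheet is `-y0`. -/
def y0 : ℂ → ℂ := Classical.epsilon C.IsUpperBranch

/-! ### Spectral density, filling fractions and the planar free energy -/

/-- The planar resolvent `ω₀ = (W' - y₀) / (2t)`. -/
def resolvent (x : ℂ) : ℂ := ((derivative C.W).eval x - C.y0 x) / (2 * C.t)

/-- The (complex) spectral density: the discontinuity of the resolvent across the path, times
`dγ/ds`. It vanishes off the cuts. -/
def density (s : ℝ) : ℂ :=
  deriv C.path s * limUnder (𝓝[>] (0 : ℝ)) (fun ε : ℝ =>
    1 / (2 * Real.pi * Complex.I) *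
      (C.resolvent (C.path s - Complex.I * ε * deriv C.path s)
        - C.resolvent (C.path s + Complex.I * ε * deriv C.path s)))

/-- `S_i = t ∫_{γ⁻¹(cut i)} ρ₀ ds`. -/
def filling (i : Fin (g + 1)) : ℂ := C.t * ∫ s in (C.left i)..(C.right i), C.density s

/-- `S̃_i = S_1 + ⋯ + S_i` for `i = 1, …, n - 1`. -/
def fillingSum (i : Fin g) : ℂ := ∑ j ∈ Finset.Iic i.castSucc, C.filling j

/-- For `s' < s`: the value at `x = γ(s)` of the branch of `log (x - γ(s'))` that is continued
along `γ` from large positive `x`, where it is asymptotic to the real logarithm of `x`. -/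
def logAlong (s s' : ℝ) : ℂ :=
  limUnder atTop (fun L : ℝ =>
    (Real.log L : ℂ) - ∫ σ in s..L, deriv C.path σ / (C.path σ - C.path s'))

/-- The principal value of `log (γ(s) - γ(s'))`, the branch of `log (x - γ(s'))` being cut along
the part of `γ` that precedes `γ(s')`. For `s' < s` it is the value of the branch at `γ(s)`. For
`s < s'` the values on the two sides of the cut are `log (γ(s') - γ(s)) ± iπ`, and their average is
the continuation along `γ` of `log (γ(s') - γ(s))`. -/
def pvLog (s s' : ℝ) : ℂ := C.logAlong (max s s') (min s s')

/-- The planar free energy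
`𝓕₀ = t² 𝒫∫∫ log (γ(s) - γ(s')) ρ₀(s) ρ₀(s') ds ds' - t ∫ W(γ(s)) ρ₀(s) ds`. -/
def freeEnergy : ℂ :=
  C.t ^ 2 * (∫ s : ℝ, ∫ s' : ℝ, C.pvLog s s' * C.density s * C.density s')
    - C.t * ∫ s : ℝ, C.W.eval (C.path s) * C.density s

/-! ### The relative cycle `β̂` -/

/-- The last branch point `a_n^+` is `γ (lastMark)`. -/
def lastMark : ℝ := C.right (Fin.last g)

/-- The standard representative of `β̂` with cut-off `L`: backwards along `γ` on the lower sheet from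
`L'` to the branch point `a_n^+` and then along `γ` on the upper sheet from `a_n^+` to `L`
(parameter `r ∈ [0,1]`). -/
def betaStd (L r : ℝ) : ℂ × ℂ :=
  (C.path (C.lastMark + |2 * r - 1| * (L - C.lastMark)),
    (if r < 1 / 2 then -1 else 1) * C.y0 (C.path (C.lastMark + |2 * r - 1| * (L - C.lastMark))))

/-- The path `b`, from the point `L'` on the lower sheet to the point `L` on the upper sheet,
represents the relative cycle `β̂`: it is `C¹`, lies on the affine curve, avoids the branch points
(where forms `d(P/y)` have double poles), and is homotopic on the affine curve, with fixed end
points, to the standard representative. -/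
structure IsBetaHat (L : ℝ) (b : Path ((L : ℂ), -C.y0 L) ((L : ℂ), C.y0 L)) : Prop where
  smooth : ContDiffOn ℝ 1 b.extend (Set.Icc 0 1)
  mem : ∀ r, b r ∈ C.affine
  avoids : ∀ r, (b r).2 ≠ 0
  homotopic : ∃ H : C(unitInterval × unitInterval, ℂ × ℂ),
    (∀ q, H q ∈ C.affine) ∧ (∀ r, H (0, r) = b r) ∧ (∀ r, H (1, r) = C.betaStd L r) ∧
    (∀ q, H (q, 0) = ((L : ℂ), -C.y0 L)) ∧ (∀ q, H (q, 1) = ((L : ℂ), C.y0 L))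

/-! ### One-forms, poles at infinity, and the pairing -/

/-- The one-form `ζ = y dx`. -/
def zeta (q : ℂ × ℂ) : ℂ × ℂ →L[ℂ] ℂ := q.2 • ContinuousLinearMap.fst ℂ ℂ ℂ

/-- The local coordinate `u = 1/x` at the point at infinity of the upper sheet (`σ = 1`, the point
`Q`) or of the lower sheet (`σ = -1`, the point `Q'`): the point with coordinate `u ≠ 0`. -/
def atInfinity (σ : ℂ) (u : ℂ) : ℂ × ℂ := (u⁻¹, σ * C.y0 u⁻¹)

/-- At `Q` (`σ = 1`) or `Q'` (`σ = -1`) the one-form `η` is `(c/u + holomorphic) du`: it has a pole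
of order at most one, with residue `c`. -/
def HasSimplePole (η : ℂ × ℂ → ℂ × ℂ →L[ℂ] ℂ) (σ c : ℂ) : Prop :=
  ∃ k : ℂ → ℂ, AnalyticAt ℂ k 0 ∧
    ∀ᶠ u in 𝓝[≠] (0 : ℂ), η (C.atInfinity σ u) (deriv (C.atInfinity σ) u) = c / u + k u

/-- The polynomial `P = W W' - (2t/(n+1)) xⁿ + R`, with `n = g + 1`. -/
def numerator (R : ℂ[X]) : ℂ[X] :=
  C.W * derivative C.W - Polynomial.C (2 * C.t / (g + 2)) * X ^ (g + 1) + R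

/-- The function `φ = P/y = (W W' - (2t/(n+1)) xⁿ + R)/y`. -/
def phi (R : ℂ[X]) (q : ℂ × ℂ) : ℂ := (C.numerator R).eval q.1 / q.2

end MarkedCurve

/-- The regularised pairing `∫_b (η - dφ)`. -/
def regPairing {a₀ a₁ : ℂ × ℂ} (b : Path a₀ a₁) (η : ℂ × ℂ → ℂ × ℂ →L[ℂ] ℂ)
    (φ : ℂ × ℂ → ℂ) : ℂ :=
  curveIntegral (fun q => η q - fderiv ℂ φ q) b

/-! ### The local Calabi-Yau threefold -/

/-- The wedge product `ℓ₀ ∧ ⋯ ∧ ℓ_{k-1}` of covectors on `ℂ⁴`, whose value at `(m₀, …, m_{k-1})` is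
`det (ℓ_j (m_i))`. -/
def wedge {k : ℕ} (l : Fin k → ((Fin 4 → ℂ) →L[ℂ] ℂ)) : (Fin 4 → ℂ) [⋀^Fin k]→L[ℂ] ℂ :=
  { (Matrix.detRowAlternating (R := ℂ) (n := Fin k)).compLinearMap
      (LinearMap.pi fun j => (l j : (Fin 4 → ℂ) →ₗ[ℂ] ℂ)) with
    cont := by
      change Continuous fun m : Fin k → Fin 4 → ℂ =>
        Matrix.det (Matrix.of fun i j => l j (m i))
      refine Continuous.matrix_det (continuous_matrix fun i j => ?_)
      exact (l j).continuous.comp (continuous_apply i) }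

/-- Coordinates on `ℂ⁴` are `(v, w, x, z) = (p 0, p 1, p 2, p 3)`; `dCoord i` is the differential of
the `i`-th one. -/
def dCoord (i : Fin 4) : (Fin 4 → ℂ) →L[ℂ] ℂ := ContinuousLinearMap.proj i

/-- The holomorphic three-form `Ω = dx ∧ dv ∧ dw / (2z)`. -/
def Omega (p : Fin 4 → ℂ) : (Fin 4 → ℂ) [⋀^Fin 3]→L[ℂ] ℂ :=
  (1 / (2 * p 3)) • wedge ![dCoord 2, dCoord 0, dCoord 1]

/-- The parametrised two-sphere `{(v,w,z) = i y u : u ∈ S²}` in the fibre of the threefold over a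
point `(x,y)` of the affine curve; `u` is given in spherical coordinates. -/
def fibreSphere (q : ℂ × ℂ) (θ ψ : ℝ) : Fin 4 → ℂ :=
  ![Complex.I * q.2 * (Real.sin θ * Real.cos ψ), Complex.I * q.2 * (Real.sin θ * Real.sin ψ),
    q.1, Complex.I * q.2 * Real.cos θ]

/-- The integral of a three-form over the three-chain `Γ_b`. This chain is `-1/2` times the
`S²`-fibration over the path `b` in the affine curve: `b` runs over the segment in the `x`-plane
once on each sheet, so that the `S²`-fibration over this segment is covered twice, and the sign is
the choice of orientation for which `∫_{Γ_b} Ω = -iπ ∫_b ζ`. -/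
def integralGamma {a₀ a₁ : ℂ × ℂ} (b : Path a₀ a₁)
    (η : (Fin 4 → ℂ) → (Fin 4 → ℂ) [⋀^Fin 3]→L[ℂ] ℂ) : ℂ :=
  -(1 / 2) * ∫ s in (0 : ℝ)..1, ∫ θ in (0 : ℝ)..Real.pi, ∫ ψ in (0 : ℝ)..(2 * Real.pi),
    η (fibreSphere (b.extend s) θ ψ)
      ![deriv (fun s' => fibreSphere (b.extend s') θ ψ) s,
        deriv (fun θ' => fibreSphere (b.extend s) θ' ψ) θ,
        deriv (fun ψ' => fibreSphere (b.extend s) θ ψ') ψ]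

namespace MarkedCurve

variable {g : ℕ} (C : MarkedCurve g)

/-- The deformed threefold `W'(x)² + f(x) + v² + w² + z² = 0`. -/
def Xdef : Set (Fin 4 → ℂ) := {p | C.ySq.eval (p 2) + p 0 ^ 2 + p 1 ^ 2 + p 3 ^ 2 = 0}

/-- The coordinate expression `(P(x) / (W'(x)² + f(x))) dv ∧ dw / (2z)`, `P` being the numerator
of `φ`, for a two-form along the fibres `x = const` of the threefold (where `z ≠ 0`). -/
def PhiFibre (R : ℂ[X]) (p : Fin 4 → ℂ) : (Fin 4 → ℂ) [⋀^Fin 2]→L[ℂ] ℂ :=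
  ((C.numerator R).eval (p 2) / C.ySq.eval (p 2) * (1 / (2 * p 3))) • wedge ![dCoord 0, dCoord 1]

/-- The two-form `Φ`. On a fibre `x = const`, where `v² + w² + z²` is constant, one has
`dv ∧ dw / z = dw ∧ dz / v = dz ∧ dv / w = (v dw ∧ dz + w dz ∧ dv + z dv ∧ dw) / (v² + w² + z²)`;
the last expression is used since it is regular also at `z = 0`. -/
def Phi (R : ℂ[X]) (p : Fin 4 → ℂ) : (Fin 4 → ℂ) [⋀^Fin 2]→L[ℂ] ℂ :=
  ((C.numerator R).eval (p 2) / C.ySq.eval (p 2) * (1 / (2 * (p 0 ^ 2 + p 1 ^ 2 + p 3 ^ 2)))) •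
    (p 0 • wedge ![dCoord 1, dCoord 3] + p 1 • wedge ![dCoord 3, dCoord 0]
      + p 3 • wedge ![dCoord 0, dCoord 1])

/-- The lifted pairing `⟨Γ_b, Ω⟩ = ∫_{Γ_b} (Ω - dΦ)`. -/
def liftedPairing {a₀ a₁ : ℂ × ℂ} (b : Path a₀ a₁) (R : ℂ[X]) : ℂ :=
  integralGamma b (fun p => Omega p - extDeriv (C.Phi R) p)

end MarkedCurve

/-! ### The coordinates `(t, S̃)` -/

/-- A local parametrisation of the curves with given `W` by the coordinates
`(t, S̃) = (t, S̃_1, …, S̃_{n-1})` in an open set, the coefficients of `f` depending holomorphically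
and the marked path smoothly on the parameters. -/
structure CurveFamily (g : ℕ) (W : ℂ[X]) where
  U : Set (ℂ × (Fin g → ℂ))
  isOpen : IsOpen U
  curve : ℂ × (Fin g → ℂ) → MarkedCurve g
  valid : ∀ p ∈ U, (curve p).IsValid
  potential : ∀ p ∈ U, (curve p).W = W
  coord_t : ∀ p ∈ U, (curve p).t = p.1
  coord_S : ∀ p ∈ U, ∀ i, (curve p).fillingSum i = p.2 i
  holo : ∀ k, DifferentiableOn ℂ (fun p => (curve p).f.coeff k) U
  smooth : ContDiffOn ℝ ∞ (fun q : (ℂ × (Fin g → ℂ)) × ℝ => (curve q.1).path q.2)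
    (U ×ˢ Set.univ)
  marks : ∀ p ∈ U, ∀ p' ∈ U, (curve p).left = (curve p').left ∧ (curve p).right = (curve p').right
  tail : ∃ s₀ : ℝ, ∀ p ∈ U, ∀ s, s₀ ≤ s → (curve p).path s = (s : ℂ)

end

noncomputable section

/-! ### Continuous logarithms -/

/-! Everything hinges on the effective potential V(s) = 2 ∫ log(γ(s) - γ(s')) m(s') ds' - W(γ(s)),
where m = t ρ₀ is the mass density carried by the cuts. Its value V* at the last branch point is
computed in two ways: it is ∂𝓕₀/∂t, and it is the finite part of ∫ y₀ dx from that branch point to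
Λ₀.

The analytic input is the Cauchy representation y₀ = W' - 2 ∫ m(s')/(x - γ(s')) ds' with total mass
t (`MarkedCurve.prodBranch_eq_and_integral_mass`, `MarkedCurve.y0_tube_eq`). For one cut, 1/√((x - γ
l)(x - γ r)) is written as a Cauchy integral, since both satisfy the same linear differential
equation; a product over the cuts is then expanded by partial fractions
(`exists_prod_eq_cauchyIntegral`). Connectedness of the complement of an arc is never used: all
comparisons run along the path or along parallel curves in a thin tube around it, on which the
kernels are controlled by `TubeBound`. Logarithms of γ(s) - γ(s') are handled by splitting off log
|s - s'| and taking a global continuous logarithm of the divided difference (`pathLog`).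

Averaging the representation over the two sides of the path shows that V' is -γ' times the mean
boundary value of y₀ (`MarkedCurve.effPotential_sub`). On a cut the two boundary values are
opposite, so V is constant there (`MarkedCurve.effPotential_of_mem`). Beyond the last cut the mean
is y₀ itself, so ∫ y₀ dx = V* - V(Λ₀), and V(Λ₀) = 2t log Λ₀ - W(Λ₀) + O(1/Λ₀)
(`MarkedCurve.exists_norm_integral_y0_sub_le`).

For the derivative of 𝓕₀, all integrals live on a fixed parameter line, and both the path and the
density vary. To first order the displacement of the path contributes nothing: this is the loop
equation (`MarkedCurve.integral_integral_divDiff_mul_mass`). The variation of the density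
contributes ∫ V δm, which is the sum over the cuts of V on the cut times the change of its filling.
At fixed S̃ only the last filling changes, and it changes by δt, which leaves V* δt. The remainder
is quadratic (`MarkedCurve.exists_norm_freeEnergy_sub_le`), so the complex derivative exists and
equals V* (`CurveFamily.hasDerivAt_freeEnergy`).

The form y dx is holomorphic also at branch points, where y is a local coordinate. It therefore has
local primitives everywhere on the affine curve, and its integral over any representative of β̂
equals the one over the standard path, 2 ∫ y₀ dx (`MarkedCurve.curveIntegral_zeta`). Expansions in u
= 1/x give φ = ±W + O(1/x), so the end point values of φ remove exactly the growth W(Λ₀). Another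
admissible choice of φ differs from φ + ρ by a single-valued function with derivative c/u +
holomorphic; this forces c = 0, so the difference has limits at infinity.

On the sphere bundle over a path, Ω restricts to (i/2) sin θ times y dx and dΦ to (i/2) sin θ times
dφ. Integration over the spheres and the factor -1/2 give -iπ, which carries the statements on the
curve over to the threefold. -/

theorem Complex.eq_zero_of_exp_eq_one_of_norm_lt {z : ℂ} (h : Complex.exp z = 1) (hz : ‖z‖ < 1) :
    z = 0 := by
  obtain ⟨n, rfl⟩ := Complex.exp_eq_one_iff.1 h
  have h1 : ‖(n : ℂ) * (2 * Real.pi * Complex.I)‖ = |(n : ℝ)| * (2 * Real.pi) := by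
    simp [abs_of_pos Real.pi_pos]
  rw [h1] at hz
  have h2 : |(n : ℝ)| < 1 := by
    by_contra! h3
    nlinarith [Real.pi_gt_three]
  have h3 : n = 0 := by
    have : |n| < 1 := by exact_mod_cast h2
    exact Int.abs_lt_one_iff.1 this
  simp [h3]

/-- A continuous function with `exp f = 1` on a connected set is constant there. -/
theorem IsPreconnected.eq_of_exp_eq_one {X : Type*} [TopologicalSpace X] {S : Set X}
    (hS : IsPreconnected S) {f : X → ℂ} (hf : ContinuousOn f S)
    (he : ∀ x ∈ S, Complex.exp (f x) = 1) {x y : X} (hx : x ∈ S) (hy : y ∈ S) : f x = f y := by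
  have key : ∀ x ∈ S, (f x).re = 0 ∧ ∃ n : ℤ, (n : ℝ) = (f x).im / (2 * Real.pi) := by
    intro x hx
    obtain ⟨n, hn⟩ := Complex.exp_eq_one_iff.1 (he x hx)
    rw [hn]
    refine ⟨by simp, n, ?_⟩
    simp [Real.pi_ne_zero]
  have hd : DiscreteTopology (Set.range ((↑) : ℤ → ℝ)) :=
    (Int.isClosedEmbedding_coe_real.isEmbedding.toHomeomorph.symm).isEmbedding.discreteTopology
  have := hS.eqOn_const_of_mapsTo (f := fun x => (f x).im / (2 * Real.pi))
    (T := Set.range ((↑) : ℤ → ℝ))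
    (isDiscrete_iff_discreteTopology.2 hd) ((Complex.continuous_im.comp_continuousOn hf).div_const _)
    (fun x hx => (key x hx).2) (Set.range_nonempty _)
  obtain ⟨v, -, hv⟩ := this
  have h1 := (hv hx).trans (hv hy).symm
  have h2 : (f x).im = (f y).im := by
    have := Real.pi_pos
    field_simp at h1
    exact h1
  exact Complex.ext ((key x hx).1.trans (key y hy).1.symm) h2

theorem IsPreconnected.eq_zero_of_exp_eq_one {X : Type*} [TopologicalSpace X] {S : Set X}
    (hS : IsPreconnected S) {f : X → ℂ} (hf : ContinuousOn f S)
    (he : ∀ x ∈ S, Complex.exp (f x) = 1) {x₀ : X} (hx₀ : x₀ ∈ S) (h₀ : ‖f x₀‖ < 1) {x : X}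
    (hx : x ∈ S) : f x = 0 :=
  (hS.eq_of_exp_eq_one hf he hx hx₀).trans
    (Complex.eq_zero_of_exp_eq_one_of_norm_lt (he _ hx₀) h₀)

/-- A continuous function with values `±1` on a connected set is constant there. -/
theorem IsPreconnected.eq_of_sq_eq_one {X : Type*} [TopologicalSpace X] {S : Set X}
    (hS : IsPreconnected S) {f : X → ℂ} (hf : ContinuousOn f S)
    (he : ∀ x ∈ S, f x ^ 2 = 1) {x y : X} (hx : x ∈ S) (hy : y ∈ S) : f x = f y := by
  rcases hS.eq_one_or_eq_neg_one_of_sq_eq hf (fun x hx => by simpa using he x hx) with h | h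
  · rw [h hx, h hy]; rfl
  · rw [h hx, h hy]; rfl

/-- A continuous logarithm is locally a translate of the principal one: near `x` the increment of
`f` has norm below 1, so `Complex.log` inverts the exponential on it, and differentiability is
inherited. -/
theorem HasDerivAt.of_exp_eq {f g : ℝ → ℂ} {g' : ℂ} {x : ℝ} (hf : ContinuousAt f x)
    (h : ∀ᶠ y in 𝓝 x, Complex.exp (f y) = g y) (hg : HasDerivAt g g' x) :
    HasDerivAt f (g' / g x) x := by
  have hx := h.self_of_nhds
  have h1 : HasDerivAt (fun y => Complex.log (g y * Complex.exp (-f x)))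
      (g' / g x) x := by
    have h2 := (hg.mul_const (Complex.exp (-f x))).clog_real (by
      rw [← hx, ← Complex.exp_add]; simp)
    convert h2 using 1
    have : Complex.exp (-f x) ≠ 0 := Complex.exp_ne_zero _
    field_simp
  have h3 : ∀ᶠ y in 𝓝 x, f y = f x + Complex.log (g y * Complex.exp (-f x)) := by
    have h4 : ∀ᶠ y in 𝓝 x, ‖f y - f x‖ < 1 := by
      have : Tendsto (fun y => ‖f y - f x‖) (𝓝 x) (𝓝 ‖f x - f x‖) :=
        (hf.sub continuousAt_const).norm
      simp only [sub_self, norm_zero] at this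
      exact this.eventually_lt_const one_pos
    filter_upwards [h, h4] with y hy hy'
    rw [← hy, ← Complex.exp_add, ← sub_eq_add_neg, Complex.log_exp]
    · ring
    · have := (abs_le.1 (Complex.abs_im_le_norm (f y - f x))).1
      linarith [Real.pi_gt_three]
    · have := (abs_le.1 (Complex.abs_im_le_norm (f y - f x))).2
      linarith [Real.pi_gt_three]
  exact (h1.const_add (f x)).congr_of_eventuallyEq h3

/-! ### Regular paths and divided differences -/

/-- A smooth regular injective path which goes to infinity in both directions and finally runs along
the positive real axis. -/
structure IsRegularPath (γ : ℝ → ℂ) : Prop where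
  smooth : ContDiff ℝ ∞ γ
  regular : ∀ s, deriv γ s ≠ 0
  injective : Function.Injective γ
  atBot : Tendsto γ atBot (cocompact ℂ)
  tail : ∀ᶠ s : ℝ in atTop, γ s = (s : ℂ)

/-- The divided difference of `γ`, extended by the derivative to the diagonal. -/
def divDiff (γ : ℝ → ℂ) (s s' : ℝ) : ℂ := ∫ θ in (0 : ℝ)..1, deriv γ (s' + θ * (s - s'))

/-- The point at height `e` on the normal to the path at `γ s`. -/
def tube (γ : ℝ → ℂ) (s e : ℝ) : ℂ := γ s + Complex.I * e * deriv γ s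

namespace IsRegularPath

variable {γ : ℝ → ℂ} (hγ : IsRegularPath γ)

include hγ

theorem continuous : Continuous γ := hγ.smooth.continuous

theorem contDiff_deriv : ContDiff ℝ 1 (deriv γ) :=
  ((contDiff_infty_iff_deriv.1 hγ.smooth).2).of_le (by exact_mod_cast le_top)

theorem continuous_deriv : Continuous (deriv γ) := hγ.contDiff_deriv.continuous

theorem hasDerivAt (s : ℝ) : HasDerivAt γ (deriv γ s) s :=
  ((contDiff_infty_iff_deriv.1 hγ.smooth).1 s).hasDerivAt

theorem continuous_divDiff : Continuous fun p : ℝ × ℝ => divDiff γ p.1 p.2 := by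
  refine intervalIntegral.continuous_parametric_intervalIntegral_of_continuous' ?_ 0 1
  have := hγ.continuous_deriv
  simp only [Function.uncurry_def]
  fun_prop

theorem divDiff_mul (s s' : ℝ) : divDiff γ s s' * (s - s') = γ s - γ s' := by
  have h : ∀ θ : ℝ, HasDerivAt (fun θ : ℝ => γ (s' + θ * (s - s')))
      ((s - s') • deriv γ (s' + θ * (s - s'))) θ := by
    intro θ
    refine (hγ.hasDerivAt _).scomp θ ?_
    simpa using ((hasDerivAt_id θ).mul_const (s - s')).const_add s'
  have h2 := intervalIntegral.integral_eq_sub_of_hasDerivAt (a := 0) (b := 1)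
    (fun θ _ => h θ) (by
      have := hγ.continuous_deriv
      exact Continuous.intervalIntegrable (by fun_prop) _ _)
  rw [intervalIntegral.integral_smul] at h2
  simp only [one_mul, zero_mul, add_zero, add_sub_cancel] at h2
  rw [← h2, divDiff, Complex.real_smul, mul_comm]
  simp

omit hγ in
theorem divDiff_self (s : ℝ) : divDiff γ s s = deriv γ s := by simp [divDiff]

theorem divDiff_of_ne {s s' : ℝ} (h : s ≠ s') :
    divDiff γ s s' = (γ s - γ s') / ((s : ℂ) - s') := by
  rw [← hγ.divDiff_mul, mul_div_cancel_right₀]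
  exact sub_ne_zero.2 (by exact_mod_cast h)

theorem divDiff_comm (s s' : ℝ) : divDiff γ s s' = divDiff γ s' s := by
  rcases eq_or_ne s s' with rfl | h
  · rfl
  · rw [hγ.divDiff_of_ne h, hγ.divDiff_of_ne h.symm, ← neg_sub (γ s'), ← neg_sub (s' : ℂ),
      neg_div_neg_eq]

/-- Regularity on the diagonal and injectivity off it. Together they allow a global logarithm of the
divided difference. -/
theorem divDiff_ne_zero (s s' : ℝ) : divDiff γ s s' ≠ 0 := by
  rcases eq_or_ne s s' with rfl | h
  · rw [divDiff_self]; exact hγ.regular s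
  · intro h0
    have := hγ.divDiff_mul s s'
    rw [h0, zero_mul] at this
    exact h (hγ.injective (sub_eq_zero.1 this.symm))

end IsRegularPath

theorem isSimplyConnected_univ_of_real_prod :
    IsSimplyConnected (Set.univ : Set (ℝ × ℝ)) := by
  have : ContractibleSpace (Set.univ : Set (ℝ × ℝ)) :=
    (Homeomorph.Set.univ (ℝ × ℝ)).contractibleSpace
  exact SimplyConnectedSpace.ofContractible _

/-- A continuous logarithm of the divided difference, normalised at infinity. -/
structure IsPathLog (γ : ℝ → ℂ) (k : ℝ → ℝ → ℂ) : Prop where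
  continuous : Continuous fun p : ℝ × ℝ => k p.1 p.2
  exp_eq : ∀ s s', Complex.exp (k s s') = divDiff γ s s'
  tendsto : ∀ s', Tendsto (fun s => k s s') atTop (𝓝 0)

/-- The continuous logarithm of the divided difference of `γ`, normalised at infinity. -/
def pathLog (γ : ℝ → ℂ) : ℝ → ℝ → ℂ := Classical.epsilon (IsPathLog γ)

namespace IsRegularPath

variable {γ : ℝ → ℂ} (hγ : IsRegularPath γ)

include hγ

theorem exists_tail : ∃ s₀ : ℝ, 0 < s₀ ∧ ∀ s, s₀ ≤ s → γ s = s := by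
  obtain ⟨a, ha⟩ := eventually_atTop.1 hγ.tail
  exact ⟨max a 1, by positivity, fun s hs => ha s ((le_max_left _ _).trans hs)⟩

/-- Far out γ(s) = s, so the divided difference minus one is (s' - γ(s'))/(s - s'): a bounded
numerator over a large denominator. -/
theorem exists_divDiff_near_one (B : ℝ) {η : ℝ} (hη : 0 < η) : ∃ L : ℝ, 0 < L ∧ B < L ∧
    ∀ s s', L ≤ s → s' ∈ Set.Icc (-B) B → ‖divDiff γ s s' - 1‖ ≤ η := by
  obtain ⟨s₀, hs₀, htail⟩ := hγ.exists_tail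
  obtain ⟨M, hM⟩ := isCompact_Icc.exists_bound_of_continuousOn (s := Set.Icc (-B) B)
    (f := fun s' => (s' : ℂ) - γ s') (by have := hγ.continuous; fun_prop)
  have hM0 : 0 < |M| + 1 := by positivity
  refine ⟨max s₀ (|B| + (|M| + 1) / η), by positivity, ?_, fun s s' hs hs' => ?_⟩
  · refine lt_of_le_of_lt (le_abs_self B) (lt_of_lt_of_le ?_ (le_max_right _ _))
    have : 0 < (|M| + 1) / η := by positivity
    linarith
  · have h1 := (le_max_left _ _).trans hs
    have h2 := (le_max_right _ _).trans hs
    have h3 : 0 < (|M| + 1) / η := by positivity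
    have h4 : (|M| + 1) / η ≤ s - s' := by linarith [hs'.2, le_abs_self B]
    have hne : s ≠ s' := by intro h; rw [h] at h4; simp at h4; linarith
    have hne' : (s : ℂ) - s' ≠ 0 := sub_ne_zero.2 (by exact_mod_cast hne)
    rw [hγ.divDiff_of_ne hne, htail s h1, div_sub_one hne', norm_div]
    have h5 : ‖(s : ℂ) - s'‖ = s - s' := by
      rw [← Complex.ofReal_sub, Complex.norm_real, Real.norm_of_nonneg (h3.le.trans h4)]
    rw [h5, div_le_iff₀ (h3.trans_le h4)]
    have h6 := hM s' hs'
    have h7 : (s : ℂ) - γ s' - (s - s') = s' - γ s' := by ring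
    rw [h7]
    have h8 : |M| + 1 ≤ η * (s - s') := by
      rw [div_le_iff₀ hη] at h4; linarith
    linarith [le_abs_self M]

/-- The parameter plane is simply connected and the divided difference has no zeros on it, so a
continuous logarithm exists. On a half strip where s is large and s' is bounded it differs from the
principal logarithm by a constant whose exponential is 1. All these half strips meet the line s' =
0, so the constants agree, and subtracting one of them normalises the logarithm at infinity for
every s' at once. -/
theorem exists_isPathLog : ∃ k, IsPathLog γ k := by
  obtain ⟨k0, hk0, hexp⟩ := Complex.exists_continuousOn_eqOn_exp_comp
    isSimplyConnected_univ_of_real_prod isOpen_univ hγ.continuous_divDiff.continuousOn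
    (by rintro ⟨p, -, hp⟩; exact hγ.divDiff_ne_zero _ _ hp)
  rw [continuousOn_univ] at hk0
  have hexp : ∀ s s', Complex.exp (k0 (s, s')) = divDiff γ s s' := fun s s' =>
    hexp (Set.mem_univ (s, s'))
  have hconst : ∀ B, 0 ≤ B → ∃ L c, ∀ s s', L ≤ s → s' ∈ Set.Icc (-B) B →
      k0 (s, s') = Complex.log (divDiff γ s s') + c ∧ Complex.exp c = 1 := by
    intro B hB
    obtain ⟨L, hL0, hL, h⟩ := hγ.exists_divDiff_near_one B (η := 1 / 2) (by norm_num)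
    have hS : IsPreconnected (Set.Ici L ×ˢ Set.Icc (-B) B) :=
      isPreconnected_Ici.prod isPreconnected_Icc
    have hslit : ∀ s s', L ≤ s → s' ∈ Set.Icc (-B) B → divDiff γ s s' ∈ Complex.slitPlane := by
      intro s s' hs hs'
      left
      have h1 := h s s' hs hs'
      have h2 := (abs_le.1 ((Complex.abs_re_le_norm _).trans h1)).1
      simp at h2
      linarith
    let f : ℝ × ℝ → ℂ := fun p => k0 p - Complex.log (divDiff γ p.1 p.2)
    have hf : ContinuousOn f (Set.Ici L ×ˢ Set.Icc (-B) B) :=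
      hk0.continuousOn.sub (hγ.continuous_divDiff.continuousOn.clog
        fun p hp => hslit _ _ hp.1 hp.2)
    have he : ∀ p ∈ Set.Ici L ×ˢ Set.Icc (-B) B, Complex.exp (f p) = 1 := by
      intro p hp
      simp only [f]
      rw [Complex.exp_sub, Complex.exp_log (hγ.divDiff_ne_zero _ _), hexp,
        div_self (hγ.divDiff_ne_zero _ _)]
    have hmem : ((L, 0) : ℝ × ℝ) ∈ Set.Ici L ×ˢ Set.Icc (-B) B := by simp [hB]
    refine ⟨L, f (L, 0), fun s s' hs hs' => ⟨?_, he _ hmem⟩⟩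
    have := hS.eq_of_exp_eq_one hf he (x := (s, s')) ⟨hs, hs'⟩ hmem
    rw [← this]
    simp [f]
  have hlim : ∀ s', Tendsto (fun s => Complex.log (divDiff γ s s')) atTop (𝓝 0) := by
    intro s'
    have h1 : Tendsto (fun s => divDiff γ s s') atTop (𝓝 1) := by
      rw [Metric.tendsto_atTop]
      intro ε hε
      obtain ⟨L, -, -, h⟩ := hγ.exists_divDiff_near_one |s'| (η := ε / 2) (by positivity)
      refine ⟨L, fun s hs => ?_⟩
      rw [dist_eq_norm]
      have := h s s' hs ⟨neg_abs_le _, le_abs_self _⟩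
      linarith
    have := h1.clog (by simp)
    simpa using this
  obtain ⟨L₀, c, hc⟩ := hconst 0 le_rfl
  have hc1 : Complex.exp c = 1 := (hc L₀ 0 le_rfl (by simp)).2
  refine ⟨fun s s' => k0 (s, s') - c, by fun_prop, fun s s' => ?_, fun s' => ?_⟩
  · rw [Complex.exp_sub, hc1, hexp, div_one]
  · obtain ⟨L, c', h⟩ := hconst |s'| (abs_nonneg _)
    have hcc : c' = c := by
      have h1 := (h (max L L₀) 0 (le_max_left _ _) (by simp)).1
      have h2 := (hc (max L L₀) 0 (le_max_right _ _) (by simp)).1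
      rw [h1] at h2
      exact add_left_cancel h2
    refine (hlim s').congr' ?_
    filter_upwards [eventually_ge_atTop L] with s hs
    rw [(h s s' hs ⟨neg_abs_le _, le_abs_self _⟩).1, hcc]
    ring

theorem isPathLog : IsPathLog γ (pathLog γ) := Classical.epsilon_spec hγ.exists_isPathLog

theorem continuous_pathLog : Continuous fun p : ℝ × ℝ => pathLog γ p.1 p.2 :=
  hγ.isPathLog.continuous

theorem exp_pathLog (s s' : ℝ) : Complex.exp (pathLog γ s s') = divDiff γ s s' :=
  hγ.isPathLog.exp_eq s s'

theorem tendsto_pathLog (s' : ℝ) : Tendsto (fun s => pathLog γ s s') atTop (𝓝 0) :=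
  hγ.isPathLog.tendsto s'

/-- The difference of the two sides is a continuous logarithm of 1 that vanishes on the diagonal,
and the plane is connected. -/
theorem pathLog_comm (s s' : ℝ) : pathLog γ s s' = pathLog γ s' s := by
  have hk := hγ.continuous_pathLog
  have hk' : Continuous fun p : ℝ × ℝ => pathLog γ p.2 p.1 :=
    hk.comp (continuous_snd.prodMk continuous_fst)
  have := isPreconnected_univ.eq_zero_of_exp_eq_one
    (f := fun p : ℝ × ℝ => pathLog γ p.1 p.2 - pathLog γ p.2 p.1)
    (hk.sub hk').continuousOn (fun p _ => by
      rw [Complex.exp_sub, hγ.exp_pathLog, hγ.exp_pathLog, hγ.divDiff_comm p.2,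
        div_self (hγ.divDiff_ne_zero _ _)]) (x₀ := (s, s)) trivial (by simp)
    (x := (s, s')) trivial
  exact sub_eq_zero.1 this

theorem hasDerivAt_pathLog {s s' : ℝ} (h : s ≠ s') :
    HasDerivAt (fun σ => pathLog γ σ s')
      (deriv γ s / (γ s - γ s') - 1 / ((s : ℂ) - s')) s := by
  have h0 : (s : ℂ) - s' ≠ 0 := sub_ne_zero.2 (by exact_mod_cast h)
  have h1 : γ s - γ s' ≠ 0 := sub_ne_zero.2 (hγ.injective.ne h)
  have hd : HasDerivAt (fun σ : ℝ => (γ σ - γ s') / ((σ : ℂ) - s'))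
      ((deriv γ s * (s - s') - (γ s - γ s') * 1) / ((s : ℂ) - s') ^ 2) s :=
    ((hγ.hasDerivAt s).sub_const _).div (((hasDerivAt_id s).ofReal_comp).sub_const _) h0
  have hc : ContinuousAt (fun σ => pathLog γ σ s') s :=
    (hγ.continuous_pathLog.comp (continuous_id.prodMk continuous_const)).continuousAt
  have := HasDerivAt.of_exp_eq hc (by
    filter_upwards [isOpen_ne.mem_nhds h] with σ hσ
    rw [hγ.exp_pathLog, hγ.divDiff_of_ne hσ]) hd
  convert this using 1
  field_simp

theorem continuous_pathLog_left (s' : ℝ) : Continuous fun s => pathLog γ s s' :=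
  hγ.continuous_pathLog.comp (continuous_id.prodMk continuous_const)

theorem continuous_pathLog_right (s : ℝ) : Continuous fun s' => pathLog γ s s' :=
  hγ.continuous_pathLog.comp (continuous_const.prodMk continuous_id)

/-- Along the path log(σ - s') plus `pathLog` is a continuous logarithm of γ(σ) - γ(s'), with the
singularity at σ = s' split off explicitly. -/
theorem integral_logDeriv {s s' L : ℝ} (h : s' < s) (hL : s ≤ L) :
    ∫ σ in s..L, deriv γ σ / (γ σ - γ s') = (Real.log (L - s') + pathLog γ L s')
      - (Real.log (s - s') + pathLog γ s s') := by
  have hpos : ∀ σ ∈ Set.uIcc s L, s' < σ := fun σ hσ => by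
    rw [Set.uIcc_of_le hL] at hσ; exact h.trans_le hσ.1
  refine intervalIntegral.integral_eq_sub_of_hasDerivAt
    (f := fun σ : ℝ => (Real.log (σ - s') : ℂ) + pathLog γ σ s') (fun σ hσ => ?_) ?_
  · have h1 : HasDerivAt (fun σ : ℝ => (Real.log (σ - s') : ℂ)) ((1 / (σ - s') : ℝ) : ℂ) σ :=
      (((hasDerivAt_id σ).sub_const s').log (sub_ne_zero.2 (hpos σ hσ).ne')).ofReal_comp
    refine (h1.add (hγ.hasDerivAt_pathLog (hpos σ hσ).ne')).congr_deriv ?_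
    push_cast
    ring
  · refine ContinuousOn.intervalIntegrable ?_
    refine hγ.continuous_deriv.continuousOn.div (by have := hγ.continuous; fun_prop) ?_
    exact fun σ hσ => sub_ne_zero.2 (hγ.injective.ne (hpos σ hσ).ne')

end IsRegularPath

/-! ### The logarithm in the free energy and its principal value. -/

theorem Real.tendsto_log_sub_log_sub (c : ℝ) :
    Tendsto (fun L : ℝ => Real.log L - Real.log (L - c)) atTop (𝓝 0) := by
  have h1 : Tendsto (fun L : ℝ => 1 - c / L) atTop (𝓝 (1 - 0)) :=
    tendsto_const_nhds.sub (tendsto_const_nhds.div_atTop tendsto_id)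
  have h2 := (h1.log (by norm_num)).neg
  simp only [sub_zero, Real.log_one, neg_zero] at h2
  refine h2.congr' ?_
  filter_upwards [eventually_gt_atTop 0, eventually_gt_atTop c] with L h0 hc
  rw [one_sub_div h0.ne', Real.log_div (sub_pos.2 hc).ne' h0.ne']
  ring

/-- The upper limit of integration contributes log L - log(L - s') - `pathLog` at (L, s'), and this
tends to 0 by the normalisation of `pathLog`. -/
theorem MarkedCurve.logAlong_eq {g : ℕ} (C : MarkedCurve g) (hγ : IsRegularPath C.path)
    {s s' : ℝ} (h : s' < s) :
    C.logAlong s s' = Real.log (s - s') + pathLog C.path s s' := by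
  refine Tendsto.limUnder_eq ?_
  have h1 : Tendsto (fun L : ℝ => ((Real.log L - Real.log (L - s') : ℝ) : ℂ)) atTop (𝓝 (0 : ℝ)) :=
    (Complex.continuous_ofReal.tendsto _).comp (Real.tendsto_log_sub_log_sub s')
  have h2 := (h1.sub (hγ.tendsto_pathLog s')).add_const
    ((Real.log (s - s') : ℂ) + pathLog C.path s s')
  simp only [Complex.ofReal_zero, sub_zero, zero_add] at h2
  refine h2.congr' ?_
  filter_upwards [eventually_ge_atTop s] with L hL
  rw [hγ.integral_logDeriv h hL]
  push_cast
  ring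

/-- Since `pathLog` is symmetric, the two orders of the parameters give one formula, in which the
real logarithm only sees |s - s'|. -/
theorem MarkedCurve.pvLog_eq {g : ℕ} (C : MarkedCurve g) (hγ : IsRegularPath C.path)
    {s s' : ℝ} (h : s ≠ s') :
    C.pvLog s s' = Real.log |s - s'| + pathLog C.path s s' := by
  rw [MarkedCurve.pvLog]
  rcases lt_or_gt_of_ne h with h | h
  · rw [max_eq_right h.le, min_eq_left h.le, C.logAlong_eq hγ h, hγ.pathLog_comm s' s,
      abs_sub_comm, abs_of_pos (sub_pos.2 h)]
  · rw [max_eq_left h.le, min_eq_right h.le, C.logAlong_eq hγ h, abs_of_pos (sub_pos.2 h)]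

/-! ### Estimates for the Cauchy kernel in a tube around the path. -/

/-- Uniform control of the path on a compact parameter interval: `c` bounds the distance between
the tube and the path from below, `M` bounds the derivatives from above. -/
structure TubeBound (γ : ℝ → ℂ) (A B c M e₀ : ℝ) : Prop where
  pos : 0 < c
  nonneg : 0 ≤ M
  pos_height : 0 < e₀
  lower : ∀ s ∈ Set.Icc A B, ∀ s' ∈ Set.Icc A B, ∀ e : ℝ, |e| ≤ e₀ →
    c * (|s - s'| + |e|) ≤ ‖tube γ s e - γ s'‖
  lipschitz : ∀ s ∈ Set.Icc A B, ∀ s' ∈ Set.Icc A B, ‖deriv γ s - deriv γ s'‖ ≤ M * |s - s'|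
  taylor : ∀ s ∈ Set.Icc A B, ∀ s' ∈ Set.Icc A B,
    ‖γ s - γ s' - (s - s') * deriv γ s‖ ≤ M * |s - s'| ^ 2

namespace IsRegularPath

variable {γ : ℝ → ℂ} (hγ : IsRegularPath γ)

include hγ

/-- Two regimes. For |s - s'| < δ the vector is (s - s' + ie)γ'(s), of norm at least c₁(|s - s'| +
|e|)/2, up to an error of at most c₁|s - s'|/4. For larger |s - s'| the chord has norm at least c₁|s
- s'|, and the height is so small that the normal displacement costs at most half of it. -/
theorem exists_tubeBound (A B : ℝ) : ∃ c M e₀, TubeBound γ A B c M e₀ := by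
  have hcd := hγ.continuous_deriv
  have hconv : ∀ s ∈ Set.Icc A B, ∀ s' ∈ Set.Icc A B, ∀ θ ∈ Set.Icc (0 : ℝ) 1,
      s' + θ * (s - s') ∈ Set.Icc A B := by
    intro s hs s' hs' θ hθ
    exact ⟨by nlinarith [hs.1, hs'.1, hθ.1, hθ.2], by nlinarith [hs.2, hs'.2, hθ.1, hθ.2]⟩
  obtain ⟨M₁, hM₁⟩ := isCompact_Icc.exists_bound_of_continuousOn (s := Set.Icc A B)
    (f := deriv γ) hcd.continuousOn
  obtain ⟨M₂, hM₂⟩ := isCompact_Icc.exists_bound_of_continuousOn (s := Set.Icc A B)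
    (f := deriv (deriv γ)) (hγ.contDiff_deriv.continuous_deriv le_rfl).continuousOn
  set M := max |M₁| |M₂| with hM
  have hM0 : 0 ≤ M := (abs_nonneg _).trans (le_max_left _ _)
  have h1 : ∀ s ∈ Set.Icc A B, ‖deriv γ s‖ ≤ M := fun s hs =>
    (hM₁ s hs).trans ((le_abs_self _).trans (le_max_left _ _))
  have h2 : ∀ s ∈ Set.Icc A B, ∀ s' ∈ Set.Icc A B, ‖deriv γ s - deriv γ s'‖ ≤ M * |s - s'| := by
    intro s hs s' hs'
    exact (convex_Icc A B).norm_image_sub_le_of_norm_deriv_le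
      (fun x _ => (hγ.contDiff_deriv.differentiable one_ne_zero) x)
      (fun x hx => (hM₂ x hx).trans ((le_abs_self _).trans (le_max_right _ _))) hs' hs
  have h3 : ∀ s ∈ Set.Icc A B, ∀ s' ∈ Set.Icc A B, ‖divDiff γ s s' - deriv γ s‖ ≤ M * |s - s'| := by
    intro s hs s' hs'
    have : divDiff γ s s' - deriv γ s
        = ∫ θ in (0 : ℝ)..1, (deriv γ (s' + θ * (s - s')) - deriv γ s) := by
      rw [intervalIntegral.integral_sub (Continuous.intervalIntegrable (by fun_prop) _ _)
        (by simp)]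
      simp [divDiff]
    rw [this]
    have := intervalIntegral.norm_integral_le_of_norm_le_const (a := 0) (b := 1)
      (f := fun θ : ℝ => deriv γ (s' + θ * (s - s')) - deriv γ s) (C := M * |s - s'|) (by
        intro θ hθ
        rw [Set.uIoc_of_le zero_le_one] at hθ
        refine (h2 _ (hconv s hs s' hs' θ ⟨hθ.1.le, hθ.2⟩) s hs).trans ?_
        refine mul_le_mul_of_nonneg_left ?_ hM0
        rw [show s' + θ * (s - s') - s = -((1 - θ) * (s - s')) by ring, abs_neg, abs_mul]
        refine mul_le_of_le_one_left (abs_nonneg _) ?_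
        rw [abs_of_nonneg] <;> linarith [hθ.1, hθ.2])
    simpa using this
  have h4 : ∀ s ∈ Set.Icc A B, ∀ s' ∈ Set.Icc A B,
      ‖γ s - γ s' - (s - s') * deriv γ s‖ ≤ M * |s - s'| ^ 2 := by
    intro s hs s' hs'
    rw [← hγ.divDiff_mul, mul_comm, ← mul_sub, norm_mul, ← Complex.ofReal_sub, Complex.norm_real,
      Real.norm_eq_abs]
    nlinarith [h3 s hs s' hs', abs_nonneg (s - s')]
  have hcpt : IsCompact (Set.Icc A B ×ˢ Set.Icc A B) := isCompact_Icc.prod isCompact_Icc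
  obtain ⟨c₁, hc₁, hlow⟩ : ∃ c₁ : ℝ, 0 < c₁ ∧ ∀ s ∈ Set.Icc A B, ∀ s' ∈ Set.Icc A B,
      c₁ ≤ ‖divDiff γ s s'‖ := by
    rcases (Set.Icc A B).eq_empty_or_nonempty with he | hne
    · exact ⟨1, one_pos, fun s hs => by simp [he] at hs⟩
    · obtain ⟨p, -, hp⟩ := hcpt.exists_isMinOn (hne.prod hne)
        hγ.continuous_divDiff.norm.continuousOn
      exact ⟨_, norm_pos_iff.2 (hγ.divDiff_ne_zero p.1 p.2), fun s hs s' hs' =>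
        hp (Set.mk_mem_prod hs hs')⟩
  have hlow' : ∀ s ∈ Set.Icc A B, c₁ ≤ ‖deriv γ s‖ := fun s hs => by
    have := hlow s hs s hs; rwa [divDiff_self] at this
  -- With this δ the variation of the divided difference near the diagonal is at most c₁/4; `M + 1`
  -- in place of `M` avoids a zero denominator.
  set δ := c₁ / (4 * (M + 1)) with hδ
  have hδ0 : 0 < δ := by positivity
  set e₀ := min δ (c₁ * δ / (2 * (M + 1))) with he₀
  refine ⟨c₁ / 4, M, e₀, by positivity, hM0, by positivity, ?_, h2, h4⟩
  intro s hs s' hs' e he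
  have hu : ‖((s - s' : ℝ) : ℂ)‖ = |s - s'| := by rw [Complex.norm_real, Real.norm_eq_abs]
  have hdec : tube γ s e - γ s' = ((s - s' : ℝ) : ℂ) * (divDiff γ s s')
      + Complex.I * e * deriv γ s := by
    rw [tube, add_sub_right_comm, ← hγ.divDiff_mul]; push_cast; ring
  have hIe : ‖Complex.I * e * deriv γ s‖ ≤ |e| * M := by
    rw [norm_mul, norm_mul, Complex.norm_I, one_mul, Complex.norm_real, Real.norm_eq_abs]
    exact mul_le_mul_of_nonneg_left (h1 s hs) (abs_nonneg _)
  rcases lt_or_ge |s - s'| δ with h | h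
  · have hdec2 : tube γ s e - γ s' = ((s - s' : ℝ) + (e : ℝ) * Complex.I) * deriv γ s
        + ((s - s' : ℝ) : ℂ) * (divDiff γ s s' - deriv γ s) := by rw [hdec]; ring
    have h5 : (|s - s'| + |e|) / 2 ≤ ‖((s - s' : ℝ) : ℂ) + (e : ℝ) * Complex.I‖ := by
      have h6 := Complex.abs_re_le_norm (((s - s' : ℝ) : ℂ) + (e : ℝ) * Complex.I)
      have h7 := Complex.abs_im_le_norm (((s - s' : ℝ) : ℂ) + (e : ℝ) * Complex.I)
      simp only [Complex.add_re, Complex.ofReal_re, Complex.mul_re, Complex.I_re, mul_zero,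
        Complex.ofReal_im, Complex.I_im, mul_one, sub_self, add_zero, Complex.add_im,
        Complex.mul_im, zero_add] at h6 h7
      linarith
    have h8 : ‖((s - s' : ℝ) : ℂ) * (divDiff γ s s' - deriv γ s)‖ ≤ c₁ / 4 * |s - s'| := by
      rw [norm_mul, hu, mul_comm]
      refine mul_le_mul_of_nonneg_right ((h3 s hs s' hs').trans ?_) (abs_nonneg _)
      calc M * |s - s'| ≤ (M + 1) * δ := by
            exact mul_le_mul (by linarith) h.le (abs_nonneg _) (by linarith)
        _ = c₁ / 4 := by rw [hδ]; field_simp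
    have h9 : (|s - s'| + |e|) / 2 * c₁ ≤ ‖(((s - s' : ℝ) : ℂ) + (e : ℝ) * Complex.I) * deriv γ s‖ := by
      rw [norm_mul]
      exact mul_le_mul h5 (hlow' s hs) hc₁.le (norm_nonneg _)
    rw [hdec2]
    have h10 := norm_sub_le_norm_add ((((s - s' : ℝ) : ℂ) + (e : ℝ) * Complex.I) * deriv γ s)
      (((s - s' : ℝ) : ℂ) * (divDiff γ s s' - deriv γ s))
    nlinarith [abs_nonneg e, abs_nonneg (s - s'), mul_nonneg hc₁.le (abs_nonneg e),
      mul_nonneg hc₁.le (abs_nonneg (s - s'))]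
  · have h5 : c₁ * |s - s'| ≤ ‖((s - s' : ℝ) : ℂ) * (divDiff γ s s')‖ := by
      rw [norm_mul, hu, mul_comm]
      exact mul_le_mul_of_nonneg_left (hlow s hs s' hs') (abs_nonneg _)
    have h6 : |e| * M ≤ c₁ * |s - s'| / 2 := by
      calc |e| * M ≤ (c₁ * δ / (2 * (M + 1))) * (M + 1) :=
            mul_le_mul (he.trans (min_le_right _ _)) (by linarith) hM0 (by positivity)
        _ = c₁ * δ / 2 := by field_simp
        _ ≤ _ := by nlinarith
    have h7 : |e| ≤ |s - s'| := he.trans ((min_le_left _ _).trans h)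
    rw [hdec]
    have h10 := norm_sub_le_norm_add (((s - s' : ℝ) : ℂ) * (divDiff γ s s'))
      (Complex.I * e * deriv γ s)
    nlinarith

end IsRegularPath

namespace TubeBound

variable {γ : ℝ → ℂ} {A B c M e₀ : ℝ} (h : TubeBound γ A B c M e₀)

include h

theorem tube_sub_ne_zero {s s' e : ℝ} (hs : s ∈ Set.Icc A B) (hs' : s' ∈ Set.Icc A B)
    (he : |e| ≤ e₀) (hne : s ≠ s' ∨ e ≠ 0) : tube γ s e - γ s' ≠ 0 := by
  have h1 := h.lower s hs s' hs' e he
  have h2 : 0 < |s - s'| + |e| := by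
    rcases hne with h | h
    · have := abs_pos.2 (sub_ne_zero.2 h); positivity
    · positivity
  exact norm_pos_iff.1 ((mul_pos h.pos h2).trans_le h1)

theorem norm_inv_le {s s' e : ℝ} (hs : s ∈ Set.Icc A B) (hs' : s' ∈ Set.Icc A B)
    (he : |e| ≤ e₀) : ‖(tube γ s e - γ s')⁻¹‖ ≤ c⁻¹ * (|s - s'| + |e|)⁻¹ := by
  have h1 := h.lower s hs s' hs' e he
  rw [norm_inv, ← mul_inv]
  rcases (add_nonneg (abs_nonneg (s - s')) (abs_nonneg e)).eq_or_lt with h2 | h2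
  -- For s = s' and e = 0 both sides are inverses of zero, hence 0.
  · rw [← h2]
    have hz : |s - s'| = 0 ∧ |e| = 0 := by
      constructor <;> linarith [abs_nonneg (s - s'), abs_nonneg e]
    have h3 : s = s' := sub_eq_zero.1 (abs_eq_zero.1 hz.1)
    have h4 : e = 0 := abs_eq_zero.1 hz.2
    simp [tube, h3, h4]
  · exact inv_anti₀ (mul_pos h.pos h2) h1

omit h in
theorem half_le_norm_add_mul_I (u e : ℝ) : (|u| + |e|) / 2 ≤ ‖(u : ℂ) + Complex.I * e‖ := by
  have h6 := Complex.abs_re_le_norm ((u : ℂ) + Complex.I * e)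
  have h7 := Complex.abs_im_le_norm ((u : ℂ) + Complex.I * e)
  simp only [Complex.add_re, Complex.ofReal_re, Complex.mul_re, Complex.I_re, zero_mul,
    Complex.ofReal_im, Complex.I_im, mul_zero, sub_self, add_zero, Complex.add_im,
    Complex.mul_im, zero_add, one_mul] at h6 h7
  linarith

/-- The Cauchy kernel of the path differs from that of the real line by a bounded term. -/
theorem norm_kernel_sub_le {s s' e : ℝ} (hs : s ∈ Set.Icc A B) (hs' : s' ∈ Set.Icc A B)
    (he : |e| ≤ e₀) :
    ‖deriv γ s * (tube γ s e - γ s')⁻¹ - ((s : ℂ) - s' + Complex.I * e)⁻¹‖ ≤ 2 * M * c⁻¹ := by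
  have hc := h.pos
  have hM := h.nonneg
  by_cases hne : s ≠ s' ∨ e ≠ 0
  · have h1 := h.tube_sub_ne_zero hs hs' he hne
    have h2 : 0 < |s - s'| + |e| := by
      rcases hne with h | h
      · have := abs_pos.2 (sub_ne_zero.2 h); positivity
      · positivity
    have h3 := half_le_norm_add_mul_I (s - s') e
    have h4 : (s : ℂ) - s' + Complex.I * e ≠ 0 := by
      rw [← norm_pos_iff]; push_cast at h3; linarith
    -- The heights cancel in the numerator and leave the second order Taylor remainder of the path,
    -- which is divided by two factors of first order.
    have h5 : deriv γ s * (tube γ s e - γ s')⁻¹ - ((s : ℂ) - s' + Complex.I * e)⁻¹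
        = -(γ s - γ s' - (s - s') * deriv γ s)
          * ((tube γ s e - γ s')⁻¹ * ((s : ℂ) - s' + Complex.I * e)⁻¹) := by
      have h6 : γ s = tube γ s e - γ s' - Complex.I * e * deriv γ s + γ s' := by rw [tube]; ring
      generalize tube γ s e - γ s' = D at h1 h6 ⊢
      rw [h6]
      field_simp
      ring
    have h6 : ‖((s : ℂ) - s' + Complex.I * e)⁻¹‖ ≤ 2 * (|s - s'| + |e|)⁻¹ := by
      rw [norm_inv, ← inv_inv (2 : ℝ), ← mul_inv]
      refine inv_anti₀ (by positivity) ?_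
      push_cast at h3
      linarith
    rw [h5, norm_mul, norm_neg, norm_mul]
    calc ‖γ s - γ s' - (s - s') * deriv γ s‖ * (‖(tube γ s e - γ s')⁻¹‖
          * ‖((s : ℂ) - s' + Complex.I * e)⁻¹‖)
        ≤ M * (|s - s'| + |e|) ^ 2 * ((c⁻¹ * (|s - s'| + |e|)⁻¹) * (2 * (|s - s'| + |e|)⁻¹)) := by
          refine mul_le_mul ((h.taylor s hs s' hs').trans ?_) (mul_le_mul (h.norm_inv_le hs hs' he)
            h6 (norm_nonneg _) (by positivity)) (by positivity) (by positivity)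
          gcongr
          linarith [abs_nonneg e]
      _ = 2 * M * c⁻¹ := by field_simp
  · push Not at hne
    rw [hne.1, hne.2]
    simp [tube]
    positivity

/-- The same with the derivative taken at the point of the path. -/
theorem norm_kernel_sub_le' {s s' e : ℝ} (hs : s ∈ Set.Icc A B) (hs' : s' ∈ Set.Icc A B)
    (he : |e| ≤ e₀) :
    ‖deriv γ s' * (tube γ s e - γ s')⁻¹ - ((s : ℂ) - s' + Complex.I * e)⁻¹‖ ≤ 3 * M * c⁻¹ := by
  have hc := h.pos
  have hM := h.nonneg
  have h1 := h.norm_kernel_sub_le hs hs' he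
  have h2 : ‖(deriv γ s' - deriv γ s) * (tube γ s e - γ s')⁻¹‖ ≤ M * c⁻¹ := by
    rw [norm_mul]
    calc _ ≤ (M * |s - s'|) * (c⁻¹ * (|s - s'| + |e|)⁻¹) := by
          refine mul_le_mul ?_ (h.norm_inv_le hs hs' he) (norm_nonneg _) (by positivity)
          rw [abs_sub_comm]
          exact h.lipschitz s' hs' s hs
      _ = M * c⁻¹ * (|s - s'| / (|s - s'| + |e|)) := by ring
      _ ≤ M * c⁻¹ * 1 := by
          refine mul_le_mul_of_nonneg_left (div_le_one_of_le₀ ?_ (by positivity)) (by positivity)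
          linarith [abs_nonneg e]
      _ = _ := mul_one _
  calc _ = ‖(deriv γ s * (tube γ s e - γ s')⁻¹ - ((s : ℂ) - s' + Complex.I * e)⁻¹)
        + (deriv γ s' - deriv γ s) * (tube γ s e - γ s')⁻¹‖ := by congr 1; ring
    _ ≤ _ := (norm_add_le _ _).trans (by linarith)

end TubeBound

/-! ### Cauchy-type integrals -/

theorem eq_of_hasDerivAt_zero {f : ℝ → ℂ} {a b : ℝ} (hab : a ≤ b)
    (hc : ContinuousOn f (Set.Icc a b)) (hd : ∀ x ∈ Set.Ioo a b, HasDerivAt f 0 x) :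
    f a = f b := by
  have := intervalIntegral.integral_eq_sub_of_hasDerivAt_of_le hab hc hd
    (by simp)
  simp only [intervalIntegral.integral_zero] at this
  exact (sub_eq_zero.1 this.symm).symm

/-- If `f' = h f` then `f b = f a exp (∫ h)`. -/
theorem eq_mul_exp_integral {f h : ℝ → ℂ} {a b : ℝ} (hab : a ≤ b)
    (hc : ContinuousOn f (Set.Icc a b)) (hh : ContinuousOn h (Set.Icc a b))
    (hd : ∀ x ∈ Set.Ioo a b, HasDerivAt f (h x * f x) x) :
    f b = f a * Complex.exp (∫ x in a..b, h x) := by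
  -- `h` is controlled on [a, b] only; its constant extension is continuous on the line, so the
  -- primitive is differentiable everywhere.
  set g := Set.IccExtend hab ((Set.Icc a b).domRestrict h) with hg
  have hgc : Continuous g := (continuousOn_iff_continuous_domRestrict.1 hh).Icc_extend'
  have hgeq : ∀ x ∈ Set.Icc a b, g x = h x := fun x hx => by
    rw [hg, Set.IccExtend_of_mem _ _ hx]; rfl
  have hI : ∀ x, HasDerivAt (fun u => ∫ t in a..u, g t) (g x) x := fun x =>
    hgc.integral_hasStrictDerivAt a x |>.hasDerivAt
  have key := eq_of_hasDerivAt_zero (f := fun x => f x * Complex.exp (-∫ t in a..x, g t)) hab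
    (hc.mul (Complex.continuous_exp.comp_continuousOn
      (continuous_iff_continuousAt.2 fun x => (hI x).continuousAt).neg.continuousOn))
    (fun x hx => by
      have h1 := (hd x hx).mul (hI x).neg.cexp
      refine h1.congr_deriv ?_
      rw [hgeq x (Set.Ioo_subset_Icc_self hx)]
      ring)
  have h2 : ∫ x in a..b, h x = ∫ x in a..b, g x :=
    intervalIntegral.integral_congr fun x hx => by
      rw [Set.uIcc_of_le hab] at hx; exact (hgeq x hx).symm
  simp only [intervalIntegral.integral_same, neg_zero, Complex.exp_zero, mul_one] at key
  rw [h2, key, mul_assoc, ← Complex.exp_add]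
  simp

theorem exists_le_norm_sub {p : ℝ → ℂ} (hp : Continuous p) {a b : ℝ} {x : ℂ}
    (hx : x ∉ p '' Set.uIcc a b) : ∃ δ > 0, ∀ s ∈ Set.uIcc a b, δ ≤ ‖p s - x‖ := by
  have hcl : IsClosed (p '' Set.uIcc a b) := (isCompact_uIcc.image hp).isClosed
  obtain ⟨δ, hδ, h⟩ := Metric.isOpen_iff.1 hcl.isOpen_compl x hx
  refine ⟨δ, hδ, fun s hs => ?_⟩
  by_contra! hlt
  exact h (by simpa [dist_eq_norm] using hlt) ⟨s, hs, rfl⟩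

theorem hasDerivAt_cauchyIntegral {n p : ℝ → ℂ} (hn : Continuous n) (hp : Continuous p) {a b : ℝ}
    {x : ℂ} (hx : x ∉ p '' Set.uIcc a b) :
    HasDerivAt (fun x => ∫ s in a..b, n s / (p s - x)) (∫ s in a..b, n s / (p s - x) ^ 2) x := by
  obtain ⟨δ, hδ, hlow⟩ := exists_le_norm_sub hp hx
  obtain ⟨C, hC⟩ := isCompact_uIcc.exists_bound_of_continuousOn (s := Set.uIcc a b)
    hn.continuousOn
  have hC0 : 0 ≤ C := (norm_nonneg _).trans (hC a Set.left_mem_uIcc)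
  have hlow2 : ∀ s ∈ Set.uIcc a b, ∀ y ∈ Metric.ball x (δ / 2), δ / 2 ≤ ‖p s - y‖ := by
    intro s hs y hy
    rw [mem_ball_iff_norm] at hy
    have := norm_sub_le_norm_add (p s - x) (-(y - x))
    have h2 := hlow s hs
    rw [norm_neg] at this
    have h3 : p s - x + -(y - x) = p s - y := by ring
    rw [h3] at this
    linarith
  have hne : ∀ s ∈ Set.uIcc a b, ∀ y ∈ Metric.ball x (δ / 2), p s - y ≠ 0 := fun s hs y hy =>
    norm_pos_iff.1 ((half_pos hδ).trans_le (hlow2 s hs y hy))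
  have hint : ∀ y ∈ Metric.ball x (δ / 2), ∀ k : ℕ,
      ContinuousOn (fun s => n s / (p s - y) ^ k) (Set.uIcc a b) := fun y hy k =>
    hn.continuousOn.div (by fun_prop) fun s hs => pow_ne_zero _ (hne s hs y hy)
  have hxb : x ∈ Metric.ball x (δ / 2) := Metric.mem_ball_self (half_pos hδ)
  refine (intervalIntegral.hasDerivAt_integral_of_dominated_loc_of_deriv_le
    (F' := fun y s => n s / (p s - y) ^ 2) (bound := fun _ => C / (δ / 2) ^ 2)
    (Metric.ball_mem_nhds x (half_pos hδ)) ?_ ?_ ?_ ?_ ?_ ?_).2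
  · filter_upwards [Metric.ball_mem_nhds x (half_pos hδ)] with y hy
    have := (hint y hy 1).mono Set.uIoc_subset_uIcc
    simp only [pow_one] at this
    exact this.aestronglyMeasurable measurableSet_uIoc
  · have := (hint x hxb 1).intervalIntegrable (μ := MeasureTheory.volume)
    simpa only [pow_one] using this
  · exact ((hint x hxb 2).mono Set.uIoc_subset_uIcc).aestronglyMeasurable measurableSet_uIoc
  · refine MeasureTheory.ae_of_all _ fun s hs y hy => ?_
    have hs' := Set.uIoc_subset_uIcc hs
    rw [norm_div, norm_pow]
    have := hlow2 s hs' y hy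
    exact div_le_div₀ hC0 (hC s hs') (by positivity) (by gcongr)
  · exact intervalIntegrable_const
  · refine MeasureTheory.ae_of_all _ fun s hs y hy => ?_
    have h1 := hne s (Set.uIoc_subset_uIcc hs) y hy
    have h2 := (((hasDerivAt_id y).const_sub (p s)).inv h1).const_mul (n s)
    simp only [id] at h2
    refine h2.congr_deriv ?_
    ring

theorem tendsto_cauchyIntegral_cocompact {n p : ℝ → ℂ} (hn : Continuous n) (hp : Continuous p)
    (a b : ℝ) :
    Tendsto (fun x => ∫ s in a..b, n s / (p s - x)) (cocompact ℂ) (𝓝 0) := by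
  obtain ⟨C, hC⟩ := isCompact_uIcc.exists_bound_of_continuousOn (s := Set.uIcc a b)
    hn.continuousOn
  have hC0 : 0 ≤ C := (norm_nonneg _).trans (hC a Set.left_mem_uIcc)
  obtain ⟨D, hD⟩ := isCompact_uIcc.exists_bound_of_continuousOn (s := Set.uIcc a b)
    hp.continuousOn
  have hinf : Tendsto (fun x : ℂ => ‖x‖ - D) (cocompact ℂ) atTop :=
    tendsto_atTop_add_const_right _ _ (tendsto_norm_cocompact_atTop)
  have hlim : Tendsto (fun x : ℂ => C / (‖x‖ - D) * |b - a|) (cocompact ℂ) (𝓝 0) := by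
    have := (tendsto_const_nhds (x := C)).div_atTop hinf
    simpa using this.mul_const |b - a|
  refine squeeze_zero_norm' ?_ hlim
  filter_upwards [hinf.eventually_gt_atTop 0] with x hx
  refine intervalIntegral.norm_integral_le_of_norm_le_const fun s hs => ?_
  have hs' := Set.uIoc_subset_uIcc hs
  rw [norm_div]
  refine div_le_div₀ hC0 (hC s hs') hx ?_
  have := norm_sub_norm_le x (p s)
  rw [norm_sub_rev]
  linarith [hD s hs']

/-- Since x/(x - p) = 1 - p/(p - x), the product is the total mass minus a Cauchy integral that
tends to 0. -/
theorem tendsto_mul_cauchyIntegral_cocompact {n p : ℝ → ℂ} (hn : Continuous n) (hp : Continuous p)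
    (a b : ℝ) :
    Tendsto (fun x => x * ∫ s in a..b, n s / (x - p s)) (cocompact ℂ)
      (𝓝 (∫ s in a..b, n s)) := by
  have h1 := (tendsto_cauchyIntegral_cocompact (hn.mul hp) hp a b).const_sub (∫ s in a..b, n s)
  rw [sub_zero] at h1
  refine h1.congr' ?_
  have hcpt : IsCompact (p '' Set.uIcc a b) := isCompact_uIcc.image hp
  filter_upwards [hcpt.compl_mem_cocompact] with x hx
  have hne : ∀ s ∈ Set.uIcc a b, p s - x ≠ 0 := fun s hs h0 =>
    hx ⟨s, hs, sub_eq_zero.1 h0⟩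
  rw [← intervalIntegral.integral_const_mul, ← intervalIntegral.integral_sub
    (hn.intervalIntegrable _ _)]
  · refine intervalIntegral.integral_congr fun s hs => ?_
    have h2 := hne s hs
    have h3 : x - p s ≠ 0 := by rw [← neg_sub]; exact neg_ne_zero.2 h2
    have h4 : p s - x = -(x - p s) := by ring
    simp only [Pi.mul_apply]
    rw [h4]
    field_simp
    ring
  · exact ContinuousOn.intervalIntegrable ((hn.mul hp).continuousOn.div (by fun_prop) hne)

/-! ### The square root on the complement of a single cut -/

/-- The branch of `√((x - γ l)(x - γ r))` outside the cut `γ [l, r]` that is asymptotic to `x`. -/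
def cutBranch (γ : ℝ → ℂ) (l r : ℝ) (x : ℂ) : ℂ :=
  (x - γ l) * Complex.exp (1 / 2 * ∫ σ in l..r, deriv γ σ / (γ σ - x))

/-- The square root of the real number `u`, continued from positive `u` through the upper (`σ = 1`)
or lower (`σ = -1`) half plane. -/
def sideSqrt (σ u : ℝ) : ℂ := √u + σ * Complex.I * √(-u)

/-- The boundary value of `√((s - l)(s - r))` on the upper or lower side of the real line. -/
def cutWeight (σ l r s : ℝ) : ℂ := sideSqrt σ (s - l) * sideSqrt σ (s - r)

/-- The ratio between the boundary values of `√((x - γ l)(x - γ r))` along the path and those of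
`√((s - l)(s - r))` along the real line. -/
def cutFactor (γ : ℝ → ℂ) (l r s : ℝ) : ℂ :=
  Complex.exp (1 / 2 * (pathLog γ r s + pathLog γ l s))

theorem continuous_sideSqrt (σ : ℝ) : Continuous (sideSqrt σ) := by
  unfold sideSqrt
  have := Real.continuous_sqrt
  fun_prop

theorem sideSqrt_sq {σ : ℝ} (hσ : σ ^ 2 = 1) (u : ℝ) : sideSqrt σ u ^ 2 = u := by
  have hσ' : (σ : ℂ) ^ 2 = 1 := by exact_mod_cast hσ
  rcases le_total 0 u with h | h
  · rw [sideSqrt, Real.sqrt_eq_zero_of_nonpos (neg_nonpos.2 h)]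
    simp only [Complex.ofReal_zero, mul_zero, add_zero]
    exact_mod_cast Real.sq_sqrt h
  · rw [sideSqrt, Real.sqrt_eq_zero_of_nonpos h]
    have h2 : ((√(-u) : ℝ) : ℂ) ^ 2 = -u := by exact_mod_cast Real.sq_sqrt (neg_nonneg.2 h)
    simp only [Complex.ofReal_zero, zero_add, mul_pow, Complex.I_sq, hσ', h2]
    ring

theorem sideSqrt_ne_zero {σ : ℝ} (hσ : σ ^ 2 = 1) {u : ℝ} (hu : u ≠ 0) : sideSqrt σ u ≠ 0 := by
  intro h
  have := sideSqrt_sq hσ u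
  rw [h] at this
  simp at this
  exact hu (by exact_mod_cast this.symm)

/-- On the negative axis the imaginary part of the principal logarithm tends to π from above and to
-π from below; halving and exponentiating produces the factor ±i in `sideSqrt`. -/
theorem tendsto_exp_half_log {σ : ℝ} (hσ : σ ^ 2 = 1) {u : ℝ} (hu : u ≠ 0) :
    Tendsto (fun e : ℝ => Complex.exp (Complex.log (u + Complex.I * (σ * e : ℝ)) / 2))
      (𝓝[>] 0) (𝓝 (sideSqrt σ u)) := by
  have hz : Tendsto (fun e : ℝ => (u : ℂ) + Complex.I * (σ * e : ℝ)) (𝓝[>] 0) (𝓝 u) := by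
    have : Continuous fun e : ℝ => (u : ℂ) + Complex.I * (σ * e : ℝ) := by fun_prop
    have h2 := this.tendsto 0
    simp only [mul_zero, Complex.ofReal_zero, add_zero] at h2
    exact h2.mono_left nhdsWithin_le_nhds
  have hfin : ∀ v : ℂ, Complex.exp (v / 2) = sideSqrt σ u →
      Tendsto (fun e : ℝ => Complex.log (u + Complex.I * (σ * e : ℝ))) (𝓝[>] 0) (𝓝 v) →
      Tendsto (fun e : ℝ => Complex.exp (Complex.log (u + Complex.I * (σ * e : ℝ)) / 2))
        (𝓝[>] 0) (𝓝 (sideSqrt σ u)) := by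
    intro v hv h
    rw [← hv]
    exact (Complex.continuous_exp.tendsto _).comp (h.div_const 2)
  rcases lt_or_gt_of_ne hu with hneg | hpos
  · have hlog : Real.exp (Real.log (-u) / 2) = √(-u) := by
      rw [← Real.exp_log (Real.sqrt_pos.2 (neg_pos.2 hneg)), Real.log_sqrt (by linarith)]
    have hn : ‖(u : ℂ)‖ = -u := by rw [Complex.norm_real, Real.norm_of_nonpos hneg.le]
    rcases sq_eq_one_iff.1 hσ with rfl | rfl
    · refine hfin (Real.log ‖(u : ℂ)‖ + Real.pi * Complex.I) ?_ ?_
      · rw [hn, add_div, Complex.exp_add,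
          show (Real.pi : ℂ) * Complex.I / 2 = Real.pi / 2 * Complex.I by ring,
          Complex.exp_pi_div_two_mul_I, sideSqrt, Real.sqrt_eq_zero_of_nonpos hneg.le, ← hlog]
        push_cast
        ring
      · refine (Complex.tendsto_log_nhdsWithin_im_nonneg_of_re_neg_of_im_zero (z := (u : ℂ))
          (by simpa) (by simp)).comp (tendsto_nhdsWithin_iff.2 ⟨hz, ?_⟩)
        filter_upwards [self_mem_nhdsWithin] with e he
        simpa using (Set.mem_Ioi.1 he).le
    · refine hfin (Real.log ‖(u : ℂ)‖ - Real.pi * Complex.I) ?_ ?_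
      · rw [hn, sub_div, Complex.exp_sub, div_eq_mul_inv, ← Complex.exp_neg,
          show -((Real.pi : ℂ) * Complex.I / 2) = -Real.pi / 2 * Complex.I by ring,
          Complex.exp_neg_pi_div_two_mul_I, sideSqrt, Real.sqrt_eq_zero_of_nonpos hneg.le, ← hlog]
        push_cast
        ring
      · refine (Complex.tendsto_log_nhdsWithin_im_neg_of_re_neg_of_im_zero (z := (u : ℂ))
          (by simpa) (by simp)).comp (tendsto_nhdsWithin_iff.2 ⟨hz, ?_⟩)
        filter_upwards [self_mem_nhdsWithin] with e he
        simpa using he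
  · refine hfin (Complex.log u) ?_ ?_
    · rw [← Complex.ofReal_log hpos.le, sideSqrt, Real.sqrt_eq_zero_of_nonpos (by linarith : -u ≤ 0)]
      have hlog : Real.exp (Real.log u / 2) = √u := by
        rw [← Real.exp_log (Real.sqrt_pos.2 hpos), Real.log_sqrt hpos.le]
      rw [← hlog]
      push_cast
      ring
    · exact hz.clog (by left; simpa)

theorem integral_inv_add_I {s l r e : ℝ} (he : e ≠ 0) :
    ∫ σ in l..r, ((s : ℂ) - σ + Complex.I * e)⁻¹
      = Complex.log ((s - l : ℝ) + Complex.I * e) - Complex.log ((s - r : ℝ) + Complex.I * e) := by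
  have h : ∀ σ : ℝ, HasDerivAt (fun σ : ℝ => -Complex.log ((s : ℂ) - σ + Complex.I * e))
      ((s : ℂ) - σ + Complex.I * e)⁻¹ σ := by
    intro σ
    have h1 : HasDerivAt (fun σ : ℝ => (s : ℂ) - σ + Complex.I * e) (-1) σ := by
      simpa using ((hasDerivAt_id σ).ofReal_comp.const_sub (s : ℂ)).add_const (Complex.I * e)
    refine (h1.clog_real (by right; simpa)).neg.congr_deriv ?_
    rw [div_eq_mul_inv]; ring
  rw [intervalIntegral.integral_eq_sub_of_hasDerivAt (fun σ _ => h σ)]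
  · push_cast; ring
  · refine Continuous.intervalIntegrable (Continuous.inv₀ (by fun_prop) fun σ => ?_) _ _
    intro h0
    have := congrArg Complex.im h0
    simp at this
    exact he this

namespace IsRegularPath

variable {γ : ℝ → ℂ} (hγ : IsRegularPath γ)

include hγ

omit hγ in
theorem continuous_tube (hc : Continuous γ) (hd : Continuous (deriv γ)) :
    Continuous fun p : ℝ × ℝ => tube γ p.1 p.2 := by
  unfold tube
  fun_prop

omit hγ in
theorem tendsto_tube (s : ℝ) (σ : ℝ) :
    Tendsto (fun e : ℝ => tube γ s (σ * e)) (𝓝[>] 0) (𝓝 (γ s)) := by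
  have : Continuous fun e : ℝ => tube γ s (σ * e) := by unfold tube; fun_prop
  have h2 := this.tendsto 0
  simp only [mul_zero] at h2
  have h3 : tube γ s 0 = γ s := by simp [tube]
  rw [h3] at h2
  exact h2.mono_left nhdsWithin_le_nhds

/-- The regularised logarithmic integral of the path. -/
theorem integral_kernel_sub {s l r : ℝ} (hlr : l ≤ r) :
    ∫ σ in l..r, (deriv γ σ * (γ s - γ σ)⁻¹ - ((s : ℂ) - σ)⁻¹)
      = -(pathLog γ r s - pathLog γ l s) := by
  obtain ⟨c, M, e₀, hT⟩ := hγ.exists_tubeBound (min s l) (max s r)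
  have hmem : ∀ σ ∈ Set.Icc l r, σ ∈ Set.Icc (min s l) (max s r) := fun σ hσ =>
    ⟨(min_le_right _ _).trans hσ.1, hσ.2.trans (le_max_right _ _)⟩
  have hs : s ∈ Set.Icc (min s l) (max s r) := ⟨min_le_left _ _, le_max_left _ _⟩
  -- The primitive `-pathLog` is continuous but its derivative is known only for σ ≠ s, and s may
  -- lie in the interval of integration. The tube bound at height 0 makes the integrand bounded.
  have := MeasureTheory.integral_eq_of_hasDerivAt_off_countable_of_le
    (fun σ => -pathLog γ σ s) (fun σ => deriv γ σ * (γ s - γ σ)⁻¹ - ((s : ℂ) - σ)⁻¹) hlr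
    (Set.countable_singleton s) (hγ.continuous_pathLog_left s).neg.continuousOn ?_ ?_
  · rw [this]; ring
  · intro σ hσ
    refine (hγ.hasDerivAt_pathLog hσ.2).neg.congr_deriv ?_
    rw [← neg_sub (γ s), ← neg_sub (s : ℂ), div_neg, div_neg, div_eq_mul_inv, one_div]
    ring
  · have hc := hγ.continuous.measurable
    have hd := hγ.continuous_deriv.measurable
    rw [intervalIntegrable_iff_integrableOn_Icc_of_le hlr]
    refine MeasureTheory.Measure.integrableOn_of_bounded (M := 3 * M * c⁻¹) (by simp)
      (Measurable.aestronglyMeasurable (by fun_prop)) ?_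
    rw [MeasureTheory.ae_restrict_iff' measurableSet_Icc]
    refine MeasureTheory.ae_of_all _ fun σ hσ => ?_
    have := hT.norm_kernel_sub_le' (e := 0) hs (hmem σ hσ) (by simpa using hT.pos_height.le)
    simpa [tube] using this

/-- The kernel of the path is compared with that of the real line. Their difference is bounded, so
its integral passes to the limit and yields a difference of `pathLog`. The real kernel integrates to
two logarithms, whose halves exponentiate to the quotient of `sideSqrt` at s - r by that at s - l.
The prefactor γ(s) - γ(l) contains the square of the latter and turns the quotient into a product.
-/
theorem tendsto_cutBranch_tube {σ : ℝ} (hσ : σ ^ 2 = 1) {l r s : ℝ} (hlr : l < r) (hl : s ≠ l)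
    (hr : s ≠ r) :
    Tendsto (fun e : ℝ => cutBranch γ l r (tube γ s (σ * e))) (𝓝[>] 0)
      (𝓝 (cutWeight σ l r s * cutFactor γ l r s)) := by
  obtain ⟨c, M, e₀, hT⟩ := hγ.exists_tubeBound (min s l) (max s r)
  have hmem : ∀ σ ∈ Set.Icc l r, σ ∈ Set.Icc (min s l) (max s r) := fun σ hσ =>
    ⟨(min_le_right _ _).trans hσ.1, hσ.2.trans (le_max_right _ _)⟩
  have hs : s ∈ Set.Icc (min s l) (max s r) := ⟨min_le_left _ _, le_max_left _ _⟩
  have hσ1 : |σ| = 1 := by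
    rcases sq_eq_one_iff.1 hσ with rfl | rfl <;> simp
  have hσ0 : σ ≠ 0 := by rintro rfl; simp at hσ
  have hsmall : ∀ᶠ e : ℝ in 𝓝[>] 0, 0 < e ∧ |σ * e| ≤ e₀ := by
    filter_upwards [Ioo_mem_nhdsGT hT.pos_height] with e he
    exact ⟨he.1, by rw [abs_mul, hσ1, one_mul, abs_of_pos he.1]; exact he.2.le⟩
  have hcd := hγ.continuous_deriv
  have hcc := hγ.continuous
  have hcont : ∀ e : ℝ, 0 < e → |σ * e| ≤ e₀ →
      ContinuousOn (fun x => deriv γ x * (tube γ s (σ * e) - γ x)⁻¹) (Set.uIcc l r) ∧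
      Continuous (fun x : ℝ => ((s : ℂ) - x + Complex.I * (σ * e : ℝ))⁻¹) := by
    intro e he he'
    rw [Set.uIcc_of_le hlr.le]
    refine ⟨hcd.continuousOn.mul (ContinuousOn.inv₀ (by fun_prop) fun x hx =>
      hT.tube_sub_ne_zero hs (hmem x hx) he' (Or.inr (mul_ne_zero hσ0 he.ne'))), ?_⟩
    refine Continuous.inv₀ (by fun_prop) fun x h0 => ?_
    have := congrArg Complex.im h0
    simp at this
    exact this.elim hσ0 he.ne'
  have hR : Tendsto (fun e : ℝ => ∫ x in l..r, (deriv γ x * (tube γ s (σ * e) - γ x)⁻¹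
      - ((s : ℂ) - x + Complex.I * (σ * e : ℝ))⁻¹)) (𝓝[>] 0)
      (𝓝 (∫ x in l..r, (deriv γ x * (γ s - γ x)⁻¹ - ((s : ℂ) - x)⁻¹))) := by
    refine intervalIntegral.tendsto_integral_filter_of_dominated_convergence
      (fun _ => 3 * M * c⁻¹) ?_ ?_ intervalIntegrable_const ?_
    · filter_upwards [hsmall] with e he
      have := hcont e he.1 he.2
      exact ((this.1.sub this.2.continuousOn).mono
        Set.uIoc_subset_uIcc).aestronglyMeasurable measurableSet_uIoc
    · filter_upwards [hsmall] with e he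
      refine MeasureTheory.ae_of_all _ fun x hx => ?_
      rw [Set.uIoc_of_le hlr.le] at hx
      exact hT.norm_kernel_sub_le' hs (hmem x (Set.Ioc_subset_Icc_self hx)) he.2
    · filter_upwards [MeasureTheory.Measure.ae_ne MeasureTheory.volume s] with x hx _
      have h1 : γ s - γ x ≠ 0 := sub_ne_zero.2 (hγ.injective.ne hx.symm)
      have h2 : (s : ℂ) - x ≠ 0 := sub_ne_zero.2 (by exact_mod_cast hx.symm)
      refine (tendsto_const_nhds.mul (((tendsto_tube (γ := γ) s σ).sub_const _).inv₀ h1)).sub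
        (Tendsto.inv₀ ?_ h2)
      have : Continuous fun e : ℝ => (s : ℂ) - x + Complex.I * (σ * e : ℝ) := by fun_prop
      have h3 := this.tendsto 0
      simp only [mul_zero, Complex.ofReal_zero, add_zero] at h3
      exact h3.mono_left nhdsWithin_le_nhds
  rw [hγ.integral_kernel_sub hlr.le] at hR
  have hmain := ((((tendsto_tube (γ := γ) s σ).sub_const (γ l)).mul
    ((Complex.continuous_exp.tendsto _).comp (hR.const_mul (-(1 / 2) : ℂ)))).mul
    (tendsto_exp_half_log hσ (sub_ne_zero.2 hr))).mul
    ((tendsto_exp_half_log hσ (sub_ne_zero.2 hl)).inv₀ (sideSqrt_ne_zero hσ (sub_ne_zero.2 hl)))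
  have hlim : (γ s - γ l) * Complex.exp (-(1 / 2) * -(pathLog γ r s - pathLog γ l s))
      * sideSqrt σ (s - r) * (sideSqrt σ (s - l))⁻¹ = cutWeight σ l r s * cutFactor γ l r s := by
    have h1 : γ s - γ l = Complex.exp (pathLog γ l s) * sideSqrt σ (s - l) ^ 2 := by
      rw [hγ.exp_pathLog, sideSqrt_sq hσ, hγ.divDiff_comm, ← hγ.divDiff_mul]
      push_cast; rfl
    have h2 := sideSqrt_ne_zero hσ (sub_ne_zero.2 hl)
    rw [h1, cutWeight, cutFactor]
    have h3 : Complex.exp (1 / 2 * (pathLog γ r s + pathLog γ l s))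
        = Complex.exp (pathLog γ l s)
          * Complex.exp (-(1 / 2) * -(pathLog γ r s - pathLog γ l s)) := by
      rw [← Complex.exp_add]; congr 1; ring
    rw [h3]
    field_simp
  rw [hlim] at hmain
  refine hmain.congr' ?_
  filter_upwards [hsmall] with e he
  have hc := hcont e he.1 he.2
  have hsplit : ∫ x in l..r, deriv γ x / (γ x - tube γ s (σ * e))
      = -(∫ x in l..r, (deriv γ x * (tube γ s (σ * e) - γ x)⁻¹
        - ((s : ℂ) - x + Complex.I * (σ * e : ℝ))⁻¹))
        - (Complex.log ((s - l : ℝ) + Complex.I * (σ * e : ℝ))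
          - Complex.log ((s - r : ℝ) + Complex.I * (σ * e : ℝ))) := by
    rw [intervalIntegral.integral_sub hc.1.intervalIntegrable (hc.2.intervalIntegrable _ _),
      integral_inv_add_I (mul_ne_zero hσ0 he.1.ne'), ← sub_eq_zero]
    have : ∫ x in l..r, deriv γ x / (γ x - tube γ s (σ * e))
      = -∫ x in l..r, deriv γ x * (tube γ s (σ * e) - γ x)⁻¹ := by
      rw [← intervalIntegral.integral_neg]
      congr 1; ext x
      rw [← neg_sub, div_neg, div_eq_mul_inv]
    rw [this]; ring
  rw [cutBranch, hsplit, Function.comp_apply, ← Complex.exp_neg, mul_assoc, mul_assoc,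
    ← Complex.exp_add, ← Complex.exp_add]
  congr 2
  ring

end IsRegularPath

/-! ### The inverse square root of a quadratic polynomial as a Cauchy integral. -/

/-- The parametrisation of `[l, r]` by an angle in `[0, π]`. -/
def arcParam (l r θ : ℝ) : ℝ := (l + r) / 2 - (r - l) / 2 * Real.cos θ

/-- The density of the Cauchy transform of `1 / √((x - γ l)(x - γ r))` in the angle. -/
def arcDensity (γ : ℝ → ℂ) (l r θ : ℝ) : ℂ :=
  deriv γ (arcParam l r θ) / cutFactor γ l r (arcParam l r θ)

/-- The square root along the cut, as a function of the angle. -/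
def arcRoot (γ : ℝ → ℂ) (l r θ : ℝ) : ℂ :=
  (r - l) / 2 * Real.sin θ * cutFactor γ l r (arcParam l r θ)

/-- `-π` times `1 / √((x - γ l)(x - γ r))`, as a Cauchy integral. -/
def cutTransform (γ : ℝ → ℂ) (l r : ℝ) (x : ℂ) : ℂ :=
  ∫ θ in (0 : ℝ)..Real.pi, arcDensity γ l r θ / (γ (arcParam l r θ) - x)

theorem continuous_arcParam (l r : ℝ) : Continuous (arcParam l r) := by
  unfold arcParam; fun_prop

theorem hasDerivAt_arcParam (l r θ : ℝ) :
    HasDerivAt (arcParam l r) ((r - l) / 2 * Real.sin θ) θ := by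
  have := ((Real.hasDerivAt_cos θ).const_mul ((r - l) / 2)).const_sub ((l + r) / 2)
  refine this.congr_deriv ?_
  ring

theorem arcParam_mem {l r : ℝ} (hlr : l ≤ r) (θ : ℝ) : arcParam l r θ ∈ Set.Icc l r := by
  unfold arcParam
  constructor <;> nlinarith [Real.neg_one_le_cos θ, Real.cos_le_one θ]

theorem arcParam_mem_Ioo {l r : ℝ} (hlr : l < r) {θ : ℝ} (hθ : θ ∈ Set.Ioo 0 Real.pi) :
    arcParam l r θ ∈ Set.Ioo l r := by
  have h1 : Real.cos θ < 1 := by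
    rw [← Real.cos_zero]
    exact Real.cos_lt_cos_of_nonneg_of_le_pi le_rfl hθ.2.le hθ.1
  have h2 : -1 < Real.cos θ := by
    rw [← Real.cos_pi]
    exact Real.cos_lt_cos_of_nonneg_of_le_pi hθ.1.le le_rfl hθ.2
  unfold arcParam
  constructor <;> nlinarith

theorem arcParam_zero (l r : ℝ) : arcParam l r 0 = l := by simp [arcParam]; ring

theorem arcParam_pi (l r : ℝ) : arcParam l r Real.pi = r := by simp [arcParam]; ring

theorem arcParam_sub_mul (l r θ : ℝ) :
    (arcParam l r θ - l) * (r - arcParam l r θ) = ((r - l) / 2 * Real.sin θ) ^ 2 := by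
  have := Real.sin_sq_add_cos_sq θ
  unfold arcParam
  linear_combination (-(r - l) ^ 2 / 4) * this

theorem cutFactor_ne_zero (γ : ℝ → ℂ) (l r s : ℝ) : cutFactor γ l r s ≠ 0 :=
  Complex.exp_ne_zero _

namespace IsRegularPath

variable {γ : ℝ → ℂ} (hγ : IsRegularPath γ)

include hγ

theorem continuous_cutFactor (l r : ℝ) : Continuous (cutFactor γ l r) := by
  have h1 := hγ.continuous_pathLog_right r
  have h2 := hγ.continuous_pathLog_right l
  unfold cutFactor
  fun_prop

theorem continuous_arcDensity (l r : ℝ) : Continuous (arcDensity γ l r) := by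
  have h1 := hγ.continuous_cutFactor l r
  have h2 := hγ.continuous_deriv
  have h3 := continuous_arcParam l r
  exact (h2.comp h3).div (h1.comp h3) fun θ => cutFactor_ne_zero _ _ _ _

theorem continuous_arcRoot (l r : ℝ) : Continuous (arcRoot γ l r) := by
  have h1 := hγ.continuous_cutFactor l r
  have h3 := continuous_arcParam l r
  unfold arcRoot
  fun_prop

theorem cutFactor_sq_mul (l r s : ℝ) :
    cutFactor γ l r s ^ 2 * (((s - l) * (s - r) : ℝ) : ℂ) = (γ s - γ l) * (γ s - γ r) := by
  rw [cutFactor, ← Complex.exp_nat_mul]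
  have : ((2 : ℕ) : ℂ) * (1 / 2 * (pathLog γ r s + pathLog γ l s))
    = pathLog γ r s + pathLog γ l s := by push_cast; ring
  rw [this, Complex.exp_add, hγ.exp_pathLog, hγ.exp_pathLog, hγ.divDiff_comm r, hγ.divDiff_comm l,
    ← hγ.divDiff_mul s l, ← hγ.divDiff_mul s r]
  push_cast
  ring

theorem arcRoot_sq (l r θ : ℝ) : arcRoot γ l r θ ^ 2
    = -((γ (arcParam l r θ) - γ l) * (γ (arcParam l r θ) - γ r)) := by
  rw [← hγ.cutFactor_sq_mul, arcRoot, mul_pow, mul_comm, ← mul_neg]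
  congr 1
  have := arcParam_sub_mul l r θ
  have h2 : (((arcParam l r θ - l) * (r - arcParam l r θ) : ℝ) : ℂ)
    = (((r - l) / 2 * Real.sin θ) ^ 2 : ℝ) := by rw [this]
  push_cast at h2 ⊢
  rw [← h2]; ring

theorem hasDerivAt_cutFactor {l r s : ℝ} (hl : s ≠ l) (hr : s ≠ r) :
    HasDerivAt (cutFactor γ l r) (cutFactor γ l r s * (1 / 2 *
      ((deriv γ s / (γ s - γ r) - 1 / ((s : ℂ) - r))
        + (deriv γ s / (γ s - γ l) - 1 / ((s : ℂ) - l))))) s := by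
  have h1 : HasDerivAt (fun s => pathLog γ r s)
      (deriv γ s / (γ s - γ r) - 1 / ((s : ℂ) - r)) s := by
    simp_rw [hγ.pathLog_comm r]
    exact hγ.hasDerivAt_pathLog hr
  have h2 : HasDerivAt (fun s => pathLog γ l s)
      (deriv γ s / (γ s - γ l) - 1 / ((s : ℂ) - l)) s := by
    simp_rw [hγ.pathLog_comm l]
    exact hγ.hasDerivAt_pathLog hl
  exact ((h1.add h2).const_mul (1 / 2 : ℂ)).cexp

theorem hasDerivAt_arcPoint (l r θ : ℝ) :
    HasDerivAt (fun θ => γ (arcParam l r θ)) (arcDensity γ l r θ * arcRoot γ l r θ) θ := by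
  refine ((hγ.hasDerivAt _).scomp θ (hasDerivAt_arcParam l r θ)).congr_deriv ?_
  have := cutFactor_ne_zero γ l r (arcParam l r θ)
  rw [arcDensity, arcRoot, Complex.real_smul]
  push_cast
  field_simp

/-- With w = γ - (γ l + γ r)/2, root ρ and density n one has w' = nρ and ρ' = -nw: the pair rotates
through the complex angle ∫ n, as (-cos θ, sin θ) does for a straight cut. Using the angle as
parameter removes the inverse square root singularities at the ends. -/
theorem hasDerivAt_arcRoot {l r θ : ℝ} (hlr : l < r) (hθ : θ ∈ Set.Ioo 0 Real.pi) :
    HasDerivAt (arcRoot γ l r)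
      (-(γ (arcParam l r θ) - (γ l + γ r) / 2) * arcDensity γ l r θ) θ := by
  have hmem := arcParam_mem_Ioo hlr hθ
  have hl : arcParam l r θ ≠ l := hmem.1.ne'
  have hr : arcParam l r θ ≠ r := hmem.2.ne
  have h1 : HasDerivAt (fun θ : ℝ => ((r : ℂ) - l) / 2 * (Real.sin θ : ℝ))
      (((r : ℂ) - l) / 2 * (Real.cos θ : ℝ)) θ :=
    ((Real.hasDerivAt_sin θ).ofReal_comp).const_mul _
  have h2 := (hγ.hasDerivAt_cutFactor hl hr).scomp θ (hasDerivAt_arcParam l r θ)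
  refine (h1.mul h2).congr_deriv ?_
  have hE := cutFactor_ne_zero γ l r (arcParam l r θ)
  have hE2 := hγ.cutFactor_sq_mul l r (arcParam l r θ)
  have hgl : γ (arcParam l r θ) - γ l ≠ 0 := sub_ne_zero.2 (hγ.injective.ne hl)
  have hgr : γ (arcParam l r θ) - γ r ≠ 0 := sub_ne_zero.2 (hγ.injective.ne hr)
  have hsl : (arcParam l r θ : ℂ) - l ≠ 0 := sub_ne_zero.2 (by exact_mod_cast hl)
  have hsr : (arcParam l r θ : ℂ) - r ≠ 0 := sub_ne_zero.2 (by exact_mod_cast hr)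
  have hs2 : (((r : ℂ) - l) / 2 * (Real.sin θ : ℝ)) ^ 2
      = -((arcParam l r θ - l) * (arcParam l r θ - r)) := by
    have := arcParam_sub_mul l r θ
    have h2 : (((arcParam l r θ - l) * (r - arcParam l r θ) : ℝ) : ℂ)
      = (((r - l) / 2 * Real.sin θ) ^ 2 : ℝ) := by rw [this]
    push_cast at h2 ⊢
    rw [← h2]; ring
  have hcos : ((r : ℂ) - l) / 2 * (Real.cos θ : ℝ) = (l + r) / 2 - arcParam l r θ := by
    rw [arcParam]; push_cast; ring
  rw [arcDensity, hcos, Complex.real_smul]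
  simp only [Function.comp]
  push_cast at hE2 ⊢
  generalize (arcParam l r θ : ℂ) = z at *
  generalize cutFactor γ l r (arcParam l r θ) = E at *
  generalize γ (arcParam l r θ) = w at *
  generalize deriv γ (arcParam l r θ) = w' at *
  rw [show ∀ A B : ℂ, ((r : ℂ) - l) / 2 * Complex.sin θ * (((r : ℂ) - l) / 2 * Complex.sin θ * (E * A))
    = (((r : ℂ) - l) / 2 * Complex.sin θ) ^ 2 * (E * A) from fun A B => by ring]
  rw [Complex.ofReal_sin] at hs2
  rw [hs2]
  · have h5 : E ^ 2 * ((z - l) * (z - r)) * ((w - γ r) + (w - γ l))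
      = (w - γ l) * (w - γ r) * ((w - γ r) + (w - γ l)) := by rw [hE2]
    field_simp
    linear_combination (-1 : ℂ) * w' * h5
  · exact 0

end IsRegularPath

/-- The density, along the path, of the jump of `-√((x - γ l)(x - γ r)) / 2` divided by `2πi`. -/
def cutDensity (γ : ℝ → ℂ) (l r s : ℝ) : ℂ :=
  deriv γ s * √((s - l) * (r - s)) * cutFactor γ l r s / (2 * Real.pi)

namespace IsRegularPath

variable {γ : ℝ → ℂ} (hγ : IsRegularPath γ)

include hγ

theorem continuous_arcPoint (l r : ℝ) : Continuous fun θ => γ (arcParam l r θ) :=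
  hγ.continuous.comp (continuous_arcParam l r)

/-- The function f = w + iρ, with w and ρ the centred position and the root, satisfies f' = -i n f
and changes sign from θ = 0 to θ = π. Hence exp(-i ∫ n) = -1, and ∫ n lies in π + 2πℤ. It is
continuous in r and equals π for the degenerate cut r = l, where n = 1. -/
theorem integral_arcDensity {l r : ℝ} (hlr : l ≤ r) :
    ∫ θ in (0 : ℝ)..Real.pi, arcDensity γ l r θ = Real.pi := by
  have hcont : Continuous fun r : ℝ => ∫ θ in (0 : ℝ)..Real.pi, arcDensity γ l r θ := by
    refine intervalIntegral.continuous_parametric_intervalIntegral_of_continuous' ?_ 0 Real.pi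
    have harc : Continuous fun p : ℝ × ℝ => arcParam l p.1 p.2 := by unfold arcParam; fun_prop
    have h1 : Continuous fun p : ℝ × ℝ => cutFactor γ l p.1 (arcParam l p.1 p.2) := by
      have h2 := hγ.continuous_pathLog.comp (continuous_fst.prodMk harc)
      have h3 := (hγ.continuous_pathLog_right l).comp harc
      exact Complex.continuous_exp.comp (continuous_const.mul (h2.add h3))
    exact (hγ.continuous_deriv.comp harc).div h1 fun p => cutFactor_ne_zero _ _ _ _
  have hl : ∫ θ in (0 : ℝ)..Real.pi, arcDensity γ l l θ = Real.pi := by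
    have : ∀ θ, arcDensity γ l l θ = 1 := by
      intro θ
      have h1 : arcParam l l θ = l := by simp [arcParam]
      have h2 : cutFactor γ l l l = deriv γ l := by
        rw [cutFactor, ← two_mul, ← mul_assoc]
        norm_num
        rw [hγ.exp_pathLog, divDiff_self]
      rw [arcDensity, h1, h2, div_self (hγ.regular l)]
    simp [this]
  have hexp : ∀ r, l ≤ r →
      Complex.exp (-Complex.I * ((∫ θ in (0 : ℝ)..Real.pi, arcDensity γ l r θ) - Real.pi)) = 1 := by
    intro r hr
    rcases hr.eq_or_lt with rfl | hr
    · rw [hl]; simp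
    have key := eq_mul_exp_integral Real.pi_pos.le
      (f := fun θ => γ (arcParam l r θ) - (γ l + γ r) / 2 + Complex.I * arcRoot γ l r θ)
      (h := fun θ => -Complex.I * arcDensity γ l r θ)
      (by
        have h1 := hγ.continuous_arcPoint l r
        have h2 := hγ.continuous_arcRoot l r
        exact ((h1.sub continuous_const).add (continuous_const.mul h2)).continuousOn)
      (by
        have h2 := hγ.continuous_arcDensity l r
        fun_prop) (fun θ hθ => by
        refine (((hγ.hasDerivAt_arcPoint l r θ).sub_const _).add
          ((hγ.hasDerivAt_arcRoot hr hθ).const_mul Complex.I)).congr_deriv ?_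
        linear_combination (arcDensity γ l r θ * arcRoot γ l r θ) * Complex.I_sq)
    rw [intervalIntegral.integral_const_mul] at key
    simp only [arcParam_pi, arcParam_zero, arcRoot, Real.sin_pi, Real.sin_zero,
      Complex.ofReal_zero, mul_zero, zero_mul, add_zero] at key
    have hne : γ r - γ l ≠ 0 := sub_ne_zero.2 (hγ.injective.ne hr.ne')
    rw [mul_sub, sub_eq_add_neg, Complex.exp_add]
    have h2 : Complex.exp (-(-Complex.I * Real.pi)) = -1 := by
      rw [neg_mul, neg_neg, mul_comm, Complex.exp_pi_mul_I]
    rw [h2]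
    have h3 : (γ r - γ l) * Complex.exp (-Complex.I * ∫ θ in (0 : ℝ)..Real.pi, arcDensity γ l r θ)
      = (γ r - γ l) * (-1) := by linear_combination (2 : ℂ) * key
    rw [mul_left_cancel₀ hne h3]
    norm_num
  have := isPreconnected_Ici.eq_zero_of_exp_eq_one
    (f := fun r => -Complex.I * ((∫ θ in (0 : ℝ)..Real.pi, arcDensity γ l r θ) - Real.pi))
    (continuous_const.mul (hcont.sub continuous_const)).continuousOn hexp (x₀ := l) (Set.mem_Ici.2 le_rfl) (by rw [hl]; simp) (Set.mem_Ici.2 hlr)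
  simpa [sub_eq_zero] using this

omit hγ in
theorem notMem_image_arc {l r : ℝ} (hlr : l ≤ r) {x : ℂ} (hx : x ∉ γ '' Set.Icc l r) :
    x ∉ (fun θ => γ (arcParam l r θ)) '' Set.uIcc 0 Real.pi := by
  rintro ⟨θ, -, rfl⟩
  exact hx ⟨_, arcParam_mem hlr θ, rfl⟩

theorem hasDerivAt_cutTransform {l r : ℝ} (hlr : l ≤ r) {x : ℂ} (hx : x ∉ γ '' Set.Icc l r) :
    HasDerivAt (cutTransform γ l r) (∫ θ in (0 : ℝ)..Real.pi,
      arcDensity γ l r θ / (γ (arcParam l r θ) - x) ^ 2) x :=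
  hasDerivAt_cauchyIntegral (hγ.continuous_arcDensity l r) (hγ.continuous_arcPoint l r)
    (notMem_image_arc hlr hx)

/-- The left side is the integral of the θ-derivative of `arcRoot` divided by γ - x, and `arcRoot`
vanishes at both ends. -/
theorem cutTransform_ode {l r : ℝ} (hlr : l < r) {x : ℂ} (hx : x ∉ γ '' Set.Icc l r) :
    (x - γ l) * (x - γ r) * (∫ θ in (0 : ℝ)..Real.pi,
      arcDensity γ l r θ / (γ (arcParam l r θ) - x) ^ 2)
      + (x - (γ l + γ r) / 2) * cutTransform γ l r x = 0 := by
  have hn := hγ.continuous_arcDensity l r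
  have hp := hγ.continuous_arcPoint l r
  have hg := hγ.continuous_arcRoot l r
  have hne : ∀ θ, γ (arcParam l r θ) - x ≠ 0 := fun θ h0 =>
    hx ⟨_, arcParam_mem hlr.le θ, sub_eq_zero.1 h0⟩
  have hc1 : Continuous fun θ => arcDensity γ l r θ / (γ (arcParam l r θ) - x) ^ 2 :=
    hn.div ((hp.sub continuous_const).pow 2) fun θ => pow_ne_zero _ (hne θ)
  have hc2 : Continuous fun θ => arcDensity γ l r θ / (γ (arcParam l r θ) - x) :=
    hn.div (hp.sub continuous_const) hne
  have hi1 : IntervalIntegrable (fun θ => (x - γ l) * (x - γ r)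
      * (arcDensity γ l r θ / (γ (arcParam l r θ) - x) ^ 2)) MeasureTheory.volume 0 Real.pi :=
    (continuous_const.mul hc1).intervalIntegrable _ _
  have hi2 : IntervalIntegrable (fun θ => (x - (γ l + γ r) / 2)
      * (arcDensity γ l r θ / (γ (arcParam l r θ) - x))) MeasureTheory.volume 0 Real.pi :=
    (continuous_const.mul hc2).intervalIntegrable _ _
  have key := intervalIntegral.integral_eq_sub_of_hasDerivAt_of_le Real.pi_pos.le
    (f := fun θ => arcRoot γ l r θ / (γ (arcParam l r θ) - x))
    (f' := fun θ => (x - γ l) * (x - γ r) * (arcDensity γ l r θ / (γ (arcParam l r θ) - x) ^ 2)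
      + (x - (γ l + γ r) / 2) * (arcDensity γ l r θ / (γ (arcParam l r θ) - x)))
    (hg.div (hp.sub continuous_const) hne).continuousOn (fun θ hθ => by
      refine ((hγ.hasDerivAt_arcRoot hlr hθ).div ((hγ.hasDerivAt_arcPoint l r θ).sub_const x)
        (hne θ)).congr_deriv ?_
      have h1 := hγ.arcRoot_sq l r θ
      have h2 := hne θ
      field_simp
      linear_combination (-2 * arcDensity γ l r θ) * h1)
    (hi1.add hi2)
  rw [intervalIntegral.integral_add hi1 hi2, intervalIntegral.integral_const_mul,
    intervalIntegral.integral_const_mul] at key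
  rw [cutTransform, key]
  simp [arcRoot]

theorem differentiableAt_cutBranch {l r : ℝ} (hlr : l ≤ r) {x : ℂ} (hx : x ∉ γ '' Set.Icc l r) :
    DifferentiableAt ℂ (cutBranch γ l r) x := by
  have h := (hasDerivAt_cauchyIntegral hγ.continuous_deriv hγ.continuous (a := l) (b := r)
    (x := x) (by rwa [Set.uIcc_of_le hlr])).differentiableAt
  unfold cutBranch
  fun_prop

/-- Exponentiating the integral of the logarithmic derivative of γ - x gives the ratio of its end
point values; no branch of the logarithm enters. -/
theorem cutBranch_sq {l r : ℝ} (hlr : l ≤ r) {x : ℂ} (hx : x ∉ γ '' Set.Icc l r) :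
    cutBranch γ l r x ^ 2 = (x - γ l) * (x - γ r) := by
  have hne : ∀ s ∈ Set.Icc l r, γ s - x ≠ 0 := fun s hs h0 => hx ⟨s, hs, sub_eq_zero.1 h0⟩
  have hc := hγ.continuous
  have := eq_mul_exp_integral hlr (f := fun s => γ s - x) (h := fun s => deriv γ s / (γ s - x))
    (by fun_prop) (hγ.continuous_deriv.continuousOn.div (by fun_prop) hne) (fun s hs => by
      refine ((hγ.hasDerivAt s).sub_const x).congr_deriv ?_
      rw [div_mul_cancel₀ _ (hne s (Set.Ioo_subset_Icc_self hs))])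
  rw [cutBranch, mul_pow, ← Complex.exp_nat_mul]
  have h2 : ((2 : ℕ) : ℂ) * (1 / 2 * ∫ σ in l..r, deriv γ σ / (γ σ - x))
    = ∫ σ in l..r, deriv γ σ / (γ σ - x) := by push_cast; ring
  rw [h2]
  linear_combination (x - γ l) * this

theorem cutBranch_ne_zero {l r : ℝ} (hlr : l ≤ r) {x : ℂ} (hx : x ∉ γ '' Set.Icc l r) :
    cutBranch γ l r x ≠ 0 := by
  intro h0
  have := hγ.cutBranch_sq hlr hx
  rw [h0] at this
  simp only [ne_eq, OfNat.ofNat_ne_zero, not_false_eq_true, zero_pow, zero_eq_mul,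
    sub_eq_zero] at this
  rcases this with h | h
  · exact hx ⟨l, ⟨le_rfl, hlr⟩, h.symm⟩
  · exact hx ⟨r, ⟨hlr, le_rfl⟩, h.symm⟩

omit hγ in
theorem isClosed_cut (hc : Continuous γ) (l r : ℝ) : IsClosed (γ '' Set.Icc l r) :=
  (isCompact_Icc.image hc).isClosed

/-- The equation 2YY' = 2x - (γ l + γ r) and `cutTransform_ode` say that Y and the transform have
opposite logarithmic derivatives. Constancy of the product on the whole complement would require
that an arc does not separate the plane; it is used only along explicit curves that lead to
infinity. -/
theorem hasDerivAt_cutTransform_mul_cutBranch {l r : ℝ} (hlr : l < r) {x : ℂ}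
    (hx : x ∉ γ '' Set.Icc l r) :
    HasDerivAt (fun x => cutTransform γ l r x * cutBranch γ l r x) 0 x := by
  have hY := (hγ.differentiableAt_cutBranch hlr.le hx).hasDerivAt
  have hU := hγ.hasDerivAt_cutTransform hlr.le hx
  have hsq : 2 * cutBranch γ l r x * deriv (cutBranch γ l r) x = 2 * x - (γ l + γ r) := by
    have h1 : HasDerivAt (fun x => cutBranch γ l r x ^ 2) (2 * x - (γ l + γ r)) x := by
      have h2 : HasDerivAt (fun x => (x - γ l) * (x - γ r)) (2 * x - (γ l + γ r)) x := by
        refine (((hasDerivAt_id x).sub_const _).mul ((hasDerivAt_id x).sub_const _)).congr_deriv ?_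
        simp only [id]; ring
      refine h2.congr_of_eventuallyEq ?_
      filter_upwards [(isClosed_cut hγ.continuous l r).isOpen_compl.mem_nhds hx] with y hy
      exact hγ.cutBranch_sq hlr.le hy
    have h3 := (hY.pow 2).unique h1
    simpa using h3
  refine (hU.mul hY).congr_deriv ?_
  refine mul_right_cancel₀ (hγ.cutBranch_ne_zero hlr.le hx) ?_
  have h1 := hγ.cutTransform_ode hlr hx
  have h2 := hγ.cutBranch_sq hlr.le hx
  rw [zero_mul]
  linear_combination h1 + (∫ θ in (0 : ℝ)..Real.pi,
      arcDensity γ l r θ / (γ (arcParam l r θ) - x) ^ 2) * h2 + cutTransform γ l r x / 2 * hsq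

theorem cutTransform_mul_cutBranch_eq {l r : ℝ} (hlr : l < r) {c c' : ℝ → ℂ} {a b : ℝ} (hab : a ≤ b)
    (hc : ∀ s ∈ Set.Icc a b, HasDerivAt c (c' s) s) (hx : ∀ s ∈ Set.Icc a b, c s ∉ γ '' Set.Icc l r) :
    cutTransform γ l r (c a) * cutBranch γ l r (c a)
      = cutTransform γ l r (c b) * cutBranch γ l r (c b) := by
  have h : ∀ s ∈ Set.Icc a b,
      HasDerivAt (fun s => cutTransform γ l r (c s) * cutBranch γ l r (c s)) 0 s := fun s hs => by
    have := (hγ.hasDerivAt_cutTransform_mul_cutBranch hlr (hx s hs)).comp s (hc s hs)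
    simpa [Function.comp_def] using this
  exact eq_of_hasDerivAt_zero hab (fun s hs => (h s hs).continuousAt.continuousWithinAt)
    fun s hs => h s (Set.Ioo_subset_Icc_self hs)

theorem tendsto_cutBranch_div (l r : ℝ) :
    Tendsto (fun x => cutBranch γ l r x / x) (cocompact ℂ) (𝓝 1) := by
  have h1 := (tendsto_cauchyIntegral_cocompact hγ.continuous_deriv hγ.continuous l r).const_mul
    (1 / 2 : ℂ)
  have h2 := (Complex.continuous_exp.tendsto _).comp h1
  have h3 : Tendsto (fun x : ℂ => 1 - γ l * x⁻¹) (cocompact ℂ) (𝓝 (1 - γ l * 0)) :=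
    (tendsto_inv₀_cobounded.mono_left Metric.cobounded_eq_cocompact.ge).const_mul _ |>.const_sub _
  have h4 := h3.mul h2
  simp only [mul_zero, sub_zero, Complex.exp_zero, mul_one] at h4
  refine h4.congr' ?_
  filter_upwards [(isCompact_singleton (x := (0 : ℂ))).compl_mem_cocompact] with x hx
  have hx : x ≠ 0 := hx
  simp only [Function.comp_apply, cutBranch]
  field_simp

theorem tendsto_cutTransform_mul_cutBranch {l r : ℝ} (hlr : l ≤ r) :
    Tendsto (fun x => cutTransform γ l r x * cutBranch γ l r x) (cocompact ℂ) (𝓝 (-Real.pi)) := by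
  have h1 := tendsto_mul_cauchyIntegral_cocompact (hγ.continuous_arcDensity l r)
    (hγ.continuous_arcPoint l r) 0 Real.pi
  rw [hγ.integral_arcDensity hlr] at h1
  have h2 := (h1.mul (hγ.tendsto_cutBranch_div l r)).neg
  rw [mul_one] at h2
  refine h2.congr' ?_
  filter_upwards [(isCompact_singleton (x := (0 : ℂ))).compl_mem_cocompact] with x hx
  have hx : x ≠ 0 := hx
  have h3 : ∫ s in (0 : ℝ)..Real.pi, arcDensity γ l r s / (x - γ (arcParam l r s))
      = -cutTransform γ l r x := by
    rw [cutTransform, ← intervalIntegral.integral_neg]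
    congr 1; ext θ
    rw [← neg_sub, div_neg]
  rw [h3]
  field_simp

theorem tendsto_atTop : Tendsto γ atTop (cocompact ℂ) := by
  have : Tendsto (fun s : ℝ => (s : ℂ)) atTop (cocompact ℂ) :=
    (Complex.isometry_ofReal.isClosedEmbedding.tendsto_cocompact).mono_left atTop_le_cocompact
  refine this.congr' ?_
  filter_upwards [hγ.tail] with s hs using hs.symm

theorem notMem_cut {l r s : ℝ} (hs : s ∉ Set.Icc l r) : γ s ∉ γ '' Set.Icc l r := by
  rintro ⟨s', hs', h⟩
  exact hs (hγ.injective h ▸ hs')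

/-- The path itself joins γ(s) to infinity without meeting the cut: backwards if s precedes the cut,
forwards if it follows. So the constant is the limit at infinity. -/
theorem cutTransform_mul_cutBranch_path {l r s : ℝ} (hlr : l < r) (hs : s ∉ Set.Icc l r) :
    cutTransform γ l r (γ s) * cutBranch γ l r (γ s) = -Real.pi := by
  have hlim := hγ.tendsto_cutTransform_mul_cutBranch hlr.le
  rcases lt_or_ge s l with h | h
  · refine tendsto_nhds_unique (tendsto_const_nhds.congr' ?_) (hlim.comp hγ.atBot)
    filter_upwards [eventually_le_atBot s] with s' hs'
    exact (hγ.cutTransform_mul_cutBranch_eq hlr hs' (fun u _ => hγ.hasDerivAt u) fun u hu =>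
      hγ.notMem_cut fun h' => by linarith [hu.2, h'.1]).symm
  · have h : r < s := by
      by_contra! h'
      exact hs ⟨h, h'⟩
    refine tendsto_nhds_unique (tendsto_const_nhds.congr' ?_) (hlim.comp hγ.tendsto_atTop)
    filter_upwards [eventually_ge_atTop s] with s' hs'
    exact hγ.cutTransform_mul_cutBranch_eq hlr hs' (fun u _ => hγ.hasDerivAt u) fun u hu =>
      hγ.notMem_cut fun h' => by linarith [hu.1, h'.2]

theorem hasDerivAt_tube (s e : ℝ) :
    HasDerivAt (fun s => tube γ s e) (deriv γ s + Complex.I * e * deriv (deriv γ) s) s :=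
  (hγ.hasDerivAt s).add
    (((hγ.contDiff_deriv.differentiable one_ne_zero s).hasDerivAt).const_mul _)

omit hγ in
theorem hasDerivAt_tube_height (s e : ℝ) :
    HasDerivAt (fun e => tube γ s e) (Complex.I * deriv γ s) e := by
  have := ((((hasDerivAt_id e).ofReal_comp).const_mul Complex.I).mul_const (deriv γ s)).const_add
    (γ s)
  unfold tube
  simpa using this

omit hγ in
theorem tube_notMem {A B c M e₀ l r s e : ℝ} (hT : TubeBound γ A B c M e₀) (hl : A ≤ l) (hr : r ≤ B)
    (hs : s ∈ Set.Icc A B) (he : |e| ≤ e₀) (hne : s ∉ Set.Icc l r ∨ e ≠ 0) :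
    tube γ s e ∉ γ '' Set.Icc l r := by
  rintro ⟨s', hs', h⟩
  refine hT.tube_sub_ne_zero hs ⟨hl.trans hs'.1, hs'.2.trans hr⟩ he ?_ (sub_eq_zero.2 h.symm)
  exact hne.imp_left fun h1 h2 => h1 (h2 ▸ hs')

/-- A point of the tube is moved parallel to the path up to the parameter B beyond the cut, and from
there along the normal down to γ(B). -/
theorem cutTransform_mul_cutBranch_tube {A B c M e₀ l r s e : ℝ} (hT : TubeBound γ A B c M e₀)
    (hlr : l < r) (hl : A ≤ l) (hr : r < B) (hs : s ∈ Set.Icc A B) (he : |e| ≤ e₀) (he0 : e ≠ 0) :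
    cutTransform γ l r (tube γ s e) * cutBranch γ l r (tube γ s e) = -Real.pi := by
  have hAB : A ≤ B := hs.1.trans hs.2
  rw [hγ.cutTransform_mul_cutBranch_eq hlr hs.2 (c := fun s => tube γ s e)
    (fun u _ => hγ.hasDerivAt_tube u e) fun u hu =>
      tube_notMem hT hl hr.le ⟨hs.1.trans hu.1, hu.2⟩ he (Or.inr he0)]
  have hB : B ∉ Set.Icc l r := fun h => by linarith [h.2]
  have h1 := hγ.cutTransform_mul_cutBranch_eq hlr (c := fun u => tube γ B (u * e))
    (c' := fun u => Complex.I * deriv γ B * e) zero_le_one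
    (fun u _ => by
      have := (hasDerivAt_tube_height (γ := γ) B (u * e)).scomp u ((hasDerivAt_id u).mul_const e)
      simpa [mul_comm, Function.comp_def] using this)
    (fun u hu => tube_notMem hT hl hr.le ⟨hAB, le_rfl⟩ (by
      rw [abs_mul, abs_of_nonneg hu.1]
      exact (mul_le_of_le_one_left (abs_nonneg _) hu.2).trans he) (Or.inl hB))
  simp only [zero_mul, one_mul] at h1
  rw [← h1]
  have h2 : tube γ B 0 = γ B := by simp [tube]
  rw [h2, hγ.cutTransform_mul_cutBranch_path hlr hB]

theorem continuous_cutDensity (l r : ℝ) : Continuous (cutDensity γ l r) := by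
  have h1 := hγ.continuous_cutFactor l r
  have h2 := hγ.continuous_deriv
  have := Real.continuous_sqrt
  unfold cutDensity
  fun_prop

/-- The Cauchy representation of the square root of a quadratic polynomial. -/
theorem exists_cutBranch_eq {l r : ℝ} (hlr : l < r) : ∃ c₀ : ℂ, ∀ x, x ∉ γ '' Set.Icc l r →
    cutTransform γ l r x * cutBranch γ l r x = -Real.pi →
    cutBranch γ l r x = x + c₀ - 2 * ∫ s in l..r, cutDensity γ l r s / (x - γ s) := by
  have hpi : (Real.pi : ℂ) ≠ 0 := by exact_mod_cast Real.pi_ne_zero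
  have hn := hγ.continuous_arcDensity l r
  have hp := hγ.continuous_arcPoint l r
  have hg := hγ.continuous_arcRoot l r
  refine ⟨1 / Real.pi * (∫ θ in (0 : ℝ)..Real.pi, arcDensity γ l r θ * γ (arcParam l r θ))
    - (γ l + γ r), fun x hx hVY => ?_⟩
  have hne : ∀ θ, γ (arcParam l r θ) - x ≠ 0 := fun θ h0 =>
    hx ⟨_, arcParam_mem hlr.le θ, sub_eq_zero.1 h0⟩
  have hne' : ∀ s ∈ Set.Icc l r, x - γ s ≠ 0 := fun s hs h0 =>
    hx ⟨s, hs, (sub_eq_zero.1 h0).symm⟩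
  have hsq := hγ.cutBranch_sq hlr.le hx
  have hY0 := hγ.cutBranch_ne_zero hlr.le hx
  -- This is Y = Y²/Y, with 1/Y replaced by -1/π times the transform.
  have h1 : cutBranch γ l r x = -(1 / Real.pi) * ((x - γ l) * (x - γ r) * cutTransform γ l r x) := by
    refine mul_left_cancel₀ hY0 ?_
    rw [← hsq]
    field_simp
    linear_combination hVY
  have hc1 : Continuous fun θ =>
      arcDensity γ l r θ * arcRoot γ l r θ ^ 2 / (x - γ (arcParam l r θ)) :=
    (hn.mul (hg.pow 2)).div (continuous_const.sub hp) fun θ => by rw [← neg_sub]; exact neg_ne_zero.2 (hne θ)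
  -- Dividing the quadratic polynomial by x - γ leaves the remainder -`arcRoot`²; the quotient gives
  -- the polynomial part.
  have h2 : (x - γ l) * (x - γ r) * cutTransform γ l r x
      = (∫ θ in (0 : ℝ)..Real.pi, arcDensity γ l r θ * arcRoot γ l r θ ^ 2
          / (x - γ (arcParam l r θ)))
        - (∫ θ in (0 : ℝ)..Real.pi, arcDensity γ l r θ * γ (arcParam l r θ))
        - (x - (γ l + γ r)) * ∫ θ in (0 : ℝ)..Real.pi, arcDensity γ l r θ := by
    rw [cutTransform, ← intervalIntegral.integral_const_mul,
      ← intervalIntegral.integral_const_mul (x - (γ l + γ r)), ← intervalIntegral.integral_sub,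
      ← intervalIntegral.integral_sub]
    · refine intervalIntegral.integral_congr fun θ _ => ?_
      have h3 := hγ.arcRoot_sq l r θ
      have h4 := hne θ
      have h5 : x - γ (arcParam l r θ) = -(γ (arcParam l r θ) - x) := by ring
      rw [h3, h5]
      field_simp
      ring
    · exact (hc1.sub (hn.mul hp)).intervalIntegrable _ _
    · exact (continuous_const.mul hn).intervalIntegrable _ _
    · exact hc1.intervalIntegrable _ _
    · exact (hn.mul hp).intervalIntegrable _ _
  -- Back to the parameter s: with ds = ((r - l)/2) sin θ dθ, the numerator in θ is 2π times
  -- `cutDensity` times ds/dθ.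
  have h3 : ∫ θ in (0 : ℝ)..Real.pi, arcDensity γ l r θ * arcRoot γ l r θ ^ 2
      / (x - γ (arcParam l r θ)) = 2 * Real.pi * ∫ s in l..r, cutDensity γ l r s / (x - γ s) := by
    have hs := intervalIntegral.integral_deriv_smul_comp' (a := 0) (b := Real.pi)
      (f := arcParam l r) (f' := fun θ => (r - l) / 2 * Real.sin θ)
      (g := fun s => cutDensity γ l r s / (x - γ s)) (fun θ _ => hasDerivAt_arcParam l r θ)
      (by fun_prop)
    rw [arcParam_zero, arcParam_pi] at hs
    rw [← hs, ← intervalIntegral.integral_const_mul]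
    · refine intervalIntegral.integral_congr fun θ hθ => ?_
      rw [Set.uIcc_of_le Real.pi_pos.le] at hθ
      have hsin : 0 ≤ (r - l) / 2 * Real.sin θ :=
        mul_nonneg (by linarith) (Real.sin_nonneg_of_mem_Icc hθ)
      have h5 : x - γ (arcParam l r θ) = -(γ (arcParam l r θ) - x) := by ring
      have h4 := hne θ
      have hE := cutFactor_ne_zero γ l r (arcParam l r θ)
      simp only [Function.comp, cutDensity, Complex.real_smul]
      rw [arcParam_sub_mul, Real.sqrt_sq hsin, arcDensity, arcRoot, h5]
      push_cast
      field_simp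
    · refine ContinuousOn.div (hγ.continuous_cutDensity l r).continuousOn
        (by have := hγ.continuous; fun_prop) ?_
      rintro s ⟨θ, -, rfl⟩
      exact hne' _ (arcParam_mem hlr.le θ)
  rw [h1, h2, h3, hγ.integral_arcDensity hlr.le]
  field_simp
  ring

end IsRegularPath

/-! ### Partial fractions for products of Cauchy integrals. -/

theorem intervalIntegral_swap_of_continuousOn {f : ℝ → ℝ → ℂ} {a b c d : ℝ} (hab : a ≤ b)
    (hcd : c ≤ d) (hf : ContinuousOn (Function.uncurry f) (Set.Icc a b ×ˢ Set.Icc c d)) :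
    ∫ x in a..b, ∫ y in c..d, f x y = ∫ y in c..d, ∫ x in a..b, f x y := by
  refine MeasureTheory.intervalIntegral_intervalIntegral_swap ?_
  rw [Set.uIoc_of_le hab, Set.uIoc_of_le hcd]
  exact (hf.integrableOn_compact (isCompact_Icc.prod isCompact_Icc)).mono_set
    (Set.prod_mono Set.Ioc_subset_Icc_self Set.Ioc_subset_Icc_self)

theorem continuousOn_cauchyIntegral {γ : ℝ → ℂ} (hγ : Continuous γ) {n : ℝ → ℂ} {l r : ℝ}
    (hlr : l ≤ r) (hn : ContinuousOn n (Set.Icc l r)) :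
    ContinuousOn (fun x => ∫ s in l..r, n s / (x - γ s)) (γ '' Set.Icc l r)ᶜ := by
  intro x hx
  have hc : Continuous (Set.IccExtend hlr ((Set.Icc l r).domRestrict n)) :=
    (continuousOn_iff_continuous_domRestrict.1 hn).Icc_extend'
  have h1 := (hasDerivAt_cauchyIntegral hc hγ (a := l) (b := r)
    (x := x) (by rwa [Set.uIcc_of_le hlr])).continuousAt.continuousWithinAt (s := (γ '' Set.Icc l r)ᶜ)
  have h2 : ∀ x, ∫ s in l..r, n s / (x - γ s)
      = -∫ s in l..r, Set.IccExtend hlr ((Set.Icc l r).domRestrict n) s / (γ s - x) := fun x => by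
    rw [← intervalIntegral.integral_neg]
    refine intervalIntegral.integral_congr fun s hs => ?_
    rw [Set.uIcc_of_le hlr] at hs
    simp only [Set.IccExtend_of_mem hlr _ hs, Set.domRestrict_apply]
    rw [← neg_sub, div_neg]
  simp only [h2]
  exact h1.neg

theorem continuousOn_div_sub {γ : ℝ → ℂ} (hγ : Continuous γ) {n : ℝ → ℂ} {l r : ℝ} (hn : ContinuousOn n (Set.Icc l r))
    {x : ℂ} (hx : x ∉ γ '' Set.Icc l r) :
    ContinuousOn (fun s => n s / (x - γ s)) (Set.Icc l r) :=
  hn.div (continuous_const.sub hγ).continuousOn fun s hs h0 => hx ⟨s, hs, (sub_eq_zero.1 h0).symm⟩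

/-- P(x) - P(γ(s)) is divisible by x - γ(s), so P can be moved under the integral at the price of a
polynomial. -/
theorem exists_eval_mul_cauchyIntegral {γ : ℝ → ℂ} (hγ : Continuous γ) {l r : ℝ} (hlr : l ≤ r)
    (P : ℂ[X]) {n : ℝ → ℂ} (hn : ContinuousOn n (Set.Icc l r)) :
    ∃ R : ℂ[X], ∀ x, x ∉ γ '' Set.Icc l r → P.eval x * (∫ s in l..r, n s / (x - γ s))
      = R.eval x + ∫ s in l..r, n s * P.eval (γ s) / (x - γ s) := by
  have hint : ∀ (Q : ℂ[X]) (x : ℂ), x ∉ γ '' Set.Icc l r → IntervalIntegrable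
      (fun s => n s * Q.eval (γ s) / (x - γ s)) MeasureTheory.volume l r := fun Q x hx =>
    ((continuousOn_div_sub hγ (hn.mul (Q.continuous.comp hγ).continuousOn)
      hx).mono (by rw [Set.uIcc_of_le hlr])).intervalIntegrable
  induction P using Polynomial.induction_on with
  | C a =>
    refine ⟨0, fun x _ => ?_⟩
    rw [eval_C, eval_zero, zero_add, ← intervalIntegral.integral_const_mul]
    congr 1; ext s; rw [eval_C]; ring
  | add p q hp hq =>
    obtain ⟨R₁, h₁⟩ := hp
    obtain ⟨R₂, h₂⟩ := hq
    refine ⟨R₁ + R₂, fun x hx => ?_⟩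
    have : (fun s => n s * (p + q).eval (γ s) / (x - γ s)) = fun s =>
        n s * p.eval (γ s) / (x - γ s) + n s * q.eval (γ s) / (x - γ s) := by
      ext s; rw [eval_add]; ring
    rw [this, intervalIntegral.integral_add (hint p x hx) (hint q x hx), eval_add, eval_add]
    linear_combination h₁ x hx + h₂ x hx
  | monomial k a h =>
    obtain ⟨R, h⟩ := h
    set P : ℂ[X] := Polynomial.C a * X ^ k with hP
    refine ⟨X * R + Polynomial.C (∫ s in l..r, n s * P.eval (γ s)), fun x hx => ?_⟩
    have h1 : (Polynomial.C a * X ^ (k + 1) : ℂ[X]) = X * P := by rw [hP]; ring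
    rw [h1]
    have hi : IntervalIntegrable (fun s => n s * P.eval (γ s)) MeasureTheory.volume l r :=
      ((hn.mul (P.continuous.comp hγ).continuousOn).mono
        (by rw [Set.uIcc_of_le hlr])).intervalIntegrable
    have h2 : (∫ s in l..r, n s * P.eval (γ s))
        + ∫ s in l..r, n s * (X * P).eval (γ s) / (x - γ s)
        = x * ∫ s in l..r, n s * P.eval (γ s) / (x - γ s) := by
      rw [← intervalIntegral.integral_add hi (hint _ x hx), ← intervalIntegral.integral_const_mul]
      refine intervalIntegral.integral_congr fun s hs => ?_
      rw [Set.uIcc_of_le hlr] at hs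
      have h0 : x - γ s ≠ 0 := fun h0 => hx ⟨s, hs, (sub_eq_zero.1 h0).symm⟩
      simp only [eval_mul, eval_X]
      field_simp
      ring
    have h3 := h x hx
    simp only [eval_add, eval_mul, eval_X, eval_C] at h2 ⊢
    linear_combination x * h3 - h2

/-- Partial fractions: a product of functions, each of which is a linear polynomial plus a Cauchy
integral over an arc of its own, is a polynomial plus Cauchy integrals over these arcs. -/
theorem exists_prod_eq_cauchyIntegral {ι : Type*} [DecidableEq ι] {γ : ℝ → ℂ} (hγ : Continuous γ)
    {l r : ι → ℝ} (hlr : ∀ j, l j ≤ r j) {m : ι → ℝ → ℂ} (hm : ∀ j, Continuous (m j))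
    {c : ι → ℂ} {Y : ι → ℂ → ℂ} {G : ι → Set ℂ}
    (hG : ∀ j, ∀ x ∈ G j, x ∉ γ '' Set.Icc (l j) (r j))
    (hY : ∀ j, ∀ x ∈ G j, Y j x = x + c j - 2 * ∫ s in (l j)..(r j), m j s / (x - γ s))
    (hdisj : ∀ j k, j ≠ k → ∀ s ∈ Set.Icc (l j) (r j), γ s ∈ G k)
    (hYc : ∀ j k, j ≠ k → ContinuousOn (fun s => Y k (γ s)) (Set.Icc (l j) (r j)))
    (T : Finset ι) : ∃ P : ℂ[X], ∀ x, (∀ j ∈ T, x ∈ G j) → ∏ j ∈ T, Y j x = P.eval x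
      - 2 * ∑ j ∈ T, ∫ s in (l j)..(r j), m j s * (∏ k ∈ T.erase j, Y k (γ s)) / (x - γ s) := by
  induction T using Finset.induction_on with
  | empty => exact ⟨1, fun x _ => by simp⟩
  | insert k T hk ih =>
    obtain ⟨P, hP⟩ := ih
    obtain ⟨R, hR⟩ := exists_eval_mul_cauchyIntegral hγ (hlr k) P (hm k).continuousOn
    set D : ι → ℝ → ℂ := fun j s => m j s * ∏ i ∈ T.erase j, Y i (γ s) with hD
    have hDc : ∀ j, ContinuousOn (D j) (Set.Icc (l j) (r j)) := fun j =>
      (hm j).continuousOn.mul (continuousOn_finsetProd _ fun i hi =>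
        hYc j i (Finset.ne_of_mem_erase hi).symm)
    have hkT : ∀ j ∈ T, j ≠ k := fun j hj h => hk (h ▸ hj)
    refine ⟨(X + Polynomial.C (c k)) * P - 2 * R
      - Polynomial.C (2 * ∑ j ∈ T, ∫ s in (l j)..(r j), D j s), fun x hx => ?_⟩
    have hxk : x ∈ G k := hx k (Finset.mem_insert_self _ _)
    have hxT : ∀ j ∈ T, x ∈ G j := fun j hj => hx j (Finset.mem_insert_of_mem hj)
    rw [Finset.prod_insert hk, Finset.sum_insert hk, Finset.erase_insert hk]
    -- Under the integral over arc j the factor Y_k(x) is replaced by Y_k(γ(s)). The difference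
    -- quotient of Y_k is 1 plus twice a Cauchy integral over arc k, which produces a constant and a
    -- cross term.
    have hstep : ∀ j ∈ T, Y k x * (∫ s in (l j)..(r j), D j s / (x - γ s))
        = (∫ s in (l j)..(r j), m j s * (∏ i ∈ (insert k T).erase j, Y i (γ s)) / (x - γ s))
          + (∫ s in (l j)..(r j), D j s)
          + 2 * ∫ s' in (l k)..(r k), m k s' / (x - γ s')
              * -(∫ s in (l j)..(r j), D j s / (γ s' - γ s)) := by
      intro j hj
      have hjk := hkT j hj
      have hne : ∀ s ∈ Set.Icc (l j) (r j), x - γ s ≠ 0 := fun s hs h0 =>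
        hG j x (hxT j hj) ⟨s, hs, (sub_eq_zero.1 h0).symm⟩
      have hne' : ∀ s ∈ Set.Icc (l k) (r k), x - γ s ≠ 0 := fun s hs h0 =>
        hG k x hxk ⟨s, hs, (sub_eq_zero.1 h0).symm⟩
      have hnn : ∀ s ∈ Set.Icc (l j) (r j), ∀ s' ∈ Set.Icc (l k) (r k), γ s - γ s' ≠ 0 :=
        fun s hs s' hs' h0 =>
        hG k (γ s) (hdisj j k hjk s hs) ⟨s', hs', (sub_eq_zero.1 h0).symm⟩
      have hswap := intervalIntegral_swap_of_continuousOn (hlr j) (hlr k)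
        (f := fun s s' => D j s * (m k s' / ((x - γ s') * (γ s - γ s')))) (by
          refine ContinuousOn.mul ((hDc j).comp continuous_fst.continuousOn fun p hp => hp.1)
            (ContinuousOn.div ((hm k).comp continuous_snd).continuousOn ?_ fun p hp =>
              mul_ne_zero (hne' _ hp.2) (hnn _ hp.1 _ hp.2))
          fun_prop)
      have h1 : ∀ s ∈ Set.Icc (l j) (r j), Y k x * (D j s / (x - γ s))
          = m j s * (∏ i ∈ (insert k T).erase j, Y i (γ s)) / (x - γ s) + D j s
            + 2 * ∫ s' in (l k)..(r k), D j s * (m k s' / ((x - γ s') * (γ s - γ s'))) := by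
        intro s hs
        have h2 : (insert k T).erase j = insert k (T.erase j) :=
          Finset.erase_insert_of_ne hjk.symm
        have h3 : k ∉ T.erase j := fun h => hk (Finset.mem_of_mem_erase h)
        rw [h2, Finset.prod_insert h3]
        have h4 : Y k x - Y k (γ s) = (x - γ s) * (1 + 2 * ∫ s' in (l k)..(r k),
            m k s' / ((x - γ s') * (γ s - γ s'))) := by
          have hs' := hdisj j k hjk s hs
          have i1 : IntervalIntegrable (fun s' => m k s' / (x - γ s')) MeasureTheory.volume
              (l k) (r k) := ((continuousOn_div_sub hγ (hm k).continuousOn (hG k x hxk)).mono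
                (by rw [Set.uIcc_of_le (hlr k)])).intervalIntegrable
          have i2 : IntervalIntegrable (fun s' => m k s' / (γ s - γ s')) MeasureTheory.volume
              (l k) (r k) := ((continuousOn_div_sub hγ (hm k).continuousOn (hG k _ hs')).mono
                (by rw [Set.uIcc_of_le (hlr k)])).intervalIntegrable
          have h5 : (∫ s' in (l k)..(r k), m k s' / (γ s - γ s'))
              - (∫ s' in (l k)..(r k), m k s' / (x - γ s'))
              = (x - γ s) * ∫ s' in (l k)..(r k), m k s' / ((x - γ s') * (γ s - γ s')) := by
            rw [← intervalIntegral.integral_sub i2 i1, ← intervalIntegral.integral_const_mul]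
            refine intervalIntegral.integral_congr fun s' hs' => ?_
            rw [Set.uIcc_of_le (hlr k)] at hs'
            have e1 := hne' s' hs'
            have e2 := hnn s hs s' hs'
            field_simp
            ring
          rw [hY k x hxk, hY k _ hs']
          linear_combination 2 * h5
        have h6 : Y k x = Y k (γ s) + (x - γ s) * (1 + 2 * ∫ s' in (l k)..(r k),
            m k s' / ((x - γ s') * (γ s - γ s'))) := by linear_combination h4
        rw [intervalIntegral.integral_const_mul, h6]
        have e1 := hne s hs
        simp only [hD]
        field_simp
        ring
      have i1 : IntervalIntegrable (fun s => m j s * (∏ i ∈ (insert k T).erase j, Y i (γ s))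
          / (x - γ s)) MeasureTheory.volume (l j) (r j) := by
        refine ContinuousOn.intervalIntegrable ?_
        rw [Set.uIcc_of_le (hlr j)]
        exact continuousOn_div_sub hγ ((hm j).continuousOn.mul (continuousOn_finsetProd _
          fun i hi => hYc j i (Finset.ne_of_mem_erase hi).symm)) (hG j x (hxT j hj))
      have i2 : IntervalIntegrable (D j) MeasureTheory.volume (l j) (r j) :=
        ((hDc j).mono (by rw [Set.uIcc_of_le (hlr j)])).intervalIntegrable
      have i4 : ContinuousOn (fun s => Y k x * (D j s / (x - γ s))) (Set.Icc (l j) (r j)) :=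
        continuousOn_const.mul (continuousOn_div_sub hγ (hDc j) (hG j x (hxT j hj)))
      have i5 : IntervalIntegrable (fun s => m j s * (∏ i ∈ (insert k T).erase j, Y i (γ s))
          / (x - γ s) + D j s) MeasureTheory.volume (l j) (r j) := i1.add i2
      have i3 : IntervalIntegrable (fun s => 2 * ∫ s' in (l k)..(r k),
          D j s * (m k s' / ((x - γ s') * (γ s - γ s')))) MeasureTheory.volume (l j) (r j) := by
        have i6 : IntervalIntegrable (fun s => Y k x * (D j s / (x - γ s)))
            MeasureTheory.volume (l j) (r j) :=
          (i4.mono (by rw [Set.uIcc_of_le (hlr j)])).intervalIntegrable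
        refine (i6.sub i5).congr fun s hs => ?_
        rw [Set.uIoc_of_le (hlr j)] at hs
        have := h1 s (Set.Ioc_subset_Icc_self hs)
        simp only [this]
        ring
      rw [← intervalIntegral.integral_const_mul, intervalIntegral.integral_congr
        (g := fun s => m j s * (∏ i ∈ (insert k T).erase j, Y i (γ s)) / (x - γ s) + D j s
            + 2 * ∫ s' in (l k)..(r k), D j s * (m k s' / ((x - γ s') * (γ s - γ s'))))
        (fun s hs => h1 s (by rwa [Set.uIcc_of_le (hlr j)] at hs)),
        intervalIntegral.integral_add i5 i3, intervalIntegral.integral_add i1 i2,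
        intervalIntegral.integral_const_mul, hswap]
      congr 2
      refine intervalIntegral.integral_congr fun s' _ => ?_
      rw [← intervalIntegral.integral_neg, ← intervalIntegral.integral_const_mul]
      refine intervalIntegral.integral_congr fun s _ => ?_
      rw [← neg_sub (γ s) (γ s'), div_neg, neg_neg, div_mul_div_comm, mul_div_assoc', mul_comm (m k s')]
    -- By the induction hypothesis at points of arc k, the cross terms sum to the density required
    -- on that arc, up to a term with the old polynomial that `hR` absorbs.
    have hlast : ∑ j ∈ T, ∫ s' in (l k)..(r k), m k s' / (x - γ s')
              * -(∫ s in (l j)..(r j), D j s / (γ s' - γ s))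
        = 1 / 2 * ((∫ s in (l k)..(r k), m k s * (∏ i ∈ T, Y i (γ s)) / (x - γ s))
          - ∫ s in (l k)..(r k), m k s * P.eval (γ s) / (x - γ s)) := by
      have hxk' := hG k x hxk
      have j1 : ∀ u : ℝ → ℂ, ContinuousOn u (Set.Icc (l k) (r k)) → IntervalIntegrable
          (fun s => u s / (x - γ s)) MeasureTheory.volume (l k) (r k) := fun u hu => by
        refine ContinuousOn.intervalIntegrable ?_
        rw [Set.uIcc_of_le (hlr k)]
        exact continuousOn_div_sub hγ hu hxk'
      have j2 : ContinuousOn (fun s => m k s * ∏ i ∈ T, Y i (γ s)) (Set.Icc (l k) (r k)) :=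
        (hm k).continuousOn.mul (continuousOn_finsetProd _ fun i hi => hYc k i (hkT i hi).symm)
      have j3 : ContinuousOn (fun s => m k s * P.eval (γ s)) (Set.Icc (l k) (r k)) :=
        ((hm k).mul (P.continuous.comp hγ)).continuousOn
      rw [← intervalIntegral.integral_sub (j1 _ j2) (j1 _ j3),
        ← intervalIntegral.integral_finsetSum, ← intervalIntegral.integral_const_mul]
      · refine intervalIntegral.integral_congr fun s' hs' => ?_
        rw [Set.uIcc_of_le (hlr k)] at hs'
        have := hP (γ s') fun j hj => hdisj k j (hkT j hj).symm s' hs'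
        rw [this, ← Finset.mul_sum, Finset.sum_neg_distrib]
        ring
      · intro j hj
        have hc : ContinuousOn (fun s' => ∫ s in (l j)..(r j), D j s / (γ s' - γ s))
            (Set.Icc (l k) (r k)) := by
          exact (continuousOn_cauchyIntegral hγ (hlr j) (hDc j)).comp hγ.continuousOn
            fun s' hs' => hG j _ (hdisj k j (hkT j hj).symm s' hs')
        have h := j1 (fun s' => m k s' * -(∫ s in (l j)..(r j), D j s / (γ s' - γ s)))
          ((hm k).continuousOn.mul hc.neg)
        exact h.congr fun s _ => by ring
    rw [hP x hxT, mul_sub, mul_left_comm, Finset.mul_sum, Finset.sum_congr rfl hstep,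
      Finset.sum_add_distrib, Finset.sum_add_distrib, ← Finset.mul_sum, hlast]
    have hRx := hR x (hG k x hxk)
    simp only [eval_sub, eval_mul, eval_add, eval_X, eval_C, eval_ofNat]
    rw [hY k x hxk]
    linear_combination (-2 : ℂ) * hRx

/-! ### Polynomials at infinity -/

theorem Polynomial.eval_eq_pow_mul_reflect {p : ℂ[X]} {n : ℕ} (hn : p.natDegree ≤ n) {x : ℂ}
    (hx : x ≠ 0) : p.eval x = x ^ n * (reflect n p).eval x⁻¹ := by
  let := invertibleOfNonzero hx
  have := eval₂_reflect_mul_pow (RingHom.id ℂ) x n p hn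
  rw [invOf_eq_inv] at this
  rw [mul_comm]
  exact this.symm

theorem Polynomial.eval_zero_reflect (p : ℂ[X]) (n : ℕ) :
    (reflect n p).eval 0 = p.coeff n := by
  rw [← coeff_zero_eq_eval_zero, coeff_reflect, revAt_le (Nat.zero_le n), Nat.sub_zero]

theorem tendsto_inv_cocompact : Tendsto (fun x : ℂ => x⁻¹) (cocompact ℂ) (𝓝 0) :=
  tendsto_inv₀_cobounded.mono_left Metric.cobounded_eq_cocompact.ge

theorem eventually_ne_zero_cocompact : ∀ᶠ x in cocompact ℂ, x ≠ 0 :=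
  (isCompact_singleton (x := (0 : ℂ))).compl_mem_cocompact

theorem Polynomial.tendsto_eval_div_pow {p : ℂ[X]} {n : ℕ} (hn : p.natDegree ≤ n) :
    Tendsto (fun x => p.eval x / x ^ n) (cocompact ℂ) (𝓝 (p.coeff n)) := by
  have h := ((reflect n p).continuous.tendsto 0).comp tendsto_inv_cocompact
  rw [eval_zero_reflect] at h
  refine h.congr' ?_
  filter_upwards [eventually_ne_zero_cocompact] with x hx
  rw [eval_eq_pow_mul_reflect hn hx, mul_div_cancel_left₀ _ (pow_ne_zero _ hx)]
  rfl

/-- Divided by the top power of z the values tend to the leading coefficient, but under the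
hypothesis they also tend to 0. -/
theorem Polynomial.eq_zero_of_tendsto_zero {p : ℂ[X]} {z : ℕ → ℂ}
    (hz : Tendsto z atTop (cocompact ℂ)) (h : Tendsto (fun k => p.eval (z k)) atTop (𝓝 0)) :
    p = 0 := by
  have h1 := (tendsto_eval_div_pow (le_refl p.natDegree)).comp hz
  have h2 : Tendsto (fun k => p.eval (z k) / z k ^ p.natDegree) atTop (𝓝 (0 * 0 ^ p.natDegree)) := by
    simp only [div_eq_mul_inv, ← inv_pow]
    exact h.mul ((tendsto_inv_cocompact.comp hz).pow _)
  rw [zero_mul] at h2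
  exact leadingCoeff_eq_zero.1 (tendsto_nhds_unique h1 h2)

/-! ### The branch on the upper sheet as a product over the cuts. -/

namespace MarkedCurve

variable {g : ℕ} (C : MarkedCurve g)

theorem IsValid.isRegularPath {C : MarkedCurve g} (hC : C.IsValid) : IsRegularPath C.path :=
  ⟨hC.path_smooth, hC.path_regular, hC.path_injective, hC.path_atBot, hC.path_atTop⟩

/-- The product of the square roots belonging to the single cuts. -/
def prodBranch (x : ℂ) : ℂ := ∏ i, cutBranch C.path (C.left i) (C.right i) x

variable {C} (hC : C.IsValid)

include hC

omit hC in
theorem notMem_cut_of_notMem_cuts {x : ℂ} (hx : x ∉ C.cuts) (i : Fin (g + 1)) :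
    x ∉ C.path '' Set.Icc (C.left i) (C.right i) := fun h => hx (Set.mem_iUnion.2 ⟨i, h⟩)

theorem isClosed_cuts : IsClosed C.cuts :=
  isClosed_iUnion_of_finite fun _ => IsRegularPath.isClosed_cut hC.isRegularPath.continuous _ _

theorem isCompact_cuts : IsCompact C.cuts :=
  isCompact_iUnion fun _ => isCompact_Icc.image hC.isRegularPath.continuous

theorem eventually_notMem_cuts : ∀ᶠ x in cocompact ℂ, x ∉ C.cuts :=
  (isCompact_cuts hC).compl_mem_cocompact

theorem prodBranch_sq {x : ℂ} (hx : x ∉ C.cuts) : C.prodBranch x ^ 2 = C.ySq.eval x := by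
  rw [prodBranch, ← Finset.prod_pow, hC.branch, eval_prod]
  refine Finset.prod_congr rfl fun i _ => ?_
  rw [hC.isRegularPath.cutBranch_sq (hC.left_lt_right i).le (notMem_cut_of_notMem_cuts hx i)]
  simp

theorem prodBranch_ne_zero {x : ℂ} (hx : x ∉ C.cuts) : C.prodBranch x ≠ 0 :=
  Finset.prod_ne_zero_iff.2 fun i _ => hC.isRegularPath.cutBranch_ne_zero (hC.left_lt_right i).le
    (notMem_cut_of_notMem_cuts hx i)

theorem differentiableAt_prodBranch {x : ℂ} (hx : x ∉ C.cuts) :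
    DifferentiableAt ℂ C.prodBranch x := by
  unfold prodBranch
  refine DifferentiableAt.fun_finsetProd fun i _ => ?_
  exact hC.isRegularPath.differentiableAt_cutBranch (hC.left_lt_right i).le
    (notMem_cut_of_notMem_cuts hx i)

theorem tendsto_derivW_div_pow :
    Tendsto (fun x => (derivative C.W).eval x / x ^ (g + 1)) (cocompact ℂ) (𝓝 1) := by
  have := tendsto_eval_div_pow hC.natDegree_deriv.le
  rwa [← hC.natDegree_deriv, hC.monic_deriv.coeff_natDegree, hC.natDegree_deriv] at this

theorem tendsto_prodBranch_div_pow :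
    Tendsto (fun x => C.prodBranch x / x ^ (g + 1)) (cocompact ℂ) (𝓝 1) := by
  have h : Tendsto (fun x => ∏ i, (cutBranch C.path (C.left i) (C.right i) x / x)) (cocompact ℂ)
      (𝓝 (∏ _i : Fin (g + 1), (1 : ℂ))) :=
    tendsto_finsetProd _ fun i _ => hC.isRegularPath.tendsto_cutBranch_div _ _
  simpa [Finset.prod_div_distrib, prodBranch] using h

theorem tendsto_prodBranch_div :
    Tendsto (fun x => C.prodBranch x / (derivative C.W).eval x) (cocompact ℂ) (𝓝 1) := by
  have h := (tendsto_prodBranch_div_pow hC).div (tendsto_derivW_div_pow hC) one_ne_zero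
  rw [div_one] at h
  refine h.congr' ?_
  filter_upwards [eventually_ne_zero_cocompact] with x hx
  exact div_div_div_cancel_right₀ (pow_ne_zero _ hx) _ _

theorem isUpperBranch_y0 : C.IsUpperBranch C.y0 := by
  classical
  -- The equation for the square is demanded on the cuts as well, where any root will do.
  refine Classical.epsilon_spec ⟨fun x => if x ∈ C.cuts then
    Classical.choose (IsAlgClosed.exists_pow_nat_eq (C.ySq.eval x) two_pos) else C.prodBranch x,
    fun x => ?_, fun x hx => ?_, ?_⟩
  · by_cases hx : x ∈ C.cuts
    · simp only [hx, if_true]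
      exact Classical.choose_spec (IsAlgClosed.exists_pow_nat_eq (C.ySq.eval x) two_pos)
    · simp only [hx, if_false]
      exact prodBranch_sq hC hx
  · refine ((differentiableAt_prodBranch hC hx).congr_of_eventuallyEq ?_).differentiableWithinAt
    filter_upwards [(isClosed_cuts hC).isOpen_compl.mem_nhds hx] with z hz
    rw [if_neg hz]
  · refine (tendsto_prodBranch_div hC).congr' ?_
    filter_upwards [eventually_notMem_cuts hC] with x hx
    rw [if_neg hx]

theorem y0_sq (x : ℂ) : C.y0 x ^ 2 = C.ySq.eval x := (isUpperBranch_y0 hC).sq x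

theorem differentiableAt_y0 {x : ℂ} (hx : x ∉ C.cuts) : DifferentiableAt ℂ C.y0 x :=
  (isUpperBranch_y0 hC).holo.differentiableAt ((isClosed_cuts hC).isOpen_compl.mem_nhds hx)

theorem tendsto_y0_div_prodBranch :
    Tendsto (fun x => C.y0 x / C.prodBranch x) (cocompact ℂ) (𝓝 1) := by
  have h := (isUpperBranch_y0 hC).asymp.div (tendsto_prodBranch_div hC) one_ne_zero
  rw [div_one] at h
  refine h.congr' ?_
  have h1 : ∀ᶠ x in cocompact ℂ, (derivative C.W).eval x / x ^ (g + 1) ≠ 0 :=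
    (tendsto_derivW_div_pow hC).eventually_ne one_ne_zero
  filter_upwards [h1] with x hx
  have hx' : (derivative C.W).eval x ≠ 0 := fun h => hx (by rw [h, zero_div])
  exact div_div_div_cancel_right₀ hx' _ _

/-- The quotient of the two branches is continuous off the cuts and squares to 1. Agreement is
transported only along given connected sets, so connectedness of the complement of the cuts is not
needed. -/
theorem y0_eq_prodBranch_of_isPreconnected {X : Type*} [TopologicalSpace X] {S : Set X}
    (hS : IsPreconnected S) {c : X → ℂ} (hc : ContinuousOn c S) (hcut : ∀ x ∈ S, c x ∉ C.cuts)
    {x₀ x : X} (hx₀ : x₀ ∈ S) (h₀ : C.y0 (c x₀) = C.prodBranch (c x₀)) (hx : x ∈ S) :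
    C.y0 (c x) = C.prodBranch (c x) := by
  have h1 := hS.eq_of_sq_eq_one (f := fun x => C.y0 (c x) / C.prodBranch (c x)) (by
    refine ContinuousOn.div ?_ ?_ fun x hx => prodBranch_ne_zero hC (hcut x hx)
    · exact fun x hx => ((differentiableAt_y0 hC (hcut x hx)).continuousAt).comp_continuousWithinAt
        (hc x hx)
    · exact fun x hx => ((differentiableAt_prodBranch hC
        (hcut x hx)).continuousAt).comp_continuousWithinAt (hc x hx))
    (fun x hx => by
      rw [div_pow, y0_sq hC, prodBranch_sq hC (hcut x hx), div_self]
      rw [← prodBranch_sq hC (hcut x hx)]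
      exact pow_ne_zero _ (prodBranch_ne_zero hC (hcut x hx))) hx hx₀
  rw [h₀, div_self (prodBranch_ne_zero hC (hcut x₀ hx₀)),
    div_eq_one_iff_eq (prodBranch_ne_zero hC (hcut x hx))] at h1
  exact h1

theorem right_le_lastMark (i : Fin (g + 1)) : C.right i ≤ C.lastMark := by
  rcases (Fin.le_last i).eq_or_lt with rfl | h
  · exact le_rfl
  · exact ((hC.right_lt_left _ _ h).trans (hC.left_lt_right _)).le

theorem left_zero_le (i : Fin (g + 1)) : C.left 0 ≤ C.left i := by
  rcases (Fin.zero_le i).eq_or_lt with rfl | h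
  · exact le_rfl
  · exact ((hC.left_lt_right 0).trans (hC.right_lt_left _ _ h)).le

theorem path_notMem_cuts {s : ℝ} (hs : ∀ i, s ∉ Set.Icc (C.left i) (C.right i)) :
    C.path s ∉ C.cuts := by
  rw [cuts, Set.mem_iUnion]
  rintro ⟨i, hi⟩
  exact hC.isRegularPath.notMem_cut (hs i) hi

theorem path_notMem_cuts_of_lt {s : ℝ} (hs : C.lastMark < s) : C.path s ∉ C.cuts :=
  path_notMem_cuts hC fun i h => by linarith [h.2, right_le_lastMark hC i]

/-- Far out the quotient of the two branches tends to 1, which excludes the sign -1; the parameters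
beyond the last mark form a connected ray. -/
theorem y0_path {s : ℝ} (hs : C.lastMark < s) : C.y0 (C.path s) = C.prodBranch (C.path s) := by
  have h1 := (tendsto_y0_div_prodBranch hC).comp hC.isRegularPath.tendsto_atTop
  have h2 : ∀ᶠ s in atTop, ‖C.y0 (C.path s) / C.prodBranch (C.path s) - 1‖ < 1 := by
    have := (tendsto_iff_norm_sub_tendsto_zero.1 h1).eventually_lt_const one_pos
    exact this
  obtain ⟨s₁, h3, h4⟩ := (h2.and (eventually_gt_atTop C.lastMark)).exists
  have hb := prodBranch_ne_zero hC (path_notMem_cuts_of_lt hC h4)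
  have h5 : C.y0 (C.path s₁) = C.prodBranch (C.path s₁) := by
    have h6 : (C.y0 (C.path s₁) - C.prodBranch (C.path s₁))
        * (C.y0 (C.path s₁) + C.prodBranch (C.path s₁)) = 0 := by
      linear_combination y0_sq hC (C.path s₁) - prodBranch_sq hC (path_notMem_cuts_of_lt hC h4)
    rcases mul_eq_zero.1 h6 with h6 | h6
    · exact sub_eq_zero.1 h6
    · rw [eq_neg_of_add_eq_zero_left h6, neg_div, div_self hb] at h3
      norm_num at h3
  exact y0_eq_prodBranch_of_isPreconnected hC isPreconnected_Ioi
    hC.isRegularPath.continuous.continuousOn (fun s hs => path_notMem_cuts_of_lt hC hs) h4 h5 hs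

theorem tube_notMem_cuts {A B c M e₀ : ℝ} (hT : TubeBound C.path A B c M e₀) (hA : A ≤ C.left 0)
    (hB : C.lastMark ≤ B) {s e : ℝ} (hs : s ∈ Set.Icc A B) (he : |e| ≤ e₀)
    (hne : (∀ i, s ∉ Set.Icc (C.left i) (C.right i)) ∨ e ≠ 0) : tube C.path s e ∉ C.cuts := by
  rw [cuts, Set.mem_iUnion]
  rintro ⟨i, hi⟩
  exact IsRegularPath.tube_notMem hT (hA.trans (left_zero_le hC i))
    ((right_le_lastMark hC i).trans hB) hs he (hne.imp_left fun h => h i) hi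

theorem y0_tube {A B c M e₀ : ℝ} (hT : TubeBound C.path A B c M e₀) (hA : A ≤ C.left 0)
    (hB : C.lastMark < B) {s e : ℝ} (hs : s ∈ Set.Icc A B) (he : |e| ≤ e₀) (he0 : e ≠ 0) :
    C.y0 (tube C.path s e) = C.prodBranch (tube C.path s e) := by
  -- The second coordinate scales the height. The added point (B, 0) lies in the closure, so the set
  -- is connected, and it represents the point γ(B) beyond all cuts, where the sign is known.
  set S : Set (ℝ × ℝ) := Set.Icc A B ×ˢ Set.Ioc 0 1 ∪ {(B, 0)} with hS
  have hAB : A ≤ B := hs.1.trans hs.2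
  have hconn : IsPreconnected S := by
    have h1 : IsPreconnected (Set.Icc A B ×ˢ Set.Ioc (0 : ℝ) 1) :=
      isPreconnected_Icc.prod isPreconnected_Ioc
    refine h1.subset_closure Set.subset_union_left (Set.union_subset subset_closure ?_)
    rw [closure_prod_eq, closure_Ioc zero_ne_one, closure_Icc, Set.singleton_subset_iff]
    exact ⟨⟨hAB, le_rfl⟩, ⟨le_rfl, zero_le_one⟩⟩
  have hc : Continuous fun p : ℝ × ℝ => tube C.path p.1 (e * p.2) :=
    (IsRegularPath.continuous_tube hC.isRegularPath.continuous
      hC.isRegularPath.continuous_deriv).comp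
      (continuous_fst.prodMk (continuous_const.mul continuous_snd))
  have hcut : ∀ p ∈ S, tube C.path p.1 (e * p.2) ∉ C.cuts := by
    rintro p (hp | rfl)
    · refine tube_notMem_cuts hC hT hA hB.le hp.1 ?_ (Or.inr (mul_ne_zero he0 hp.2.1.ne'))
      rw [abs_mul, abs_of_pos hp.2.1]
      exact (mul_le_of_le_one_right (abs_nonneg _) hp.2.2).trans he
    · refine tube_notMem_cuts hC hT hA hB.le ⟨hAB, le_rfl⟩ (by simpa using hT.pos_height.le)
        (Or.inl fun i h => ?_)
      linarith [h.2, right_le_lastMark hC i]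
  have h0 : C.y0 (tube C.path B (e * 0)) = C.prodBranch (tube C.path B (e * 0)) := by
    have : tube C.path B (e * 0) = C.path B := by simp [tube]
    rw [this, y0_path hC hB]
  have := y0_eq_prodBranch_of_isPreconnected hC hconn hc.continuousOn hcut
    (x₀ := (B, 0)) (x := (s, 1)) (Or.inr rfl) h0 (Or.inl ⟨hs, ⟨one_pos, le_rfl⟩⟩)
  simpa using this

theorem t_ne_zero : C.t ≠ 0 := by
  have h1 := coeff_ne_zero_of_eq_degree hC.degree_f
  have : C.f.coeff g ≠ 0 := h1
  simpa [t] using this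

theorem natDegree_f : C.f.natDegree = g := natDegree_eq_of_degree_eq_some hC.degree_f

/-- (W' - y₀)(W' + y₀) = -f, where f has leading coefficient -4t in degree g and W' + y₀ grows like
2x^(g+1). -/
theorem tendsto_mul_derivW_sub_y0 :
    Tendsto (fun x => x * ((derivative C.W).eval x - C.y0 x)) (cocompact ℂ) (𝓝 (2 * C.t)) := by
  have h1 := tendsto_eval_div_pow (natDegree_f hC).le
  have h2 : Tendsto (fun x => C.y0 x / x ^ (g + 1)) (cocompact ℂ) (𝓝 1) := by
    have := (tendsto_y0_div_prodBranch hC).mul (tendsto_prodBranch_div_pow hC)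
    rw [mul_one] at this
    refine this.congr' ?_
    filter_upwards [eventually_notMem_cuts hC] with x hx
    exact div_mul_div_cancel₀ (prodBranch_ne_zero hC hx)
  have h3 := (tendsto_derivW_div_pow hC).add h2
  have h4 := (h1.div h3 (by norm_num)).neg
  have h5 : -(C.f.coeff g / (1 + 1)) = 2 * C.t := by rw [t]; ring
  rw [h5] at h4
  refine h4.congr' ?_
  filter_upwards [eventually_ne_zero_cocompact, h3.eventually_ne (by norm_num : (1 + 1 : ℂ) ≠ 0)]
    with x hx h6
  have h7 : (derivative C.W).eval x + C.y0 x ≠ 0 := fun h => h6 (by rw [← add_div, h, zero_div])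
  have h8 := y0_sq hC x
  rw [ySq, eval_add, eval_pow] at h8
  simp only [Pi.div_apply]
  rw [← add_div]
  field_simp
  linear_combination x * x ^ g * h8

end MarkedCurve

/-! ### Jumps across the cuts, the spectral density and the Cauchy representation of y₀. -/

theorem sideSqrt_of_nonneg (σ : ℝ) {u : ℝ} (hu : 0 ≤ u) : sideSqrt σ u = √u := by
  rw [sideSqrt, Real.sqrt_eq_zero_of_nonpos (neg_nonpos.2 hu)]
  simp

theorem sideSqrt_of_nonpos (σ : ℝ) {u : ℝ} (hu : u ≤ 0) :
    sideSqrt σ u = σ * Complex.I * √(-u) := by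
  rw [sideSqrt, Real.sqrt_eq_zero_of_nonpos hu]
  simp

/-- Outside the cut either none or both of the factors carry ±i, so the side enters through σ² = 1
only. -/
theorem cutWeight_of_notMem {σ : ℝ} (hσ : σ ^ 2 = 1) {l r s : ℝ} (hlr : l ≤ r)
    (hs : s ∉ Set.Ioo l r) : cutWeight σ l r s = cutWeight 1 l r s := by
  have hσ' : (σ : ℂ) ^ 2 = 1 := by exact_mod_cast hσ
  rcases le_or_gt s l with h | h
  · have h1 : s - l ≤ 0 := by linarith
    have h2 : s - r ≤ 0 := by linarith
    simp only [cutWeight, sideSqrt_of_nonpos _ h1, sideSqrt_of_nonpos _ h2]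
    push_cast
    linear_combination (Complex.I ^ 2 * √(-(s - l)) * √(-(s - r))) * hσ'
  · have h1 : 0 ≤ s - l := by linarith
    have h2 : 0 ≤ s - r := by
      by_contra! h'
      exact hs ⟨h, by linarith⟩
    simp only [cutWeight, sideSqrt_of_nonneg _ h1, sideSqrt_of_nonneg _ h2]

theorem cutWeight_of_mem (σ : ℝ) {l r s : ℝ} (hs : s ∈ Set.Icc l r) :
    cutWeight σ l r s = σ * Complex.I * √((s - l) * (r - s)) := by
  have h1 : 0 ≤ s - l := by linarith [hs.1]
  have h2 : s - r ≤ 0 := by linarith [hs.2]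
  rw [cutWeight, sideSqrt_of_nonneg _ h1, sideSqrt_of_nonpos _ h2, Real.sqrt_mul h1, neg_sub]
  push_cast
  ring

theorem continuous_cutWeight (σ l r : ℝ) : Continuous (cutWeight σ l r) :=
  ((continuous_sideSqrt σ).comp (continuous_id.sub continuous_const)).mul
    ((continuous_sideSqrt σ).comp (continuous_id.sub continuous_const))

/-- The jump of `∏ √((s - l i)(s - r i))` across the real line, divided by `4πi`. -/
def jumpWeight {ι : Type*} [Fintype ι] (l r : ι → ℝ) (s : ℝ) : ℂ :=
  (∏ i, cutWeight 1 (l i) (r i) s - ∏ i, cutWeight (-1) (l i) (r i) s)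
    / (4 * Real.pi * Complex.I)

theorem continuous_jumpWeight {ι : Type*} [Fintype ι] (l r : ι → ℝ) :
    Continuous (jumpWeight l r) := by
  have h : ∀ σ : ℝ, Continuous fun s => ∏ i, cutWeight σ (l i) (r i) s := fun σ =>
    continuous_finsetProd _ fun i _ => continuous_cutWeight _ _ _
  have h1 := h 1
  have h2 := h (-1)
  unfold jumpWeight
  fun_prop

theorem jumpWeight_eq_zero {ι : Type*} [Fintype ι] {l r : ι → ℝ} (hlr : ∀ i, l i ≤ r i) {s : ℝ}
    (hs : ∀ i, s ∉ Set.Ioo (l i) (r i)) : jumpWeight l r s = 0 := by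
  rw [jumpWeight, Finset.prod_congr rfl fun i _ =>
    cutWeight_of_notMem (σ := -1) (by norm_num) (hlr i) (hs i), sub_self, zero_div]

/-- Only the factor of the cut through s changes sign across the line; all others agree on the two
sides. -/
theorem jumpWeight_of_mem {ι : Type*} [Fintype ι] [DecidableEq ι] {l r : ι → ℝ}
    (hlr : ∀ i, l i ≤ r i) {s : ℝ} {i : ι} (hs : s ∈ Set.Icc (l i) (r i))
    (hne : ∀ j, j ≠ i → s ∉ Set.Ioo (l j) (r j)) : jumpWeight l r s
      = √((s - l i) * (r i - s)) * (∏ j ∈ Finset.univ.erase i, cutWeight 1 (l j) (r j) s)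
        / (2 * Real.pi) := by
  have h : ∏ j ∈ Finset.univ.erase i, cutWeight (-1) (l j) (r j) s
      = ∏ j ∈ Finset.univ.erase i, cutWeight 1 (l j) (r j) s :=
    Finset.prod_congr rfl fun j hj => cutWeight_of_notMem (by norm_num) (hlr j)
      (hne j (Finset.ne_of_mem_erase hj))
  rw [jumpWeight, ← Finset.mul_prod_erase _ _ (Finset.mem_univ i),
    ← Finset.mul_prod_erase _ _ (Finset.mem_univ i), h, cutWeight_of_mem _ hs,
    cutWeight_of_mem _ hs]
  have hpi : (Real.pi : ℂ) ≠ 0 := by exact_mod_cast Real.pi_ne_zero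
  have hI := Complex.I_ne_zero
  push_cast
  field_simp
  ring

/-- Off the cut the root is continuous, so its value is its one-sided boundary value. -/
theorem IsRegularPath.cutBranch_path {γ : ℝ → ℂ} (hγ : IsRegularPath γ) {l r s : ℝ} (hlr : l < r)
    (hs : s ∉ Set.Icc l r) :
    cutBranch γ l r (γ s) = cutWeight 1 l r s * cutFactor γ l r s := by
  have h1 := hγ.tendsto_cutBranch_tube (σ := 1) (by norm_num) hlr
    (fun h => hs ⟨h.ge, h.trans_le hlr.le⟩) (fun h => hs ⟨hlr.le.trans h.ge, h.le⟩)
  have h2 := ((hγ.differentiableAt_cutBranch hlr.le (hγ.notMem_cut hs)).continuousAt.tendsto).comp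
    (IsRegularPath.tendsto_tube (γ := γ) s 1)
  exact tendsto_nhds_unique h2 h1

namespace MarkedCurve

variable {g : ℕ} (C : MarkedCurve g)

/-- The density `t ρ₀`, as an explicit continuous function on the parameter line. -/
def mass (s : ℝ) : ℂ :=
  jumpWeight C.left C.right s * deriv C.path s * ∏ i, cutFactor C.path (C.left i) (C.right i) s

variable {C} (hC : C.IsValid)

include hC

theorem disjoint_cuts {i j : Fin (g + 1)} (hij : i ≠ j) {s : ℝ}
    (hs : s ∈ Set.Icc (C.left i) (C.right i)) : s ∉ Set.Icc (C.left j) (C.right j) := by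
  intro h
  rcases lt_or_gt_of_ne hij with h' | h'
  · linarith [hC.right_lt_left _ _ h', hs.2, h.1]
  · linarith [hC.right_lt_left _ _ h', hs.1, h.2]

theorem continuous_mass : Continuous C.mass := by
  have h1 := continuous_jumpWeight C.left C.right
  have h2 := hC.isRegularPath.continuous_deriv
  have h3 : Continuous fun s => ∏ i, cutFactor C.path (C.left i) (C.right i) s :=
    continuous_finsetProd _ fun i _ => hC.isRegularPath.continuous_cutFactor _ _
  unfold mass
  fun_prop

theorem mass_eq_zero {s : ℝ} (hs : ∀ i, s ∉ Set.Ioo (C.left i) (C.right i)) : C.mass s = 0 := by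
  rw [mass, jumpWeight_eq_zero (fun i => (hC.left_lt_right i).le) hs, zero_mul, zero_mul]

/-- In this form the mass is the density that `exists_prod_eq_cauchyIntegral` attaches to the i-th
cut. -/
theorem mass_of_mem {i : Fin (g + 1)} {s : ℝ} (hs : s ∈ Set.Icc (C.left i) (C.right i)) :
    C.mass s = cutDensity C.path (C.left i) (C.right i) s
      * ∏ j ∈ Finset.univ.erase i, cutBranch C.path (C.left j) (C.right j) (C.path s) := by
  have hne : ∀ j, j ≠ i → s ∉ Set.Icc (C.left j) (C.right j) := fun j hj =>
    disjoint_cuts hC hj.symm hs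
  rw [Finset.prod_congr rfl fun j hj => hC.isRegularPath.cutBranch_path (hC.left_lt_right j)
    (hne j (Finset.ne_of_mem_erase hj)), Finset.prod_mul_distrib, mass,
    jumpWeight_of_mem (fun i => (hC.left_lt_right i).le) hs
      (fun j hj h => hne j hj (Set.Ioo_subset_Icc_self h)),
    ← Finset.mul_prod_erase _ (fun i => cutFactor C.path (C.left i) (C.right i) s)
      (Finset.mem_univ i), cutDensity]
  ring

theorem support_subset_Ioc {n : ℝ → ℂ} (hn : ∀ s, (∀ i, s ∉ Set.Ioo (C.left i) (C.right i)) → n s = 0)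
    {A B : ℝ} (hA : A ≤ C.left 0) (hB : C.lastMark ≤ B) : Function.support n ⊆ Set.Ioc A B := by
  intro s hs
  by_contra h
  refine hs (hn s fun i hi => h ⟨?_, ?_⟩)
  · linarith [hi.1, left_zero_le hC i]
  · linarith [hi.2, right_le_lastMark hC i]

theorem integral_eq_sum_cuts {n : ℝ → ℂ}
    (hn : ∀ s, (∀ i, s ∉ Set.Ioo (C.left i) (C.right i)) → n s = 0)
    (hc : ∀ i, ContinuousOn n (Set.Icc (C.left i) (C.right i))) {A B : ℝ} (hA : A ≤ C.left 0)
    (hB : C.lastMark ≤ B) :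
    ∫ s in A..B, n s = ∑ i, ∫ s in (C.left i)..(C.right i), n s := by
  rw [intervalIntegral.integral_eq_integral_of_support_subset (support_subset_Ioc hC hn hA hB),
    ← MeasureTheory.setIntegral_eq_integral_of_forall_compl_eq_zero
      (s := ⋃ i, Set.Ioc (C.left i) (C.right i)), MeasureTheory.integral_iUnion_fintype]
  · exact Finset.sum_congr rfl fun i _ =>
      (intervalIntegral.integral_of_le (hC.left_lt_right i).le).symm
  · exact fun i => measurableSet_Ioc
  · exact fun i j hij => Set.disjoint_left.2 fun s h1 h2 =>
      disjoint_cuts hC hij (Set.Ioc_subset_Icc_self h1) (Set.Ioc_subset_Icc_self h2)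
  · exact fun i => (hc i).integrableOn_Icc.mono_set Set.Ioc_subset_Icc_self
  · exact fun s hs => hn s fun i hi => hs (Set.mem_iUnion.2 ⟨i, Set.Ioo_subset_Ioc_self hi⟩)

theorem tendsto_y0_tube {σ : ℝ} (hσ : σ ^ 2 = 1) {s : ℝ} (hl : ∀ i, s ≠ C.left i)
    (hr : ∀ i, s ≠ C.right i) :
    Tendsto (fun e : ℝ => C.y0 (tube C.path s (σ * e))) (𝓝[>] 0)
      (𝓝 ((∏ i, cutWeight σ (C.left i) (C.right i) s)
        * ∏ i, cutFactor C.path (C.left i) (C.right i) s)) := by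
  obtain ⟨c, M, e₀, hT⟩ := hC.isRegularPath.exists_tubeBound (min s (C.left 0))
    (max s (C.lastMark + 1))
  have h1 : Tendsto (fun e : ℝ => C.prodBranch (tube C.path s (σ * e))) (𝓝[>] 0)
      (𝓝 (∏ i, (cutWeight σ (C.left i) (C.right i) s
        * cutFactor C.path (C.left i) (C.right i) s))) :=
    tendsto_finsetProd _ fun i _ =>
      hC.isRegularPath.tendsto_cutBranch_tube hσ (hC.left_lt_right i) (hl i) (hr i)
  rw [Finset.prod_mul_distrib] at h1
  refine h1.congr' ?_
  have hσ1 : |σ| = 1 := by rwa [← sq_eq_sq₀ (abs_nonneg _) zero_le_one, sq_abs, one_pow]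
  filter_upwards [Ioo_mem_nhdsGT hT.pos_height] with e he
  have h2 : |σ * e| = e := by rw [abs_mul, hσ1, one_mul, abs_of_pos he.1]
  refine (y0_tube hC hT (min_le_right _ _) ((lt_add_one _).trans_le (le_max_right _ _))
    ⟨min_le_left _ _, le_max_left _ _⟩ (by rw [h2]; exact he.2.le) fun h => ?_).symm
  rw [h, abs_zero] at h2
  exact he.1.ne h2

/-- The polynomial W' has no jump, so only the boundary values of y₀ contribute. They were computed
away from the marks, a finite set that integrals do not see. -/
theorem density_eq {s : ℝ} (hl : ∀ i, s ≠ C.left i) (hr : ∀ i, s ≠ C.right i) :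
    C.density s = C.mass s / C.t := by
  have h1 := tendsto_y0_tube hC (σ := 1) (by norm_num) hl hr
  have h2 := tendsto_y0_tube hC (σ := -1) (by norm_num) hl hr
  have h3 : ∀ σ : ℝ, Tendsto (fun e : ℝ => (derivative C.W).eval (tube C.path s (σ * e))) (𝓝[>] 0)
      (𝓝 ((derivative C.W).eval (C.path s))) := fun σ =>
    ((derivative C.W).continuous.tendsto _).comp (IsRegularPath.tendsto_tube s σ)
  have h4 := ((((h3 (-1)).sub h2).div_const (2 * C.t)).sub
    (((h3 1).sub h1).div_const (2 * C.t))).const_mul (1 / (2 * Real.pi * Complex.I))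
  have h5 := Tendsto.congr (f₂ := fun ε : ℝ => 1 / (2 * Real.pi * Complex.I) *
      (C.resolvent (C.path s - Complex.I * ε * deriv C.path s)
        - C.resolvent (C.path s + Complex.I * ε * deriv C.path s))) (fun e => by
    have e1 : C.path s - Complex.I * e * deriv C.path s = tube C.path s (-1 * e) := by
      rw [tube]; push_cast; ring
    have e2 : C.path s + Complex.I * e * deriv C.path s = tube C.path s (1 * e) := by
      rw [tube]; push_cast; ring
    rw [e1, e2, resolvent, resolvent]) h4
  rw [density, h5.limUnder_eq, mass, jumpWeight]
  have hpi : (Real.pi : ℂ) ≠ 0 := by exact_mod_cast Real.pi_ne_zero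
  have hI := Complex.I_ne_zero
  have ht := t_ne_zero hC
  field_simp
  ring

theorem density_ae_eq : ∀ᵐ s, C.density s = C.mass s / C.t := by
  have h : ∀ᵐ s : ℝ, (∀ i, s ≠ C.left i) ∧ ∀ i, s ≠ C.right i :=
    (MeasureTheory.ae_all_iff.2 fun i => MeasureTheory.Measure.ae_ne _ _).and
      (MeasureTheory.ae_all_iff.2 fun i => MeasureTheory.Measure.ae_ne _ _)
  filter_upwards [h] with s hs using density_eq hC hs.1 hs.2

/-- A point is away from the cuts and on the side of infinity of each of them. -/
def IsOuterPoint (C : MarkedCurve g) (x : ℂ) : Prop :=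
  ∀ i, x ∉ C.path '' Set.Icc (C.left i) (C.right i) ∧
    cutTransform C.path (C.left i) (C.right i) x * cutBranch C.path (C.left i) (C.right i) x
      = -Real.pi

theorem isOuterPoint_path {s : ℝ} (hs : ∀ i, s ∉ Set.Icc (C.left i) (C.right i)) :
    IsOuterPoint C (C.path s) := fun i =>
  ⟨hC.isRegularPath.notMem_cut (hs i),
    hC.isRegularPath.cutTransform_mul_cutBranch_path (hC.left_lt_right i) (hs i)⟩

theorem isOuterPoint_tube {A B c M e₀ : ℝ} (hT : TubeBound C.path A B c M e₀) (hA : A ≤ C.left 0)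
    (hB : C.lastMark < B) {s e : ℝ} (hs : s ∈ Set.Icc A B) (he : |e| ≤ e₀) (he0 : e ≠ 0) :
    IsOuterPoint C (tube C.path s e) := fun i =>
  ⟨IsRegularPath.tube_notMem hT (hA.trans (left_zero_le hC i))
    ((right_le_lastMark hC i).trans hB.le) hs he (Or.inr he0),
    hC.isRegularPath.cutTransform_mul_cutBranch_tube hT (hC.left_lt_right i)
      (hA.trans (left_zero_le hC i)) ((right_le_lastMark hC i).trans_lt hB) hs he he0⟩

/-- Partial fractions over all cuts at once; the polynomial is identified afterwards from the
behaviour at infinity. -/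
theorem exists_prodBranch_eq : ∃ P : ℂ[X], ∀ x, IsOuterPoint C x → C.prodBranch x
    = P.eval x - 2 * ∫ s in (C.left 0)..C.lastMark, C.mass s / (x - C.path s) := by
  classical
  have hγ := hC.isRegularPath
  choose c₀ hc₀ using fun i => hγ.exists_cutBranch_eq (hC.left_lt_right i)
  obtain ⟨P, hP⟩ := exists_prod_eq_cauchyIntegral hγ.continuous
    (fun i => (hC.left_lt_right i).le) (fun i => hγ.continuous_cutDensity (C.left i) (C.right i))
    (c := c₀) (Y := fun i => cutBranch C.path (C.left i) (C.right i))
    (G := fun i => {x | x ∉ C.path '' Set.Icc (C.left i) (C.right i) ∧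
      cutTransform C.path (C.left i) (C.right i) x * cutBranch C.path (C.left i) (C.right i) x
        = -Real.pi})
    (fun i x hx => hx.1) (fun i x hx => hc₀ i x hx.1 hx.2)
    (fun i j hij s hs => ⟨hγ.notMem_cut (disjoint_cuts hC hij hs),
      hγ.cutTransform_mul_cutBranch_path (hC.left_lt_right j) (disjoint_cuts hC hij hs)⟩)
    (fun i j hij s hs => ((hγ.differentiableAt_cutBranch (hC.left_lt_right j).le
      (hγ.notMem_cut (disjoint_cuts hC hij hs))).continuousAt.comp
        hγ.continuous.continuousAt).continuousWithinAt) Finset.univ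
  refine ⟨P, fun x hx => ?_⟩
  rw [prodBranch, hP x fun i _ => hx i, integral_eq_sum_cuts hC
    (fun s hs => by rw [mass_eq_zero hC hs, zero_div])
    (fun i => continuousOn_div_sub hγ.continuous (continuous_mass hC).continuousOn (hx i).1)
    le_rfl le_rfl]
  congr 2
  refine Finset.sum_congr rfl fun i _ => intervalIntegral.integral_congr fun s hs => ?_
  rw [Set.uIcc_of_le (hC.left_lt_right i).le] at hs
  rw [mass_of_mem hC hs]

theorem tendsto_mass_cauchyIntegral_cocompact :
    Tendsto (fun x => x * ∫ s in (C.left 0)..C.lastMark, C.mass s / (x - C.path s)) (cocompact ℂ)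
      (𝓝 (∫ s in (C.left 0)..C.lastMark, C.mass s)) :=
  tendsto_mul_cauchyIntegral_cocompact (continuous_mass hC) hC.isRegularPath.continuous _ _

/-- Along the points γ(k), k → ∞, both W' - y₀ and the Cauchy integral are of order 1/x, so the
polynomial part must be W'. The coefficients of 1/x are 2t and twice the total mass. -/
theorem prodBranch_eq_and_integral_mass : (∀ x, IsOuterPoint C x → C.prodBranch x
    = (derivative C.W).eval x - 2 * ∫ s in (C.left 0)..C.lastMark, C.mass s / (x - C.path s)) ∧
    ∫ s in (C.left 0)..C.lastMark, C.mass s = C.t := by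
  obtain ⟨P, hP⟩ := exists_prodBranch_eq hC
  have hz : Tendsto (fun k : ℕ => C.path k) atTop (cocompact ℂ) :=
    hC.isRegularPath.tendsto_atTop.comp tendsto_natCast_atTop_atTop
  have h1 := (tendsto_mul_derivW_sub_y0 hC).comp hz
  have h2 := (tendsto_mass_cauchyIntegral_cocompact hC).comp hz
  have hev : ∀ᶠ k : ℕ in atTop, C.y0 (C.path k) = P.eval (C.path k)
      - 2 * ∫ s in (C.left 0)..C.lastMark, C.mass s / (C.path k - C.path s) := by
    filter_upwards [tendsto_natCast_atTop_atTop.eventually (eventually_gt_atTop C.lastMark)]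
      with k hk
    rw [y0_path hC hk, hP]
    exact isOuterPoint_path hC fun i h => by linarith [h.2, right_le_lastMark hC i]
  have hne := hz.eventually eventually_ne_zero_cocompact
  have hPW : derivative C.W - P = 0 := by
    have h3 : Tendsto (fun k : ℕ => (C.path k)⁻¹ * (C.path k * ((derivative C.W).eval (C.path k)
        - C.y0 (C.path k)) - 2 * (C.path k * ∫ s in (C.left 0)..C.lastMark,
          C.mass s / (C.path k - C.path s)))) atTop (𝓝 (0 * (2 * C.t - 2 *
            ∫ s in (C.left 0)..C.lastMark, C.mass s))) :=
      (tendsto_inv_cocompact.comp hz).mul (h1.sub (h2.const_mul 2))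
    rw [zero_mul] at h3
    refine eq_zero_of_tendsto_zero hz (h3.congr' ?_)
    filter_upwards [hev, hne] with k hk hk0
    rw [hk, eval_sub]
    field_simp
    ring
  have hPW' : P = derivative C.W := (sub_eq_zero.1 hPW).symm
  subst hPW'
  refine ⟨hP, ?_⟩
  have h4 := tendsto_nhds_unique (h1.congr' (f₂ := fun k : ℕ => 2 * (C.path k *
    ∫ s in (C.left 0)..C.lastMark, C.mass s / (C.path k - C.path s))) (by
      filter_upwards [hev] with k hk
      simp only [Function.comp_apply]
      rw [hk]
      ring)) (h2.const_mul 2)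
  exact (mul_left_cancel₀ two_ne_zero h4).symm

theorem integral_mass : ∫ s in (C.left 0)..C.lastMark, C.mass s = C.t :=
  (prodBranch_eq_and_integral_mass hC).2

theorem y0_tube_eq {A B c M e₀ : ℝ} (hT : TubeBound C.path A B c M e₀) (hA : A ≤ C.left 0)
    (hB : C.lastMark < B) {s e : ℝ} (hs : s ∈ Set.Icc A B) (he : |e| ≤ e₀) (he0 : e ≠ 0) :
    C.y0 (tube C.path s e) = (derivative C.W).eval (tube C.path s e)
      - 2 * ∫ s' in (C.left 0)..C.lastMark, C.mass s' / (tube C.path s e - C.path s') := by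
  rw [y0_tube hC hT hA hB hs he he0,
    (prodBranch_eq_and_integral_mass hC).1 _ (isOuterPoint_tube hC hT hA hB hs he he0)]

theorem filling_eq (i : Fin (g + 1)) :
    C.filling i = ∫ s in (C.left i)..(C.right i), C.mass s := by
  rw [filling, ← intervalIntegral.integral_const_mul]
  refine intervalIntegral.integral_congr_ae ?_
  filter_upwards [density_ae_eq hC] with s hs _
  rw [hs, mul_div_cancel₀ _ (t_ne_zero hC)]

theorem freeEnergy_eq : C.freeEnergy = (∫ s in (C.left 0)..C.lastMark,
      ∫ s' in (C.left 0)..C.lastMark, C.pvLog s s' * C.mass s * C.mass s')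
    - ∫ s in (C.left 0)..C.lastMark, C.W.eval (C.path s) * C.mass s := by
  have ht := t_ne_zero hC
  have hz : ∀ s, (∀ i, s ∉ Set.Ioo (C.left i) (C.right i)) → C.mass s = 0 := fun s hs =>
    mass_eq_zero hC hs
  have h1 : ∀ n : ℝ → ℂ, (∀ s, C.mass s = 0 → n s = 0) →
      ∫ s in (C.left 0)..C.lastMark, n s = ∫ s, n s := fun n hn =>
    intervalIntegral.integral_eq_integral_of_support_subset
      (support_subset_Ioc hC (fun s hs => hn s (hz s hs)) le_rfl le_rfl)
  have h2 : ∀ s, ∫ s', C.pvLog s s' * C.density s * C.density s'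
      = C.density s * ∫ s' in (C.left 0)..C.lastMark, C.pvLog s s' * C.mass s' / C.t := by
    intro s
    rw [h1 _ fun s' hs' => by rw [hs']; ring, ← MeasureTheory.integral_const_mul]
    refine MeasureTheory.integral_congr_ae ?_
    filter_upwards [density_ae_eq hC] with s' hs'
    rw [hs']
    ring
  have h3 : (∫ s, ∫ s', C.pvLog s s' * C.density s * C.density s')
      = ∫ s in (C.left 0)..C.lastMark, C.mass s / C.t *
        ∫ s' in (C.left 0)..C.lastMark, C.pvLog s s' * C.mass s' / C.t := by
    rw [h1 _ fun s hs => by rw [hs]; ring]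
    refine MeasureTheory.integral_congr_ae ?_
    filter_upwards [density_ae_eq hC] with s hs
    rw [h2, hs]
  have h4 : (∫ s, C.W.eval (C.path s) * C.density s)
      = ∫ s in (C.left 0)..C.lastMark, C.W.eval (C.path s) * (C.mass s / C.t) := by
    rw [h1 _ fun s hs => by rw [hs]; ring]
    refine MeasureTheory.integral_congr_ae ?_
    filter_upwards [density_ae_eq hC] with s hs
    rw [hs]
  rw [freeEnergy, h3, h4, ← intervalIntegral.integral_const_mul,
    ← intervalIntegral.integral_const_mul]
  congr 1
  · refine intervalIntegral.integral_congr fun s _ => ?_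
    rw [← intervalIntegral.integral_const_mul, ← intervalIntegral.integral_const_mul]
    refine intervalIntegral.integral_congr fun s' _ => ?_
    field_simp
  · refine intervalIntegral.integral_congr fun s _ => ?_
    field_simp

end MarkedCurve

/-! ### The symmetrised Cauchy kernel -/

/-- The mean of the Cauchy kernels at the points at heights `e` and `-e` over the path. -/
def meanKernel (γ : ℝ → ℂ) (e s s' : ℝ) : ℂ :=
  1 / 2 * ((tube γ s e - γ s')⁻¹ + (tube γ s (-e) - γ s')⁻¹)

/-- The logarithm of `γ s - γ s'`, averaged over the two sides of the path. -/
def logKernel (γ : ℝ → ℂ) (s s' : ℝ) : ℂ := Real.log |s - s'| + pathLog γ s s'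

/-- The average over the two sides keeps the odd real part of the kernel; the Poisson part,
responsible for the jump, cancels. -/
theorem half_inv_add_inv (u : ℝ) {e : ℝ} (he : e ≠ 0) :
    1 / 2 * (((u : ℂ) + Complex.I * e)⁻¹ + ((u : ℂ) + Complex.I * (-e : ℝ))⁻¹)
      = ((u / (u ^ 2 + e ^ 2) : ℝ) : ℂ) := by
  have h : ∀ e : ℝ, e ≠ 0 → (u : ℂ) + Complex.I * e ≠ 0 := fun e he h0 => by
    have := congrArg Complex.im h0
    simp at this
    exact he this
  have h1 := h e he
  have h2 := h (-e) (neg_ne_zero.2 he)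
  have h3 : (u : ℂ) ^ 2 + (e : ℂ) ^ 2 ≠ 0 := by
    have : u ^ 2 + e ^ 2 ≠ 0 := by positivity
    exact_mod_cast this
  push_cast at h2 ⊢
  rw [inv_add_inv h1 h2, ← mul_div_assoc, div_eq_div_iff (mul_ne_zero h1 h2) h3]
  linear_combination ((u : ℂ) * e ^ 2) * Complex.I_sq

theorem hasDerivAt_half_log (u : ℝ) {e : ℝ} (he : e ≠ 0) :
    HasDerivAt (fun u : ℝ => Real.log (u ^ 2 + e ^ 2) / 2) (u / (u ^ 2 + e ^ 2)) u := by
  have h : u ^ 2 + e ^ 2 ≠ 0 := by positivity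
  refine (((((hasDerivAt_id u).pow 2).add_const (e ^ 2)).log h).div_const 2).congr_deriv ?_
  simp
  field_simp

/-- A majorant that does not depend on the height and has an integrable singularity. -/
theorem abs_half_log_le {u e D : ℝ} (hu : u ≠ 0) (hD : |u| ≤ D) (he : |e| ≤ 1) :
    |Real.log (u ^ 2 + e ^ 2) / 2| ≤ |(Real.log |u|)| + Real.log (D ^ 2 + 1) := by
  have h1 : Real.log |u| ≤ Real.log (u ^ 2 + e ^ 2) / 2 := by
    have h2 : Real.log (u ^ 2) ≤ Real.log (u ^ 2 + e ^ 2) :=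
      Real.log_le_log (by positivity) (by nlinarith [sq_nonneg e])
    rw [Real.log_pow] at h2
    push_cast at h2
    rw [Real.log_abs]
    linarith
  have h3 : Real.log (u ^ 2 + e ^ 2) ≤ Real.log (D ^ 2 + 1) := by
    refine Real.log_le_log (by positivity) ?_
    have h4 : e ^ 2 ≤ 1 := by rw [← sq_abs]; nlinarith [abs_nonneg e]
    have h5 : u ^ 2 ≤ D ^ 2 := by rw [← sq_abs]; nlinarith [abs_nonneg u]
    linarith
  have h6 : 0 ≤ Real.log (D ^ 2 + 1) := Real.log_nonneg (by nlinarith [sq_nonneg D])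
  rw [abs_le]
  constructor
  · linarith [neg_abs_le (Real.log |u|)]
  · linarith [abs_nonneg (Real.log |u|)]

theorem measurable_meanKernel {γ : ℝ → ℂ} (hc : Continuous γ) (hd : Continuous (deriv γ)) (e : ℝ) :
    Measurable fun p : ℝ × ℝ => meanKernel γ e p.1 p.2 := by
  have h1 : ∀ e : ℝ, Measurable fun p : ℝ × ℝ => tube γ p.1 e - γ p.2 := fun e => by
    unfold tube
    have := hc.measurable
    have := hd.measurable
    fun_prop
  exact (((h1 e).inv).add ((h1 (-e)).inv)).const_mul _

theorem continuousOn_meanKernel {γ : ℝ → ℂ} {A B c M e₀ e : ℝ} (hc : Continuous γ)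
    (hd : Continuous (deriv γ)) (hT : TubeBound γ A B c M e₀) (he : |e| ≤ e₀) (he0 : e ≠ 0) :
    ContinuousOn (fun p : ℝ × ℝ => meanKernel γ e p.1 p.2) (Set.Icc A B ×ˢ Set.Icc A B) := by
  have h1 : ∀ e : ℝ, |e| ≤ e₀ → e ≠ 0 →
      ContinuousOn (fun p : ℝ × ℝ => (tube γ p.1 e - γ p.2)⁻¹) (Set.Icc A B ×ˢ Set.Icc A B) :=
    fun e he he0 => ContinuousOn.inv₀ (by unfold tube; fun_prop)
      fun p hp => hT.tube_sub_ne_zero hp.1 hp.2 he (Or.inr he0)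
  exact continuousOn_const.mul ((h1 e he he0).add (h1 (-e) (by rwa [abs_neg]) (neg_ne_zero.2 he0)))

theorem tendsto_meanKernel {γ : ℝ → ℂ} {s s' : ℝ} (h : γ s ≠ γ s') :
    Tendsto (fun e => meanKernel γ e s s') (𝓝[>] 0) (𝓝 (γ s - γ s')⁻¹) := by
  have h1 : ∀ σ : ℝ, Tendsto (fun e : ℝ => (tube γ s (σ * e) - γ s')⁻¹) (𝓝[>] 0)
      (𝓝 (γ s - γ s')⁻¹) := fun σ =>
    ((IsRegularPath.tendsto_tube s σ).sub_const _).inv₀ (sub_ne_zero.2 h)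
  have h2 := ((h1 1).add (h1 (-1))).const_mul (1 / 2)
  simp only [one_mul, neg_one_mul] at h2
  have h3 : 1 / 2 * ((γ s - γ s')⁻¹ + (γ s - γ s')⁻¹) = (γ s - γ s')⁻¹ := by ring
  rw [h3] at h2
  exact h2

namespace TubeBound

variable {γ : ℝ → ℂ} {A B c M e₀ : ℝ} (hT : TubeBound γ A B c M e₀)

include hT

theorem norm_meanKernel_le {s s' e : ℝ} (hs : s ∈ Set.Icc A B) (hs' : s' ∈ Set.Icc A B)
    (he : |e| ≤ e₀) : ‖meanKernel γ e s s'‖ ≤ c⁻¹ * (|s - s'| + |e|)⁻¹ := by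
  have h1 := hT.norm_inv_le hs hs' he
  have h2 := hT.norm_inv_le hs hs' (e := -e) (by rwa [abs_neg])
  rw [abs_neg] at h2
  have h3 := norm_add_le (tube γ s e - γ s')⁻¹ (tube γ s (-e) - γ s')⁻¹
  rw [meanKernel, norm_mul]
  norm_num
  linarith

theorem norm_meanKernel_sub_le {s s' e : ℝ} (hs : s ∈ Set.Icc A B) (hs' : s' ∈ Set.Icc A B)
    (he : |e| ≤ e₀) (he0 : e ≠ 0) :
    ‖deriv γ s * meanKernel γ e s s' - (((s - s') / ((s - s') ^ 2 + e ^ 2) : ℝ) : ℂ)‖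
      ≤ 2 * M * c⁻¹ := by
  have h1 := hT.norm_kernel_sub_le hs hs' he
  have h2 := hT.norm_kernel_sub_le hs hs' (e := -e) (by rwa [abs_neg])
  have h3 := norm_add_le (deriv γ s * (tube γ s e - γ s')⁻¹ - ((s : ℂ) - s' + Complex.I * e)⁻¹)
    (deriv γ s * (tube γ s (-e) - γ s')⁻¹ - ((s : ℂ) - s' + Complex.I * (-e : ℝ))⁻¹)
  rw [← half_inv_add_inv _ he0, meanKernel, Complex.ofReal_sub]
  have h4 : deriv γ s * (1 / 2 * ((tube γ s e - γ s')⁻¹ + (tube γ s (-e) - γ s')⁻¹))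
      - 1 / 2 * (((s : ℂ) - s' + Complex.I * e)⁻¹ + ((s : ℂ) - s' + Complex.I * (-e : ℝ))⁻¹)
      = 1 / 2 * ((deriv γ s * (tube γ s e - γ s')⁻¹ - ((s : ℂ) - s' + Complex.I * e)⁻¹)
        + (deriv γ s * (tube γ s (-e) - γ s')⁻¹
          - ((s : ℂ) - s' + Complex.I * (-e : ℝ))⁻¹)) := by ring
  rw [h4, norm_mul, show ‖(1 / 2 : ℂ)‖ = 1 / 2 by norm_num]
  linarith

theorem norm_meanKernel_sub_le' {s s' e : ℝ} (hs : s ∈ Set.Icc A B) (hs' : s' ∈ Set.Icc A B)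
    (he : |e| ≤ e₀) (he0 : e ≠ 0) :
    ‖deriv γ s' * meanKernel γ e s s' - (((s - s') / ((s - s') ^ 2 + e ^ 2) : ℝ) : ℂ)‖
      ≤ 3 * M * c⁻¹ := by
  have h1 := hT.norm_kernel_sub_le' hs hs' he
  have h2 := hT.norm_kernel_sub_le' hs hs' (e := -e) (by rwa [abs_neg])
  have h3 := norm_add_le (deriv γ s' * (tube γ s e - γ s')⁻¹ - ((s : ℂ) - s' + Complex.I * e)⁻¹)
    (deriv γ s' * (tube γ s (-e) - γ s')⁻¹ - ((s : ℂ) - s' + Complex.I * (-e : ℝ))⁻¹)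
  rw [← half_inv_add_inv _ he0, meanKernel, Complex.ofReal_sub]
  have h4 : deriv γ s' * (1 / 2 * ((tube γ s e - γ s')⁻¹ + (tube γ s (-e) - γ s')⁻¹))
      - 1 / 2 * (((s : ℂ) - s' + Complex.I * e)⁻¹ + ((s : ℂ) - s' + Complex.I * (-e : ℝ))⁻¹)
      = 1 / 2 * ((deriv γ s' * (tube γ s e - γ s')⁻¹ - ((s : ℂ) - s' + Complex.I * e)⁻¹)
        + (deriv γ s' * (tube γ s (-e) - γ s')⁻¹
          - ((s : ℂ) - s' + Complex.I * (-e : ℝ))⁻¹)) := by ring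
  rw [h4, norm_mul, show ‖(1 / 2 : ℂ)‖ = 1 / 2 by norm_num]
  linarith

/-- The symmetrised kernel is antisymmetric up to a bounded error. -/
theorem norm_meanKernel_add_swap_le {s s' e : ℝ} (hs : s ∈ Set.Icc A B) (hs' : s' ∈ Set.Icc A B)
    (he : |e| ≤ e₀) (he0 : e ≠ 0) :
    ‖meanKernel γ e s s' + meanKernel γ e s' s‖ ≤ 5 * M * c⁻¹ * c⁻¹ := by
  have h1 := hT.norm_meanKernel_sub_le hs hs' he he0
  have h2 := hT.norm_meanKernel_sub_le' hs' hs he he0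
  have h3 := norm_add_le _ _ |>.trans (add_le_add h1 h2)
  have h4 : ((((s' - s) / ((s' - s) ^ 2 + e ^ 2) : ℝ)) : ℂ)
      = -(((s - s') / ((s - s') ^ 2 + e ^ 2) : ℝ) : ℂ) := by
    rw [← Complex.ofReal_neg]
    congr 1
    rw [← neg_div]
    congr 1 <;> ring
  rw [h4] at h3
  -- Both comparisons carry the same factor γ'(s), because s is the foot of the normal in the first
  -- kernel and the point on the path in the second. This is why both versions of the kernel bound
  -- are needed.
  have h5 : deriv γ s * meanKernel γ e s s' - (((s - s') / ((s - s') ^ 2 + e ^ 2) : ℝ) : ℂ)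
      + (deriv γ s * meanKernel γ e s' s - -(((s - s') / ((s - s') ^ 2 + e ^ 2) : ℝ) : ℂ))
      = deriv γ s * (meanKernel γ e s s' + meanKernel γ e s' s) := by ring
  rw [h5, norm_mul] at h3
  have h6 : c ≤ ‖deriv γ s‖ := by
    have h7 := hT.lower s hs s hs e he
    have h8 : ‖tube γ s e - γ s‖ = |e| * ‖deriv γ s‖ := by simp [tube]
    rw [h8, sub_self, abs_zero, zero_add, mul_comm] at h7
    exact le_of_mul_le_mul_left h7 (abs_pos.2 he0)
  have hc := hT.pos
  have h9 := (mul_le_mul_of_nonneg_right h6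
    (norm_nonneg (meanKernel γ e s s' + meanKernel γ e s' s))).trans h3
  rw [← mul_le_mul_iff_right₀ hc]
  refine h9.trans (le_of_eq ?_)
  field_simp
  ring

end TubeBound

/-! ### Dominated convergence for double integrals -/

/-- Bounded convergence, applied to the inner and then to the outer integral; the diagonal, where no
limit is assumed, is a single point of each inner integral. -/
theorem tendsto_double_integral {f : ℝ → ℝ → ℝ → ℂ} {F : ℝ → ℝ → ℂ} {a b K : ℝ} (hab : a ≤ b)
    (hm : ∀ e, Measurable fun p : ℝ × ℝ => f e p.1 p.2)
    (hb : ∀ᶠ e in 𝓝[>] (0 : ℝ), ∀ s ∈ Set.Icc a b, ∀ s' ∈ Set.Icc a b, ‖f e s s'‖ ≤ K)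
    (hl : ∀ s ∈ Set.Icc a b, ∀ s' ∈ Set.Icc a b, s ≠ s' →
      Tendsto (fun e => f e s s') (𝓝[>] 0) (𝓝 (F s s'))) :
    Tendsto (fun e => ∫ s in a..b, ∫ s' in a..b, f e s s') (𝓝[>] 0)
      (𝓝 (∫ s in a..b, ∫ s' in a..b, F s s')) := by
  have hIoc : Set.uIoc a b ⊆ Set.Icc a b := by
    rw [Set.uIoc_of_le hab]; exact Set.Ioc_subset_Icc_self
  refine intervalIntegral.tendsto_integral_filter_of_dominated_convergence
    (fun _ => K * |b - a|) ?_ ?_ (by simp) ?_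
  · refine Eventually.of_forall fun e => ?_
    have h1 := (MeasureTheory.StronglyMeasurable.integral_prod_right
      (f := fun s s' => f e s s') (ν := MeasureTheory.volume.restrict (Set.Ioc a b))
      (hm e).stronglyMeasurable).aestronglyMeasurable
      (μ := MeasureTheory.volume.restrict (Set.uIoc a b))
    simpa only [intervalIntegral.integral_of_le hab] using h1
  · filter_upwards [hb] with e he
    exact MeasureTheory.ae_of_all _ fun s hs => intervalIntegral.norm_integral_le_of_norm_le_const
      fun s' hs' => he s (hIoc hs) s' (hIoc hs')
  · refine MeasureTheory.ae_of_all _ fun s hs => ?_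
    refine intervalIntegral.tendsto_integral_filter_of_dominated_convergence (fun _ => K) ?_ ?_
      (by simp) ?_
    · exact Eventually.of_forall fun e =>
        ((hm e).comp (measurable_const.prodMk measurable_id)).aestronglyMeasurable
    · filter_upwards [hb] with e he
      exact MeasureTheory.ae_of_all _ fun s' hs' => he s (hIoc hs) s' (hIoc hs')
    · filter_upwards [MeasureTheory.Measure.ae_ne MeasureTheory.volume s] with s' hs' h
      exact hl s (hIoc hs) s' (hIoc h) hs'.symm

/-! ### Integrating the kernel along the path -/

namespace IsRegularPath

variable {γ : ℝ → ℂ} (hγ : IsRegularPath γ)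

include hγ

theorem integral_deriv_mul_meanKernel {A B c M e₀ e : ℝ} (hT : TubeBound γ A B c M e₀)
    (he : |e| ≤ e₀) (he0 : e ≠ 0) {s₁ s₂ s' : ℝ} (h1 : A ≤ s₁) (h12 : s₁ ≤ s₂) (h2 : s₂ ≤ B)
    (hs' : s' ∈ Set.Icc A B) :
    ∫ s in s₁..s₂, deriv γ s * meanKernel γ e s s'
      = (∫ s in s₁..s₂, (deriv γ s * meanKernel γ e s s'
          - (((s - s') / ((s - s') ^ 2 + e ^ 2) : ℝ) : ℂ)))
        + ((Real.log ((s₂ - s') ^ 2 + e ^ 2) / 2 - Real.log ((s₁ - s') ^ 2 + e ^ 2) / 2 : ℝ) : ℂ) := by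
  have hpos : ∀ s : ℝ, (s - s') ^ 2 + e ^ 2 ≠ 0 := fun s => by positivity
  have hcr : Continuous fun s : ℝ => (s - s') / ((s - s') ^ 2 + e ^ 2) :=
    Continuous.div (by fun_prop) (by fun_prop) hpos
  have h3 : ∫ s in s₁..s₂, (((s - s') / ((s - s') ^ 2 + e ^ 2) : ℝ) : ℂ)
      = ((Real.log ((s₂ - s') ^ 2 + e ^ 2) / 2 - Real.log ((s₁ - s') ^ 2 + e ^ 2) / 2 : ℝ) : ℂ) := by
    rw [intervalIntegral.integral_ofReal, intervalIntegral.integral_eq_sub_of_hasDerivAt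
      (f := fun s => Real.log ((s - s') ^ 2 + e ^ 2) / 2) (fun s _ => by
        have := (hasDerivAt_half_log (s - s') he0).comp s ((hasDerivAt_id s).sub_const s')
        rw [mul_one] at this
        exact this) (hcr.intervalIntegrable _ _)]
  have hck : ContinuousOn (fun s => deriv γ s * meanKernel γ e s s') (Set.uIcc s₁ s₂) := by
    rw [Set.uIcc_of_le h12]
    exact hγ.continuous_deriv.continuousOn.mul
      ((continuousOn_meanKernel hγ.continuous hγ.continuous_deriv hT he he0).comp
        (f := fun s => (s, s')) (by fun_prop) fun s hs => ⟨⟨h1.trans hs.1, hs.2.trans h2⟩, hs'⟩)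
  have hi1 : IntervalIntegrable (fun s => deriv γ s * meanKernel γ e s s') MeasureTheory.volume
      s₁ s₂ := hck.intervalIntegrable
  have hi2 : IntervalIntegrable (fun s : ℝ => (((s - s') / ((s - s') ^ 2 + e ^ 2) : ℝ) : ℂ))
      MeasureTheory.volume s₁ s₂ := (Complex.continuous_ofReal.comp hcr).intervalIntegrable _ _
  rw [← h3, intervalIntegral.integral_sub hi1 hi2, sub_add_cancel]

/-- The bounded difference to the real kernel passes to the limit and gives the `pathLog` part. The
real kernel has the primitive log((s - s')² + e²)/2, whose limit gives log |s - s'| at the end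
points. Only the end points have to avoid s'. -/
theorem tendsto_integral_deriv_mul_meanKernel {A B c M e₀ : ℝ} (hT : TubeBound γ A B c M e₀)
    {s₁ s₂ s' : ℝ} (h1 : A ≤ s₁) (h12 : s₁ ≤ s₂) (h2 : s₂ ≤ B) (hs' : s' ∈ Set.Icc A B)
    (hn1 : s' ≠ s₁) (hn2 : s' ≠ s₂) :
    Tendsto (fun e => ∫ s in s₁..s₂, deriv γ s * meanKernel γ e s s') (𝓝[>] 0)
      (𝓝 (logKernel γ s₂ s' - logKernel γ s₁ s')) := by
  have hmem : ∀ s ∈ Set.uIoc s₁ s₂, s ∈ Set.Icc A B := fun s hs => by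
    rw [Set.uIoc_of_le h12] at hs
    exact ⟨h1.trans hs.1.le, hs.2.trans h2⟩
  have hlog : ∀ u : ℝ, u ≠ 0 → Tendsto (fun e : ℝ => Real.log (u ^ 2 + e ^ 2) / 2) (𝓝[>] 0)
      (𝓝 (Real.log |u|)) := fun u hu => by
    have h3 : ContinuousAt (fun e : ℝ => Real.log (u ^ 2 + e ^ 2) / 2) 0 := by
      refine ContinuousAt.div_const (ContinuousAt.log (by fun_prop) ?_) _
      positivity
    have h4 := h3.tendsto
    simp only [ne_eq, OfNat.ofNat_ne_zero, not_false_eq_true, zero_pow, add_zero, Real.log_pow,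
      Nat.cast_ofNat] at h4
    rw [mul_div_cancel_left₀ _ (two_ne_zero' ℝ), ← Real.log_abs] at h4
    exact h4.mono_left nhdsWithin_le_nhds
  have h5 : Tendsto (fun e : ℝ => ∫ s in s₁..s₂, (deriv γ s * meanKernel γ e s s'
      - (((s - s') / ((s - s') ^ 2 + e ^ 2) : ℝ) : ℂ))) (𝓝[>] 0)
      (𝓝 (∫ s in s₁..s₂, (deriv γ s * (γ s - γ s')⁻¹ - ((s : ℂ) - s')⁻¹))) := by
    refine intervalIntegral.tendsto_integral_filter_of_dominated_convergence
      (fun _ => 2 * M * c⁻¹) ?_ ?_ (by simp) ?_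
    · refine Eventually.of_forall fun e => Measurable.aestronglyMeasurable ?_
      have h6 : Measurable fun s => meanKernel γ e s s' :=
        Measurable.comp (g := fun p : ℝ × ℝ => meanKernel γ e p.1 p.2) (f := fun s => (s, s'))
          (measurable_meanKernel hγ.continuous hγ.continuous_deriv e)
          (measurable_id.prodMk measurable_const)
      have h7 : Measurable fun s : ℝ => (s - s') / ((s - s') ^ 2 + e ^ 2) := by fun_prop
      exact (hγ.continuous_deriv.measurable.mul h6).sub (Complex.measurable_ofReal.comp h7)
    · filter_upwards [Ioo_mem_nhdsGT hT.pos_height] with e he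
      exact MeasureTheory.ae_of_all _ fun s hs => hT.norm_meanKernel_sub_le (hmem s hs) hs'
        (by rw [abs_of_pos he.1]; exact he.2.le) he.1.ne'
    · filter_upwards [MeasureTheory.Measure.ae_ne MeasureTheory.volume s'] with s hs _
      refine ((tendsto_meanKernel (hγ.injective.ne hs)).const_mul _).sub ?_
      have h0 : s - s' ≠ 0 := sub_ne_zero.2 hs
      have h8 : ContinuousAt (fun e : ℝ => (s - s') / ((s - s') ^ 2 + e ^ 2)) 0 :=
        ContinuousAt.div (by fun_prop) (by fun_prop) (by positivity)
      have h9 := (Complex.continuous_ofReal.tendsto _).comp h8.tendsto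
      have h10 : (((s - s') / ((s - s') ^ 2 + 0 ^ 2) : ℝ) : ℂ) = ((s : ℂ) - s')⁻¹ := by
        rw [← Complex.ofReal_sub, ← Complex.ofReal_inv]
        congr 1
        field_simp
        ring
      rw [h10] at h9
      exact h9.mono_left nhdsWithin_le_nhds
  have h6 : ∫ s in s₁..s₂, (deriv γ s * (γ s - γ s')⁻¹ - ((s : ℂ) - s')⁻¹)
      = pathLog γ s₂ s' - pathLog γ s₁ s' := by
    have := hγ.integral_kernel_sub (s := s') h12
    rw [← neg_inj, ← this, ← intervalIntegral.integral_neg]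
    refine intervalIntegral.integral_congr fun s _ => ?_
    rw [← neg_sub (γ s) (γ s'), ← neg_sub (s : ℂ) s', inv_neg, inv_neg]
    ring
  rw [h6] at h5
  have h7 := h5.add ((Complex.continuous_ofReal.tendsto _).comp ((hlog (s₂ - s')
    (sub_ne_zero.2 hn2.symm)).sub (hlog (s₁ - s') (sub_ne_zero.2 hn1.symm))))
  have h8 : pathLog γ s₂ s' - pathLog γ s₁ s' + ((Real.log |s₂ - s'| - Real.log |s₁ - s'| : ℝ) : ℂ)
      = logKernel γ s₂ s' - logKernel γ s₁ s' := by
    rw [logKernel, logKernel]; push_cast; ring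
  rw [h8] at h7
  refine h7.congr' ?_
  filter_upwards [Ioo_mem_nhdsGT hT.pos_height] with e he
  exact (hγ.integral_deriv_mul_meanKernel hT (by rw [abs_of_pos he.1]; exact he.2.le) he.1.ne' h1
    h12 h2 hs').symm

/-- A bound uniform in the height, with logarithmic singularities in s' only; it is the majorant for
integration against the mass. -/
theorem norm_integral_deriv_mul_meanKernel_le {A B c M e₀ e : ℝ} (hT : TubeBound γ A B c M e₀)
    (he : |e| ≤ e₀) (he1 : |e| ≤ 1) (he0 : e ≠ 0) {s₁ s₂ s' : ℝ} (h1 : A ≤ s₁) (h12 : s₁ ≤ s₂)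
    (h2 : s₂ ≤ B) (hs' : s' ∈ Set.Icc A B) (hn1 : s' ≠ s₁) (hn2 : s' ≠ s₂) :
    ‖∫ s in s₁..s₂, deriv γ s * meanKernel γ e s s'‖ ≤ 2 * M * c⁻¹ * |s₂ - s₁|
      + (|(Real.log |s₂ - s'|)| + |(Real.log |s₁ - s'|)| + 2 * Real.log ((B - A) ^ 2 + 1)) := by
  rw [hγ.integral_deriv_mul_meanKernel hT he he0 h1 h12 h2 hs']
  refine (norm_add_le _ _).trans (add_le_add ?_ ?_)
  · refine intervalIntegral.norm_integral_le_of_norm_le_const fun s hs => ?_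
    rw [Set.uIoc_of_le h12] at hs
    exact hT.norm_meanKernel_sub_le ⟨h1.trans hs.1.le, hs.2.trans h2⟩ hs' he he0
  · rw [Complex.norm_real, Real.norm_eq_abs]
    have h3 : ∀ s, A ≤ s → s ≤ B → |s - s'| ≤ B - A := fun s h3 h4 =>
      abs_le.2 ⟨by linarith [hs'.2], by linarith [hs'.1]⟩
    have h4 := abs_half_log_le (sub_ne_zero.2 hn2.symm) (h3 s₂ (h1.trans h12) h2) he1
    have h5 := abs_half_log_le (sub_ne_zero.2 hn1.symm) (h3 s₁ h1 (h12.trans h2)) he1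
    have h6 := abs_sub (Real.log ((s₂ - s') ^ 2 + e ^ 2) / 2) (Real.log ((s₁ - s') ^ 2 + e ^ 2) / 2)
    linarith

end IsRegularPath

/-! ### The effective potential along the path. -/

/-- The mean of the boundary values of `∏ √((s - l i)(s - r i))` on the two sides of the line. -/
def meanWeight {ι : Type*} [Fintype ι] (l r : ι → ℝ) (s : ℝ) : ℂ :=
  1 / 2 * (∏ i, cutWeight 1 (l i) (r i) s + ∏ i, cutWeight (-1) (l i) (r i) s)

theorem continuous_meanWeight {ι : Type*} [Fintype ι] (l r : ι → ℝ) :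
    Continuous (meanWeight l r) := by
  have h : ∀ σ : ℝ, Continuous fun s => ∏ i, cutWeight σ (l i) (r i) s := fun σ =>
    continuous_finsetProd _ fun i _ => continuous_cutWeight _ _ _
  have h1 := h 1
  have h2 := h (-1)
  unfold meanWeight
  fun_prop

theorem meanWeight_of_notMem {ι : Type*} [Fintype ι] {l r : ι → ℝ} (hlr : ∀ i, l i ≤ r i) {s : ℝ}
    (hs : ∀ i, s ∉ Set.Ioo (l i) (r i)) :
    meanWeight l r s = ∏ i, cutWeight 1 (l i) (r i) s := by
  rw [meanWeight, Finset.prod_congr rfl fun i _ =>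
    cutWeight_of_notMem (σ := -1) (by norm_num) (hlr i) (hs i)]
  ring

/-- The boundary values on the two sides of a cut are opposite; this is the origin of the saddle
point equation. -/
theorem meanWeight_of_mem {ι : Type*} [Fintype ι] {l r : ι → ℝ}
    (hlr : ∀ i, l i ≤ r i) {s : ℝ} {i : ι} (hs : s ∈ Set.Icc (l i) (r i))
    (hne : ∀ j, j ≠ i → s ∉ Set.Ioo (l j) (r j)) : meanWeight l r s = 0 := by
  classical
  have h : ∏ j ∈ Finset.univ.erase i, cutWeight (-1) (l j) (r j) s
      = ∏ j ∈ Finset.univ.erase i, cutWeight 1 (l j) (r j) s :=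
    Finset.prod_congr rfl fun j hj => cutWeight_of_notMem (by norm_num) (hlr j)
      (hne j (Finset.ne_of_mem_erase hj))
  rw [meanWeight, ← Finset.mul_prod_erase _ _ (Finset.mem_univ i),
    ← Finset.mul_prod_erase _ _ (Finset.mem_univ i), h, cutWeight_of_mem _ hs,
    cutWeight_of_mem _ hs]
  push_cast
  ring

theorem intervalIntegrable_log_abs_sub (s a b : ℝ) :
    IntervalIntegrable (fun s' => Real.log |s - s'|) MeasureTheory.volume a b := by
  have h := (intervalIntegral.intervalIntegrable_log' (a := s - a) (b := s - b)).comp_sub_left s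
  simp only [sub_sub_cancel] at h
  simpa only [Real.log_abs] using h

theorem IsRegularPath.stronglyMeasurable_integral_meanKernel {γ : ℝ → ℂ} (hγ : IsRegularPath γ)
    (e s₁ s₂ : ℝ) : MeasureTheory.StronglyMeasurable fun s' =>
      ∫ s in Set.Ioc s₁ s₂, deriv γ s * meanKernel γ e s s' := by
  have h1 : Measurable fun p : ℝ × ℝ => deriv γ p.2 :=
    hγ.continuous_deriv.measurable.comp measurable_snd
  have h2 : Measurable fun p : ℝ × ℝ => meanKernel γ e p.2 p.1 :=
    Measurable.comp (g := fun p : ℝ × ℝ => meanKernel γ e p.1 p.2) (f := Prod.swap)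
      (measurable_meanKernel hγ.continuous hγ.continuous_deriv e) measurable_swap
  have h3 := (h1.mul h2).stronglyMeasurable
  exact MeasureTheory.StronglyMeasurable.integral_prod_right
    (f := fun s' s => deriv γ s * meanKernel γ e s s') h3

namespace MarkedCurve

variable {g : ℕ} (C : MarkedCurve g)

/-- The mean of the boundary values of `y₀` on the two sides of the path. -/
def meanBranch (s : ℝ) : ℂ :=
  meanWeight C.left C.right s * ∏ i, cutFactor C.path (C.left i) (C.right i) s

/-- The effective potential along the path. -/
def effPotential (s : ℝ) : ℂ :=
  2 * (∫ s' in (C.left 0)..C.lastMark, logKernel C.path s s' * C.mass s') - C.W.eval (C.path s)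

/-- The mean of the values of `y₀` at heights `e` and `-e` over the path. -/
def meanTube (e s : ℝ) : ℂ := 1 / 2 * (C.y0 (tube C.path s e) + C.y0 (tube C.path s (-e)))

variable {C} (hC : C.IsValid)

include hC

theorem left_zero_lt_lastMark : C.left 0 < C.lastMark :=
  (hC.left_lt_right 0).trans_le (right_le_lastMark hC 0)

theorem continuous_meanBranch : Continuous C.meanBranch := by
  have h1 := continuous_meanWeight C.left C.right
  have h3 : Continuous fun s => ∏ i, cutFactor C.path (C.left i) (C.right i) s :=
    continuous_finsetProd _ fun i _ => hC.isRegularPath.continuous_cutFactor _ _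
  unfold meanBranch
  fun_prop

theorem meanBranch_of_mem {i : Fin (g + 1)} {s : ℝ} (hs : s ∈ Set.Icc (C.left i) (C.right i)) :
    C.meanBranch s = 0 := by
  rw [meanBranch, meanWeight_of_mem (fun i => (hC.left_lt_right i).le) hs
    (fun j hj h => disjoint_cuts hC hj.symm hs (Set.Ioo_subset_Icc_self h)), zero_mul]

theorem y0_path_eq_meanBranch {s : ℝ} (hs : C.lastMark < s) : C.y0 (C.path s) = C.meanBranch s := by
  have h : ∀ i, s ∉ Set.Icc (C.left i) (C.right i) := fun i h => by
    linarith [h.2, right_le_lastMark hC i]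
  rw [y0_path hC hs, prodBranch, meanBranch, meanWeight_of_notMem
    (fun i => (hC.left_lt_right i).le) fun i h' => h i (Set.Ioo_subset_Icc_self h'),
    ← Finset.prod_mul_distrib]
  exact Finset.prod_congr rfl fun i _ =>
    hC.isRegularPath.cutBranch_path (hC.left_lt_right i) (h i)

theorem tendsto_meanTube {s : ℝ} (hl : ∀ i, s ≠ C.left i) (hr : ∀ i, s ≠ C.right i) :
    Tendsto (fun e => C.meanTube e s) (𝓝[>] 0) (𝓝 (C.meanBranch s)) := by
  have h1 := tendsto_y0_tube hC (σ := 1) (by norm_num) hl hr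
  have h2 := tendsto_y0_tube hC (σ := -1) (by norm_num) hl hr
  have h3 := (h1.add h2).const_mul (1 / 2)
  simp only [one_mul, neg_one_mul] at h3
  rw [meanBranch, meanWeight, mul_assoc, add_mul]
  exact h3

omit hC in
theorem ae_ne_marks : ∀ᵐ s : ℝ, (∀ i, s ≠ C.left i) ∧ ∀ i, s ≠ C.right i :=
  (MeasureTheory.ae_all_iff.2 fun _ => MeasureTheory.Measure.ae_ne _ _).and
    (MeasureTheory.ae_all_iff.2 fun _ => MeasureTheory.Measure.ae_ne _ _)

theorem continuousOn_meanTube {B c M e₀ e : ℝ} (hT : TubeBound C.path (C.left 0) B c M e₀)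
    (hB : C.lastMark < B) (he : |e| ≤ e₀) (he0 : e ≠ 0) :
    ContinuousOn (C.meanTube e) (Set.Icc (C.left 0) B) := by
  have h : ∀ e : ℝ, |e| ≤ e₀ → e ≠ 0 →
      ContinuousOn (fun s => C.y0 (tube C.path s e)) (Set.Icc (C.left 0) B) := by
    intro e he he0 s hs
    exact (ContinuousAt.comp (g := C.y0) (f := fun s => tube C.path s e) (differentiableAt_y0 hC
      (tube_notMem_cuts hC hT le_rfl hB.le hs he (Or.inr he0))).continuousAt
      (hC.isRegularPath.hasDerivAt_tube s e).continuousAt).continuousWithinAt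
  exact continuousOn_const.mul ((h e he he0).add (h (-e) (by rwa [abs_neg]) (neg_ne_zero.2 he0)))

/-- The bound is read off from y₀² = W'² + f, which is continuous, so nothing has to be known about
the branch near branch points. -/
theorem exists_norm_meanTube_le (A B e₀ : ℝ) :
    ∃ K, ∀ s ∈ Set.Icc A B, ∀ e : ℝ, |e| ≤ e₀ → ‖C.meanTube e s‖ ≤ K := by
  have hcont : Continuous fun p : ℝ × ℝ => C.ySq.eval (tube C.path p.1 p.2) :=
    C.ySq.continuous.comp (IsRegularPath.continuous_tube hC.isRegularPath.continuous
      hC.isRegularPath.continuous_deriv)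
  obtain ⟨K, hK⟩ := (isCompact_Icc.prod (isCompact_Icc (a := -e₀) (b := e₀))).exists_bound_of_continuousOn
    (s := Set.Icc A B ×ˢ Set.Icc (-e₀) e₀) hcont.continuousOn
  have h : ∀ s ∈ Set.Icc A B, ∀ e : ℝ, |e| ≤ e₀ → ‖C.y0 (tube C.path s e)‖ ≤ √K := by
    intro s hs e he
    have h1 := hK (s, e) ⟨hs, abs_le.1 he⟩
    rw [← y0_sq hC, norm_pow] at h1
    exact Real.le_sqrt_of_sq_le h1
  refine ⟨√K, fun s hs e he => ?_⟩
  have h1 := h s hs e he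
  have h2 := h s hs (-e) (by rwa [abs_neg])
  have h3 := norm_add_le (C.y0 (tube C.path s e)) (C.y0 (tube C.path s (-e)))
  rw [meanTube, norm_mul, show ‖(1 / 2 : ℂ)‖ = 1 / 2 by norm_num]
  linarith

/-- Dominated convergence; the pointwise limit is known except at the finitely many marks. -/
theorem tendsto_integral_mul_meanTube {B : ℝ} (hB : C.lastMark < B) {u : ℝ → ℂ}
    (hu : Continuous u) {s₁ s₂ : ℝ} (h1 : C.left 0 ≤ s₁) (h12 : s₁ ≤ s₂) (h2 : s₂ ≤ B) :
    Tendsto (fun e => ∫ s in s₁..s₂, u s * C.meanTube e s) (𝓝[>] 0)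
      (𝓝 (∫ s in s₁..s₂, u s * C.meanBranch s)) := by
  obtain ⟨c, M, e₀, hT⟩ := hC.isRegularPath.exists_tubeBound (C.left 0) B
  obtain ⟨K, hK⟩ := exists_norm_meanTube_le hC (C.left 0) B e₀
  have hsub : Set.Icc s₁ s₂ ⊆ Set.Icc (C.left 0) B := Set.Icc_subset_Icc h1 h2
  refine intervalIntegral.tendsto_integral_filter_of_dominated_convergence
    (fun s => ‖u s‖ * K) ?_ ?_ ((hu.norm.mul continuous_const).intervalIntegrable _ _) ?_
  · filter_upwards [Ioo_mem_nhdsGT hT.pos_height] with e he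
    rw [Set.uIoc_of_le h12]
    refine ContinuousOn.aestronglyMeasurable ?_ measurableSet_Ioc
    exact (hu.continuousOn.mul (continuousOn_meanTube hC hT hB
      (by rw [abs_of_pos he.1]; exact he.2.le) he.1.ne')).mono
      (Set.Ioc_subset_Icc_self.trans hsub)
  · filter_upwards [Ioo_mem_nhdsGT hT.pos_height] with e he
    refine MeasureTheory.ae_of_all _ fun s hs => ?_
    rw [Set.uIoc_of_le h12] at hs
    rw [norm_mul]
    exact mul_le_mul_of_nonneg_left (hK s (hsub (Set.Ioc_subset_Icc_self hs)) e
      (by rw [abs_of_pos he.1]; exact he.2.le)) (norm_nonneg _)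
  · filter_upwards [ae_ne_marks (C := C)] with s hs _
    exact (tendsto_meanTube hC hs.1 hs.2).const_mul _

theorem tendsto_integral_mul_meanDeriv {u : ℝ → ℂ} (hu : Continuous u) (s₁ s₂ : ℝ) :
    Tendsto (fun e : ℝ => ∫ s in s₁..s₂, u s * (1 / 2 *
      ((derivative C.W).eval (tube C.path s e) + (derivative C.W).eval (tube C.path s (-e)))))
      (𝓝[>] 0) (𝓝 (∫ s in s₁..s₂, u s * (derivative C.W).eval (C.path s))) := by
  have ht := IsRegularPath.continuous_tube hC.isRegularPath.continuous
    hC.isRegularPath.continuous_deriv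
  have hc : Continuous fun p : ℝ × ℝ => u p.2 * (1 / 2 *
      ((derivative C.W).eval (tube C.path p.2 p.1)
        + (derivative C.W).eval (tube C.path p.2 (-p.1)))) := by
    have h1 : Continuous fun p : ℝ × ℝ => tube C.path p.2 p.1 :=
      ht.comp (continuous_snd.prodMk continuous_fst)
    have h2 : Continuous fun p : ℝ × ℝ => tube C.path p.2 (-p.1) :=
      ht.comp (continuous_snd.prodMk continuous_fst.neg)
    have h3 := (derivative C.W).continuous.comp h1
    have h4 := (derivative C.W).continuous.comp h2
    exact (hu.comp continuous_snd).mul (continuous_const.mul (h3.add h4))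
  have h := (intervalIntegral.continuous_parametric_intervalIntegral_of_continuous'
    (f := fun e s : ℝ => u s * (1 / 2 * ((derivative C.W).eval (tube C.path s e)
        + (derivative C.W).eval (tube C.path s (-e))))) (μ := MeasureTheory.volume) hc s₁ s₂).tendsto 0
  have h0 : ∀ s, u s * (1 / 2 * ((derivative C.W).eval (tube C.path s 0)
        + (derivative C.W).eval (tube C.path s (-0)))) = u s * (derivative C.W).eval (C.path s) :=
    fun s => by
      rw [show tube C.path s 0 = C.path s by simp [tube],
        show tube C.path s (-0) = C.path s by simp [tube]]
      ring
  simp only [h0] at h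
  exact h.mono_left nhdsWithin_le_nhds

theorem meanTube_eq {B c M e₀ e : ℝ} (hT : TubeBound C.path (C.left 0) B c M e₀)
    (hB : C.lastMark < B) (he : |e| ≤ e₀) (he0 : e ≠ 0) {s : ℝ} (hs : s ∈ Set.Icc (C.left 0) B) :
    C.meanTube e s = 1 / 2 * ((derivative C.W).eval (tube C.path s e)
        + (derivative C.W).eval (tube C.path s (-e)))
      - 2 * ∫ s' in (C.left 0)..C.lastMark, meanKernel C.path e s s' * C.mass s' := by
  have he' : |-e| ≤ e₀ := by rwa [abs_neg]
  have hab := (left_zero_lt_lastMark hC).le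
  have hi : ∀ e : ℝ, |e| ≤ e₀ → e ≠ 0 → IntervalIntegrable
      (fun s' => C.mass s' / (tube C.path s e - C.path s')) MeasureTheory.volume
      (C.left 0) C.lastMark := fun e he he0 => by
    refine ContinuousOn.intervalIntegrable ?_
    rw [Set.uIcc_of_le hab]
    refine (continuous_mass hC).continuousOn.div
      (continuous_const.sub hC.isRegularPath.continuous).continuousOn fun s' hs' => ?_
    exact hT.tube_sub_ne_zero hs ⟨hs'.1, hs'.2.trans hB.le⟩ he (Or.inr he0)
  have h1 : ∫ s' in (C.left 0)..C.lastMark, meanKernel C.path e s s' * C.mass s'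
      = 1 / 2 * ((∫ s' in (C.left 0)..C.lastMark, C.mass s' / (tube C.path s e - C.path s'))
        + ∫ s' in (C.left 0)..C.lastMark, C.mass s' / (tube C.path s (-e) - C.path s')) := by
    rw [← intervalIntegral.integral_add (hi e he he0) (hi (-e) he' (neg_ne_zero.2 he0)),
      ← intervalIntegral.integral_const_mul]
    refine intervalIntegral.integral_congr fun s' _ => ?_
    simp only [meanKernel, div_eq_mul_inv]
    ring
  rw [meanTube, y0_tube_eq hC hT le_rfl hB hs he he0,
    y0_tube_eq hC hT le_rfl hB hs he' (neg_ne_zero.2 he0), h1]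
  ring

theorem integral_deriv_mul_derivW (s₁ s₂ : ℝ) :
    ∫ s in s₁..s₂, deriv C.path s * (derivative C.W).eval (C.path s)
      = C.W.eval (C.path s₂) - C.W.eval (C.path s₁) := by
  have hγ := hC.isRegularPath
  refine intervalIntegral.integral_eq_sub_of_hasDerivAt (f := fun s => C.W.eval (C.path s))
    (fun s _ => ?_) ?_
  · have := (C.W.hasDerivAt (C.path s)).scomp s (hγ.hasDerivAt s)
    simpa [Function.comp_def] using this
  · exact (hγ.continuous_deriv.mul ((derivative C.W).continuous.comp
      hγ.continuous)).intervalIntegrable _ _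

theorem intervalIntegrable_logKernel_mul (s a b : ℝ) {u : ℝ → ℂ} (hu : Continuous u) :
    IntervalIntegrable (fun s' => logKernel C.path s s' * u s') MeasureTheory.volume a b := by
  have hγ := hC.isRegularPath
  have h1 : IntervalIntegrable (fun s' => (Real.log |s - s'| : ℂ)) MeasureTheory.volume a b :=
    ⟨(intervalIntegrable_log_abs_sub s a b).1.ofReal, (intervalIntegrable_log_abs_sub s a b).2.ofReal⟩
  have h2 : IntervalIntegrable (fun s' => pathLog C.path s s') MeasureTheory.volume a b :=
    (hγ.continuous_pathLog_right s).intervalIntegrable _ _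
  exact (h1.add h2).mul_continuousOn hu.continuousOn

/-- Dominated convergence in s', where the two points s₁ and s₂ at which the majorant is not
available form a null set. -/
theorem tendsto_integral_meanKernel_mul_mass {B c M e₀ : ℝ}
    (hT : TubeBound C.path (C.left 0) B c M e₀) (hB : C.lastMark < B) {s₁ s₂ : ℝ}
    (h1 : C.left 0 ≤ s₁) (h12 : s₁ ≤ s₂) (h2 : s₂ ≤ B) :
    Tendsto (fun e : ℝ => ∫ s' in (C.left 0)..C.lastMark,
      (∫ s in s₁..s₂, deriv C.path s * meanKernel C.path e s s') * C.mass s') (𝓝[>] 0)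
      (𝓝 (∫ s' in (C.left 0)..C.lastMark,
        (logKernel C.path s₂ s' - logKernel C.path s₁ s') * C.mass s')) := by
  have hγ := hC.isRegularPath
  have hab := (left_zero_lt_lastMark hC).le
  have hpos : 0 < min e₀ 1 := lt_min hT.pos_height one_pos
  have hmem : ∀ s' ∈ Set.uIoc (C.left 0) C.lastMark, s' ∈ Set.Icc (C.left 0) B := fun s' hs' => by
    rw [Set.uIoc_of_le hab] at hs'
    exact ⟨hs'.1.le, hs'.2.trans hB.le⟩
  refine intervalIntegral.tendsto_integral_filter_of_dominated_convergence
    (fun s' => (2 * M * c⁻¹ * |s₂ - s₁| + (|(Real.log |s₂ - s'|)| + |(Real.log |s₁ - s'|)|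
      + 2 * Real.log ((B - C.left 0) ^ 2 + 1))) * ‖C.mass s'‖) ?_ ?_ ?_ ?_
  · refine Eventually.of_forall fun e => ?_
    have h3 := (hγ.stronglyMeasurable_integral_meanKernel e s₁ s₂).mul
      (continuous_mass hC).stronglyMeasurable
    have h5 := h3.aestronglyMeasurable
      (μ := MeasureTheory.volume.restrict (Set.uIoc (C.left 0) C.lastMark))
    simp only [intervalIntegral.integral_of_le h12]
    exact h5
  · filter_upwards [Ioo_mem_nhdsGT hpos] with e he
    have he1 : |e| ≤ e₀ := by rw [abs_of_pos he.1]; exact he.2.le.trans (min_le_left _ _)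
    have he2 : |e| ≤ 1 := by rw [abs_of_pos he.1]; exact he.2.le.trans (min_le_right _ _)
    filter_upwards [MeasureTheory.Measure.ae_ne MeasureTheory.volume s₁,
      MeasureTheory.Measure.ae_ne MeasureTheory.volume s₂] with s' hn1 hn2 hs'
    rw [norm_mul]
    exact mul_le_mul_of_nonneg_right (hγ.norm_integral_deriv_mul_meanKernel_le hT he1 he2
      he.1.ne' h1 h12 h2 (hmem s' hs') hn1 hn2) (norm_nonneg _)
  · refine IntervalIntegrable.mul_continuousOn ?_ (continuous_mass hC).norm.continuousOn
    have h3 := (intervalIntegrable_log_abs_sub s₂ (C.left 0) C.lastMark).abs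
    have h4 := (intervalIntegrable_log_abs_sub s₁ (C.left 0) C.lastMark).abs
    exact (intervalIntegrable_const).add ((h3.add h4).add intervalIntegrable_const)
  · filter_upwards [MeasureTheory.Measure.ae_ne MeasureTheory.volume s₁,
      MeasureTheory.Measure.ae_ne MeasureTheory.volume s₂] with s' hn1 hn2 hs'
    exact (hγ.tendsto_integral_deriv_mul_meanKernel hT h1 h12 h2 (hmem s' hs') hn1
      hn2).mul_const _

/-- The derivative of the effective potential along the path is the mean boundary value. -/
theorem effPotential_sub {s₁ s₂ : ℝ} (h1 : C.left 0 ≤ s₁) (h12 : s₁ ≤ s₂) :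
    C.effPotential s₂ - C.effPotential s₁ = -∫ s in s₁..s₂, deriv C.path s * C.meanBranch s := by
  have hγ := hC.isRegularPath
  have hab := (left_zero_lt_lastMark hC).le
  set B := max s₂ (C.lastMark + 1) with hBdef
  have hB : C.lastMark < B := (lt_add_one _).trans_le (le_max_right _ _)
  have h2 : s₂ ≤ B := le_max_left _ _
  obtain ⟨c, M, e₀, hT⟩ := hγ.exists_tubeBound (C.left 0) B
  have hI := tendsto_integral_mul_meanTube hC hB hγ.continuous_deriv h1 h12 h2
  have hJ := tendsto_integral_mul_meanDeriv hC hγ.continuous_deriv s₁ s₂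
  rw [integral_deriv_mul_derivW hC] at hJ
  have hmem : ∀ s' ∈ Set.uIoc (C.left 0) C.lastMark, s' ∈ Set.Icc (C.left 0) B := fun s' hs' => by
    rw [Set.uIoc_of_le hab] at hs'
    exact ⟨hs'.1.le, hs'.2.trans hB.le⟩
  have hN := tendsto_integral_meanKernel_mul_mass hC hT hB h1 h12 h2
  -- At positive height the kernel is continuous, so the Cauchy representation of the mean of y₀ may
  -- be integrated against γ' with the order of integration exchanged. The limits of the three terms
  -- are `hJ`, `hN` and `hI`.
  have hkey : ∀ᶠ e : ℝ in 𝓝[>] 0, (∫ s in s₁..s₂, deriv C.path s * (1 / 2 *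
      ((derivative C.W).eval (tube C.path s e) + (derivative C.W).eval (tube C.path s (-e)))))
      - 2 * (∫ s' in (C.left 0)..C.lastMark,
        (∫ s in s₁..s₂, deriv C.path s * meanKernel C.path e s s') * C.mass s')
      = ∫ s in s₁..s₂, deriv C.path s * C.meanTube e s := by
    filter_upwards [Ioo_mem_nhdsGT hT.pos_height] with e he
    have he1 : |e| ≤ e₀ := by rw [abs_of_pos he.1]; exact he.2.le
    have hsub : Set.Icc s₁ s₂ ⊆ Set.Icc (C.left 0) B := Set.Icc_subset_Icc h1 h2
    have hsub' : Set.Icc (C.left 0) C.lastMark ⊆ Set.Icc (C.left 0) B :=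
      Set.Icc_subset_Icc le_rfl hB.le
    have hck : ContinuousOn (Function.uncurry fun s s' => deriv C.path s
        * meanKernel C.path e s s' * C.mass s')
        (Set.Icc s₁ s₂ ×ˢ Set.Icc (C.left 0) C.lastMark) :=
      ((hγ.continuous_deriv.comp continuous_fst).continuousOn.mul
        ((continuousOn_meanKernel hγ.continuous hγ.continuous_deriv hT he1 he.1.ne').mono
          (Set.prod_mono hsub hsub'))).mul ((continuous_mass hC).comp continuous_snd).continuousOn
    have hswap := intervalIntegral_swap_of_continuousOn h12 hab hck
    have hW : Continuous fun s => deriv C.path s * (1 / 2 *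
        ((derivative C.W).eval (tube C.path s e) + (derivative C.W).eval (tube C.path s (-e)))) := by
      have h3 : ∀ e : ℝ, Continuous fun s => (derivative C.W).eval (tube C.path s e) := fun e =>
        (derivative C.W).continuous.comp (IsRegularPath.continuous_tube hγ.continuous
          hγ.continuous_deriv |>.comp (continuous_id.prodMk continuous_const))
      exact hγ.continuous_deriv.mul (continuous_const.mul ((h3 e).add (h3 (-e))))
    have hI1 : IntervalIntegrable (fun s => deriv C.path s * C.meanTube e s)
        MeasureTheory.volume s₁ s₂ := by
      refine ContinuousOn.intervalIntegrable ?_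
      rw [Set.uIcc_of_le h12]
      exact hγ.continuous_deriv.continuousOn.mul
        ((continuousOn_meanTube hC hT hB he1 he.1.ne').mono hsub)
    have hI2 := hW.intervalIntegrable (μ := MeasureTheory.volume) s₁ s₂
    have h4 : (∫ s in s₁..s₂, deriv C.path s * (1 / 2 *
        ((derivative C.W).eval (tube C.path s e) + (derivative C.W).eval (tube C.path s (-e)))))
        - (∫ s in s₁..s₂, deriv C.path s * C.meanTube e s)
        = 2 * ∫ s in s₁..s₂, ∫ s' in (C.left 0)..C.lastMark,
          deriv C.path s * meanKernel C.path e s s' * C.mass s' := by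
      rw [← intervalIntegral.integral_sub hI2 hI1, ← intervalIntegral.integral_const_mul]
      refine intervalIntegral.integral_congr fun s hs => ?_
      rw [Set.uIcc_of_le h12] at hs
      rw [meanTube_eq hC hT hB he1 he.1.ne' (hsub hs)]
      simp only [mul_assoc]
      rw [intervalIntegral.integral_const_mul]
      ring
    have h5 : ∀ s', (∫ s in s₁..s₂, deriv C.path s * meanKernel C.path e s s') * C.mass s'
        = ∫ s in s₁..s₂, deriv C.path s * meanKernel C.path e s s' * C.mass s' := fun s' =>
      (intervalIntegral.integral_mul_const _ _).symm
    simp only [h5]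
    rw [← hswap]
    linear_combination h4
  have hfin := tendsto_nhds_unique ((hJ.sub (hN.const_mul 2)).congr' hkey) hI
  rw [← hfin, effPotential, effPotential]
  have h6 : ∫ s' in (C.left 0)..C.lastMark,
        (logKernel C.path s₂ s' - logKernel C.path s₁ s') * C.mass s'
      = (∫ s' in (C.left 0)..C.lastMark, logKernel C.path s₂ s' * C.mass s')
        - ∫ s' in (C.left 0)..C.lastMark, logKernel C.path s₁ s' * C.mass s' := by
    rw [← intervalIntegral.integral_sub
      (intervalIntegrable_logKernel_mul hC _ _ _ (continuous_mass hC))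
      (intervalIntegrable_logKernel_mul hC _ _ _ (continuous_mass hC))]
    simp only [sub_mul]
  rw [h6]
  ring

/-- The saddle point equation: the derivative of the effective potential is a multiple of the mean
boundary value of y₀, and this vanishes on the cut. -/
theorem effPotential_of_mem {i : Fin (g + 1)} {s : ℝ} (hs : s ∈ Set.Icc (C.left i) (C.right i)) :
    C.effPotential s = C.effPotential (C.right i) := by
  have h := effPotential_sub hC ((left_zero_le hC i).trans hs.1) hs.2
  have h0 : ∫ s in s..C.right i, deriv C.path s * C.meanBranch s = 0 := by
    rw [intervalIntegral.integral_congr (g := fun _ => 0) fun u hu => ?_]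
    · simp
    · rw [Set.uIcc_of_le hs.2] at hu
      simp only
      rw [meanBranch_of_mem hC ⟨hs.1.trans hu.1, hu.2⟩, mul_zero]
  rw [h0, neg_zero] at h
  exact (sub_eq_zero.1 h).symm

end MarkedCurve

/-! ### Asymptotics far out on the path. -/

theorem IsRegularPath.exp_logKernel {γ : ℝ → ℂ} (hγ : IsRegularPath γ) {s s' : ℝ} (h : s' < s) :
    Complex.exp (logKernel γ s s') = γ s - γ s' := by
  have h1 : 0 < |s - s'| := abs_pos.2 (sub_ne_zero.2 h.ne')
  rw [logKernel, Complex.exp_add, hγ.exp_pathLog, ← Complex.ofReal_exp, Real.exp_log h1,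
    ← hγ.divDiff_mul, abs_of_pos (sub_pos.2 h)]
  push_cast
  ring

/-- The logarithmic kernel far out on the path. -/
theorem IsRegularPath.logKernel_eq_log_add {γ : ℝ → ℂ} (hγ : IsRegularPath γ) {s₀ s' : ℝ}
    (hs₀ : ∀ s, s₀ ≤ s → γ s = s) {L : ℝ} (h0 : 0 < L) (hL : s₀ ≤ L) (hs' : s' < L)
    (hsmall : 2 * ‖γ s'‖ ≤ L) :
    logKernel γ L s' = Real.log L + Complex.log (1 + -(γ s' / L)) := by
  have hnorm : ∀ s, L ≤ s → ‖-(γ s' / (s : ℂ))‖ ≤ 1 / 2 := fun s hs => by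
    have hs0 : 0 < s := h0.trans_le hs
    rw [norm_neg, norm_div, Complex.norm_real, Real.norm_of_nonneg hs0.le, div_le_iff₀ hs0]
    linarith
  have hslit : ∀ s, L ≤ s → 1 + -(γ s' / (s : ℂ)) ∈ Complex.slitPlane := fun s hs =>
    Complex.mem_slitPlane_of_norm_lt_one ((hnorm s hs).trans_lt (by norm_num))
  set f : ℝ → ℂ := fun s => logKernel γ s s' - Real.log s - Complex.log (1 + -(γ s' / s)) with hf
  have hne : ∀ s, L ≤ s → (s : ℂ) ≠ 0 := fun s hs => by exact_mod_cast (h0.trans_le hs).ne'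
  have hcont : ContinuousOn f (Set.Ici L) := by
    intro s hs
    have hs0 : s ≠ 0 := (h0.trans_le hs).ne'
    have h1 : |s - s'| ≠ 0 := abs_ne_zero.2 (sub_ne_zero.2 (hs'.trans_le hs).ne')
    have h2 : ContinuousAt (fun s : ℝ => -(γ s' / (s : ℂ))) s :=
      (continuousAt_const.div Complex.continuous_ofReal.continuousAt (hne s hs)).neg
    have h3 : ContinuousAt (fun s : ℝ => Complex.log (1 + -(γ s' / s))) s :=
      (continuousAt_const.add h2).clog (hslit s hs)
    have h4 : ContinuousAt (fun s : ℝ => ((Real.log |s - s'| : ℝ) : ℂ)) s :=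
      Complex.continuous_ofReal.continuousAt.comp
        (ContinuousAt.log (f := fun s => |s - s'|) (by fun_prop) h1)
    have h5 : ContinuousAt (fun s : ℝ => ((Real.log s : ℝ) : ℂ)) s :=
      Complex.continuous_ofReal.continuousAt.comp (Real.continuousAt_log hs0)
    exact (((h4.add (hγ.continuous_pathLog_left s').continuousAt).sub h5).sub
      h3).continuousWithinAt
  have hexp : ∀ s ∈ Set.Ici L, Complex.exp (f s) = 1 := fun s hs => by
    have hs0 : 0 < s := h0.trans_le hs
    have h1 : (1 : ℂ) + -(γ s' / s) ≠ 0 := Complex.slitPlane_ne_zero (hslit s hs)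
    rw [hf, Complex.exp_sub, Complex.exp_sub, hγ.exp_logKernel (hs'.trans_le hs),
      Complex.exp_log h1, ← Complex.ofReal_exp, Real.exp_log hs0, hs₀ s (hL.trans hs),
      div_div, div_eq_one_iff_eq (mul_ne_zero (hne s hs) h1)]
    have := hne s hs
    field_simp
    ring
  have hlim : Tendsto f atTop (𝓝 0) := by
    have h1 : Tendsto (fun s : ℝ => ((Real.log s - Real.log (s - s') : ℝ) : ℂ)) atTop (𝓝 (0 : ℝ)) :=
      (Complex.continuous_ofReal.tendsto _).comp (Real.tendsto_log_sub_log_sub s')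
    have h2 : Tendsto (fun s : ℝ => 1 + -(γ s' / (s : ℂ))) atTop (𝓝 (1 + -(γ s' * 0))) := by
      have h3 : Tendsto (fun s : ℝ => (s : ℂ)⁻¹) atTop (𝓝 0) := tendsto_inv_cocompact.comp
        ((Complex.isometry_ofReal.isClosedEmbedding.tendsto_cocompact).mono_left atTop_le_cocompact)
      simpa only [div_eq_mul_inv] using ((h3.const_mul (γ s')).neg).const_add 1
    simp only [mul_zero, neg_zero, add_zero] at h2
    have h4 := h2.clog (by simp)
    rw [Complex.log_one] at h4
    have h5 := ((hγ.tendsto_pathLog s').sub h1).sub h4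
    simp only [Complex.ofReal_zero, sub_zero] at h5
    refine h5.congr' ?_
    filter_upwards [eventually_gt_atTop s'] with s hs
    simp only [hf, logKernel, abs_of_pos (sub_pos.2 hs)]
    push_cast
    ring
  -- On the ray both sides are logarithms of γ(s) - γ(s'), so their difference is constant, and the
  -- limit at infinity shows that it is 0.
  have hconst : ∀ s ∈ Set.Ici L, f L = f s := fun s hs =>
    isPreconnected_Ici.eq_of_exp_eq_one hcont hexp (Set.mem_Ici.2 le_rfl) hs
  have h0 : f L = 0 := tendsto_nhds_unique (tendsto_const_nhds.congr' (by
    filter_upwards [eventually_ge_atTop L] with s hs using hconst s hs)) hlim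
  linear_combination h0

theorem double_integral_add {f h : ℝ → ℝ → ℂ} {a b : ℝ} (hab : a ≤ b)
    (hf : ContinuousOn (fun p : ℝ × ℝ => f p.1 p.2) (Set.Icc a b ×ˢ Set.Icc a b))
    (hh : ContinuousOn (fun p : ℝ × ℝ => h p.1 p.2) (Set.Icc a b ×ˢ Set.Icc a b)) :
    ∫ s in a..b, ∫ s' in a..b, (f s s' + h s s')
      = (∫ s in a..b, ∫ s' in a..b, f s s') + ∫ s in a..b, ∫ s' in a..b, h s s' := by
  have i1 : ∀ {f : ℝ → ℝ → ℂ}, ContinuousOn (fun p : ℝ × ℝ => f p.1 p.2)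
      (Set.Icc a b ×ˢ Set.Icc a b) → ∀ s ∈ Set.Icc a b,
      IntervalIntegrable (f s) MeasureTheory.volume a b := by
    intro f hf s hs
    refine ContinuousOn.intervalIntegrable ?_
    rw [Set.uIcc_of_le hab]
    exact hf.comp (f := fun s' => (s, s')) (by fun_prop) fun s' hs' => ⟨hs, hs'⟩
  have i2 : ∀ {f : ℝ → ℝ → ℂ}, ContinuousOn (fun p : ℝ × ℝ => f p.1 p.2)
      (Set.Icc a b ×ˢ Set.Icc a b) → IntervalIntegrable
      (fun s => ∫ s' in a..b, f s s') MeasureTheory.volume a b := by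
    intro f hf
    have h1 : MeasureTheory.IntegrableOn (fun p : ℝ × ℝ => f p.1 p.2) (Set.Ioc a b ×ˢ Set.Ioc a b)
        (MeasureTheory.volume.prod MeasureTheory.volume) :=
      (hf.integrableOn_compact (isCompact_Icc.prod isCompact_Icc)).mono_set
        (Set.prod_mono Set.Ioc_subset_Icc_self Set.Ioc_subset_Icc_self)
    rw [MeasureTheory.IntegrableOn, ← MeasureTheory.Measure.prod_restrict] at h1
    rw [intervalIntegrable_iff_integrableOn_Ioc_of_le hab]
    simp only [intervalIntegral.integral_of_le hab]
    exact h1.integral_prod_left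
  rw [← intervalIntegral.integral_add (i2 hf) (i2 hh)]
  refine intervalIntegral.integral_congr fun s hs => ?_
  rw [Set.uIcc_of_le hab] at hs
  exact intervalIntegral.integral_add (i1 hf s hs) (i1 hh s hs)

namespace MarkedCurve

variable {g : ℕ} {C : MarkedCurve g} (hC : C.IsValid)

include hC

/-- The total mass t gives the coefficient of log L. What remains under the integral is log(1 -
γ(s')/L), of norm at most (3/2)|γ(s')|/L. -/
theorem exists_norm_effPotential_add_le : ∃ K L₁ : ℝ, 0 < L₁ ∧ ∀ L, L₁ ≤ L →
    C.path L = L ∧ C.lastMark < L ∧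
    ‖C.effPotential L - (2 * C.t * Real.log L - C.W.eval (L : ℂ))‖ ≤ K / L := by
  have hγ := hC.isRegularPath
  have hab := (left_zero_lt_lastMark hC).le
  obtain ⟨s₀, hs₀, htail⟩ := hγ.exists_tail
  obtain ⟨M, hM⟩ := isCompact_Icc.exists_bound_of_continuousOn (s := Set.Icc (C.left 0) C.lastMark)
    hγ.continuous.continuousOn
  obtain ⟨N, hN⟩ := isCompact_Icc.exists_bound_of_continuousOn (s := Set.Icc (C.left 0) C.lastMark)
    (continuous_mass hC).continuousOn
  have hN0 : 0 ≤ N := (norm_nonneg _).trans (hN (C.left 0) ⟨le_rfl, hab⟩)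
  refine ⟨2 * (3 / 2 * M * N * |C.lastMark - C.left 0|),
    max s₀ (max (C.lastMark + 1) (2 * M)), by positivity, fun L hL => ?_⟩
  have hL1 : s₀ ≤ L := (le_max_left _ _).trans hL
  have hL2 : C.lastMark + 1 ≤ L := (le_max_left _ _).trans ((le_max_right _ _).trans hL)
  have hL3 : 2 * M ≤ L := (le_max_right _ _).trans ((le_max_right _ _).trans hL)
  have hL0 : 0 < L := hs₀.trans_le hL1
  refine ⟨htail L hL1, by linarith, ?_⟩
  have hIoc : Set.uIoc (C.left 0) C.lastMark ⊆ Set.Icc (C.left 0) C.lastMark := by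
    rw [Set.uIoc_of_le hab]; exact Set.Ioc_subset_Icc_self
  have h1 : C.effPotential L - (2 * C.t * Real.log L - C.W.eval (L : ℂ))
      = 2 * ∫ s' in (C.left 0)..C.lastMark, (logKernel C.path L s' - Real.log L) * C.mass s' := by
    have h2 : (∫ s' in (C.left 0)..C.lastMark, (logKernel C.path L s' - Real.log L) * C.mass s')
        = (∫ s' in (C.left 0)..C.lastMark, logKernel C.path L s' * C.mass s')
          - Real.log L * ∫ s' in (C.left 0)..C.lastMark, C.mass s' := by
      have hi : IntervalIntegrable (fun s' => (Real.log L : ℂ) * C.mass s') MeasureTheory.volume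
          (C.left 0) C.lastMark :=
        (continuous_const.mul (continuous_mass hC)).intervalIntegrable _ _
      rw [← intervalIntegral.integral_const_mul, ← intervalIntegral.integral_sub
        (intervalIntegrable_logKernel_mul hC _ _ _ (continuous_mass hC)) hi]
      simp only [sub_mul]
    rw [h2, integral_mass hC, effPotential, htail L hL1]
    ring
  rw [h1, norm_mul, Complex.norm_ofNat, mul_div_assoc]
  refine mul_le_mul_of_nonneg_left ?_ zero_le_two
  rw [mul_div_right_comm]
  refine intervalIntegral.norm_integral_le_of_norm_le_const fun s' hs' => ?_
  have hs := hIoc hs'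
  have h3 := hM s' hs
  rw [hγ.logKernel_eq_log_add htail hL0 hL1 (by linarith [hs.2]) (by linarith), add_sub_cancel_left,
    norm_mul, mul_div_right_comm]
  refine mul_le_mul ?_ (hN s' hs) (norm_nonneg _) ?_
  · have h4 : ‖-(C.path s' / (L : ℂ))‖ ≤ M / L := by
      rw [norm_neg, norm_div, Complex.norm_real, Real.norm_of_nonneg hL0.le]
      exact div_le_div_of_nonneg_right h3 hL0.le
    have h5 : M / L ≤ 1 / 2 := by rw [div_le_iff₀ hL0]; linarith
    refine (Complex.norm_log_one_add_half_le_self (h4.trans h5)).trans ?_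
    rw [mul_div_assoc]
    linarith
  · have : 0 ≤ M := (norm_nonneg _).trans h3
    positivity

/-- The asymptotics of the integral of `y₀` along the path. -/
theorem exists_norm_integral_y0_sub_le : ∃ K L₁ : ℝ, 0 < L₁ ∧ ∀ L, L₁ ≤ L →
    C.path L = L ∧ C.lastMark < L ∧
    ‖(∫ s in C.lastMark..L, deriv C.path s * C.y0 (C.path s))
      - (C.effPotential C.lastMark - 2 * C.t * Real.log L + C.W.eval (L : ℂ))‖ ≤ K / L := by
  obtain ⟨K, L₁, hL₁, h⟩ := exists_norm_effPotential_add_le hC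
  refine ⟨K, L₁, hL₁, fun L hL => ?_⟩
  obtain ⟨h1, h2, h3⟩ := h L hL
  refine ⟨h1, h2, ?_⟩
  have h4 := effPotential_sub hC (left_zero_lt_lastMark hC).le h2.le
  have h5 : ∫ s in C.lastMark..L, deriv C.path s * C.meanBranch s
      = ∫ s in C.lastMark..L, deriv C.path s * C.y0 (C.path s) := by
    refine intervalIntegral.integral_congr_ae (MeasureTheory.ae_of_all _ fun s hs => ?_)
    rw [Set.uIoc_of_le h2.le] at hs
    rw [y0_path_eq_meanBranch hC hs.1]
  rw [h5] at h4
  rw [← norm_neg]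
  refine le_of_eq_of_le (congrArg norm ?_) h3
  linear_combination -h4

/-! ### The loop equation. -/

theorem mass_mul_meanBranch (s : ℝ) : C.mass s * C.meanBranch s = 0 := by
  by_cases h : ∃ i, s ∈ Set.Icc (C.left i) (C.right i)
  · obtain ⟨i, hi⟩ := h
    rw [meanBranch_of_mem hC hi, mul_zero]
  · push Not at h
    rw [mass_eq_zero hC fun i hi => h i (Set.Ioo_subset_Icc_self hi), zero_mul]

/-- The loop equation: the infinitesimal form of the invariance of the interaction and the potential
under reparametrisations of the `x`-plane. -/
theorem integral_integral_divDiff_mul_mass {δ : ℝ → ℂ} (hδ : Continuous δ) {Λ : ℝ}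
    (hlip : ∀ s ∈ Set.Icc (C.left 0) C.lastMark, ∀ s' ∈ Set.Icc (C.left 0) C.lastMark,
      ‖δ s - δ s'‖ ≤ Λ * |s - s'|) :
    ∫ s in (C.left 0)..C.lastMark, ∫ s' in (C.left 0)..C.lastMark,
        (δ s - δ s') / (C.path s - C.path s') * C.mass s * C.mass s'
      = ∫ s in (C.left 0)..C.lastMark, δ s * C.mass s * (derivative C.W).eval (C.path s) := by
  have hγ := hC.isRegularPath
  have hab := (left_zero_lt_lastMark hC).le
  have hm := continuous_mass hC
  have hB : C.lastMark < C.lastMark + 1 := lt_add_one _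
  obtain ⟨c, M, e₀, hT⟩ := hγ.exists_tubeBound (C.left 0) (C.lastMark + 1)
  have hsub : Set.Icc (C.left 0) C.lastMark ⊆ Set.Icc (C.left 0) (C.lastMark + 1) :=
    Set.Icc_subset_Icc le_rfl hB.le
  obtain ⟨D, hD⟩ := isCompact_Icc.exists_bound_of_continuousOn (s := Set.Icc (C.left 0) C.lastMark)
    hδ.continuousOn
  obtain ⟨N, hN⟩ := isCompact_Icc.exists_bound_of_continuousOn (s := Set.Icc (C.left 0) C.lastMark)
    hm.continuousOn
  have hN0 : 0 ≤ N := (norm_nonneg _).trans (hN (C.left 0) ⟨le_rfl, hab⟩)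
  have hD0 : 0 ≤ D := (norm_nonneg _).trans (hD (C.left 0) ⟨le_rfl, hab⟩)
  have hc := hT.pos
  -- The mean of y₀ is tested against δ·m. The limit is 0, since the mass lives on the cuts and the
  -- mean boundary value off them.
  have hI := tendsto_integral_mul_meanTube hC hB (u := fun s => δ s * C.mass s) (hδ.mul hm) le_rfl hab hB.le
  have hI0 : ∫ s in (C.left 0)..C.lastMark, δ s * C.mass s * C.meanBranch s = 0 := by
    simp [mul_assoc, mass_mul_meanBranch hC]
  rw [hI0] at hI
  have hJ := tendsto_integral_mul_meanDeriv hC (u := fun s => δ s * C.mass s) (hδ.mul hm) (C.left 0) C.lastMark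
  have hmk := fun e => measurable_meanKernel hγ.continuous hγ.continuous_deriv e
  have hmk' : ∀ e, Measurable fun p : ℝ × ℝ => meanKernel C.path e p.2 p.1 := fun e =>
    Measurable.comp (g := fun p : ℝ × ℝ => meanKernel C.path e p.1 p.2) (f := Prod.swap)
      (hmk e) measurable_swap
  have hm1 : Measurable fun p : ℝ × ℝ => C.mass p.1 := hm.measurable.comp measurable_fst
  have hm2 : Measurable fun p : ℝ × ℝ => C.mass p.2 := hm.measurable.comp measurable_snd
  have hδ1 : Measurable fun p : ℝ × ℝ => δ p.1 := hδ.measurable.comp measurable_fst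
  have hδ2 : Measurable fun p : ℝ × ℝ => δ p.2 := hδ.measurable.comp measurable_snd
  -- The symmetrised integrand is written as (δ(s) - δ(s')) K(s,s') + δ(s') (K(s,s') + K(s',s)). The
  -- first term is bounded because δ is Lipschitz, the second because K is antisymmetric up to a
  -- bounded error.
  have hlim := tendsto_double_integral (a := C.left 0) (b := C.lastMark)
    (f := fun e s s' => (δ s * meanKernel C.path e s s' + δ s' * meanKernel C.path e s' s)
      * C.mass s * C.mass s')
    (F := fun s s' => (δ s - δ s') / (C.path s - C.path s') * C.mass s * C.mass s')
    (K := (Λ * c⁻¹ + D * (5 * M * c⁻¹ * c⁻¹)) * N * N) hab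
    (fun e => (((hδ1.mul (hmk e)).add (hδ2.mul (hmk' e))).mul hm1).mul hm2)
    (by
      filter_upwards [Ioo_mem_nhdsGT hT.pos_height] with e he s hs s' hs'
      have he1 : |e| ≤ e₀ := by rw [abs_of_pos he.1]; exact he.2.le
      have h1 : ‖(δ s - δ s') * meanKernel C.path e s s'‖ ≤ Λ * c⁻¹ := by
        have h2 := hT.norm_meanKernel_le (hsub hs) (hsub hs') he1
        have h3 := hlip s hs s' hs'
        rw [norm_mul]
        refine (mul_le_mul h3 h2 (norm_nonneg _) ((norm_nonneg _).trans h3)).trans ?_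
        have h4 : 0 < |s - s'| + |e| := by
          have := abs_pos.2 he.1.ne'
          positivity
        have h5 : Λ * |s - s'| * (c⁻¹ * (|s - s'| + |e|)⁻¹)
            = (Λ * |s - s'|) * c⁻¹ / (|s - s'| + |e|) := by ring
        rw [h5, div_le_iff₀ h4]
        have h6 : 0 ≤ Λ := by
          have h7 := hlip (C.left 0) ⟨le_rfl, hab⟩ C.lastMark ⟨hab, le_rfl⟩
          have h8 : 0 < |C.left 0 - C.lastMark| :=
            abs_pos.2 (sub_ne_zero.2 (left_zero_lt_lastMark hC).ne)
          exact nonneg_of_mul_nonneg_left ((norm_nonneg _).trans h7) h8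
        have h9 : 0 ≤ Λ * c⁻¹ * |e| := by positivity
        linarith
      have h2 : ‖δ s' * (meanKernel C.path e s s' + meanKernel C.path e s' s)‖
          ≤ D * (5 * M * c⁻¹ * c⁻¹) := by
        rw [norm_mul]
        exact mul_le_mul (hD s' hs')
          (hT.norm_meanKernel_add_swap_le (hsub hs) (hsub hs') he1 he.1.ne') (norm_nonneg _) hD0
      have h3 : δ s * meanKernel C.path e s s' + δ s' * meanKernel C.path e s' s
          = (δ s - δ s') * meanKernel C.path e s s'
            + δ s' * (meanKernel C.path e s s' + meanKernel C.path e s' s) := by ring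
      rw [norm_mul, norm_mul, h3]
      have h4 := (norm_add_le _ _).trans (add_le_add h1 h2)
      exact mul_le_mul (mul_le_mul h4 (hN s hs) (norm_nonneg _) ((norm_nonneg _).trans h4))
        (hN s' hs') (norm_nonneg _) (mul_nonneg ((norm_nonneg _).trans h4) hN0))
    (fun s hs s' hs' hne => by
      have h1 := tendsto_meanKernel (hγ.injective.ne hne)
      have h2 := tendsto_meanKernel (hγ.injective.ne hne.symm)
      have h3 := (((h1.const_mul (δ s)).add (h2.const_mul (δ s'))).mul_const
        (C.mass s)).mul_const (C.mass s')
      have h4 : δ s * (C.path s - C.path s')⁻¹ + δ s' * (C.path s' - C.path s)⁻¹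
          = (δ s - δ s') / (C.path s - C.path s') := by
        rw [← neg_sub (C.path s) (C.path s'), inv_neg]
        ring
      rwa [h4] at h3)
  -- The factor 2 in front of the Cauchy integral is used up by the symmetrisation of the double
  -- integral.
  have hkey : ∀ᶠ e : ℝ in 𝓝[>] 0, (∫ s in (C.left 0)..C.lastMark, δ s * C.mass s * (1 / 2 *
      ((derivative C.W).eval (tube C.path s e) + (derivative C.W).eval (tube C.path s (-e)))))
      - (∫ s in (C.left 0)..C.lastMark, δ s * C.mass s * C.meanTube e s)
      = ∫ s in (C.left 0)..C.lastMark, ∫ s' in (C.left 0)..C.lastMark,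
        (δ s * meanKernel C.path e s s' + δ s' * meanKernel C.path e s' s)
          * C.mass s * C.mass s' := by
    filter_upwards [Ioo_mem_nhdsGT hT.pos_height] with e he
    have he1 : |e| ≤ e₀ := by rw [abs_of_pos he.1]; exact he.2.le
    set I2 := Set.Icc (C.left 0) C.lastMark ×ˢ Set.Icc (C.left 0) C.lastMark with hI2
    have hk : ContinuousOn (fun p : ℝ × ℝ => meanKernel C.path e p.1 p.2) I2 :=
      (continuousOn_meanKernel hγ.continuous hγ.continuous_deriv hT he1 he.1.ne').mono
        (Set.prod_mono hsub hsub)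
    have hk' : ContinuousOn (fun p : ℝ × ℝ => meanKernel C.path e p.2 p.1) I2 :=
      ContinuousOn.comp (g := fun p : ℝ × ℝ => meanKernel C.path e p.1 p.2) (f := Prod.swap) hk
        continuous_swap.continuousOn fun p hp => ⟨hp.2, hp.1⟩
    have c1 : ContinuousOn (fun p : ℝ × ℝ => δ p.1 * meanKernel C.path e p.1 p.2
        * C.mass p.1 * C.mass p.2) I2 :=
      (((hδ.comp continuous_fst).continuousOn.mul hk).mul
        (hm.comp continuous_fst).continuousOn).mul (hm.comp continuous_snd).continuousOn
    have c2 : ContinuousOn (fun p : ℝ × ℝ => δ p.2 * meanKernel C.path e p.2 p.1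
        * C.mass p.1 * C.mass p.2) I2 :=
      (((hδ.comp continuous_snd).continuousOn.mul hk').mul
        (hm.comp continuous_fst).continuousOn).mul (hm.comp continuous_snd).continuousOn
    have hsum : ∫ s in (C.left 0)..C.lastMark, ∫ s' in (C.left 0)..C.lastMark,
        (δ s * meanKernel C.path e s s' + δ s' * meanKernel C.path e s' s) * C.mass s * C.mass s'
        = (∫ s in (C.left 0)..C.lastMark, ∫ s' in (C.left 0)..C.lastMark,
            δ s * meanKernel C.path e s s' * C.mass s * C.mass s')
          + ∫ s in (C.left 0)..C.lastMark, ∫ s' in (C.left 0)..C.lastMark,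
            δ s' * meanKernel C.path e s' s * C.mass s * C.mass s' := by
      rw [← double_integral_add hab c1 c2]
      simp only [add_mul]
    have hswap : ∫ s in (C.left 0)..C.lastMark, ∫ s' in (C.left 0)..C.lastMark,
        δ s' * meanKernel C.path e s' s * C.mass s * C.mass s'
        = ∫ s in (C.left 0)..C.lastMark, ∫ s' in (C.left 0)..C.lastMark,
        δ s * meanKernel C.path e s s' * C.mass s * C.mass s' := by
      rw [intervalIntegral_swap_of_continuousOn
        (f := fun s s' => δ s' * meanKernel C.path e s' s * C.mass s * C.mass s') hab hab c2]
      refine intervalIntegral.integral_congr fun s _ => intervalIntegral.integral_congr fun s' _ => ?_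
      ring
    have hW : Continuous fun s => δ s * C.mass s * (1 / 2 *
        ((derivative C.W).eval (tube C.path s e) + (derivative C.W).eval (tube C.path s (-e)))) := by
      have h3 : ∀ e : ℝ, Continuous fun s => (derivative C.W).eval (tube C.path s e) := fun e =>
        (derivative C.W).continuous.comp (IsRegularPath.continuous_tube hγ.continuous
          hγ.continuous_deriv |>.comp (continuous_id.prodMk continuous_const))
      exact (hδ.mul hm).mul (continuous_const.mul ((h3 e).add (h3 (-e))))
    have hI1 : IntervalIntegrable (fun s => δ s * C.mass s * C.meanTube e s)
        MeasureTheory.volume (C.left 0) C.lastMark := by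
      refine ContinuousOn.intervalIntegrable ?_
      rw [Set.uIcc_of_le hab]
      exact (hδ.mul hm).continuousOn.mul
        ((continuousOn_meanTube hC hT hB he1 he.1.ne').mono hsub)
    rw [hsum, hswap, ← two_mul, ← intervalIntegral.integral_sub (hW.intervalIntegrable _ _) hI1,
      ← intervalIntegral.integral_const_mul]
    refine intervalIntegral.integral_congr fun s hs => ?_
    rw [Set.uIcc_of_le hab] at hs
    have h4 : ∫ s' in (C.left 0)..C.lastMark, δ s * meanKernel C.path e s s' * C.mass s * C.mass s'
        = δ s * C.mass s * ∫ s' in (C.left 0)..C.lastMark,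
          meanKernel C.path e s s' * C.mass s' := by
      rw [← intervalIntegral.integral_const_mul]
      refine intervalIntegral.integral_congr fun s' _ => ?_
      ring
    simp only [h4]
    rw [meanTube_eq hC hT hB he1 he.1.ne' (hsub hs)]
    ring
  have hfin := tendsto_nhds_unique ((hJ.sub hI).congr' hkey) hlim
  rw [← hfin, sub_zero]

end MarkedCurve

/-! ### Perturbations of the path. -/

theorem norm_divDiff_sub_le {γ γ₁ : ℝ → ℂ} (hγ : IsRegularPath γ) (hγ₁ : IsRegularPath γ₁)
    {a B η : ℝ} (hd : ∀ s ∈ Set.Icc a B, ‖deriv γ₁ s - deriv γ s‖ ≤ η) {s s' : ℝ}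
    (hs : s ∈ Set.Icc a B) (hs' : s' ∈ Set.Icc a B) :
    ‖divDiff γ₁ s s' - divDiff γ s s'‖ ≤ η := by
  have hi : ∀ {γ : ℝ → ℂ}, IsRegularPath γ → IntervalIntegrable
      (fun θ : ℝ => deriv γ (s' + θ * (s - s'))) MeasureTheory.volume 0 1 := fun h =>
    (h.continuous_deriv.comp (by fun_prop)).intervalIntegrable _ _
  rw [divDiff, divDiff, ← intervalIntegral.integral_sub (hi hγ₁) (hi hγ)]
  refine (intervalIntegral.norm_integral_le_of_norm_le_const (C := η) fun θ hθ => hd _ ?_).trans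
    (by simp)
  rw [Set.uIoc_of_le zero_le_one] at hθ
  exact ⟨by nlinarith [hs.1, hs'.1, hθ.1, hθ.2], by nlinarith [hs.2, hs'.2, hθ.1, hθ.2]⟩

theorem TubeBound.le_norm_divDiff {γ : ℝ → ℂ} (hγ : IsRegularPath γ) {A B c M e₀ : ℝ}
    (hT : TubeBound γ A B c M e₀) {s s' : ℝ} (hs : s ∈ Set.Icc A B) (hs' : s' ∈ Set.Icc A B) :
    c ≤ ‖divDiff γ s s'‖ := by
  rcases eq_or_ne s s' with rfl | h
  · have h7 := hT.lower s hs s hs e₀ (by rw [abs_of_pos hT.pos_height])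
    have h8 : ‖tube γ s e₀ - γ s‖ = |e₀| * ‖deriv γ s‖ := by simp [tube]
    rw [h8, sub_self, abs_zero, zero_add, mul_comm] at h7
    rw [IsRegularPath.divDiff_self]
    exact le_of_mul_le_mul_left h7 (abs_pos.2 hT.pos_height.ne')
  · have h7 := hT.lower s hs s' hs' 0 (by simpa using hT.pos_height.le)
    have h8 : tube γ s 0 = γ s := by simp [tube]
    rw [h8, abs_zero, add_zero, ← hγ.divDiff_mul, norm_mul, ← Complex.ofReal_sub,
      Complex.norm_real, Real.norm_eq_abs] at h7
    exact le_of_mul_le_mul_right h7 (abs_pos.2 (sub_ne_zero.2 h))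

/-- The logarithm of the divided difference, for a perturbed path with the same tail. -/
theorem IsRegularPath.exists_pathLog_sub_eq {γ : ℝ → ℂ} (hγ : IsRegularPath γ) {a b B : ℝ}
    (hbB : b < B) (htail : ∀ s, B ≤ s → γ s = s) (hfar : ∀ s ∈ Set.Icc a b, ‖γ s‖ + 1 ≤ B) :
    ∃ K : ℝ, 0 < K ∧ ∀ γ₁, IsRegularPath γ₁ → (∀ s, B ≤ s → γ₁ s = s) → ∀ η : ℝ, K * η ≤ 1 / 2 →
      (∀ s ∈ Set.Icc a B, ‖γ₁ s - γ s‖ ≤ η) → (∀ s ∈ Set.Icc a B, ‖deriv γ₁ s - deriv γ s‖ ≤ η) →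
      ∀ s ∈ Set.Icc a b, ∀ s' ∈ Set.Icc a b,
        ‖divDiff γ₁ s s' / divDiff γ s s' - 1‖ ≤ K * η ∧
        pathLog γ₁ s s' - pathLog γ s s'
          = Complex.log (1 + (divDiff γ₁ s s' / divDiff γ s s' - 1)) := by
  obtain ⟨c, M, e₀, hT⟩ := hγ.exists_tubeBound a B
  have hc := hT.pos
  refine ⟨max c⁻¹ 1, by positivity, fun γ₁ hγ₁ htail₁ η hη hδ hd s hs s' hs' => ?_⟩
  have hη0 : 0 ≤ η := (norm_nonneg _).trans (hδ s ⟨hs.1, hs.2.trans hbB.le⟩)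
  have hs'B : s' ∈ Set.Icc a B := ⟨hs'.1, hs'.2.trans hbB.le⟩
  set w : ℝ → ℂ := fun s => divDiff γ₁ s s' / divDiff γ s s' - 1 with hw
  have hfarw : ∀ s, B ≤ s → w s = -(γ₁ s' - γ s') * (s - γ s')⁻¹ ∧ s - ‖γ s'‖ ≤ ‖(s : ℂ) - γ s'‖ ∧
      1 ≤ s - ‖γ s'‖ := by
    intro s hs
    have hne : s ≠ s' := (hs'.2.trans_lt (hbB.trans_le hs)).ne'
    have h1 : s - ‖γ s'‖ ≤ ‖(s : ℂ) - γ s'‖ := by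
      have h2 := norm_sub_norm_le (s : ℂ) (γ s')
      rw [Complex.norm_real, Real.norm_eq_abs] at h2
      linarith [le_abs_self s]
    have h3 : 1 ≤ s - ‖γ s'‖ := by linarith [hfar s' hs']
    have h4 : (s : ℂ) - γ s' ≠ 0 := norm_pos_iff.1 (by linarith)
    have h5 : (s : ℂ) - s' ≠ 0 := sub_ne_zero.2 (by exact_mod_cast hne)
    refine ⟨?_, h1, h3⟩
    simp only [hw]
    rw [hγ₁.divDiff_of_ne hne, hγ.divDiff_of_ne hne, htail s hs, htail₁ s hs]
    field_simp
    ring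
  -- Up to B the derivatives are close. Beyond B both paths are the identity, so only the
  -- displacement at s' matters, and it is divided by a distance of at least 1.
  have hbound : ∀ s, a ≤ s → ‖w s‖ ≤ max c⁻¹ 1 * η := by
    intro s hs
    rcases le_total s B with h | h
    · have h1 := norm_divDiff_sub_le hγ hγ₁ hd ⟨hs, h⟩ hs'B
      have h2 := hT.le_norm_divDiff hγ ⟨hs, h⟩ hs'B
      simp only [hw]
      rw [div_sub_one (hγ.divDiff_ne_zero _ _), norm_div, div_eq_inv_mul]
      refine mul_le_mul ((inv_anti₀ hc h2).trans (le_max_left _ _)) h1 (norm_nonneg _) (by positivity)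
    · obtain ⟨h1, h2, h3⟩ := hfarw s h
      rw [h1, norm_mul, norm_neg, norm_inv, mul_comm]
      exact mul_le_mul ((inv_le_one_of_one_le₀ (h3.trans h2)).trans (le_max_right _ _))
        (hδ s' hs'B) (norm_nonneg _) (by positivity)
  refine ⟨hbound s hs.1, ?_⟩
  have hslit : ∀ s, a ≤ s → 1 + w s ∈ Complex.slitPlane := fun s hs =>
    Complex.mem_slitPlane_of_norm_lt_one ((hbound s hs).trans_lt (hη.trans_lt (by norm_num)))
  have hwc : Continuous w := by
    have h1 : ∀ {γ : ℝ → ℂ}, IsRegularPath γ → Continuous fun s => divDiff γ s s' := fun h =>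
      h.continuous_divDiff.comp (continuous_id.prodMk continuous_const)
    exact ((h1 hγ₁).div (h1 hγ) fun s => hγ.divDiff_ne_zero _ _).sub continuous_const
  set f : ℝ → ℂ := fun s => pathLog γ₁ s s' - pathLog γ s s' - Complex.log (1 + w s) with hf
  -- The whole ray is needed, because the branches of the two logarithms are tied together only at
  -- infinity.
  have hcont : ContinuousOn f (Set.Ici a) := fun s hs =>
    (((hγ₁.continuous_pathLog_left s').continuousAt.sub
      (hγ.continuous_pathLog_left s').continuousAt).sub
      ((continuousAt_const.add hwc.continuousAt).clog (hslit s hs))).continuousWithinAt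
  have hexp : ∀ s ∈ Set.Ici a, Complex.exp (f s) = 1 := fun s hs => by
    have h1 : (1 : ℂ) + w s ≠ 0 := Complex.slitPlane_ne_zero (hslit s hs)
    rw [hf, Complex.exp_sub, Complex.exp_sub, Complex.exp_log h1, hγ.exp_pathLog, hγ₁.exp_pathLog,
      div_eq_one_iff_eq h1]
    simp [hw]
  have hlim : Tendsto f atTop (𝓝 0) := by
    have h3 : Tendsto (fun s : ℝ => ((s : ℂ) - γ s')⁻¹) atTop (𝓝 0) := by
      refine tendsto_inv₀_cobounded.comp (tendsto_norm_atTop_iff_cobounded.1 ?_)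
      refine tendsto_atTop_mono' _ ?_ (tendsto_atTop_add_const_right _ (-‖γ s'‖) tendsto_id)
      filter_upwards [eventually_ge_atTop B] with s hs
      exact (hfarw s hs).2.1
    have h4 : Tendsto w atTop (𝓝 0) := by
      have h5 := h3.const_mul (-(γ₁ s' - γ s'))
      rw [mul_zero] at h5
      refine h5.congr' ?_
      filter_upwards [eventually_ge_atTop B] with s hs
      exact (hfarw s hs).1.symm
    have h5 := (h4.const_add 1).clog (by simp)
    rw [add_zero, Complex.log_one] at h5
    have h6 := ((hγ₁.tendsto_pathLog s').sub (hγ.tendsto_pathLog s')).sub h5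
    simpa using h6
  have hconst : ∀ s' ∈ Set.Ici a, f s = f s' := fun s' hs' =>
    isPreconnected_Ici.eq_of_exp_eq_one hcont hexp hs.1 hs'
  have h0 : f s = 0 := tendsto_nhds_unique (tendsto_const_nhds.congr' (by
    filter_upwards [eventually_ge_atTop a] with s hs using hconst s hs)) hlim
  exact sub_eq_zero.1 h0

/-- Taylor's formula for a polynomial, with a locally uniform remainder. -/
theorem Polynomial.exists_norm_eval_add_sub_le (W : ℂ[X]) (R : ℝ) : ∃ K, 0 ≤ K ∧ ∀ x δ : ℂ,
    ‖x‖ ≤ R → ‖δ‖ ≤ 1 →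
      ‖W.eval (x + δ) - W.eval x - (derivative W).eval x * δ‖ ≤ K * ‖δ‖ ^ 2 := by
  induction W using Polynomial.induction_on with
  | C a => exact ⟨0, le_rfl, fun x δ _ _ => by simp⟩
  | add p q hp hq =>
    obtain ⟨K₁, h₁, hp⟩ := hp
    obtain ⟨K₂, h₂, hq⟩ := hq
    refine ⟨K₁ + K₂, add_nonneg h₁ h₂, fun x δ hx hδ => ?_⟩
    have := (norm_add_le _ _).trans (add_le_add (hp x δ hx hδ) (hq x δ hx hδ))
    rw [add_mul]
    refine le_of_eq_of_le (congrArg norm ?_) this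
    simp only [eval_add, derivative_add]
    ring
  | monomial k a h =>
    obtain ⟨K, hK0, h⟩ := h
    set P : ℂ[X] := Polynomial.C a * X ^ k with hP
    have h1 : (Polynomial.C a * X ^ (k + 1) : ℂ[X]) = X * P := by rw [hP]; ring
    obtain ⟨N, hN⟩ := (isCompact_closedBall (0 : ℂ) R).exists_bound_of_continuousOn
      (derivative P).continuous.continuousOn
    refine ⟨(|R| + 1) * K + |N|, by positivity, fun x δ hx hδ => ?_⟩
    have h2 : (Polynomial.C a * X ^ (k + 1) : ℂ[X]).eval (x + δ)
        - (Polynomial.C a * X ^ (k + 1) : ℂ[X]).eval x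
        - (derivative (Polynomial.C a * X ^ (k + 1) : ℂ[X])).eval x * δ
        = (x + δ) * (P.eval (x + δ) - P.eval x - (derivative P).eval x * δ)
          + (derivative P).eval x * δ ^ 2 := by
      rw [h1]
      simp only [eval_mul, eval_X, derivative_mul, derivative_X, one_mul, eval_add]
      ring
    rw [h2, add_mul ((|R| + 1) * K)]
    refine (norm_add_le _ _).trans (add_le_add ?_ ?_)
    · rw [norm_mul, mul_assoc]
      refine mul_le_mul ?_ (h x δ hx hδ) (norm_nonneg _) (by positivity)
      exact (norm_add_le _ _).trans (add_le_add (hx.trans (le_abs_self R)) hδ)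
    · rw [norm_mul, norm_pow]
      exact mul_le_mul_of_nonneg_right ((hN x (by simpa using hx)).trans (le_abs_self N))
        (by positivity)

/-- The singular part log |s - s'| is the integrand of a convolution of two integrable functions, an
indicator and a truncated logarithm; the rest is continuous. -/
theorem integrableOn_logKernel {γ : ℝ → ℂ} (hγ : IsRegularPath γ) (a b : ℝ) :
    MeasureTheory.IntegrableOn (fun p : ℝ × ℝ => logKernel γ p.1 p.2)
      (Set.Icc a b ×ˢ Set.Icc a b) := by
  have hK : IsCompact (Set.Icc a b ×ˢ Set.Icc a b) := isCompact_Icc.prod isCompact_Icc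
  have hmeas : MeasurableSet (Set.Icc a b ×ˢ Set.Icc a b) := measurableSet_Icc.prod measurableSet_Icc
  have h1 : MeasureTheory.Integrable ((Set.Icc a b).indicator fun _ => (1 : ℝ)) :=
    (MeasureTheory.integrable_indicator_iff measurableSet_Icc).2
      (continuous_const.continuousOn.integrableOn_Icc)
  -- The extra 1 keeps the extreme value a - b of s - s' inside the half-open interval.
  have h2 : MeasureTheory.Integrable ((Set.Ioc (a - b - 1) (b - a)).indicator Real.log) := by
    refine (MeasureTheory.integrable_indicator_iff measurableSet_Ioc).2 ?_
    exact (intervalIntegral.intervalIntegrable_log' (a := a - b - 1) (b := b - a)).1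
  have h3 := (h1.convolution_integrand (ContinuousLinearMap.mul ℝ ℝ) h2)
  rw [← MeasureTheory.Measure.volume_eq_prod] at h3
  have h4 : MeasureTheory.IntegrableOn (fun p : ℝ × ℝ => ((Real.log |p.1 - p.2| : ℝ) : ℂ))
      (Set.Icc a b ×ˢ Set.Icc a b) := by
    refine MeasureTheory.IntegrableOn.congr_fun (h3.ofReal (𝕜 := ℂ)).integrableOn ?_ hmeas
    rintro ⟨s, s'⟩ ⟨hs, hs'⟩
    have h5 : s - s' ∈ Set.Ioc (a - b - 1) (b - a) :=
      ⟨by linarith [hs.1, hs'.2], by linarith [hs.2, hs'.1]⟩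
    simp [Set.indicator_of_mem hs', Set.indicator_of_mem h5]
  exact h4.add (hγ.continuous_pathLog.continuousOn.integrableOn_compact hK)

theorem integral_integral_logKernel_eq {γ : ℝ → ℂ} (hγ : IsRegularPath γ) {a b : ℝ} (hab : a ≤ b)
    {u v : ℝ → ℂ} (hu : Continuous u) (hv : Continuous v) :
    ∫ s in a..b, ∫ s' in a..b, logKernel γ s s' * u s * v s'
      = ∫ p in Set.Ioc a b ×ˢ Set.Ioc a b, logKernel γ p.1 p.2 * (u p.1 * v p.2) := by
  have hc : Continuous fun p : ℝ × ℝ => u p.1 * v p.2 :=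
    (hu.comp continuous_fst).mul (hv.comp continuous_snd)
  have h1 := ((integrableOn_logKernel hγ a b).mul_continuousOn hc.continuousOn
    (isCompact_Icc.prod isCompact_Icc)).mono_set
    (Set.prod_mono Set.Ioc_subset_Icc_self Set.Ioc_subset_Icc_self)
  rw [MeasureTheory.Measure.volume_eq_prod] at h1 ⊢
  rw [MeasureTheory.setIntegral_prod _ h1, intervalIntegral.integral_of_le hab]
  simp only [intervalIntegral.integral_of_le hab, mul_assoc]

/-- `γ₁` is a path with the same tail as `γ`, at `C¹` distance at most `η`. -/
structure IsPathPerturbation (γ γ₁ : ℝ → ℂ) (a B η : ℝ) : Prop where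
  regular : IsRegularPath γ₁
  tail : ∀ s, B ≤ s → γ₁ s = s
  norm_sub_le : ∀ s ∈ Set.Icc a B, ‖γ₁ s - γ s‖ ≤ η
  norm_deriv_sub_le : ∀ s ∈ Set.Icc a B, ‖deriv γ₁ s - deriv γ s‖ ≤ η

theorem logKernel_comm {γ : ℝ → ℂ} (hγ : IsRegularPath γ) (s s' : ℝ) :
    logKernel γ s s' = logKernel γ s' s := by
  rw [logKernel, logKernel, hγ.pathLog_comm, abs_sub_comm]

theorem setIntegral_logKernel_swap {γ : ℝ → ℂ} (hγ : IsRegularPath γ) (S : Set ℝ) (u v : ℝ → ℂ) :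
    ∫ p in S ×ˢ S, logKernel γ p.1 p.2 * (u p.1 * v p.2)
      = ∫ p in S ×ˢ S, logKernel γ p.1 p.2 * (v p.1 * u p.2) := by
  have h := MeasureTheory.setIntegral_prod_swap (μ := (MeasureTheory.volume : MeasureTheory.Measure ℝ))
    (ν := (MeasureTheory.volume : MeasureTheory.Measure ℝ)) S S
    fun p => logKernel γ p.1 p.2 * (u p.1 * v p.2)
  rw [← MeasureTheory.Measure.volume_eq_prod] at h
  rw [← h]
  congr 1
  ext p
  simp only [Prod.fst_swap, Prod.snd_swap]
  rw [logKernel_comm hγ, mul_comm (u p.2)]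

/-! ### First variation of the free energy. -/

namespace MarkedCurve

variable {g : ℕ} {C : MarkedCurve g} (hC : C.IsValid)

include hC

/-- The parameter values of the marks do not move, so `jumpWeight` is unchanged; only γ' and the
exponentials in the cut factors vary. This is the benefit of working on a fixed parameter line,
where the densities stay comparable up to the branch points. -/
theorem exists_norm_mass_sub_le {B : ℝ} (hB : C.lastMark < B) {K : ℝ} (hK0 : 0 < K) :
    ∃ μ : ℝ, 0 ≤ μ ∧ ∀ C₁ : MarkedCurve g, C₁.left = C.left → C₁.right = C.right →
      ∀ η : ℝ, 0 ≤ η → (g + 1) * (2 * K * η) ≤ 1 → IsPathPerturbation C.path C₁.path (C.left 0) B η →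
      (∀ s ∈ Set.Icc (C.left 0) C.lastMark, ∀ s' ∈ Set.Icc (C.left 0) C.lastMark,
        ‖pathLog C₁.path s s' - pathLog C.path s s'‖ ≤ 2 * K * η) →
      ∀ s ∈ Set.Icc (C.left 0) C.lastMark, ‖C₁.mass s - C.mass s‖ ≤ μ * η := by
  have hγ := hC.isRegularPath
  have hab := (left_zero_lt_lastMark hC).le
  set n : ℝ → ℂ := fun s => jumpWeight C.left C.right s
    * ∏ i, cutFactor C.path (C.left i) (C.right i) s with hn
  have hnc : Continuous n := (continuous_jumpWeight _ _).mul
    (continuous_finsetProd _ fun i _ => hγ.continuous_cutFactor _ _)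
  obtain ⟨N, hN⟩ := isCompact_Icc.exists_bound_of_continuousOn (s := Set.Icc (C.left 0) C.lastMark)
    hnc.continuousOn
  obtain ⟨M, hM⟩ := isCompact_Icc.exists_bound_of_continuousOn (s := Set.Icc (C.left 0) C.lastMark)
    hγ.continuous_deriv.continuousOn
  have hN0 : 0 ≤ N := (norm_nonneg _).trans (hN (C.left 0) ⟨le_rfl, hab⟩)
  have hM0 : 0 ≤ M := (norm_nonneg _).trans (hM (C.left 0) ⟨le_rfl, hab⟩)
  refine ⟨N * (3 + M * (2 * ((g + 1) * (2 * K)))), by positivity,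
    fun C₁ hl hr η hη hsmall hpert hκ s hs => ?_⟩
  set κ : ℝ → ℝ → ℂ := fun s s' => pathLog C₁.path s s' - pathLog C.path s s' with hκdef
  set E : ℂ := ∑ i, 1 / 2 * (κ (C.right i) s + κ (C.left i) s) with hE
  have hprod : ∏ i, cutFactor C₁.path (C₁.left i) (C₁.right i) s
      = (∏ i, cutFactor C.path (C.left i) (C.right i) s) * Complex.exp E := by
    rw [hE, Complex.exp_sum, ← Finset.prod_mul_distrib, hl, hr]
    refine Finset.prod_congr rfl fun i _ => ?_
    rw [cutFactor, cutFactor, ← Complex.exp_add]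
    congr 1
    simp only [hκdef]
    ring
  have hEn : ‖E‖ ≤ (g + 1) * (2 * K * η) := by
    refine (norm_sum_le _ _).trans ?_
    refine (Finset.sum_le_card_nsmul _ _ (2 * K * η) fun i _ => ?_).trans (by simp)
    have h1 := hκ (C.right i) ⟨(left_zero_le hC i).trans (hC.left_lt_right i).le,
      right_le_lastMark hC i⟩ s hs
    have h2 := hκ (C.left i) ⟨left_zero_le hC i, (hC.left_lt_right i).le.trans
      (right_le_lastMark hC i)⟩ s hs
    have h3 := norm_add_le (κ (C.right i) s) (κ (C.left i) s)
    rw [norm_mul, show ‖(1 / 2 : ℂ)‖ = 1 / 2 by norm_num]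
    simp only [hκdef] at h3 ⊢
    linarith
  have hexp1 := Complex.norm_exp_sub_one_le (hEn.trans hsmall)
  have hexp2 : ‖Complex.exp E‖ ≤ 3 := by
    have h1 := norm_add_le (Complex.exp E - 1) 1
    rw [sub_add_cancel, norm_one] at h1
    linarith [hEn.trans hsmall]
  have hsB : s ∈ Set.Icc (C.left 0) B := ⟨hs.1, hs.2.trans hB.le⟩
  have hdiff : C₁.mass s - C.mass s = n s * ((deriv C₁.path s - deriv C.path s) * Complex.exp E
      + deriv C.path s * (Complex.exp E - 1)) := by
    rw [mass, mass, hprod, hl, hr, hn]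
    ring
  rw [hdiff, norm_mul, mul_assoc]
  refine mul_le_mul (hN s hs) ?_ (norm_nonneg _) hN0
  refine (norm_add_le _ _).trans ?_
  rw [norm_mul, norm_mul, add_mul]
  refine add_le_add ?_ ?_
  · rw [mul_comm]
    exact mul_le_mul hexp2 (hpert.norm_deriv_sub_le s hsB) (norm_nonneg _) (by norm_num)
  · rw [mul_assoc]
    refine mul_le_mul (hM s hs) ?_ (norm_nonneg _) hM0
    calc ‖Complex.exp E - 1‖ ≤ 2 * ‖E‖ := hexp1
      _ ≤ 2 * ((g + 1) * (2 * K * η)) := by linarith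
      _ = _ := by ring

/-- The two forms of the logarithm are identified off the diagonal, which is null in each inner
integral. -/
theorem freeEnergy_eq_logKernel : C.freeEnergy
    = (∫ p in Set.Ioc (C.left 0) C.lastMark ×ˢ Set.Ioc (C.left 0) C.lastMark,
      logKernel C.path p.1 p.2 * (C.mass p.1 * C.mass p.2))
    - ∫ s in (C.left 0)..C.lastMark, C.W.eval (C.path s) * C.mass s := by
  have hγ := hC.isRegularPath
  have hab := (left_zero_lt_lastMark hC).le
  rw [freeEnergy_eq hC, ← integral_integral_logKernel_eq hγ hab (continuous_mass hC)
    (continuous_mass hC)]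
  congr 1
  refine intervalIntegral.integral_congr fun s _ => intervalIntegral.integral_congr_ae ?_
  filter_upwards [MeasureTheory.Measure.ae_ne MeasureTheory.volume s] with s' hs' _
  rw [C.pvLog_eq hγ hs'.symm, logKernel]

theorem integral_effPotential_mul {u : ℝ → ℂ} (hu : Continuous u) :
    ∫ s in (C.left 0)..C.lastMark, C.effPotential s * u s
      = 2 * (∫ p in Set.Ioc (C.left 0) C.lastMark ×ˢ Set.Ioc (C.left 0) C.lastMark,
          logKernel C.path p.1 p.2 * (u p.1 * C.mass p.2))
        - ∫ s in (C.left 0)..C.lastMark, C.W.eval (C.path s) * u s := by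
  have hγ := hC.isRegularPath
  have hab := (left_zero_lt_lastMark hC).le
  have hm := continuous_mass hC
  rw [← integral_integral_logKernel_eq hγ hab hu hm, ← intervalIntegral.integral_const_mul,
    ← intervalIntegral.integral_sub]
  · refine intervalIntegral.integral_congr fun s _ => ?_
    have : (∫ s' in (C.left 0)..C.lastMark, logKernel C.path s s' * u s * C.mass s')
        = u s * ∫ s' in (C.left 0)..C.lastMark, logKernel C.path s s' * C.mass s' := by
      rw [← intervalIntegral.integral_const_mul]
      refine intervalIntegral.integral_congr fun s' _ => ?_
      ring
    simp only [this, effPotential]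
    ring
  · have hc : Continuous fun p : ℝ × ℝ => u p.1 * C.mass p.2 :=
      (hu.comp continuous_fst).mul (hm.comp continuous_snd)
    have h1 := ((integrableOn_logKernel hγ (C.left 0) C.lastMark).mul_continuousOn hc.continuousOn
      (isCompact_Icc.prod isCompact_Icc)).mono_set
      (Set.prod_mono Set.Ioc_subset_Icc_self Set.Ioc_subset_Icc_self)
    rw [MeasureTheory.Measure.volume_eq_prod, MeasureTheory.IntegrableOn,
      ← MeasureTheory.Measure.prod_restrict] at h1
    rw [intervalIntegrable_iff_integrableOn_Ioc_of_le hab]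
    simp only [intervalIntegral.integral_of_le hab]
    have h2 := (h1.integral_prod_left).const_mul 2
    simp only [mul_assoc]
    exact h2
  · exact ((C.W.continuous.comp hγ.continuous).mul hu).intervalIntegrable _ _

/-- The first variation of the free energy. -/
theorem exists_norm_freeEnergy_sub_le {B : ℝ} (hB : C.lastMark < B)
    (htail : ∀ s, B ≤ s → C.path s = s)
    (hfar : ∀ s ∈ Set.Icc (C.left 0) C.lastMark, ‖C.path s‖ + 1 ≤ B) :
    ∃ K η₀ : ℝ, 0 < η₀ ∧ ∀ C₁ : MarkedCurve g, C₁.IsValid → C₁.W = C.W → C₁.left = C.left →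
      C₁.right = C.right → ∀ η : ℝ, η ≤ η₀ → IsPathPerturbation C.path C₁.path (C.left 0) B η →
      ‖C₁.freeEnergy - C.freeEnergy
        - ∫ s in (C.left 0)..C.lastMark, C.effPotential s * (C₁.mass s - C.mass s)‖ ≤ K * η ^ 2 := by
  have hγ := hC.isRegularPath
  have hlt := left_zero_lt_lastMark hC
  have hab := hlt.le
  have hm := continuous_mass hC
  obtain ⟨K, hK0, hK⟩ := hγ.exists_pathLog_sub_eq (a := C.left 0) hB htail hfar
  obtain ⟨μ, hμ0, hμ⟩ := exists_norm_mass_sub_le hC hB hK0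
  obtain ⟨R, hR⟩ := isCompact_Icc.exists_bound_of_continuousOn (s := Set.Icc (C.left 0) C.lastMark)
    hγ.continuous.continuousOn
  obtain ⟨KW, hKW0, hKW⟩ := C.W.exists_norm_eval_add_sub_le R
  obtain ⟨N, hN⟩ := isCompact_Icc.exists_bound_of_continuousOn (s := Set.Icc (C.left 0) C.lastMark)
    hm.continuousOn
  obtain ⟨D, hD⟩ := isCompact_Icc.exists_bound_of_continuousOn (s := Set.Icc (C.left 0) C.lastMark)
    ((derivative C.W).continuous.comp hγ.continuous).continuousOn
  have hN0 : 0 ≤ N := (norm_nonneg _).trans (hN (C.left 0) ⟨le_rfl, hab⟩)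
  have hD0 : 0 ≤ D := (norm_nonneg _).trans (hD (C.left 0) ⟨le_rfl, hab⟩)
  set Q : Set (ℝ × ℝ) := Set.Ioc (C.left 0) C.lastMark ×ˢ Set.Ioc (C.left 0) C.lastMark with hQ
  have hQsub : Q ⊆ Set.Icc (C.left 0) C.lastMark ×ˢ Set.Icc (C.left 0) C.lastMark :=
    Set.prod_mono Set.Ioc_subset_Icc_self Set.Ioc_subset_Icc_self
  have hQcpt : IsCompact (Set.Icc (C.left 0) C.lastMark ×ˢ Set.Icc (C.left 0) C.lastMark) := isCompact_Icc.prod isCompact_Icc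
  have hQfin : MeasureTheory.volume Q < ⊤ :=
    (MeasureTheory.measure_mono hQsub).trans_lt hQcpt.measure_lt_top
  have hQmeas : MeasurableSet Q := measurableSet_Ioc.prod measurableSet_Ioc
  have hkint := (integrableOn_logKernel hγ (C.left 0) C.lastMark).mono_set hQsub
  set A := ∫ p in Q, ‖logKernel C.path p.1 p.2‖ with hA
  set v := MeasureTheory.volume.real Q with hv
  -- The three summands are the bounds `hb1`, `hb2` and `hb3`: change of the kernel, quadratic term
  -- in the change of mass, change of the potential. The restrictions on `η₀` allow linearising the
  -- logarithm and the exponential.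
  refine ⟨(K ^ 2 * (N + μ) ^ 2 + 2 * K * μ * (N + μ)) * v + A * μ ^ 2
    + (KW * (N + μ) + D * μ) * |C.lastMark - C.left 0|,
    min 1 (min (1 / (2 * K)) (1 / ((g + 1) * (2 * K)))), by positivity,
    fun C₁ hC₁ hW hl hr η hη hpert => ?_⟩
  have hη0 : 0 ≤ η := (norm_nonneg _).trans (hpert.norm_sub_le (C.left 0) ⟨le_rfl, hab.trans hB.le⟩)
  have hη1 : η ≤ 1 := hη.trans (min_le_left _ _)
  have hη2 : K * η ≤ 1 / 2 := by
    have := hη.trans ((min_le_right _ _).trans (min_le_left _ _))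
    rw [le_div_iff₀ (by positivity)] at this
    linarith
  have hη3 : (g + 1) * (2 * K * η) ≤ 1 := by
    have := hη.trans ((min_le_right _ _).trans (min_le_right _ _))
    rw [le_div_iff₀ (by positivity)] at this
    linarith
  have hγ₁ := hpert.regular
  have hm₁ := continuous_mass hC₁
  set κ : ℝ → ℝ → ℂ := fun s s' => pathLog C₁.path s s' - pathLog C.path s s' with hκ
  -- `w` is the relative change of the divided difference, that is, the linearisation of the change
  -- `κ` of its logarithm.
  set w : ℝ → ℝ → ℂ := fun s s' => divDiff C₁.path s s' / divDiff C.path s s' - 1 with hw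
  have hKs := hK C₁.path hγ₁ hpert.tail η hη2 hpert.norm_sub_le hpert.norm_deriv_sub_le
  have hwn : ∀ s ∈ Set.Icc (C.left 0) C.lastMark, ∀ s' ∈ Set.Icc (C.left 0) C.lastMark, ‖w s s'‖ ≤ K * η := fun s hs s' hs' =>
    (hKs s hs s' hs').1
  have hκw : ∀ s ∈ Set.Icc (C.left 0) C.lastMark, ∀ s' ∈ Set.Icc (C.left 0) C.lastMark, ‖κ s s' - w s s'‖ ≤ (K * η) ^ 2 := by
    intro s hs s' hs'
    have h1 := hwn s hs s' hs'
    have h2 : ‖w s s'‖ ≤ 1 / 2 := h1.trans hη2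
    have h3 : κ s s' = Complex.log (1 + w s s') := (hKs s hs s' hs').2
    rw [h3]
    refine (Complex.norm_log_one_add_sub_self_le (h2.trans_lt (by norm_num))).trans ?_
    have h4 : (1 - ‖w s s'‖)⁻¹ ≤ 2 := by
      rw [inv_le_comm₀ (by linarith) two_pos]
      linarith
    have h5 : ‖w s s'‖ ^ 2 ≤ (K * η) ^ 2 := pow_le_pow_left₀ (norm_nonneg _) h1 2
    have h6 := mul_le_mul_of_nonneg_left h4 (sq_nonneg ‖w s s'‖)
    linarith
  have hκn : ∀ s ∈ Set.Icc (C.left 0) C.lastMark, ∀ s' ∈ Set.Icc (C.left 0) C.lastMark, ‖κ s s'‖ ≤ 2 * K * η := by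
    intro s hs s' hs'
    have h1 := hκw s hs s' hs'
    have h2 := hwn s hs s' hs'
    have h3 := norm_add_le (κ s s' - w s s') (w s s')
    rw [sub_add_cancel] at h3
    have h4 : (K * η) ^ 2 ≤ K * η := by nlinarith [mul_nonneg hK0.le hη0]
    linarith
  have hΔ := hμ C₁ hl hr η hη0 hη3 hpert hκn
  set Δ : ℝ → ℂ := fun s => C₁.mass s - C.mass s with hΔdef
  have hΔc : Continuous Δ := hm₁.sub hm
  have hμη : μ * η ≤ μ := mul_le_of_le_one_right hμ0 hη1
  have hm₁n : ∀ s ∈ Set.Icc (C.left 0) C.lastMark, ‖C₁.mass s‖ ≤ N + μ := by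
    intro s hs
    have h1 := norm_add_le (C.mass s) (Δ s)
    rw [hΔdef, add_sub_cancel] at h1
    linarith [hN s hs, hΔ s hs]
  set δ : ℝ → ℂ := fun s => C₁.path s - C.path s with hδ
  have hδc : Continuous δ := hγ₁.continuous.sub hγ.continuous
  -- the loop equation in the direction of the perturbation
  have hwc : Continuous fun p : ℝ × ℝ => w p.1 p.2 :=
    (hγ₁.continuous_divDiff.div hγ.continuous_divDiff fun p => hγ.divDiff_ne_zero _ _).sub
      continuous_const
  have hmm : ∀ {u v : ℝ → ℂ}, Continuous u → Continuous v →
      Continuous fun p : ℝ × ℝ => u p.1 * v p.2 := fun hu hv =>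
    (hu.comp continuous_fst).mul (hv.comp continuous_snd)
  have hκc : Continuous fun p : ℝ × ℝ => κ p.1 p.2 :=
    hγ₁.continuous_pathLog.sub hγ.continuous_pathLog
  have hint : ∀ {f : ℝ × ℝ → ℂ}, Continuous f → MeasureTheory.IntegrableOn f Q := fun hf =>
    (hf.continuousOn.integrableOn_compact hQcpt).mono_set hQsub
  have hwmm : MeasureTheory.IntegrableOn
      (fun p : ℝ × ℝ => w p.1 p.2 * (C.mass p.1 * C.mass p.2)) Q := hint (hwc.mul (hmm hm hm))
  have hκmm : MeasureTheory.IntegrableOn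
      (fun p : ℝ × ℝ => κ p.1 p.2 * (C₁.mass p.1 * C₁.mass p.2)) Q :=
    hint (hκc.mul (hmm hm₁ hm₁))
  have hkmul : ∀ {f : ℝ × ℝ → ℂ}, Continuous f →
      MeasureTheory.IntegrableOn (fun p => logKernel C.path p.1 p.2 * f p) Q := fun hf =>
    ((integrableOn_logKernel hγ (C.left 0) C.lastMark).mul_continuousOn hf.continuousOn hQcpt).mono_set hQsub
  have hloop : ∫ p in Q, w p.1 p.2 * (C.mass p.1 * C.mass p.2)
      = ∫ s in (C.left 0)..C.lastMark, δ s * C.mass s * (derivative C.W).eval (C.path s) := by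
    have hlip : ∀ s ∈ Set.Icc (C.left 0) C.lastMark, ∀ s' ∈ Set.Icc (C.left 0) C.lastMark, ‖δ s - δ s'‖ ≤ η * |s - s'| := by
      intro s hs s' hs'
      have h1 : δ s - δ s' = (divDiff C₁.path s s' - divDiff C.path s s') * (s - s') := by
        rw [sub_mul, hγ₁.divDiff_mul, hγ.divDiff_mul, hδ]
        ring
      rw [h1, norm_mul, ← Complex.ofReal_sub, Complex.norm_real, Real.norm_eq_abs]
      exact mul_le_mul_of_nonneg_right (norm_divDiff_sub_le hγ hγ₁ hpert.norm_deriv_sub_le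
        ⟨hs.1, hs.2.trans hB.le⟩ ⟨hs'.1, hs'.2.trans hB.le⟩) (abs_nonneg _)
    rw [← integral_integral_divDiff_mul_mass hC hδc hlip]
    have h1 := hwmm
    rw [MeasureTheory.Measure.volume_eq_prod] at h1 ⊢
    rw [hQ, MeasureTheory.setIntegral_prod _ h1, intervalIntegral.integral_of_le hab]
    simp only [intervalIntegral.integral_of_le hab]
    refine MeasureTheory.integral_congr_ae (Eventually.of_forall fun s => ?_)
    refine MeasureTheory.integral_congr_ae ?_
    filter_upwards [MeasureTheory.ae_restrict_of_ae
      (MeasureTheory.Measure.ae_ne MeasureTheory.volume s)] with s' hs'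
    have h2 : w s s' = (δ s - δ s') / (C.path s - C.path s') := by
      have h3 : C.path s - C.path s' ≠ 0 := sub_ne_zero.2 (hγ.injective.ne hs'.symm)
      have h4 : (s : ℂ) - s' ≠ 0 := sub_ne_zero.2 (by exact_mod_cast hs'.symm)
      simp only [hw, hδ]
      rw [hγ.divDiff_of_ne hs'.symm, hγ₁.divDiff_of_ne hs'.symm]
      field_simp
      ring
    simp only [h2]
    ring
  -- the exact expression for the remainder
  have hF₁ := freeEnergy_eq_logKernel hC₁
  have hlast : C₁.lastMark = C.lastMark := by rw [lastMark, lastMark, hr]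
  rw [hlast, hl, hW] at hF₁
  have hkk : ∀ p : ℝ × ℝ, logKernel C₁.path p.1 p.2 = logKernel C.path p.1 p.2 + κ p.1 p.2 := by
    intro p
    simp only [logKernel, hκ]
    ring
  have hsplit : (∫ p in Q, logKernel C₁.path p.1 p.2 * (C₁.mass p.1 * C₁.mass p.2))
      = (∫ p in Q, κ p.1 p.2 * (C₁.mass p.1 * C₁.mass p.2))
        + (∫ p in Q, logKernel C.path p.1 p.2 * (C.mass p.1 * C.mass p.2))
        + 2 * (∫ p in Q, logKernel C.path p.1 p.2 * (Δ p.1 * C.mass p.2))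
        + ∫ p in Q, logKernel C.path p.1 p.2 * (Δ p.1 * Δ p.2) := by
    have h1 := setIntegral_logKernel_swap hγ (Set.Ioc (C.left 0) C.lastMark) Δ C.mass
    have j1 : MeasureTheory.IntegrableOn (fun p : ℝ × ℝ =>
        logKernel C.path p.1 p.2 * (C.mass p.1 * C.mass p.2)) Q := hkmul (hmm hm hm)
    have j2 : MeasureTheory.IntegrableOn (fun p : ℝ × ℝ =>
        logKernel C.path p.1 p.2 * (Δ p.1 * C.mass p.2)) Q := hkmul (hmm hΔc hm)
    have j3 : MeasureTheory.IntegrableOn (fun p : ℝ × ℝ =>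
        logKernel C.path p.1 p.2 * (C.mass p.1 * Δ p.2)) Q := hkmul (hmm hm hΔc)
    have j4 : MeasureTheory.IntegrableOn (fun p : ℝ × ℝ =>
        logKernel C.path p.1 p.2 * (Δ p.1 * Δ p.2)) Q := hkmul (hmm hΔc hΔc)
    have j12 : MeasureTheory.IntegrableOn (fun p : ℝ × ℝ =>
        logKernel C.path p.1 p.2 * (C.mass p.1 * C.mass p.2)
          + logKernel C.path p.1 p.2 * (Δ p.1 * C.mass p.2)) Q := j1.add j2
    have j34 : MeasureTheory.IntegrableOn (fun p : ℝ × ℝ =>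
        logKernel C.path p.1 p.2 * (C.mass p.1 * Δ p.2)
          + logKernel C.path p.1 p.2 * (Δ p.1 * Δ p.2)) Q := j3.add j4
    have j1234 : MeasureTheory.IntegrableOn (fun p : ℝ × ℝ =>
        logKernel C.path p.1 p.2 * (C.mass p.1 * C.mass p.2)
          + logKernel C.path p.1 p.2 * (Δ p.1 * C.mass p.2)
          + (logKernel C.path p.1 p.2 * (C.mass p.1 * Δ p.2)
          + logKernel C.path p.1 p.2 * (Δ p.1 * Δ p.2))) Q := j12.add j34
    have h2 : ∀ p : ℝ × ℝ, logKernel C₁.path p.1 p.2 * (C₁.mass p.1 * C₁.mass p.2)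
        = κ p.1 p.2 * (C₁.mass p.1 * C₁.mass p.2)
          + (logKernel C.path p.1 p.2 * (C.mass p.1 * C.mass p.2)
          + logKernel C.path p.1 p.2 * (Δ p.1 * C.mass p.2)
          + (logKernel C.path p.1 p.2 * (C.mass p.1 * Δ p.2)
          + logKernel C.path p.1 p.2 * (Δ p.1 * Δ p.2))) := fun p => by
      rw [hkk]
      simp only [hΔdef]
      ring
    simp only [h2]
    rw [MeasureTheory.integral_add hκmm j1234, MeasureTheory.integral_add j12 j34,
      MeasureTheory.integral_add j1 j2, MeasureTheory.integral_add j3 j4]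
    rw [← hQ] at h1
    linear_combination (-1 : ℂ) * h1
  have hWc : ∀ {γ : ℝ → ℂ}, Continuous γ → ∀ {u : ℝ → ℂ}, Continuous u → IntervalIntegrable
      (fun s => C.W.eval (γ s) * u s) MeasureTheory.volume (C.left 0) C.lastMark := fun hγ _ hu =>
    ((C.W.continuous.comp hγ).mul hu).intervalIntegrable _ _
  have hδW : IntervalIntegrable (fun s => δ s * C.mass s * (derivative C.W).eval (C.path s))
      MeasureTheory.volume (C.left 0) C.lastMark :=
    ((hδc.mul hm).mul ((derivative C.W).continuous.comp hγ.continuous)).intervalIntegrable _ _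
  -- The terms of first order in the displacement, one from the kernel and one from the potential,
  -- are subtracted from their integrals. They cancel by the loop equation, so the identity is exact
  -- and each remaining integrand is of second order.
  have hrem : C₁.freeEnergy - C.freeEnergy
        - ∫ s in (C.left 0)..C.lastMark, C.effPotential s * (C₁.mass s - C.mass s)
      = (∫ p in Q, (κ p.1 p.2 * (C₁.mass p.1 * C₁.mass p.2)
          - w p.1 p.2 * (C.mass p.1 * C.mass p.2)))
        + (∫ p in Q, logKernel C.path p.1 p.2 * (Δ p.1 * Δ p.2))
        - ∫ s in (C.left 0)..C.lastMark, (C.W.eval (C₁.path s) * C₁.mass s - C.W.eval (C.path s) * C.mass s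
          - C.W.eval (C.path s) * Δ s - δ s * C.mass s * (derivative C.W).eval (C.path s)) := by
    have i1 := hWc hγ₁.continuous hm₁
    have i2 := hWc hγ.continuous hm
    have i3 := hWc hγ.continuous hΔc
    have i4 : IntervalIntegrable (fun s => C.W.eval (C₁.path s) * C₁.mass s
      - C.W.eval (C.path s) * C.mass s) MeasureTheory.volume (C.left 0) C.lastMark := i1.sub i2
    have i5 : IntervalIntegrable (fun s => C.W.eval (C₁.path s) * C₁.mass s
      - C.W.eval (C.path s) * C.mass s - C.W.eval (C.path s) * Δ s)
      MeasureTheory.volume (C.left 0) C.lastMark := i4.sub i3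
    rw [intervalIntegral.integral_sub i5 hδW, intervalIntegral.integral_sub i4 i3,
      intervalIntegral.integral_sub i1 i2, MeasureTheory.integral_sub
      hκmm hwmm, hloop, hF₁, hsplit,
      freeEnergy_eq_logKernel hC]
    have h1 := integral_effPotential_mul hC hΔc
    rw [← hQ] at h1 ⊢
    simp only [hΔdef] at h1 ⊢
    rw [h1]
    ring
  rw [hrem]
  have hpt : ∀ p ∈ Q, p.1 ∈ Set.Icc (C.left 0) C.lastMark ∧ p.2 ∈ Set.Icc (C.left 0) C.lastMark := fun p hp => hQsub hp
  have hb1 : ‖∫ p in Q, (κ p.1 p.2 * (C₁.mass p.1 * C₁.mass p.2)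
      - w p.1 p.2 * (C.mass p.1 * C.mass p.2))‖
      ≤ ((K ^ 2 * (N + μ) ^ 2 + 2 * K * μ * (N + μ)) * η ^ 2) * v := by
    refine MeasureTheory.norm_setIntegral_le_of_norm_le_const hQfin fun p hp => ?_
    obtain ⟨h1, h2⟩ := hpt p hp
    have e1 : κ p.1 p.2 * (C₁.mass p.1 * C₁.mass p.2) - w p.1 p.2 * (C.mass p.1 * C.mass p.2)
        = (κ p.1 p.2 - w p.1 p.2) * (C₁.mass p.1 * C₁.mass p.2)
          + w p.1 p.2 * (C₁.mass p.1 * Δ p.2 + Δ p.1 * C.mass p.2) := by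
      simp only [hΔdef]; ring
    have hNμ : N ≤ N + μ := by linarith
    have e2 : ‖C₁.mass p.1 * C₁.mass p.2‖ ≤ (N + μ) * (N + μ) := by
      rw [norm_mul]
      exact mul_le_mul (hm₁n _ h1) (hm₁n _ h2) (norm_nonneg _) (by linarith)
    have e3 : ‖C₁.mass p.1 * Δ p.2 + Δ p.1 * C.mass p.2‖ ≤ 2 * (μ * η) * (N + μ) := by
      refine (norm_add_le _ _).trans ?_
      rw [norm_mul, norm_mul]
      have e4 := mul_le_mul (hm₁n _ h1) (hΔ _ h2) (norm_nonneg _) (by linarith : 0 ≤ N + μ)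
      have e5 := mul_le_mul (hΔ _ h1) ((hN _ h2).trans hNμ) (norm_nonneg _)
        (mul_nonneg hμ0 hη0)
      linarith
    rw [e1]
    refine (norm_add_le _ _).trans ?_
    rw [norm_mul (κ p.1 p.2 - w p.1 p.2), norm_mul (w p.1 p.2)]
    have e6 := mul_le_mul (hκw _ h1 _ h2) e2 (norm_nonneg _) (by positivity)
    have e7 := mul_le_mul (hwn _ h1 _ h2) e3 (norm_nonneg _) (mul_nonneg hK0.le hη0)
    refine (add_le_add e6 e7).trans (le_of_eq ?_)
    ring
  have hb2 : ‖∫ p in Q, logKernel C.path p.1 p.2 * (Δ p.1 * Δ p.2)‖ ≤ A * (μ * η) ^ 2 := by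
    rw [hA, ← MeasureTheory.integral_mul_const]
    refine MeasureTheory.norm_integral_le_of_norm_le (hkint.norm.mul_const _) ?_
    refine MeasureTheory.ae_restrict_of_forall_mem hQmeas fun p hp => ?_
    obtain ⟨h1, h2⟩ := hpt p hp
    rw [norm_mul, norm_mul, sq]
    exact mul_le_mul_of_nonneg_left (mul_le_mul (hΔ _ h1) (hΔ _ h2) (norm_nonneg _)
      (mul_nonneg hμ0 hη0)) (norm_nonneg _)
  have hb3 : ‖∫ s in (C.left 0)..C.lastMark, (C.W.eval (C₁.path s) * C₁.mass s - C.W.eval (C.path s) * C.mass s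
      - C.W.eval (C.path s) * Δ s - δ s * C.mass s * (derivative C.W).eval (C.path s))‖
      ≤ ((KW * (N + μ) + D * μ) * η ^ 2) * |C.lastMark - C.left 0| := by
    refine intervalIntegral.norm_integral_le_of_norm_le_const fun s hs => ?_
    rw [Set.uIoc_of_le hab] at hs
    have h1 : s ∈ Set.Icc (C.left 0) C.lastMark := Set.Ioc_subset_Icc_self hs
    have h2 : ‖δ s‖ ≤ η := hpert.norm_sub_le s ⟨h1.1, h1.2.trans hB.le⟩
    have e1 : C.W.eval (C₁.path s) * C₁.mass s - C.W.eval (C.path s) * C.mass s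
        - C.W.eval (C.path s) * Δ s - δ s * C.mass s * (derivative C.W).eval (C.path s)
        = (C.W.eval (C.path s + δ s) - C.W.eval (C.path s)
            - (derivative C.W).eval (C.path s) * δ s) * C₁.mass s
          + (derivative C.W).eval (C.path s) * (δ s * Δ s) := by
      have : C.path s + δ s = C₁.path s := by simp only [hδ]; ring
      rw [this]
      simp only [hΔdef]; ring
    rw [e1]
    refine (norm_add_le _ _).trans ?_
    rw [norm_mul, norm_mul, norm_mul (δ s)]
    have e2 := (hKW (C.path s) (δ s) (hR s h1) (h2.trans hη1)).trans
      (mul_le_mul_of_nonneg_left (pow_le_pow_left₀ (norm_nonneg _) h2 2) hKW0)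
    have e3 := mul_le_mul e2 (hm₁n s h1) (norm_nonneg _) (by positivity)
    have e4 := mul_le_mul (hD s h1) (mul_le_mul h2 (hΔ s h1) (norm_nonneg _) hη0)
      (by positivity) hD0
    refine (add_le_add e3 e4).trans (le_of_eq ?_)
    ring
  refine (norm_sub_le _ _).trans ((add_le_add ((norm_add_le _ _).trans (add_le_add hb1 hb2))
    hb3).trans (le_of_eq ?_))
  ring

end MarkedCurve

/-! ### The derivative of the free energy along a family of curves. -/

theorem exists_norm_sub_le_of_contDiffOn {Ψ : ℂ × ℝ → ℂ} {ρ : ℝ} (hρ : 0 < ρ)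
    (hΨ : ContDiffOn ℝ 1 Ψ (Metric.ball 0 ρ ×ˢ Set.univ)) (A B : ℝ) :
    ∃ Λ : ℝ, ∀ h : ℂ, ‖h‖ ≤ ρ / 2 → ∀ s ∈ Set.Icc A B, ‖Ψ (h, s) - Ψ (0, s)‖ ≤ Λ * ‖h‖ := by
  have hopen : IsOpen (Metric.ball (0 : ℂ) ρ ×ˢ (Set.univ : Set ℝ)) :=
    Metric.isOpen_ball.prod isOpen_univ
  set T : Set (ℂ × ℝ) := Metric.closedBall 0 (ρ / 2) ×ˢ Set.Icc A B with hT
  have hsub : T ⊆ Metric.ball (0 : ℂ) ρ ×ˢ (Set.univ : Set ℝ) :=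
    Set.prod_mono (Metric.closedBall_subset_ball (by linarith)) (Set.subset_univ _)
  have hcpt : IsCompact T := (isCompact_closedBall _ _).prod isCompact_Icc
  obtain ⟨Λ, hΛ⟩ := hcpt.exists_bound_of_continuousOn
    ((hΨ.continuousOn_fderiv_of_isOpen hopen le_rfl).mono hsub)
  refine ⟨Λ, fun h hh s hs => ?_⟩
  have hconv : Convex ℝ T := (convex_closedBall _ _).prod (convex_Icc _ _)
  have := hconv.norm_image_sub_le_of_norm_fderiv_le (𝕜 := ℝ) (f := Ψ) (C := Λ)
    (fun x hx => (hΨ.differentiableOn one_ne_zero).differentiableAt (hopen.mem_nhds (hsub hx)))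
    hΛ (x := (0, s)) (y := (h, s)) ⟨by simp; linarith, hs⟩ ⟨by simpa using hh, hs⟩
  simpa [Prod.norm_def] using this

namespace MarkedCurve

variable {g : ℕ} {C : MarkedCurve g} (hC : C.IsValid)

include hC

theorem sum_filling : ∑ i, C.filling i = C.t := by
  rw [← integral_mass hC, integral_eq_sum_cuts hC (fun s hs => mass_eq_zero hC hs)
    (fun i => (continuous_mass hC).continuousOn) le_rfl le_rfl]
  exact Finset.sum_congr rfl fun i _ => filling_eq hC i

/-- If the filling fractions `S̃` agree, only the last filling changes. -/
theorem integral_effPotential_mul_mass_sub {C₁ : MarkedCurve g} (hC₁ : C₁.IsValid)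
    (hl : C₁.left = C.left) (hr : C₁.right = C.right) (hS : C₁.fillingSum = C.fillingSum) :
    ∫ s in (C.left 0)..C.lastMark, C.effPotential s * (C₁.mass s - C.mass s)
      = C.effPotential C.lastMark * (C₁.t - C.t) := by
  have hsum : ∫ s in (C.left 0)..C.lastMark, C.effPotential s * (C₁.mass s - C.mass s)
      = ∑ i, C.effPotential (C.right i) * (C₁.filling i - C.filling i) := by
    rw [integral_eq_sum_cuts hC (fun s hs => by
      rw [mass_eq_zero hC hs, mass_eq_zero hC₁ (by rw [hl, hr]; exact hs), sub_zero, mul_zero])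
      (fun i => ?_) le_rfl le_rfl]
    · refine Finset.sum_congr rfl fun i _ => ?_
      rw [filling_eq hC, filling_eq hC₁, hl, hr, ← intervalIntegral.integral_sub
        ((continuous_mass hC₁).intervalIntegrable _ _) ((continuous_mass hC).intervalIntegrable _ _),
        ← intervalIntegral.integral_const_mul]
      refine intervalIntegral.integral_congr fun s hs => ?_
      rw [Set.uIcc_of_le (hC.left_lt_right i).le] at hs
      rw [effPotential_of_mem hC hs]
    · refine ContinuousOn.congr (f := fun s => C.effPotential (C.right i)
        * (C₁.mass s - C.mass s)) ?_ fun s hs => by rw [effPotential_of_mem hC hs]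
      exact (continuous_const.mul ((continuous_mass hC₁).sub (continuous_mass hC))).continuousOn
  set d : Fin (g + 1) → ℂ := fun i => C₁.filling i - C.filling i with hd
  -- The partial sums S̃ determine every filling but the last, by strong induction on the index.
  have hdz : ∀ n : ℕ, ∀ hn : n < g, d (Fin.castSucc ⟨n, hn⟩) = 0 := by
    intro n
    induction n using Nat.strong_induction_on with
    | _ n ih =>
      intro hn
      have h1 : ∑ j ∈ Finset.Iic (Fin.castSucc ⟨n, hn⟩), d j = 0 := by
        rw [hd, Finset.sum_sub_distrib]
        exact sub_eq_zero.2 (congrFun hS ⟨n, hn⟩)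
      rw [← Finset.Iio_insert, Finset.sum_insert (by simp)] at h1
      rw [Finset.sum_eq_zero fun j hj => ?_, add_zero] at h1
      · exact h1
      · have hj' : (j : ℕ) < n := by simpa [Fin.lt_def] using hj
        exact ih j hj' (hj'.trans hn)
  -- The fillings add up to t, so the last one absorbs the whole increment.
  have hdl : d (Fin.last g) = C₁.t - C.t := by
    rw [← sum_filling hC, ← sum_filling hC₁, ← Finset.sum_sub_distrib, Fin.sum_univ_castSucc,
      Finset.sum_eq_zero fun (i : Fin g) _ => hdz i.1 i.2, zero_add]
  rw [hsum, Fin.sum_univ_castSucc, Finset.sum_eq_zero fun (i : Fin g) _ => by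
    rw [show C₁.filling i.castSucc - C.filling i.castSucc = 0 from hdz i.1 i.2, mul_zero], zero_add]
  rw [← hdl, lastMark]

end MarkedCurve

namespace CurveFamily

variable {g : ℕ} {W : ℂ[X]} (F : CurveFamily g W)

/-- Joint smoothness makes the path and its derivative along the parameter line Lipschitz in t on
compact intervals. Real smoothness in t suffices for this. -/
theorem exists_isPathPerturbation {t : ℂ} {S : Fin g → ℂ} (h₀ : (t, S) ∈ F.U) (a : ℝ) :
    ∃ s₀ : ℝ, ∀ B, s₀ ≤ B → ∃ Λ ρ : ℝ, 0 < ρ ∧ ∀ h : ℂ, ‖h‖ ≤ ρ → (t + h, S) ∈ F.U ∧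
      IsPathPerturbation (F.curve (t, S)).path (F.curve (t + h, S)).path a B (Λ * ‖h‖) := by
  obtain ⟨s₀, htail⟩ := F.tail
  refine ⟨s₀, fun B hB => ?_⟩
  have hcont : Continuous fun h : ℂ => (t + h, S) := by fun_prop
  obtain ⟨ρ, hρ, hball⟩ := Metric.isOpen_iff.1 (F.isOpen.preimage hcont) 0
    (by simpa using h₀)
  set Γ : ℂ × ℝ → ℂ := fun q => (F.curve (t + q.1, S)).path q.2 with hΓ
  have hopen : IsOpen (Metric.ball (0 : ℂ) ρ ×ˢ (Set.univ : Set ℝ)) :=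
    Metric.isOpen_ball.prod isOpen_univ
  have hsm : ContDiffOn ℝ ∞ Γ (Metric.ball 0 ρ ×ˢ Set.univ) := by
    refine F.smooth.comp (f := fun q : ℂ × ℝ => ((t + q.1, S), q.2)) ?_ fun q hq =>
      ⟨hball hq.1, trivial⟩
    exact (by fun_prop : ContDiff ℝ ∞ fun q : ℂ × ℝ => ((t + q.1, S), q.2)).contDiffOn
  have hderiv : ∀ h ∈ Metric.ball (0 : ℂ) ρ, ∀ s : ℝ,
      deriv (F.curve (t + h, S)).path s = fderiv ℝ Γ (h, s) (0, 1) := by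
    intro h hh s
    have h1 : HasFDerivAt Γ (fderiv ℝ Γ (h, s)) (h, s) :=
      ((hsm.differentiableOn (by simp)).differentiableAt
        (hopen.mem_nhds ⟨hh, trivial⟩)).hasFDerivAt
    have h2 : HasDerivAt (fun s : ℝ => (h, s)) ((0 : ℂ), (1 : ℝ)) s :=
      (hasDerivAt_const s h).prodMk (hasDerivAt_id s)
    exact (h1.comp_hasDerivAt s h2).deriv
  have hsm' : ContDiffOn ℝ 1 (fun q => fderiv ℝ Γ q (0, 1)) (Metric.ball 0 ρ ×ˢ Set.univ) :=
    (hsm.fderiv_of_isOpen hopen (m := 1) (by norm_cast)).clm_apply contDiffOn_const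
  obtain ⟨Λ₁, h₁⟩ := exists_norm_sub_le_of_contDiffOn hρ (hsm.of_le (by norm_cast)) a B
  obtain ⟨Λ₂, h₂⟩ := exists_norm_sub_le_of_contDiffOn hρ hsm' a B
  refine ⟨max Λ₁ Λ₂, ρ / 2, by positivity, fun h hh => ?_⟩
  have hmem : h ∈ Metric.ball (0 : ℂ) ρ := by
    rw [mem_ball_zero_iff]; linarith
  have h0mem : (0 : ℂ) ∈ Metric.ball (0 : ℂ) ρ := by simpa using hρ
  have hU : (t + h, S) ∈ F.U := hball hmem
  refine ⟨hU, (F.valid _ hU).isRegularPath, fun s hs => htail _ hU s (hB.trans hs),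
    fun s hs => ?_, fun s hs => ?_⟩
  · have h3 := h₁ h hh s hs
    simp only [hΓ, add_zero] at h3
    exact h3.trans (mul_le_mul_of_nonneg_right (le_max_left _ _) (norm_nonneg _))
  · have h3 := h₂ h hh s hs
    rw [← hderiv h hmem, ← hderiv 0 h0mem, add_zero] at h3
    exact h3.trans (mul_le_mul_of_nonneg_right (le_max_right _ _) (norm_nonneg _))

/-- The derivative of the free energy with respect to `t` is the effective potential on the last
cut. -/
theorem hasDerivAt_freeEnergy {t : ℂ} {S : Fin g → ℂ} (h₀ : (t, S) ∈ F.U) :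
    HasDerivAt (fun τ : ℂ => (F.curve (τ, S)).freeEnergy)
      ((F.curve (t, S)).effPotential (F.curve (t, S)).lastMark) t := by
  set C := F.curve (t, S) with hCdef
  have hC : C.IsValid := F.valid _ h₀
  have hγ := hC.isRegularPath
  obtain ⟨s₀, hs₀⟩ := F.exists_isPathPerturbation h₀ (C.left 0)
  obtain ⟨s₁, -, htail⟩ := hγ.exists_tail
  obtain ⟨R, hR⟩ := isCompact_Icc.exists_bound_of_continuousOn (s := Set.Icc (C.left 0) C.lastMark)
    hγ.continuous.continuousOn
  -- `B` lies in the common tail of the family and in the tail of the given path, beyond the last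
  -- mark, and at least 1 farther from the origin than the part of the path carrying the cuts.
  set B := max (max s₀ s₁) (max (C.lastMark + 1) (R + 1)) with hB
  obtain ⟨Λ, ρ, hρ, hpert⟩ := hs₀ B ((le_max_left _ _).trans (le_max_left _ _))
  have hBlast : C.lastMark < B :=
    (lt_add_one _).trans_le ((le_max_left _ _).trans (le_max_right _ _))
  obtain ⟨K, η₀, hη₀, hF⟩ := MarkedCurve.exists_norm_freeEnergy_sub_le hC hBlast
    (fun s hs => htail s (((le_max_right _ _).trans (le_max_left _ _)).trans hs))
    (fun s hs => (add_le_add_left (hR s hs) 1).trans ((le_max_right _ _).trans (le_max_right _ _)))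
  rw [hasDerivAt_iff_isLittleO_nhds_zero]
  -- The linear term is exactly the effective potential at the last mark times h, which is complex
  -- linear, and the remainder is quadratic in the displacement. So the derivative is complex
  -- although the path varies only real-smoothly.
  have hO : (fun h : ℂ => (F.curve (t + h, S)).freeEnergy - C.freeEnergy
      - h • C.effPotential C.lastMark) =O[𝓝 0] fun h : ℂ => ‖h‖ ^ 2 := by
    refine Asymptotics.IsBigO.of_bound (K * Λ ^ 2) ?_
    have hev : ∀ᶠ h : ℂ in 𝓝 0, Λ * ‖h‖ < η₀ := by
      have hc : Continuous fun h : ℂ => Λ * ‖h‖ := by fun_prop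
      exact (hc.tendsto 0).eventually_lt_const (by simpa using hη₀)
    filter_upwards [Metric.closedBall_mem_nhds (0 : ℂ) hρ, hev] with h hh hη
    obtain ⟨hU, hp⟩ := hpert h (by simpa using hh)
    have hC₁ := F.valid _ hU
    obtain ⟨hl, hr⟩ := F.marks _ hU _ h₀
    have h1 := hF (F.curve (t + h, S)) hC₁ ((F.potential _ hU).trans (F.potential _ h₀).symm)
      hl hr _ hη.le hp
    rw [MarkedCurve.integral_effPotential_mul_mass_sub hC hC₁ hl hr (by
      ext i
      rw [F.coord_S _ hU, hCdef, F.coord_S _ h₀]), F.coord_t _ hU, hCdef, F.coord_t _ h₀,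
      add_sub_cancel_left, ← hCdef] at h1
    rw [smul_eq_mul, mul_comm h, norm_pow, norm_norm]
    refine h1.trans (le_of_eq ?_)
    ring
  refine hO.trans_isLittleO ?_
  rw [← Asymptotics.isLittleO_norm_right]
  have := Asymptotics.isLittleO_pow_pow (𝕜 := ℝ) (m := 1) (n := 2) (by norm_num)
  have h2 := this.comp_tendsto (tendsto_norm_zero (E := ℂ))
  simpa [Function.comp_def] using h2

end CurveFamily

/-! ### Homotopy invariance for continuous homotopies -/

theorem IsPreconnected.eq_of_eventually_eq {X Y : Type*} [TopologicalSpace X] {s : Set X}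
    (hs : IsPreconnected s) {F : X → Y} (h : ∀ x ∈ s, ∀ᶠ y in 𝓝[s] x, F y = F x) {x y : X}
    (hx : x ∈ s) (hy : y ∈ s) : F x = F y := by
  have := Subtype.preconnectedSpace hs
  have hl : IsLocallyConstant fun z : s => F z := by
    refine (IsLocallyConstant.iff_eventually_eq _).2 fun z => ?_
    have := h z z.2
    rw [← map_nhds_subtype_val z] at this
    exact this
  exact hl.apply_eq_of_preconnectedSpace ⟨x, hx⟩ ⟨y, hy⟩

section Homotopy

variable {X ι : Type*} [TopologicalSpace X] {A : Set X} {V : ι → Set X} {P : ι → X → ℂ}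

theorem sub_eq_sub_of_primitives {Y : Type*} [TopologicalSpace Y] {e : Set Y}
    (hov : ∀ i j, ∀ z ∈ V i ∩ V j ∩ A, ∀ᶠ w in 𝓝[A] z, P i w - P j w = P i z - P j z)
    (he : IsPreconnected e) {c : Y → X} (hc : ContinuousOn c e) {i j : ι}
    (hi : ∀ r ∈ e, c r ∈ V i) (hj : ∀ r ∈ e, c r ∈ V j) (hA : ∀ r ∈ e, c r ∈ A) {u v : Y}
    (hu : u ∈ e) (hv : v ∈ e) :
    P i (c v) - P i (c u) = P j (c v) - P j (c u) := by
  have := he.eq_of_eventually_eq (F := fun r => P i (c r) - P j (c r)) (fun r hr =>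
    (tendsto_nhdsWithin_iff.2 ⟨hc r hr, eventually_mem_nhdsWithin.mono hA⟩).eventually
      (hov i j _ ⟨⟨hi r hr, hj r hr⟩, hA r hr⟩)) hu hv
  linear_combination -this

/-- Continuations of a multivalued primitive along two homotopic paths agree. -/
theorem sub_eq_sub_of_homotopy (hV : ∀ i, IsOpen (V i)) (hcover : A ⊆ ⋃ i, V i)
    (hov : ∀ i j, ∀ z ∈ V i ∩ V j ∩ A, ∀ᶠ w in 𝓝[A] z, P i w - P j w = P i z - P j z)
    (H : C(unitInterval × unitInterval, X)) (hA : ∀ q, H q ∈ A)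
    (h0 : ∀ q, H (q, 0) = H (0, 0)) (h1 : ∀ q, H (q, 1) = H (0, 1))
    {G₀ G₁ : unitInterval → ℂ}
    (hG₀ : ∀ i u v, u ≤ v → (∀ r ∈ Set.Icc u v, H (0, r) ∈ V i) →
      G₀ v - G₀ u = P i (H (0, v)) - P i (H (0, u)))
    (hG₁ : ∀ i u v, u ≤ v → (∀ r ∈ Set.Icc u v, H (1, r) ∈ V i) →
      G₁ v - G₁ u = P i (H (1, v)) - P i (H (1, u))) :
    G₀ 1 - G₀ 0 = G₁ 1 - G₁ 0 := by
  -- A Lebesgue number argument: each cell of the grid is mapped into a single set of the cover.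
  obtain ⟨t, ht0, htm, ⟨N, hN⟩, hgrid⟩ :=
    exists_monotone_Icc_subset_open_cover_unitInterval_prod_self (c := fun i => H ⁻¹' V i)
      (fun i => (hV i).preimage H.continuous) fun q _ => by
        simpa using hcover (hA q)
  choose κ hκ using hgrid
  have hmem : ∀ n m, ∀ x ∈ Set.Icc (t n) (t (n + 1)), ∀ y ∈ Set.Icc (t m) (t (m + 1)),
      H (x, y) ∈ V (κ n m) := fun n m x hx y hy => hκ n m ⟨hx, hy⟩
  have hle : ∀ n, t n ≤ t (n + 1) := fun n => htm n.le_succ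
  have hl : ∀ n, t n ∈ Set.Icc (t n) (t (n + 1)) := fun n => ⟨le_rfl, hle n⟩
  have hr : ∀ n, t (n + 1) ∈ Set.Icc (t n) (t (n + 1)) := fun n => ⟨hle n, le_rfl⟩
  -- `row n k` adds the increments along the n-th intermediate path, measured with the primitives of
  -- the k-th strip of cells. Changing the strip costs nothing by `htop`. Changing the path within a
  -- strip gives a telescoping sum, which vanishes because the end points are fixed.
  set row : ℕ → ℕ → ℂ := fun n k => ∑ m ∈ Finset.range N,
    (P (κ k m) (H (t n, t (m + 1))) - P (κ k m) (H (t n, t m))) with hrow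
  have htop : ∀ n, row (n + 1) n = row (n + 1) (n + 1) := fun n =>
    Finset.sum_congr rfl fun m _ => sub_eq_sub_of_primitives hov (isPreconnected_Icc)
      (c := fun y => H (t (n + 1), y)) (by fun_prop) (fun y hy => hmem n m _ (hr n) y hy)
      (fun y hy => hmem (n + 1) m _ (hl _) y hy) (fun y _ => hA _) (hl m) (hr m)
  have hcell : ∀ n, row (n + 1) n = row n n := by
    intro n
    set v : ℕ → ℂ := fun m =>
      P (κ n m) (H (t (n + 1), t m)) - P (κ n m) (H (t n, t m)) with hv
    have hv' : ∀ m, P (κ n m) (H (t (n + 1), t (m + 1))) - P (κ n m) (H (t n, t (m + 1)))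
        = v (m + 1) := fun m =>
      sub_eq_sub_of_primitives hov (isPreconnected_Icc) (c := fun x => H (x, t (m + 1)))
        (by fun_prop) (fun x hx => hmem n m x hx _ (hr m))
        (fun x hx => hmem n (m + 1) x hx _ (hl _)) (fun _ _ => hA _) (hl n) (hr n)
    have htel : row (n + 1) n - row n n = ∑ m ∈ Finset.range N, (v (m + 1) - v m) := by
      rw [hrow, ← Finset.sum_sub_distrib]
      refine Finset.sum_congr rfl fun m _ => ?_
      rw [← hv' m]
      simp only [hv]
      ring
    rw [Finset.sum_range_sub] at htel
    have hv0 : v 0 = 0 := by simp only [hv, ht0, h0 (t (n + 1)), h0 (t n), sub_self]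
    have hvN : v N = 0 := by
      simp only [hv, hN N le_rfl, h1 (t (n + 1)), h1 (t n), sub_self]
    rw [hv0, hvN, sub_zero] at htel
    exact sub_eq_zero.1 htel
  have hall : ∀ n, row n n = row 0 0 := by
    intro n
    induction n with
    | zero => rfl
    | succ n ih => rw [← htop, hcell, ih]
  have h₀ : row 0 0 = G₀ 1 - G₀ 0 := by
    rw [← hN N le_rfl, ← ht0, ← Finset.sum_range_sub (fun m => G₀ (t m))]
    refine Finset.sum_congr rfl fun m _ => ?_
    rw [ht0, ← hG₀ (κ 0 m) _ _ (hle m)]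
    intro y hy
    have := hmem 0 m (t 0) (hl 0) y hy
    rwa [ht0] at this
  have h₁ : row N N = G₁ 1 - G₁ 0 := by
    conv_rhs => rw [← hN N le_rfl, ← ht0, ← Finset.sum_range_sub (fun m => G₁ (t m))]
    refine Finset.sum_congr rfl fun m _ => ?_
    rw [hN N le_rfl, ← hG₁ (κ N m) _ _ (hle m)]
    intro y hy
    have := hmem N m (t N) (hl N) y hy
    rwa [hN N le_rfl] at this
  rw [← h₀, ← h₁, hall N]

end Homotopy

/-! ### Local primitives of `y dx` on `y² = p(x)` -/

theorem exists_analyticAt_sqrt {h : ℂ → ℂ} {x₀ y₀ : ℂ} (hh : AnalyticAt ℂ h x₀) (hy : y₀ ≠ 0)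
    (hp : y₀ ^ 2 = h x₀) :
    ∃ s : ℂ → ℂ, s x₀ = y₀ ∧ AnalyticAt ℂ s x₀ ∧ ∀ᶠ x in 𝓝 x₀, s x ^ 2 = h x := by
  have hy2 : y₀ ^ 2 ≠ 0 := pow_ne_zero 2 hy
  have ha : AnalyticAt ℂ (fun x => h x / y₀ ^ 2) x₀ := hh.div analyticAt_const hy2
  have h1 : h x₀ / y₀ ^ 2 = 1 := by rw [← hp, div_self hy2]
  refine ⟨fun x => y₀ * Complex.exp (Complex.log (h x / y₀ ^ 2) / 2), by simp [h1], ?_, ?_⟩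
  · have : AnalyticAt ℂ (fun x => Complex.log (h x / y₀ ^ 2)) x₀ :=
      ha.clog (by rw [h1]; exact Complex.one_mem_slitPlane)
    fun_prop (disch := norm_num)
  · have : ∀ᶠ x in 𝓝 x₀, h x / y₀ ^ 2 ≠ 0 :=
      ha.continuousAt.eventually_ne (by rw [h1]; exact one_ne_zero)
    filter_upwards [this] with x hx
    rw [mul_pow, ← Complex.exp_nat_mul, show ((2 : ℕ) : ℂ) * (Complex.log (h x / y₀ ^ 2) / 2)
      = Complex.log (h x / y₀ ^ 2) by push_cast; ring, Complex.exp_log hx]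
    field_simp

/-- On `V`, the function `Φ` is a primitive of `y dx` along the curve `y² = p(x)`. -/
structure IsLocalPrimitive (p : ℂ[X]) (V : Set (ℂ × ℂ)) (Φ : ℂ × ℂ → ℂ) : Prop where
  isOpen : IsOpen V
  continuousOn : ContinuousOn Φ V
  hasDerivAt : ∀ (s : ℂ → ℂ) (x : ℂ), DifferentiableAt ℂ s x → (∀ᶠ x' in 𝓝 x, s x' ^ 2 = p.eval x')
    → s x ≠ 0 → (x, s x) ∈ V → HasDerivAt (fun x' => Φ (x', s x')) (s x) x

namespace IsLocalPrimitive

variable {p : ℂ[X]}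

/-- Here x is a local coordinate, and a primitive of a holomorphic root serves. The ball of radius
|y₀| about y₀ contains neither 0 nor a pair ±y, so it selects one sheet. -/
theorem exists_of_ne {x₀ y₀ : ℂ} (h : y₀ ^ 2 = p.eval x₀) (hy : y₀ ≠ 0) :
    ∃ V Φ, IsLocalPrimitive p V Φ ∧ (x₀, y₀) ∈ V ∧ ∀ q ∈ V, q.2 ≠ 0 := by
  obtain ⟨s₀, hs₀, hsa, hsq⟩ := exists_analyticAt_sqrt (h := fun x => p.eval x)
    (by simpa using (analyticAt_id (z := x₀)).aeval_polynomial p) hy h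
  have hev : ∀ᶠ x in 𝓝 x₀, s₀ x ^ 2 = p.eval x ∧ DifferentiableAt ℂ s₀ x ∧
      s₀ x ∈ Metric.ball y₀ ‖y₀‖ := by
    refine hsq.and ((hsa.eventually_analyticAt.mono fun x hx => hx.differentiableAt).and ?_)
    refine hsa.continuousAt.eventually (Metric.isOpen_ball.mem_nhds ?_)
    rw [hs₀]
    exact Metric.mem_ball_self (norm_pos_iff.2 hy)
  obtain ⟨r, hr, hball⟩ := Metric.eventually_nhds_iff_ball.1 hev
  have hd : DifferentiableOn ℂ s₀ (Metric.ball x₀ r) := fun x hx =>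
    (hball x hx).2.1.differentiableWithinAt
  obtain ⟨G, hG⟩ := hd.isExactOn_ball
  refine ⟨Metric.ball x₀ r ×ˢ Metric.ball y₀ ‖y₀‖, fun q => G q.1,
    ⟨Metric.isOpen_ball.prod Metric.isOpen_ball, ?_, ?_⟩, ?_, ?_⟩
  · have hGc : ContinuousOn G (Metric.ball x₀ r) := fun x hx =>
      (hG x hx).continuousAt.continuousWithinAt
    exact hGc.comp (f := Prod.fst) continuousOn_fst fun q hq => hq.1
  · intro s x _ hs _ hx
    have hsx : s x = s₀ x := by
      have h2 : s x ^ 2 = s₀ x ^ 2 := by rw [hs.self_of_nhds, (hball x hx.1).1]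
      rcases sq_eq_sq_iff_eq_or_eq_neg.1 h2 with h3 | h3
      · exact h3
      · exfalso
        have h4 : ‖s x - y₀‖ < ‖y₀‖ := by simpa [dist_eq_norm] using hx.2
        have h5 : ‖s₀ x - y₀‖ < ‖y₀‖ := by simpa [dist_eq_norm] using (hball x hx.1).2.2
        have h6 : (2 : ℂ) * y₀ = -(s x - y₀) - (s₀ x - y₀) := by rw [h3]; ring
        have h7 : ‖(2 : ℂ) * y₀‖ ≤ ‖s x - y₀‖ + ‖s₀ x - y₀‖ := by
          rw [h6]
          exact (norm_sub_le _ _).trans (by rw [norm_neg])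
        rw [norm_mul, Complex.norm_ofNat] at h7
        linarith
    rw [hsx]
    exact hG x hx.1
  · exact ⟨Metric.mem_ball_self hr, Metric.mem_ball_self (norm_pos_iff.2 hy)⟩
  · rintro ⟨x, y⟩ hq rfl
    simpa [dist_eq_norm] using hq.2

/-- At a branch point y is the coordinate. With g a local inverse of p one has x = g(y²), and y dx
becomes 2y²g'(y²) dy, which is holomorphic. Hence homotopies may pass through branch points. -/
theorem exists_of_eq_zero {a : ℂ} (h : p.eval a = 0) (hp : (derivative p).eval a ≠ 0) :
    ∃ V Φ, IsLocalPrimitive p V Φ ∧ (a, 0) ∈ V ∧ ∀ q ∈ V, q.2 ^ 2 = p.eval q.1 → q.2 = 0 → q.1 = a := by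
  have hpa : AnalyticAt ℂ (fun x => p.eval x) a := by
    simpa using (analyticAt_id (z := a)).aeval_polynomial p
  have hp' : deriv (fun x => p.eval x) a ≠ 0 := by rwa [p.deriv]
  set g := hpa.hasStrictDerivAt.localInverse _ _ _ hp' with hg
  have hga : AnalyticAt ℂ g 0 := h ▸ hpa.analyticAt_localInverse hp'
  have hgl : ∀ᶠ x in 𝓝 a, g (p.eval x) = x :=
    HasStrictDerivAt.eventually_left_inverse hpa.hasStrictDerivAt hp'
  have hg0 : g 0 = a := by simpa [h] using hgl.self_of_nhds
  obtain ⟨r, hr, hball⟩ := Metric.eventually_nhds_iff_ball.1 hgl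
  have hsq : ∀ᶠ y in 𝓝 (0 : ℂ), AnalyticAt ℂ g (y ^ 2) := by
    have hc : Tendsto (fun y : ℂ => y ^ 2) (𝓝 0) (𝓝 0) := by
      simpa using (continuous_pow (M := ℂ) 2).tendsto 0
    exact hc.eventually hga.eventually_analyticAt
  obtain ⟨δ, hδ, hδb⟩ := Metric.eventually_nhds_iff_ball.1 hsq
  have hd : DifferentiableOn ℂ (fun y => 2 * y ^ 2 * deriv g (y ^ 2)) (Metric.ball 0 δ) := by
    intro y hy
    have h1 : DifferentiableAt ℂ (deriv g) (y ^ 2) := (hδb y hy).deriv.differentiableAt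
    have h2 : DifferentiableAt ℂ (fun y => deriv g (y ^ 2)) y :=
      h1.comp (f := fun y : ℂ => y ^ 2) y (by fun_prop)
    exact ((by fun_prop : DifferentiableAt ℂ (fun y : ℂ => 2 * y ^ 2) y).mul
      h2).differentiableWithinAt
  obtain ⟨G, hG⟩ := hd.isExactOn_ball
  refine ⟨Metric.ball a r ×ˢ Metric.ball 0 δ, fun q => G q.2,
    ⟨Metric.isOpen_ball.prod Metric.isOpen_ball, ?_, ?_⟩, ?_, ?_⟩
  · have hGc : ContinuousOn G (Metric.ball 0 δ) := fun x hx =>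
      (hG x hx).continuousAt.continuousWithinAt
    exact hGc.comp (f := Prod.snd) continuousOn_snd fun q hq => hq.2
  · intro s x hds hs _ hx
    have hpx : p.eval x = s x ^ 2 := hs.self_of_nhds.symm
    have h1 : HasDerivAt (fun x' => s x' ^ 2) (2 * s x * deriv s x) x := by
      simpa using hds.hasDerivAt.fun_pow 2
    have h2 : (derivative p).eval x = 2 * s x * deriv s x :=
      (p.hasDerivAt x).unique (h1.congr_of_eventuallyEq (hs.mono fun _ h => h.symm))
    have hgd : HasDerivAt g (deriv g (p.eval x)) (p.eval x) := by
      rw [hpx]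
      exact (hδb _ hx.2).differentiableAt.hasDerivAt
    have h3 : deriv g (p.eval x) * (derivative p).eval x = 1 := by
      refine (hgd.comp x (p.hasDerivAt x)).unique ((hasDerivAt_id x).congr_of_eventuallyEq ?_)
      filter_upwards [Metric.isOpen_ball.mem_nhds hx.1] with z hz using hball z hz
    have h4 := (hG _ hx.2).comp x hds.hasDerivAt
    have h5 : 2 * s x ^ 2 * deriv g (s x ^ 2) * deriv s x = s x := by
      rw [h2, hpx] at h3
      linear_combination s x * h3
    rw [h5] at h4
    exact h4
  · exact ⟨Metric.mem_ball_self hr, Metric.mem_ball_self hδ⟩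
  · rintro ⟨x, y⟩ hq hxy rfl
    have h0 : p.eval x = 0 := by simpa using hxy.symm
    have := hball x hq.1
    rw [h0, hg0] at this
    exact this.symm

variable {V V' : Set (ℂ × ℂ)} {Φ Φ' : ℂ × ℂ → ℂ}

theorem exists_section {x₀ y₀ : ℂ} (h : y₀ ^ 2 = p.eval x₀) (hy : y₀ ≠ 0) :
    ∃ s : ℂ → ℂ, s x₀ = y₀ ∧ AnalyticAt ℂ s x₀ ∧ (∀ᶠ x in 𝓝 x₀, s x ^ 2 = p.eval x) ∧
      ∀ᶠ q in 𝓝[{q : ℂ × ℂ | q.2 ^ 2 = p.eval q.1}] (x₀, y₀), q.2 = s q.1 := by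
  obtain ⟨s, hs₀, hsa, hsq⟩ := exists_analyticAt_sqrt (h := fun x => p.eval x)
    (by simpa using (analyticAt_id (z := x₀)).aeval_polynomial p) hy h
  refine ⟨s, hs₀, hsa, hsq, ?_⟩
  have h1 : Tendsto (fun q : ℂ × ℂ => q.2 + s q.1) (𝓝 (x₀, y₀)) (𝓝 (y₀ + y₀)) := by
    have : ContinuousAt (fun q : ℂ × ℂ => s q.1) (x₀, y₀) :=
      ContinuousAt.comp (f := Prod.fst) (g := s) hsa.continuousAt continuousAt_fst
    have h2 : ContinuousAt (fun q : ℂ × ℂ => q.2 + s q.1) (x₀, y₀) := continuousAt_snd.add this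
    simpa [ContinuousAt, hs₀] using h2
  have h2 : ∀ᶠ q : ℂ × ℂ in 𝓝 (x₀, y₀), q.2 + s q.1 ≠ 0 :=
    h1.eventually_ne (by rw [← two_mul]; exact mul_ne_zero two_ne_zero hy)
  have h3 : ∀ᶠ q : ℂ × ℂ in 𝓝 (x₀, y₀), s q.1 ^ 2 = p.eval q.1 :=
    (continuous_fst.tendsto (x₀, y₀)).eventually hsq
  filter_upwards [nhdsWithin_le_nhds h2, nhdsWithin_le_nhds h3, self_mem_nhdsWithin]
    with q hq hq3 hqA
  have h4 : (q.2 + s q.1) * (q.2 - s q.1) = 0 := by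
    have : q.2 ^ 2 = p.eval q.1 := hqA
    linear_combination this - hq3
  exact sub_eq_zero.1 ((mul_eq_zero.1 h4).resolve_left hq)

/-- Two local primitives differ by a locally constant function away from the branch points. -/
theorem eventually_sub_eq (hΦ : IsLocalPrimitive p V Φ) (hΦ' : IsLocalPrimitive p V' Φ')
    {z : ℂ × ℂ} (hz : z ∈ V) (hz' : z ∈ V') (hp : z.2 ^ 2 = p.eval z.1) (hne : z.2 ≠ 0) :
    ∀ᶠ w in 𝓝[{q : ℂ × ℂ | q.2 ^ 2 = p.eval q.1}] z, Φ w - Φ' w = Φ z - Φ' z := by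
  obtain ⟨s, hs₀, hsa, hsq, hsec⟩ := exists_section hp hne
  have hmem : ∀ᶠ x in 𝓝 z.1, (x, s x) ∈ V ∩ V' := by
    have hc : ContinuousAt (fun x => (x, s x)) z.1 := continuousAt_id.prodMk hsa.continuousAt
    refine hc.eventually ((hΦ.isOpen.inter hΦ'.isOpen).mem_nhds ?_)
    simp only [hs₀]
    exact ⟨hz, hz'⟩
  have hne' : ∀ᶠ x in 𝓝 z.1, s x ≠ 0 := hsa.continuousAt.eventually_ne (by rwa [hs₀])
  obtain ⟨r, hr, hball⟩ := Metric.eventually_nhds_iff_ball.1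
    (hsq.eventually_nhds.and (hsa.eventually_analyticAt.and (hmem.and hne')))
  have hd : ∀ x ∈ Metric.ball z.1 r,
      HasDerivAt (fun x => Φ (x, s x) - Φ' (x, s x)) 0 x := by
    intro x hx
    obtain ⟨h1, h2, h3, h4⟩ := hball x hx
    have := (hΦ.hasDerivAt s x h2.differentiableAt h1 h4 h3.1).sub
      (hΦ'.hasDerivAt s x h2.differentiableAt h1 h4 h3.2)
    rwa [sub_self] at this
  have hconst : ∀ x ∈ Metric.ball z.1 r, Φ (x, s x) - Φ' (x, s x) = Φ z - Φ' z := by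
    intro x hx
    have := (convex_ball z.1 r).is_const_of_fderivWithin_eq_zero (𝕜 := ℂ)
      (fun x hx => (hd x hx).differentiableAt.differentiableWithinAt) (fun x hx => by
        rw [fderivWithin_of_isOpen Metric.isOpen_ball hx]
        ext
        simpa using (hd x hx).deriv) hx (Metric.mem_ball_self hr)
    simpa [hs₀] using this
  have hb : ∀ᶠ w : ℂ × ℂ in 𝓝 z, w.1 ∈ Metric.ball z.1 r :=
    continuousAt_fst.eventually (Metric.isOpen_ball.mem_nhds (Metric.mem_ball_self hr))
  filter_upwards [hsec, nhdsWithin_le_nhds hb] with w hw hwb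
  have := hconst w.1 hwb
  rwa [← hw] at this

/-- The increment of a local primitive along a piecewise differentiable path. -/
theorem sub_eq_sub (hΦ : IsLocalPrimitive p V Φ) {u v : ℝ} (huv : u ≤ v) {c : ℝ → ℂ × ℂ}
    {G x' : ℝ → ℂ} {E : Set ℝ} (hE : E.Countable) (hc : ContinuousOn c (Set.Icc u v))
    (hG : ContinuousOn G (Set.Icc u v)) (hV : ∀ r ∈ Set.Icc u v, c r ∈ V)
    (hA : ∀ r ∈ Set.Icc u v, (c r).2 ^ 2 = p.eval (c r).1)
    (hne : ∀ r ∈ Set.Ioo u v \ E, (c r).2 ≠ 0)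
    (hx : ∀ r ∈ Set.Ioo u v \ E, HasDerivAt (fun r => (c r).1) (x' r) r)
    (hGd : ∀ r ∈ Set.Ioo u v \ E, HasDerivAt G ((c r).2 * x' r) r) :
    G v - G u = Φ (c v) - Φ (c u) := by
  have h0 := MeasureTheory.integral_eq_of_hasDerivAt_off_countable_of_le
    (fun r => G r - Φ (c r)) (fun _ => 0) huv hE (hG.sub (hΦ.continuousOn.comp hc hV)) ?_
    (by simp)
  · rw [intervalIntegral.integral_zero] at h0
    linear_combination -h0
  · intro r hr
    have hr' : r ∈ Set.Icc u v := Set.Ioo_subset_Icc_self hr.1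
    have hnhds : Set.Icc u v ∈ 𝓝 r := Icc_mem_nhds hr.1.1 hr.1.2
    obtain ⟨s, hs₀, hsa, hsq, hsec⟩ := exists_section (hA r hr') (hne r hr)
    have hct : Tendsto c (𝓝 r) (𝓝[{q : ℂ × ℂ | q.2 ^ 2 = p.eval q.1}] (c r)) :=
      tendsto_nhdsWithin_iff.2 ⟨(hc r hr').continuousAt hnhds, by
        filter_upwards [hnhds] with r hr using hA r hr⟩
    have hev : ∀ᶠ r' in 𝓝 r, (c r').2 = s (c r').1 := hct.eventually hsec
    have h1 := hΦ.hasDerivAt s (c r).1 hsa.differentiableAt hsq (by rw [hs₀]; exact hne r hr)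
      (by rw [hs₀]; exact hV r hr')
    have h2 : HasDerivAt (fun r => Φ (c r)) (s (c r).1 * x' r) r := by
      refine (h1.comp r (hx r hr)).congr_of_eventuallyEq ?_
      filter_upwards [hev] with r' hr'
      simp only [Function.comp, ← hr']
    rw [hs₀] at h2
    have h3 : HasDerivAt (fun r => G r - Φ (c r)) _ r := (hGd r hr).sub h2
    rwa [sub_self] at h3

end IsLocalPrimitive

/-! ### The integral of `y dx` over `β̂` -/

namespace MarkedCurve

variable {g : ℕ} {C : MarkedCurve g} (hC : C.IsValid)
include hC

theorem separable_ySq : C.ySq.Separable := by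
  have h : C.ySq = ∏ k : Fin (g + 1) ⊕ Fin (g + 1),
      (X - Polynomial.C (C.path (Sum.elim C.left C.right k))) := by
    rw [hC.branch, Fintype.prod_sum_type, ← Finset.prod_mul_distrib]
    rfl
  rw [h, separable_prod_X_sub_C_iff]
  refine hC.path_injective.comp ?_
  have hne : ∀ i j, C.left i ≠ C.right j := by
    intro i j
    rcases lt_trichotomy i j with hij | rfl | hij
    · linarith [hC.right_lt_left i j hij, hC.left_lt_right i, hC.left_lt_right j]
    · exact (hC.left_lt_right i).ne
    · linarith [hC.right_lt_left j i hij]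
  rintro (i | i) (j | j) hij
  · simp only [Sum.elim_inl] at hij
    rcases lt_trichotomy i j with h | rfl | h
    · linarith [hC.right_lt_left i j h, hC.left_lt_right i]
    · rfl
    · linarith [hC.right_lt_left j i h, hC.left_lt_right j]
  · exact (hne i j hij).elim
  · exact (hne j i hij.symm).elim
  · simp only [Sum.elim_inr] at hij
    rcases lt_trichotomy i j with h | rfl | h
    · linarith [hC.right_lt_left i j h, hC.left_lt_right j]
    · rfl
    · linarith [hC.right_lt_left j i h, hC.left_lt_right i]

/-- The neighbourhood contains no branch point except possibly q. Two distinct charts therefore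
never overlap at a branch point, and their primitives are compared only where x is a coordinate. -/
theorem exists_localPrimitive {q : ℂ × ℂ} (hq : q ∈ C.affine) :
    ∃ V Φ, IsLocalPrimitive C.ySq V Φ ∧ q ∈ V ∧ ∀ z ∈ V, z ∈ C.affine → z.2 = 0 → z = q := by
  obtain ⟨x, y⟩ := q
  have hq' : y ^ 2 = C.ySq.eval x := hq
  by_cases hy : y = 0
  · subst hy
    have h0 : C.ySq.eval x = 0 := by rw [← hq']; simp
    have hd : (derivative C.ySq).eval x ≠ 0 := by
      have := (separable_ySq hC).aeval_derivative_ne_zero (x := x) (by simpa using h0)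
      simpa using this
    obtain ⟨V, Φ, h1, h2, h3⟩ := IsLocalPrimitive.exists_of_eq_zero h0 hd
    exact ⟨V, Φ, h1, h2, fun z hz hzA hz0 => Prod.ext (h3 z hz hzA hz0) hz0⟩
  · obtain ⟨V, Φ, h1, h2, h3⟩ := IsLocalPrimitive.exists_of_ne hq' hy
    exact ⟨V, Φ, h1, h2, fun z hz _ hz0 => (h3 z hz hz0).elim⟩

theorem y0_path_ne_zero {s : ℝ} (hs : C.lastMark < s) : C.y0 (C.path s) ≠ 0 := by
  rw [y0_path hC hs]
  exact prodBranch_ne_zero hC (path_notMem_cuts_of_lt hC hs)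

/-- The integral of `y dx` over any representative of `β̂`. -/
theorem curveIntegral_zeta {L : ℝ} (hL : C.lastMark < L)
    {b : Path ((L : ℂ), -C.y0 L) ((L : ℂ), C.y0 L)} (hb : C.IsBetaHat L b) :
    curveIntegral zeta b
      = 2 * ∫ s in C.lastMark..L, deriv C.path s * C.y0 (C.path s) := by
  obtain ⟨H, hHA, hH0, hH1, hHl, hHr⟩ := hb.homotopic
  choose V Φ hΦ hmem hbr using fun q : C.affine => exists_localPrimitive hC q.2
  set ℓ := L - C.lastMark with hℓ
  have hℓ0 : 0 < ℓ := sub_pos.2 hL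
  -- the primitive along `b`
  set K₀ : ℝ → ℂ := fun r => (b.extend r).2 * (derivWithin b.extend (Set.Icc 0 1) r).1 with hK₀
  have hK₀c : ContinuousOn K₀ (Set.Icc 0 1) :=
    (continuous_snd.comp b.continuous_extend).continuousOn.mul (continuous_fst.comp_continuousOn
      (hb.smooth.continuousOn_derivWithin (uniqueDiffOn_Icc zero_lt_one) le_rfl))
  have hK₀i : IntervalIntegrable K₀ MeasureTheory.volume 0 1 :=
    hK₀c.intervalIntegrable_of_Icc zero_le_one
  have hI₀ : curveIntegral zeta b = ∫ r in (0 : ℝ)..1, K₀ r := by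
    rw [curveIntegral_def]
    refine intervalIntegral.integral_congr fun r _ => ?_
    rw [curveIntegralFun_def]
    simp [zeta, hK₀]
  -- the primitive along the standard representative
  set F : ℝ → ℂ := fun s => deriv C.path s * C.meanBranch s with hF
  have hFc : Continuous F := hC.isRegularPath.continuous_deriv.mul (continuous_meanBranch hC)
  -- On the lower sheet both y and the direction of travel change sign, so the two halves share one
  -- integrand. The mean boundary value replaces y₀ because it is continuous also at the branch
  -- point.
  set K₁ : ℝ → ℂ := fun r => 2 * ℓ * F (C.lastMark + |2 * r - 1| * ℓ) with hK₁
  have hK₁c : Continuous K₁ := by fun_prop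
  have hI₁ : ∫ r in (0 : ℝ)..1, K₁ r
      = 2 * ∫ s in C.lastMark..L, deriv C.path s * C.y0 (C.path s) := by
    have hFy : ∫ s in C.lastMark..L, deriv C.path s * C.y0 (C.path s)
        = ∫ s in C.lastMark..L, F s := by
      refine intervalIntegral.integral_congr_ae (MeasureTheory.ae_of_all _ fun s hs => ?_)
      rw [Set.uIoc_of_le hL.le] at hs
      rw [hF, y0_path_eq_meanBranch hC hs.1]
    rw [hFy, ← intervalIntegral.integral_add_adjacent_intervals (b := 1 / 2)
      (hK₁c.intervalIntegrable _ _) (hK₁c.intervalIntegrable _ _)]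
    have h1 : ∫ r in (0 : ℝ)..(1 / 2), K₁ r = ∫ s in C.lastMark..L, F s := by
      have := intervalIntegral.smul_integral_comp_mul_add (a := 0) (b := 1 / 2) F (-(2 * ℓ)) L
      rw [show -(2 * ℓ) * 0 + L = L by ring,
        show -(2 * ℓ) * (1 / 2) + L = C.lastMark by rw [hℓ]; ring,
        intervalIntegral.integral_symm C.lastMark L, neg_smul, neg_inj, Complex.real_smul] at this
      rw [← this, ← intervalIntegral.integral_const_mul]
      refine intervalIntegral.integral_congr fun r hr => ?_
      rw [Set.uIcc_of_le (by norm_num)] at hr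
      have h3 : |2 * r - 1| = 1 - 2 * r := by rw [abs_of_nonpos (by linarith [hr.2])]; ring
      simp only [hK₁, h3]
      rw [show C.lastMark + (1 - 2 * r) * ℓ = -(2 * ℓ) * r + L by rw [hℓ]; ring]
      push_cast
      ring
    have h2 : ∫ r in (1 / 2 : ℝ)..1, K₁ r = ∫ s in C.lastMark..L, F s := by
      have := intervalIntegral.smul_integral_comp_mul_add (a := 1 / 2) (b := 1) F (2 * ℓ)
        (C.lastMark - ℓ)
      rw [show 2 * ℓ * 1 + (C.lastMark - ℓ) = L by rw [hℓ]; ring,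
        show 2 * ℓ * (1 / 2) + (C.lastMark - ℓ) = C.lastMark by ring, Complex.real_smul] at this
      rw [← this, ← intervalIntegral.integral_const_mul]
      refine intervalIntegral.integral_congr fun r hr => ?_
      rw [Set.uIcc_of_le (by norm_num)] at hr
      have h3 : |2 * r - 1| = 2 * r - 1 := abs_of_nonneg (by linarith [hr.1])
      simp only [hK₁, h3]
      rw [show C.lastMark + (2 * r - 1) * ℓ = 2 * ℓ * r + (C.lastMark - ℓ) by ring]
      push_cast
      ring
    rw [h1, h2, two_mul]
  have hG : ∀ {K : ℝ → ℂ}, ContinuousOn K (Set.Icc 0 1) →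
      ContinuousOn (fun r => ∫ ρ in (0 : ℝ)..r, K ρ) (Set.Icc 0 1) ∧
      ∀ r ∈ Set.Ioo (0 : ℝ) 1, HasDerivAt (fun r => ∫ ρ in (0 : ℝ)..r, K ρ) (K r) r := by
    intro K hK
    have hKi : IntervalIntegrable K MeasureTheory.volume 0 1 :=
      hK.intervalIntegrable_of_Icc zero_le_one
    refine ⟨?_, fun r hr => ?_⟩
    · have := intervalIntegral.continuousOn_primitive_interval' hKi (a := 0) (by simp)
      rwa [Set.uIcc_of_le zero_le_one] at this
    · have hn : Set.Icc (0 : ℝ) 1 ∈ 𝓝 r := Icc_mem_nhds hr.1 hr.2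
      refine intervalIntegral.integral_hasDerivAt_right (hKi.mono_set ?_) ?_
        (hK.continuousAt hn)
      · rw [Set.uIcc_of_le zero_le_one, Set.uIcc_of_le hr.1.le]
        exact Set.Icc_subset_Icc_right hr.2.le
      · exact hK.stronglyMeasurableAtFilter_nhdsWithin measurableSet_Icc r |>.filter_mono
          (by rw [nhdsWithin_eq_nhds.2 hn])
  have hstdc : ContinuousOn (C.betaStd L) (Set.Icc 0 1) := by
    rw [continuousOn_iff_continuous_domRestrict]
    have : (Set.Icc (0 : ℝ) 1).domRestrict (C.betaStd L) = fun r : unitInterval => H (1, r) :=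
      funext fun r => (hH1 r).symm
    rw [this]
    fun_prop
  have key := sub_eq_sub_of_homotopy (A := C.affine) (V := V) (P := Φ) (fun q => (hΦ q).isOpen)
    (fun q hq => Set.mem_iUnion.2 ⟨⟨q, hq⟩, hmem ⟨q, hq⟩⟩) ?_ H hHA
    (fun q => by rw [hHl, hHl]) (fun q => by rw [hHr, hHr])
    (G₀ := fun r => ∫ ρ in (0 : ℝ)..r, K₀ ρ) (G₁ := fun r => ∫ ρ in (0 : ℝ)..r, K₁ ρ) ?_ ?_
  · simp only [Set.Icc.coe_one, Set.Icc.coe_zero, intervalIntegral.integral_same, sub_zero] at key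
    rw [hI₀, key, hI₁]
  · rintro q q' z ⟨⟨hz, hz'⟩, hzA⟩
    by_cases hz0 : z.2 = 0
    · have : q = q' := Subtype.ext
        ((hbr q z hz hzA hz0).symm.trans (hbr q' z hz' hzA hz0))
      subst this
      simp
    · exact (hΦ q).eventually_sub_eq (hΦ q') hz hz' hzA hz0
  · intro q u v huv hr
    have hsub : ∀ {r : ℝ}, r ∈ Set.Icc (u : ℝ) v → r ∈ Set.Icc (0 : ℝ) 1 := fun h =>
      ⟨u.2.1.trans h.1, h.2.trans v.2.2⟩
    have hsub' : ∀ {r : ℝ}, r ∈ Set.Ioo (u : ℝ) v → r ∈ Set.Ioo (0 : ℝ) 1 := fun h =>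
      ⟨u.2.1.trans_lt h.1, h.2.trans_le v.2.2⟩
    have hbe : ∀ {r : ℝ} (h : r ∈ Set.Icc (0 : ℝ) 1), b.extend r = b ⟨r, h⟩ := fun h =>
      Path.extend_apply b h
    rw [hH0, hH0, ← Path.extend_extends' b v, ← Path.extend_extends' b u]
    refine (hΦ q).sub_eq_sub (E := ∅) (x' := fun r => (derivWithin b.extend (Set.Icc 0 1) r).1)
      huv Set.countable_empty b.continuous_extend.continuousOn
      ((hG hK₀c).1.mono fun r => hsub) (fun r h => ?_) (fun r h => ?_) (fun r h => ?_)
      (fun r h => ?_) (fun r h => (hG hK₀c).2 r (hsub' h.1))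
    · rw [hbe (hsub h), ← hH0]
      exact hr ⟨r, hsub h⟩ h
    · rw [hbe (hsub h)]
      exact hb.mem _
    · rw [hbe (hsub (Set.Ioo_subset_Icc_self h.1))]
      exact hb.avoids _
    · have h1 : HasDerivAt b.extend (derivWithin b.extend (Set.Icc 0 1) r) r :=
        ((hb.smooth.differentiableOn one_ne_zero r
          (Set.Ioo_subset_Icc_self (hsub' h.1))).hasDerivWithinAt).hasDerivAt
          (Icc_mem_nhds (hsub' h.1).1 (hsub' h.1).2)
      exact (ContinuousLinearMap.fst ℝ ℂ ℂ).hasFDerivAt.comp_hasDerivAt r h1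
  · intro q u v huv hr
    have hsub : ∀ {r : ℝ}, r ∈ Set.Icc (u : ℝ) v → r ∈ Set.Icc (0 : ℝ) 1 := fun h =>
      ⟨u.2.1.trans h.1, h.2.trans v.2.2⟩
    have hsub' : ∀ {r : ℝ}, r ∈ Set.Ioo (u : ℝ) v → r ∈ Set.Ioo (0 : ℝ) 1 := fun h =>
      ⟨u.2.1.trans_lt h.1, h.2.trans_le v.2.2⟩
    have hlt : ∀ {r : ℝ}, r ≠ 1 / 2 → C.lastMark < C.lastMark + |2 * r - 1| * ℓ := fun {r} h => by
      have : 0 < |2 * r - 1| := abs_pos.2 fun h' => h (by linarith)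
      nlinarith
    rw [hH1, hH1]
    -- At r = 1/2 the standard path meets the branch point: y vanishes and the absolute value has a
    -- corner.
    refine (hΦ q).sub_eq_sub (E := {1 / 2}) (x' := fun r => (if r < 1 / 2 then -1 else 1) * (2 * ℓ)
      * deriv C.path (C.lastMark + |2 * r - 1| * ℓ)) huv (Set.countable_singleton _)
      (hstdc.mono fun r => hsub) ((hG hK₁c.continuousOn).1.mono fun r => hsub) (fun r h => ?_)
      (fun r h => ?_) (fun r h => ?_) (fun r h => ?_) (fun r h => ?_)
    · have := hr ⟨r, hsub h⟩ h
      rwa [hH1] at this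
    · have := hHA (1, ⟨r, hsub h⟩)
      rw [hH1] at this
      exact this
    · have h2 : C.y0 (C.path (C.lastMark + |2 * r - 1| * (L - C.lastMark))) ≠ 0 :=
        y0_path_ne_zero hC (hlt h.2)
      have h3 : (if r < 1 / 2 then -1 else 1 : ℂ) ≠ 0 := by split_ifs <;> norm_num
      exact mul_ne_zero h3 h2
    · have hin : HasDerivAt (fun r : ℝ => C.lastMark + |2 * r - 1| * ℓ)
          ((if r < 1 / 2 then -1 else 1) * (2 * ℓ)) r := by
        rcases lt_or_gt_of_ne h.2 with h4 | h4
        · rw [if_pos h4]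
          have h5 : HasDerivAt (fun r : ℝ => C.lastMark + (1 - 2 * r) * ℓ) (-1 * (2 * ℓ)) r := by
            have := ((((hasDerivAt_id r).const_mul 2).const_sub 1).mul_const ℓ).const_add C.lastMark
            exact this.congr_deriv (by ring)
          refine h5.congr_of_eventuallyEq ?_
          filter_upwards [eventually_lt_nhds h4] with r' hr'
          rw [abs_of_nonpos (by linarith)]
          ring
        · rw [if_neg (not_lt.2 h4.le)]
          have h5 : HasDerivAt (fun r : ℝ => C.lastMark + (2 * r - 1) * ℓ) (1 * (2 * ℓ)) r := by
            have := ((((hasDerivAt_id r).const_mul 2).sub_const 1).mul_const ℓ).const_add C.lastMark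
            exact this.congr_deriv (by ring)
          refine h5.congr_of_eventuallyEq ?_
          filter_upwards [eventually_gt_nhds h4] with r' hr'
          rw [abs_of_nonneg (by linarith)]
      have h6 := (hC.isRegularPath.hasDerivAt (C.lastMark + |2 * r - 1| * ℓ)).scomp r hin
      refine h6.congr_deriv ?_
      rw [Complex.real_smul]
      split_ifs <;> push_cast <;> ring
    · have h7 := (hG hK₁c.continuousOn).2 r (hsub' h.1)
      refine h7.congr_deriv ?_
      have h8 : C.y0 (C.path (C.lastMark + |2 * r - 1| * ℓ))
          = C.meanBranch (C.lastMark + |2 * r - 1| * ℓ) := y0_path_eq_meanBranch hC (hlt h.2)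
      simp only [betaStd, hK₁, hF, ← hℓ, h8]
      split_ifs <;> ring

end MarkedCurve

/-! ### The points at infinity -/

theorem tendsto_inv_nhdsNE_cocompact : Tendsto (fun u : ℂ => u⁻¹) (𝓝[≠] 0) (cocompact ℂ) :=
  tendsto_inv₀_nhdsNE_zero.mono_right Metric.cobounded_eq_cocompact.le

theorem Polynomial.analyticAt_eval (p : ℂ[X]) (x : ℂ) : AnalyticAt ℂ (fun x => p.eval x) x := by
  simpa using (analyticAt_id (z := x)).aeval_polynomial p

theorem Polynomial.eval_inv_eq {p : ℂ[X]} {n : ℕ} (hn : p.natDegree ≤ n) {u : ℂ} (hu : u ≠ 0) :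
    p.eval u⁻¹ = (reflect n p).eval u / u ^ n := by
  rw [eval_eq_pow_mul_reflect hn (inv_ne_zero hu), inv_inv, inv_pow]
  field_simp

namespace MarkedCurve

variable {g : ℕ} {C : MarkedCurve g} (hC : C.IsValid)
include hC

theorem natDegree_W : C.W.natDegree ≤ g + 2 := by
  have h := hC.natDegree_deriv
  rw [natDegree_derivative] at h
  omega

theorem coeff_W : (g + 2 : ℂ) * C.W.coeff (g + 2) = 1 := by
  have h := hC.monic_deriv.coeff_natDegree
  rw [hC.natDegree_deriv, coeff_derivative] at h
  push_cast at h
  linear_combination h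

theorem eval_zero_reflect_deriv : (reflect (g + 1) (derivative C.W)).eval 0 = 1 := by
  rw [eval_zero_reflect, ← hC.natDegree_deriv]
  exact hC.monic_deriv.coeff_natDegree

/-- Near infinity `y₀ = W' S` with `S` holomorphic in `u = 1/x`. -/
theorem exists_analyticAt_y0_inv :
    ∃ S : ℂ → ℂ, AnalyticAt ℂ S 0 ∧ S 0 = 1 ∧ ∀ᶠ u in 𝓝[≠] (0 : ℂ),
      C.y0 u⁻¹ = (derivative C.W).eval u⁻¹ * S u ∧
      S u ^ 2 = 1 + u ^ (g + 2) * (reflect g C.f).eval u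
        / (reflect (g + 1) (derivative C.W)).eval u ^ 2 := by
  set fr := reflect g C.f with hfr
  set Wd := reflect (g + 1) (derivative C.W) with hWd
  have hWd0 : Wd.eval 0 = 1 := eval_zero_reflect_deriv hC
  have ha : AnalyticAt ℂ (fun u => 1 + u ^ (g + 2) * fr.eval u / Wd.eval u ^ 2) 0 :=
    analyticAt_const.add (((analyticAt_id.pow _).mul (fr.analyticAt_eval 0)).div
      ((Wd.analyticAt_eval 0).pow 2) (by rw [hWd0]; norm_num))
  obtain ⟨S, hS0, hSa, hSsq⟩ := exists_analyticAt_sqrt ha (y₀ := 1) one_ne_zero (by simp)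
  refine ⟨S, hSa, hS0, ?_⟩
  have h1 : Tendsto (fun u : ℂ => C.y0 u⁻¹ / (derivative C.W).eval u⁻¹) (𝓝[≠] 0) (𝓝 1) :=
    (isUpperBranch_y0 hC).asymp.comp tendsto_inv_nhdsNE_cocompact
  have h2 : Tendsto S (𝓝[≠] 0) (𝓝 1) := by
    have := hSa.continuousAt.tendsto
    rw [hS0] at this
    exact this.mono_left nhdsWithin_le_nhds
  -- The sum of the two candidates tends to 2, which excludes the root -S.
  have h3 : ∀ᶠ u in 𝓝[≠] (0 : ℂ), C.y0 u⁻¹ / (derivative C.W).eval u⁻¹ + S u ≠ 0 :=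
    (h1.add h2).eventually_ne (by norm_num)
  have h4 : ∀ᶠ u in 𝓝[≠] (0 : ℂ), Wd.eval u ≠ 0 :=
    nhdsWithin_le_nhds ((Wd.analyticAt_eval 0).continuousAt.eventually_ne
      (by rw [hWd0]; exact one_ne_zero))
  filter_upwards [h3, h4, nhdsWithin_le_nhds hSsq, self_mem_nhdsWithin] with u hu hW hsq hu0
  refine ⟨?_, hsq⟩
  have hu0' : u ≠ 0 := hu0
  have hW' : (derivative C.W).eval u⁻¹ = Wd.eval u / u ^ (g + 1) :=
    eval_inv_eq hC.natDegree_deriv.le hu0'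
  have hWne : (derivative C.W).eval u⁻¹ ≠ 0 := by
    rw [hW']
    exact div_ne_zero hW (pow_ne_zero _ hu0')
  have h5 : (C.y0 u⁻¹ / (derivative C.W).eval u⁻¹) ^ 2 = S u ^ 2 := by
    rw [hsq, div_pow, y0_sq hC, ySq, eval_add, eval_pow, add_div, div_self (pow_ne_zero 2 hWne),
      hW', eval_inv_eq (natDegree_f hC).le hu0', ← hfr]
    field_simp
    ring
  have h6 : C.y0 u⁻¹ / (derivative C.W).eval u⁻¹ = S u := by
    rcases sq_eq_sq_iff_eq_or_eq_neg.1 h5 with h | h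
    · exact h
    · exact (hu (by rw [h]; ring)).elim
  rw [← h6, mul_div_cancel₀ _ hWne]

/-- With y₀ = W'S the difference is W'(1 - S) = -f/(W'(1 + S)); at u = 0 the leading coefficient -4t
of f over the factor 2 gives 2t. -/
theorem exists_analyticAt_derivW_sub_y0 :
    ∃ m : ℂ → ℂ, AnalyticAt ℂ m 0 ∧ m 0 = 2 * C.t ∧ ∀ᶠ u in 𝓝[≠] (0 : ℂ),
      (derivative C.W).eval u⁻¹ - C.y0 u⁻¹ = u * m u := by
  obtain ⟨S, hSa, hS0, hev⟩ := exists_analyticAt_y0_inv hC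
  set fr := reflect g C.f with hfr
  set Wd := reflect (g + 1) (derivative C.W) with hWd
  have hWd0 : Wd.eval 0 = 1 := eval_zero_reflect_deriv hC
  have hden : AnalyticAt ℂ (fun u => Wd.eval u * (1 + S u)) 0 :=
    (Wd.analyticAt_eval 0).mul (analyticAt_const.add hSa)
  have hden0 : Wd.eval 0 * (1 + S 0) ≠ 0 := by rw [hWd0, hS0]; norm_num
  refine ⟨fun u => -fr.eval u / (Wd.eval u * (1 + S u)),
    ((fr.analyticAt_eval 0).neg).div hden hden0, ?_, ?_⟩
  · simp only [hWd0, hS0, hfr, eval_zero_reflect, t]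
    ring
  · have h1 : ∀ᶠ u in 𝓝[≠] (0 : ℂ), Wd.eval u * (1 + S u) ≠ 0 :=
      nhdsWithin_le_nhds (hden.continuousAt.eventually_ne hden0)
    filter_upwards [hev, h1, self_mem_nhdsWithin] with u ⟨h2, h3⟩ h4 hu
    have hu0 : u ≠ 0 := hu
    have hW := left_ne_zero_of_mul h4
    have hS := right_ne_zero_of_mul h4
    rw [h2, eval_inv_eq hC.natDegree_deriv.le hu0, ← hWd]
    have h5 : (1 - S u) = -(u ^ (g + 2) * fr.eval u / Wd.eval u ^ 2) / (1 + S u) := by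
      rw [eq_div_iff hS]
      linear_combination -h3
    rw [show Wd.eval u / u ^ (g + 1) - Wd.eval u / u ^ (g + 1) * S u
      = Wd.eval u / u ^ (g + 1) * (1 - S u) by ring, h5]
    field_simp
    ring

/-- With n = g + 1 and y₀ = W'S, P/y₀ - W is W(1 - S)/S plus (-2t xⁿ/(n+1) + R)/y₀. The first term
tends to 2t/(n+1), since W has leading term x^(n+1)/(n+1) and 1 - S behaves like 2t x^(-n-1). The
monomial in P is chosen to cancel this limit, and R contributes O(1/x) only. -/
theorem exists_analyticAt_numerator_div {R : ℂ[X]} (hR : R.degree < ((g + 1 : ℕ) : WithBot ℕ)) :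
    ∃ k : ℂ → ℂ, AnalyticAt ℂ k 0 ∧ k 0 = 0 ∧ ∀ᶠ u in 𝓝[≠] (0 : ℂ), C.y0 u⁻¹ ≠ 0 ∧
      (C.numerator R).eval u⁻¹ / C.y0 u⁻¹ = C.W.eval u⁻¹ + k u := by
  obtain ⟨S, hSa, hS0, hev⟩ := exists_analyticAt_y0_inv hC
  set fr := reflect g C.f with hfr
  set Wd := reflect (g + 1) (derivative C.W) with hWd
  set Wr := reflect (g + 2) C.W with hWr
  set Rr := reflect (g + 1) R with hRr
  have hWd0 : Wd.eval 0 = 1 := eval_zero_reflect_deriv hC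
  have hden : AnalyticAt ℂ (fun u => Wd.eval u ^ 2 * (S u * (1 + S u))) 0 :=
    ((Wd.analyticAt_eval 0).pow 2).mul (hSa.mul (analyticAt_const.add hSa))
  have hden0 : Wd.eval 0 ^ 2 * (S 0 * (1 + S 0)) ≠ 0 := by rw [hWd0, hS0]; norm_num
  have hden1 : AnalyticAt ℂ (fun u => Wd.eval u * S u) 0 := (Wd.analyticAt_eval 0).mul hSa
  have hden10 : Wd.eval 0 * S 0 ≠ 0 := by rw [hWd0, hS0]; norm_num
  have hRn : R.natDegree ≤ g + 1 := natDegree_le_of_degree_le hR.le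
  have hg : (g + 2 : ℂ) ≠ 0 := by exact_mod_cast (by omega : g + 2 ≠ 0)
  refine ⟨fun u => -(Wr.eval u * fr.eval u) / (Wd.eval u ^ 2 * (S u * (1 + S u)))
    + (Rr.eval u - 2 * C.t / (g + 2)) / (Wd.eval u * S u), ?_, ?_, ?_⟩
  · exact ((((Wr.analyticAt_eval 0).mul (fr.analyticAt_eval 0)).neg).div hden hden0).add
      (((Rr.analyticAt_eval 0).sub analyticAt_const).div hden1 hden10)
  · have hR0 : R.coeff (g + 1) = 0 := coeff_eq_zero_of_degree_lt hR
    have hW0 : C.W.coeff (g + 2) = 1 / (g + 2) := by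
      rw [eq_div_iff hg]
      linear_combination coeff_W hC
    simp only [hWd0, hS0, hfr, hWr, hRr, eval_zero_reflect, t, hR0, hW0]
    ring
  · have h1 : ∀ᶠ u in 𝓝[≠] (0 : ℂ), Wd.eval u ^ 2 * (S u * (1 + S u)) ≠ 0 :=
      nhdsWithin_le_nhds (hden.continuousAt.eventually_ne hden0)
    filter_upwards [hev, h1, self_mem_nhdsWithin] with u ⟨h2, h3⟩ h4 hu
    have hu0 : u ≠ 0 := hu
    have hW : Wd.eval u ≠ 0 := pow_ne_zero_iff (two_ne_zero) |>.1 (left_ne_zero_of_mul h4)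
    have hS1 := left_ne_zero_of_mul (right_ne_zero_of_mul h4)
    have hS := right_ne_zero_of_mul (right_ne_zero_of_mul h4)
    rw [h2, eval_inv_eq hC.natDegree_deriv.le hu0, ← hWd]
    refine ⟨mul_ne_zero (div_ne_zero hW (pow_ne_zero _ hu0)) hS1, ?_⟩
    have h5 : Wd.eval u ^ 2 * (1 - S u) * (1 + S u) = -(u ^ (g + 2) * fr.eval u) := by
      field_simp at h3
      linear_combination -h3
    rw [numerator, eval_add, eval_sub, eval_mul, eval_mul, eval_C, eval_pow, eval_X, inv_pow,
      eval_inv_eq hC.natDegree_deriv.le hu0, eval_inv_eq (natDegree_W hC) hu0,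
      eval_inv_eq hRn hu0, ← hWd, ← hWr, ← hRr]
    have h6 : -(Wr.eval u * fr.eval u) / (Wd.eval u ^ 2 * (S u * (1 + S u)))
        = Wr.eval u / u ^ (g + 2) * ((1 - S u) / S u) := by
      field_simp
      linear_combination -Wr.eval u * h5
    rw [h6]
    field_simp
    ring

end MarkedCurve

/-- A function with derivative `c / u + k u` near `0` extends holomorphically to `0`. -/
theorem exists_analyticAt_of_hasDerivAt {δ k : ℂ → ℂ} {c : ℂ} (hk : AnalyticAt ℂ k 0)
    (hδ : ∀ᶠ u in 𝓝[≠] (0 : ℂ), HasDerivAt δ (c / u + k u) u) :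
    ∃ κ : ℂ → ℂ, AnalyticAt ℂ κ 0 ∧ ∀ᶠ u in 𝓝[≠] (0 : ℂ), δ u = κ u := by
  obtain ⟨r, hr, hball⟩ := Metric.eventually_nhds_iff_ball.1
    ((eventually_nhdsWithin_iff.1 hδ).and hk.eventually_analyticAt)
  have hkd : DifferentiableOn ℂ k (Metric.ball 0 r) := fun x hx =>
    (hball x hx).2.differentiableAt.differentiableWithinAt
  obtain ⟨κ, hκ⟩ := hkd.isExactOn_ball
  have hr2 : 0 < r / 2 := by linarith
  -- On a circle around 0 the function δ - κ is a single-valued primitive of c/u, so the residue c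
  -- vanishes.
  have hc : c = 0 := by
    have h1 : (∮ z in C(0, r / 2), c * (z - 0)⁻¹) = 0 := by
      refine circleIntegral.integral_eq_zero_of_hasDerivWithinAt (f := fun u => δ u - κ u) hr2.le
        fun z hz => ?_
      have hz' : ‖z‖ = r / 2 := by simpa using hz
      have hzb : z ∈ Metric.ball (0 : ℂ) r := by
        simp only [Metric.mem_ball, dist_zero_right]
        linarith
      have hz0 : z ≠ 0 := norm_pos_iff.1 (by rw [hz']; exact hr2)
      have h2 : HasDerivAt (fun u => δ u - κ u) _ z := ((hball z hzb).1 hz0).sub (hκ z hzb)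
      exact (h2.congr_deriv (by rw [sub_zero]; ring)).hasDerivWithinAt
    have h2 : (∮ z in C(0, r / 2), c * (z - 0)⁻¹) = c * (∮ z in C(0, r / 2), (z - 0)⁻¹) :=
      circleIntegral.integral_const_mul _ _ _ _
    rw [h2, circleIntegral.integral_sub_center_inv _ hr2.ne'] at h1
    exact (mul_eq_zero.1 h1).resolve_right Complex.two_pi_I_ne_zero
  -- In polar coordinates the punctured disc is a continuous image of a connected rectangle.
  have hpre : IsPreconnected (Metric.ball (0 : ℂ) r \ {0}) := by
    have h1 : Metric.ball (0 : ℂ) r \ {0} = (fun q : ℝ × ℝ => (q.1 : ℂ) * Complex.exp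
        (q.2 * Complex.I)) '' (Set.Ioo 0 r ×ˢ Set.univ) := by
      ext z
      constructor
      · rintro ⟨hz, hz0⟩
        refine ⟨(‖z‖, Complex.arg z), ⟨⟨norm_pos_iff.2 hz0, by simpa using hz⟩, trivial⟩, ?_⟩
        exact Complex.norm_mul_exp_arg_mul_I z
      · rintro ⟨⟨ρ, θ⟩, ⟨hρ, -⟩, rfl⟩
        have h2 : ‖(ρ : ℂ) * Complex.exp (θ * Complex.I)‖ = ρ := by
          rw [norm_mul, Complex.norm_exp_ofReal_mul_I, mul_one, Complex.norm_real,
            Real.norm_of_nonneg hρ.1.le]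
        refine ⟨by simpa [abs_of_pos hρ.1] using hρ.2, fun h3 => ?_⟩
        have h4 : (ρ : ℂ) * Complex.exp (θ * Complex.I) = 0 := h3
        rw [h4, norm_zero] at h2
        exact hρ.1.ne h2
    rw [h1]
    exact (isPreconnected_Ioo.prod isPreconnected_univ).image _ (by fun_prop)
  have hopen : IsOpen (Metric.ball (0 : ℂ) r \ {0}) :=
    Metric.isOpen_ball.sdiff isClosed_singleton
  have hloc : ∀ x ∈ Metric.ball (0 : ℂ) r \ {0}, ∀ y ∈ Metric.ball (0 : ℂ) r \ {0},
      δ x - κ x = δ y - κ y := by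
    intro x hx y hy
    refine hopen.is_const_of_deriv_eq_zero (𝕜 := ℂ) (f := fun u => δ u - κ u) hpre (fun z hz => ?_)
      (fun z hz => ?_) hx hy
    · exact (((hball z hz.1).1 hz.2).sub (hκ z hz.1)).differentiableAt.differentiableWithinAt
    · have h2 : HasDerivAt (fun u => δ u - κ u) _ z := ((hball z hz.1).1 hz.2).sub (hκ z hz.1)
      rw [h2.deriv, hc]
      simp
  have hmid : ((r / 2 : ℝ) : ℂ) ∈ Metric.ball (0 : ℂ) r \ {0} := by
    refine ⟨?_, by simpa using hr.ne'⟩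
    rw [Metric.mem_ball, dist_zero_right, Complex.norm_real, Real.norm_of_nonneg hr2.le]
    linarith
  refine ⟨fun u => κ u + (δ (r / 2 : ℝ) - κ (r / 2 : ℝ)), ?_, ?_⟩
  · refine AnalyticAt.add ?_ analyticAt_const
    have hκd : DifferentiableOn ℂ κ (Metric.ball 0 r) := fun z hz =>
      (hκ z hz).differentiableAt.differentiableWithinAt
    exact hκd.analyticAt (Metric.ball_mem_nhds 0 hr)
  · filter_upwards [self_mem_nhdsWithin, nhdsWithin_le_nhds (Metric.ball_mem_nhds 0 hr)] with u hu hub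
    linear_combination hloc u ⟨hub, hu⟩ _ hmid

/-! ### The regularised pairing -/

theorem curveIntegral_congr {a₀ a₁ : ℂ × ℂ} {b : Path a₀ a₁} {η η' : ℂ × ℂ → ℂ × ℂ →L[ℂ] ℂ}
    (h : ∀ r, η (b r) = η' (b r)) : curveIntegral η b = curveIntegral η' b := by
  rw [curveIntegral_def, curveIntegral_def]
  refine intervalIntegral.integral_congr fun r hr => ?_
  rw [Set.uIcc_of_le zero_le_one] at hr
  have := h ⟨r, hr⟩
  rw [← Path.extend_apply b hr] at this
  rw [curveIntegralFun_def, curveIntegralFun_def, this]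

theorem continuousOn_fderiv_analyticAt (F : ℂ × ℂ → ℂ) :
    ContinuousOn (fderiv ℂ F) {q | AnalyticAt ℂ F q} := fun _ hq =>
  hq.fderiv.continuousAt.continuousWithinAt

theorem curveIntegrable_fderiv {a₀ a₁ : ℂ × ℂ} {b : Path a₀ a₁} {F : ℂ × ℂ → ℂ}
    (hb : ContDiffOn ℝ 1 b.extend (Set.Icc 0 1)) (hF : ∀ r, AnalyticAt ℂ F (b r)) :
    CurveIntegrable (fderiv ℂ F) b :=
  (continuousOn_fderiv_analyticAt F).curveIntegrable_of_contDiffOn hb hF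

theorem curveIntegral_fderiv {a₀ a₁ : ℂ × ℂ} {b : Path a₀ a₁} {F : ℂ × ℂ → ℂ}
    (hb : ContDiffOn ℝ 1 b.extend (Set.Icc 0 1)) (hF : ∀ r, AnalyticAt ℂ F (b r)) :
    curveIntegral (fderiv ℂ F) b = F a₁ - F a₀ := by
  have hF' : ∀ r ∈ Set.Icc (0 : ℝ) 1, AnalyticAt ℂ F (b.extend r) := fun r hr => by
    rw [Path.extend_apply b hr]
    exact hF _
  have hi : IntervalIntegrable (fun r => fderiv ℂ F (b.extend r)
      (derivWithin b.extend (Set.Icc 0 1) r)) MeasureTheory.volume 0 1 := by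
    have := curveIntegrable_fderiv hb hF
    simpa only [CurveIntegrable, funext (curveIntegralFun_def (fderiv ℂ F) b)] using this
  have := intervalIntegral.integral_eq_sub_of_hasDerivAt_of_le zero_le_one
    (f := fun r => F (b.extend r)) (fun r hr => ?_) (fun r hr => ?_) hi
  · rw [curveIntegral_def]
    simp only [curveIntegralFun_def]
    rw [this, Path.extend_one, Path.extend_zero]
  · exact (hF' r hr).continuousAt.comp_continuousWithinAt b.continuous_extend.continuousWithinAt
  · have h1 : HasDerivAt b.extend (derivWithin b.extend (Set.Icc 0 1) r) r :=
      ((hb.differentiableOn one_ne_zero r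
        (Set.Ioo_subset_Icc_self hr)).hasDerivWithinAt).hasDerivAt (Icc_mem_nhds hr.1 hr.2)
    exact ((hF' r (Set.Ioo_subset_Icc_self hr)).differentiableAt.hasFDerivAt.restrictScalars
      ℝ).comp_hasDerivAt r h1

theorem eventually_eventually_nhds_of_nhdsNE {X : Type*} [TopologicalSpace X] [T1Space X] {a : X}
    {p : X → Prop} (h : ∀ᶠ x in 𝓝[≠] a, p x) : ∀ᶠ x in 𝓝[≠] a, ∀ᶠ y in 𝓝 x, p y := by
  filter_upwards [eventually_eventually_nhdsWithin.2 h, self_mem_nhdsWithin] with x hx hxa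
  rwa [isOpen_compl_singleton.nhdsWithin_eq hxa] at hx

namespace MarkedCurve

variable {g : ℕ} {C : MarkedCurve g}

theorem analyticAt_phi (R : ℂ[X]) {q : ℂ × ℂ} (hq : q.2 ≠ 0) : AnalyticAt ℂ (C.phi R) q := by
  unfold phi
  refine AnalyticAt.div ?_ analyticAt_snd hq
  exact ((C.numerator R).analyticAt_eval q.1).comp analyticAt_fst

theorem continuous_zeta : Continuous zeta := by
  unfold zeta
  fun_prop

/-- The regularised pairing changes by the end point values if `φ` is changed. -/
theorem regPairing_eq_sub {a₀ a₁ : ℂ × ℂ} {b : Path a₀ a₁}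
    (hb : ContDiffOn ℝ 1 b.extend (Set.Icc 0 1)) {F : ℂ × ℂ → ℂ}
    (hF : ∀ r, AnalyticAt ℂ F (b r)) :
    regPairing b zeta F = curveIntegral zeta b - (F a₁ - F a₀) := by
  rw [regPairing, ← curveIntegral_fderiv hb hF]
  exact curveIntegral_fun_sub (continuous_zeta.continuousOn.curveIntegrable_of_contDiffOn hb
    fun _ => Set.mem_univ _) (curveIntegrable_fderiv hb hF)

variable (hC : C.IsValid)
include hC

theorem eventually_atInfinity {σ : ℂ} (hσ : σ = 1 ∨ σ = -1) : ∀ᶠ u in 𝓝[≠] (0 : ℂ),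
    (C.atInfinity σ u).2 ≠ 0 ∧ C.atInfinity σ u ∈ C.affine ∧
      HasDerivAt (C.atInfinity σ) (deriv (C.atInfinity σ) u) u ∧
      (deriv (C.atInfinity σ) u).1 = -(u ^ 2)⁻¹ := by
  have hσ0 : σ ≠ 0 := by rcases hσ with rfl | rfl <;> norm_num
  have hσ2 : σ ^ 2 = 1 := by rcases hσ with rfl | rfl <;> norm_num
  obtain ⟨k, -, -, hk⟩ := exists_analyticAt_numerator_div hC (R := 0) (by simp)
  filter_upwards [hk, self_mem_nhdsWithin,
    tendsto_inv_nhdsNE_cocompact.eventually (eventually_notMem_cuts hC)] with u hu hu0 huc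
  have h1 : HasDerivAt (fun u : ℂ => u⁻¹) (-(u ^ 2)⁻¹) u := hasDerivAt_inv hu0
  have h2 : HasDerivAt (C.atInfinity σ) (-(u ^ 2)⁻¹, σ * (deriv C.y0 u⁻¹ * -(u ^ 2)⁻¹)) u :=
    h1.prodMk (((differentiableAt_y0 hC huc).hasDerivAt.comp u h1).const_mul σ)
  refine ⟨mul_ne_zero hσ0 hu.1, ?_, h2.deriv ▸ h2, by rw [h2.deriv]⟩
  change (σ * C.y0 u⁻¹) ^ 2 = C.ySq.eval u⁻¹
  rw [mul_pow, hσ2, one_mul, y0_sq hC]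

theorem exists_phi_atInfinity {R : ℂ[X]} (hR : R.degree < ((g + 1 : ℕ) : WithBot ℕ)) {σ : ℂ}
    (hσ : σ = 1 ∨ σ = -1) :
    ∃ k : ℂ → ℂ, AnalyticAt ℂ k 0 ∧ k 0 = 0 ∧
      ∀ᶠ u in 𝓝[≠] (0 : ℂ), C.phi R (C.atInfinity σ u) = σ * C.W.eval u⁻¹ + k u := by
  obtain ⟨k, hk, hk0, hev⟩ := exists_analyticAt_numerator_div hC hR
  refine ⟨fun u => σ * k u, analyticAt_const.mul hk, by simp [hk0], ?_⟩
  filter_upwards [hev] with u hu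
  rw [← mul_add, ← hu.2]
  simp only [phi, atInfinity]
  rcases hσ with rfl | rfl
  · rw [one_mul, one_mul]
  · rw [neg_one_mul, neg_one_mul, div_neg]

/-- In u = 1/x one has dx = -du/u², so ζ - d(±W) becomes ±(W' - y₀) du/u² = ±m(u) du/u with m(0) =
2t. The correction of φ is holomorphic in u and adds no pole. -/
theorem hasSimplePole_zeta_sub {R : ℂ[X]} (hR : R.degree < ((g + 1 : ℕ) : WithBot ℕ)) {σ : ℂ}
    (hσ : σ = 1 ∨ σ = -1) :
    C.HasSimplePole (fun q => zeta q - fderiv ℂ (C.phi R) q) σ (σ * (2 * C.t)) := by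
  obtain ⟨m, hm, hm0, hmev⟩ := exists_analyticAt_derivW_sub_y0 hC
  obtain ⟨k, hk, -, hkev⟩ := exists_phi_atInfinity hC hR hσ
  have hds : AnalyticAt ℂ (dslope m 0) 0 := by
    obtain ⟨p, hp⟩ := hm
    exact ⟨_, hp.has_fpower_series_dslope_fslope⟩
  refine ⟨fun u => σ * dslope m 0 u - deriv k u, (analyticAt_const.mul hds).sub hk.deriv, ?_⟩
  filter_upwards [hmev, eventually_eventually_nhds_of_nhdsNE hkev, eventually_atInfinity hC hσ,
    self_mem_nhdsWithin, nhdsWithin_le_nhds hk.eventually_analyticAt] with u h1 h2 h3 hu hka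
  have hu0 : u ≠ 0 := hu
  obtain ⟨h4, -, h5, h6⟩ := h3
  have h7 : HasDerivAt (fun u => C.phi R (C.atInfinity σ u))
      (fderiv ℂ (C.phi R) (C.atInfinity σ u) (deriv (C.atInfinity σ) u)) u :=
    (analyticAt_phi R h4).differentiableAt.hasFDerivAt.comp_hasDerivAt u h5
  have h8 : HasDerivAt (fun u => σ * C.W.eval u⁻¹ + k u)
      (σ * ((derivative C.W).eval u⁻¹ * -(u ^ 2)⁻¹) + deriv k u) u :=
    (((C.W.hasDerivAt u⁻¹).comp u (hasDerivAt_inv hu0)).const_mul σ).add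
      hka.differentiableAt.hasDerivAt
  have h9 := h7.unique (h8.congr_of_eventuallyEq h2)
  rw [sub_apply, h9, dslope_of_ne _ hu0, slope_def_field, hm0, sub_zero]
  simp only [zeta, smul_apply, ContinuousLinearMap.coe_fst', smul_eq_mul, h6]
  simp only [atInfinity]
  have h10 : C.y0 u⁻¹ = (derivative C.W).eval u⁻¹ - u * m u := by rw [← h1]; ring
  rw [h10]
  field_simp
  ring

theorem eventually_analyticAt_atInfinity {χ : ℂ × ℂ → ℂ}
    (hχ : {q ∈ C.affine | ¬ AnalyticAt ℂ χ q}.Finite) {σ : ℂ} (hσ : σ = 1 ∨ σ = -1) :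
    ∀ᶠ u in 𝓝[≠] (0 : ℂ), AnalyticAt ℂ χ (C.atInfinity σ u) := by
  have h1 : ∀ᶠ x in cocompact ℂ, x ∉ Prod.fst '' {q ∈ C.affine | ¬ AnalyticAt ℂ χ q} :=
    (hχ.image Prod.fst).isCompact.compl_mem_cocompact
  filter_upwards [tendsto_inv_nhdsNE_cocompact.eventually h1, eventually_atInfinity hC hσ]
    with u hu h2
  by_contra h3
  exact hu ⟨_, ⟨h2.2.1, h3⟩, rfl⟩

theorem hasSimplePole_add {R : ℂ[X]} (hR : R.degree < ((g + 1 : ℕ) : WithBot ℕ)) {σ : ℂ}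
    (hσ : σ = 1 ∨ σ = -1) {ρ : ℂ × ℂ → ℂ} (hρ : ∀ q ∈ C.affine, AnalyticAt ℂ ρ q) :
    C.HasSimplePole (fun q => (zeta q + fderiv ℂ ρ q)
      - fderiv ℂ (fun q' => C.phi R q' + ρ q') q) σ (σ * (2 * C.t)) := by
  obtain ⟨k, hk, hev⟩ := hasSimplePole_zeta_sub hC hR hσ
  refine ⟨k, hk, ?_⟩
  filter_upwards [hev, eventually_atInfinity hC hσ] with u hu h
  rw [← hu, fderiv_fun_add (analyticAt_phi R h.1).differentiableAt (hρ _ h.2.1).differentiableAt]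
  congr 1
  abel

omit hC in
theorem regPairing_add (R : ℂ[X]) {ρ : ℂ × ℂ → ℂ} (hρ : ∀ q ∈ C.affine, AnalyticAt ℂ ρ q)
    {L : ℝ} {b : Path ((L : ℂ), -C.y0 L) ((L : ℂ), C.y0 L)} (hb : C.IsBetaHat L b) :
    regPairing b (fun q => zeta q + fderiv ℂ ρ q) (fun q => C.phi R q + ρ q)
      = regPairing b zeta (C.phi R) := by
  refine curveIntegral_congr fun r => ?_
  rw [fderiv_fun_add (analyticAt_phi R (hb.avoids r)).differentiableAt
    (hρ _ (hb.mem r)).differentiableAt]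
  exact add_sub_add_right_eq_sub _ _ _

/-- Two forms with at most simple poles are subtracted, so in the coordinate u the function has a
derivative c/u + holomorphic; being single-valued near infinity, it extends. -/
theorem exists_analyticAt_sub_atInfinity {R : ℂ[X]} (hR : R.degree < ((g + 1 : ℕ) : WithBot ℕ))
    {σ : ℂ} (hσ : σ = 1 ∨ σ = -1) {ρ χ : ℂ × ℂ → ℂ} (hρ : ∀ q ∈ C.affine, AnalyticAt ℂ ρ q)
    (hχ : {q ∈ C.affine | ¬ AnalyticAt ℂ χ q}.Finite) {c : ℂ}
    (hc : C.HasSimplePole (fun q => (zeta q + fderiv ℂ ρ q) - fderiv ℂ χ q) σ c) :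
    ∃ κ : ℂ → ℂ, AnalyticAt ℂ κ 0 ∧
      ∀ᶠ u in 𝓝[≠] (0 : ℂ), (χ - (C.phi R + ρ)) (C.atInfinity σ u) = κ u := by
  obtain ⟨k₁, hk₁, hev₁⟩ := hasSimplePole_zeta_sub hC hR hσ
  obtain ⟨k₂, hk₂, hev₂⟩ := hc
  refine exists_analyticAt_of_hasDerivAt (k := fun u => k₁ u - k₂ u) (c := σ * (2 * C.t) - c)
    (hk₁.sub hk₂) ?_
  filter_upwards [hev₁, hev₂, eventually_atInfinity hC hσ,
    eventually_analyticAt_atInfinity hC hχ hσ] with u h₁ h₂ h hχu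
  have hd1 := (analyticAt_phi R h.1 (C := C)).differentiableAt
  have hd2 := (hρ _ h.2.1).differentiableAt
  have hd3 := hχu.differentiableAt
  have h3 := ((hd3.hasFDerivAt.sub (hd1.hasFDerivAt.add hd2.hasFDerivAt)).comp_hasDerivAt u h.2.2.1)
  refine h3.congr_deriv ?_
  rw [show (σ * (2 * C.t) - c) / u + (k₁ u - k₂ u)
    = (σ * (2 * C.t) / u + k₁ u) - (c / u + k₂ u) by ring, ← h₁, ← h₂]
  simp only [sub_apply, add_apply]
  ring

omit hC in
-- The two integrands differ by an exact form, which leaves only end point values.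
theorem regPairing_eq_sub_of_analyticAt (R : ℂ[X]) {ρ χ : ℂ × ℂ → ℂ}
    (hρ : ∀ q ∈ C.affine, AnalyticAt ℂ ρ q)
    {L : ℝ} {b : Path ((L : ℂ), -C.y0 L) ((L : ℂ), C.y0 L)} (hb : C.IsBetaHat L b)
    (hχ : ∀ r, AnalyticAt ℂ χ (b r)) :
    regPairing b (fun q => zeta q + fderiv ℂ ρ q) χ = regPairing b zeta (C.phi R)
      - ((χ - (C.phi R + ρ)) (L, C.y0 L) - (χ - (C.phi R + ρ)) (L, -C.y0 L)) := by
  have hδ : ∀ r, AnalyticAt ℂ (χ - (C.phi R + ρ)) (b r) := fun r =>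
    (hχ r).sub ((analyticAt_phi R (hb.avoids r)).add (hρ _ (hb.mem r)))
  have hφ := fun r => analyticAt_phi (C := C) R (hb.avoids r)
  rw [← curveIntegral_fderiv hb.smooth hδ, regPairing, regPairing, ← curveIntegral_fun_sub
    (ω₁ := fun q => zeta q - fderiv ℂ (C.phi R) q)
    ((continuous_zeta.continuousOn.curveIntegrable_of_contDiffOn hb.smooth
      fun _ => Set.mem_univ _).sub (curveIntegrable_fderiv hb.smooth hφ))
    (curveIntegrable_fderiv hb.smooth hδ)]
  refine curveIntegral_congr fun r => ?_
  rw [fderiv_sub (hχ r).differentiableAt ((hφ r).add (hρ _ (hb.mem r))).differentiableAt,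
    fderiv_add (hφ r).differentiableAt (hρ _ (hb.mem r)).differentiableAt]
  abel

end MarkedCurve

theorem tendsto_ofReal_inv_atTop_nhdsNE :
    Tendsto (fun L : ℝ => (L : ℂ)⁻¹) atTop (𝓝[≠] 0) := by
  refine tendsto_nhdsWithin_iff.2 ⟨?_, ?_⟩
  · have := (Complex.continuous_ofReal.tendsto 0).comp tendsto_inv_atTop_zero
    simpa [Function.comp_def] using this
  · filter_upwards [eventually_gt_atTop 0] with L hL
    simpa using hL.ne'

theorem AnalyticAt.exists_norm_sub_le_div {κ : ℂ → ℂ} (h : AnalyticAt ℂ κ 0) :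
    ∃ M : ℝ, ∀ᶠ L : ℝ in atTop, ‖κ (L : ℂ)⁻¹ - κ 0‖ ≤ M / L := by
  obtain ⟨M, hM⟩ := h.differentiableAt.isBigO_sub.bound
  refine ⟨M, ?_⟩
  filter_upwards [(tendsto_ofReal_inv_atTop_nhdsNE.mono_right nhdsWithin_le_nhds).eventually hM,
    eventually_gt_atTop 0] with L hL hL0
  rw [sub_zero, norm_inv, Complex.norm_real, Real.norm_of_nonneg hL0.le] at hL
  exact hL

namespace MarkedCurve

variable {g : ℕ} {C : MarkedCurve g} (hC : C.IsValid)
include hC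

/-- Changing `φ` by a function with limits at infinity changes the pairing by these limits. -/
theorem exists_norm_regPairing_sub_le {R : ℂ[X]} (hR : R.degree < ((g + 1 : ℕ) : WithBot ℕ))
    {ρ χ : ℂ × ℂ → ℂ} (hρ : ∀ q ∈ C.affine, AnalyticAt ℂ ρ q)
    (hχ : {q ∈ C.affine | ¬ AnalyticAt ℂ χ q}.Finite)
    (hc : ∀ σ : ℂ, σ = 1 ∨ σ = -1 → ∃ c : ℂ,
      C.HasSimplePole (fun q => (zeta q + fderiv ℂ ρ q) - fderiv ℂ χ q) σ c) :
    ∃ cQ cQ' : ℂ,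
      Tendsto (fun u => (χ - (C.phi R + ρ)) (C.atInfinity 1 u)) (𝓝[≠] 0) (𝓝 cQ) ∧
      Tendsto (fun u => (χ - (C.phi R + ρ)) (C.atInfinity (-1) u)) (𝓝[≠] 0) (𝓝 cQ') ∧
      ∃ K L₁ : ℝ, 0 < L₁ ∧ ∀ L : ℝ, L₁ ≤ L →
        ∀ b : Path ((L : ℂ), -C.y0 L) ((L : ℂ), C.y0 L), C.IsBetaHat L b →
          (∀ r, AnalyticAt ℂ χ (b r)) →
          ‖regPairing b (fun q => zeta q + fderiv ℂ ρ q) χ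
            - (regPairing b zeta (C.phi R) - (cQ - cQ'))‖ ≤ K / L := by
  obtain ⟨c₁, hc₁⟩ := hc 1 (Or.inl rfl)
  obtain ⟨c₂, hc₂⟩ := hc (-1) (Or.inr rfl)
  obtain ⟨κ₁, hκ₁, hev₁⟩ := exists_analyticAt_sub_atInfinity hC hR (Or.inl rfl) hρ hχ hc₁
  obtain ⟨κ₂, hκ₂, hev₂⟩ := exists_analyticAt_sub_atInfinity hC hR (Or.inr rfl) hρ hχ hc₂
  obtain ⟨M₁, hM₁⟩ := hκ₁.exists_norm_sub_le_div
  obtain ⟨M₂, hM₂⟩ := hκ₂.exists_norm_sub_le_div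
  obtain ⟨L₁, hL₁⟩ := eventually_atTop.1 (hM₁.and (hM₂.and
    ((tendsto_ofReal_inv_atTop_nhdsNE.eventually hev₁).and
      (tendsto_ofReal_inv_atTop_nhdsNE.eventually hev₂))))
  refine ⟨κ₁ 0, κ₂ 0, (hκ₁.continuousAt.tendsto.mono_left nhdsWithin_le_nhds).congr'
    (hev₁.mono fun _ h => h.symm), (hκ₂.continuousAt.tendsto.mono_left nhdsWithin_le_nhds).congr'
    (hev₂.mono fun _ h => h.symm), M₁ + M₂, max L₁ 1, by positivity, fun L hL b hb hχb => ?_⟩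
  obtain ⟨h1, h2, h3, h4⟩ := hL₁ L ((le_max_left _ _).trans hL)
  rw [atInfinity, inv_inv, one_mul] at h3
  rw [atInfinity, inv_inv, neg_one_mul] at h4
  rw [regPairing_eq_sub_of_analyticAt R hρ hb hχb, h3, h4,
    show regPairing b zeta (C.phi R) - (κ₁ (L : ℂ)⁻¹ - κ₂ (L : ℂ)⁻¹)
      - (regPairing b zeta (C.phi R) - (κ₁ 0 - κ₂ 0))
      = (κ₂ (L : ℂ)⁻¹ - κ₂ 0) - (κ₁ (L : ℂ)⁻¹ - κ₁ 0) by ring, add_div]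
  refine (norm_sub_le _ _).trans ?_
  linarith

end MarkedCurve

/-! ### The threefold -/

theorem wedge_two_apply (i j : Fin 4) (m : Fin 2 → Fin 4 → ℂ) :
    wedge ![dCoord i, dCoord j] m = m 0 i * m 1 j - m 0 j * m 1 i := by
  change Matrix.det (Matrix.of fun a b => (![dCoord i, dCoord j] b) (m a)) = _
  rw [Matrix.det_fin_two]
  simp [dCoord]

theorem wedge_three_apply (i j k : Fin 4) (m : Fin 3 → Fin 4 → ℂ) :
    wedge ![dCoord i, dCoord j, dCoord k] m
      = m 0 i * m 1 j * m 2 k - m 0 i * m 1 k * m 2 j - m 0 j * m 1 i * m 2 k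
        + m 0 j * m 1 k * m 2 i + m 0 k * m 1 i * m 2 j - m 0 k * m 1 j * m 2 i := by
  change Matrix.det (Matrix.of fun a b => (![dCoord i, dCoord j, dCoord k] b) (m a)) = _
  rw [Matrix.det_fin_three]
  simp [dCoord]

section Sphere

variable (q : ℂ × ℂ) (θ ψ : ℝ)

theorem hasDerivAt_fibreSphere_theta : HasDerivAt (fun θ' => fibreSphere q θ' ψ)
    ![Complex.I * q.2 * (Real.cos θ * Real.cos ψ), Complex.I * q.2 * (Real.cos θ * Real.sin ψ),
      0, Complex.I * q.2 * -Real.sin θ] θ := by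
  have h1 := (Real.hasDerivAt_sin θ).ofReal_comp
  have h2 := (Real.hasDerivAt_cos θ).ofReal_comp
  refine hasDerivAt_pi.2 fun i => ?_
  fin_cases i
  · exact (h1.mul_const _).const_mul _
  · exact (h1.mul_const _).const_mul _
  · exact hasDerivAt_const _ _
  · simpa [fibreSphere] using h2.const_mul (Complex.I * q.2)

theorem hasDerivAt_fibreSphere_psi : HasDerivAt (fun ψ' => fibreSphere q θ ψ')
    ![Complex.I * q.2 * (Real.sin θ * -Real.sin ψ), Complex.I * q.2 * (Real.sin θ * Real.cos ψ),
      0, 0] ψ := by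
  have h1 := (Real.hasDerivAt_sin ψ).ofReal_comp
  have h2 := (Real.hasDerivAt_cos ψ).ofReal_comp
  refine hasDerivAt_pi.2 fun i => ?_
  fin_cases i
  · simpa [fibreSphere] using (h2.const_mul (Real.sin θ : ℂ)).const_mul (Complex.I * q.2)
  · exact (h1.const_mul _).const_mul _
  · exact hasDerivAt_const _ _
  · exact hasDerivAt_const _ _

theorem hasDerivAt_fibreSphere_base {c : ℝ → ℂ × ℂ} {c' : ℂ × ℂ} {s : ℝ} (hc : HasDerivAt c c' s) :
    HasDerivAt (fun s' => fibreSphere (c s') θ ψ)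
    ![Complex.I * c'.2 * (Real.sin θ * Real.cos ψ), Complex.I * c'.2 * (Real.sin θ * Real.sin ψ),
      c'.1, Complex.I * c'.2 * Real.cos θ] s := by
  have h1 : HasDerivAt (fun s => (c s).1) c'.1 s :=
    (ContinuousLinearMap.fst ℝ ℂ ℂ).hasFDerivAt.comp_hasDerivAt s hc
  have h2 : HasDerivAt (fun s => (c s).2) c'.2 s :=
    (ContinuousLinearMap.snd ℝ ℂ ℂ).hasFDerivAt.comp_hasDerivAt s hc
  refine hasDerivAt_pi.2 fun i => ?_
  fin_cases i
  · exact (h2.const_mul _).mul_const _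
  · exact (h2.const_mul _).mul_const _
  · exact h1
  · exact (h2.const_mul _).mul_const _

end Sphere

/-- A three-form whose pullback is `(i/2) sin θ · ω(b')` integrates to `-iπ ∫_b ω`. -/
theorem integralGamma_eq {a₀ a₁ : ℂ × ℂ} {b : Path a₀ a₁}
    {η : (Fin 4 → ℂ) → (Fin 4 → ℂ) [⋀^Fin 3]→L[ℂ] ℂ} {κ : ℂ × ℂ → ℂ × ℂ →L[ℂ] ℂ}
    (h : ∀ s ∈ Set.Ioo (0 : ℝ) 1, ∀ θ ψ : ℝ, Real.cos θ ≠ 0 → η (fibreSphere (b.extend s) θ ψ)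
      ![deriv (fun s' => fibreSphere (b.extend s') θ ψ) s,
        deriv (fun θ' => fibreSphere (b.extend s) θ' ψ) θ,
        deriv (fun ψ' => fibreSphere (b.extend s) θ ψ') ψ]
      = Complex.I / 2 * Real.sin θ * κ (b.extend s) (deriv b.extend s)) :
    integralGamma b η = -(Complex.I * Real.pi) * curveIntegral κ b := by
  -- (i/2) times ∫ sin θ dθ = 2 times 2π is 2πi; the factor -1/2 of the chain then gives -iπ.
  have hs : ∀ s ∈ Set.Ioo (0 : ℝ) 1,
      (∫ θ in (0 : ℝ)..Real.pi, ∫ ψ in (0 : ℝ)..(2 * Real.pi), η (fibreSphere (b.extend s) θ ψ)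
        ![deriv (fun s' => fibreSphere (b.extend s') θ ψ) s,
          deriv (fun θ' => fibreSphere (b.extend s) θ' ψ) θ,
          deriv (fun ψ' => fibreSphere (b.extend s) θ ψ') ψ])
        = 2 * (Complex.I * Real.pi) * κ (b.extend s) (deriv b.extend s) := by
    intro s hs
    have h1 : ∀ θ : ℝ, Real.cos θ ≠ 0 → (∫ ψ in (0 : ℝ)..(2 * Real.pi),
        η (fibreSphere (b.extend s) θ ψ)
        ![deriv (fun s' => fibreSphere (b.extend s') θ ψ) s,
          deriv (fun θ' => fibreSphere (b.extend s) θ' ψ) θ,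
          deriv (fun ψ' => fibreSphere (b.extend s) θ ψ') ψ])
        = Real.sin θ * (Complex.I * Real.pi * κ (b.extend s) (deriv b.extend s)) := by
      intro θ hθ
      rw [intervalIntegral.integral_congr (g := fun _ => Complex.I / 2 * Real.sin θ
        * κ (b.extend s) (deriv b.extend s)) fun ψ _ => h s hs θ ψ hθ,
        intervalIntegral.integral_const, Complex.real_smul]
      push_cast
      ring
    -- The equator, where z = 0 and the expression for Ω breaks down, is a null set.
    have h2 : ∀ᵐ θ : ℝ, θ ≠ Real.pi / 2 :=
      (Set.countable_singleton (Real.pi / 2)).ae_notMem MeasureTheory.volume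
    rw [intervalIntegral.integral_congr_ae (g := fun θ => (Real.sin θ : ℂ)
      * (Complex.I * Real.pi * κ (b.extend s) (deriv b.extend s))) ?_,
      intervalIntegral.integral_mul_const, intervalIntegral.integral_ofReal, integral_sin]
    · simp
      ring
    · filter_upwards [h2] with θ hθ hθm
      rw [Set.uIoc_of_le Real.pi_pos.le] at hθm
      refine h1 θ fun hcos => hθ ?_
      refine Real.injOn_cos ⟨hθm.1.le, hθm.2⟩ ⟨by positivity, by linarith [Real.pi_pos]⟩ ?_
      rw [hcos, Real.cos_pi_div_two]
  rw [integralGamma, curveIntegral_eq_intervalIntegral_deriv,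
    intervalIntegral.integral_congr_ae (g := fun s => 2 * (Complex.I * Real.pi)
      * κ (b.extend s) (deriv b.extend s)) ?_, intervalIntegral.integral_const_mul]
  · ring
  · have h2 : ∀ᵐ s : ℝ, s ≠ 1 :=
      (Set.countable_singleton (1 : ℝ)).ae_notMem MeasureTheory.volume
    filter_upwards [h2] with s hs1 hsm
    rw [Set.uIoc_of_le zero_le_one] at hsm
    exact hs s ⟨hsm.1, lt_of_le_of_ne hsm.2 hs1⟩

/-- The two sphere tangents have no x-component, so only dx of the base direction times dv ∧ dw of
the sphere tangents survives. The latter is -y² sin θ cos θ, whose cos θ cancels against z = iy cos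
θ. -/
theorem Omega_fibreSphere (q q' : ℂ × ℂ) {θ : ℝ} (ψ : ℝ) (hq : q.2 ≠ 0) (hθ : Real.cos θ ≠ 0) :
    Omega (fibreSphere q θ ψ)
      ![![Complex.I * q'.2 * (Real.sin θ * Real.cos ψ), Complex.I * q'.2 * (Real.sin θ * Real.sin ψ),
          q'.1, Complex.I * q'.2 * Real.cos θ],
        ![Complex.I * q.2 * (Real.cos θ * Real.cos ψ), Complex.I * q.2 * (Real.cos θ * Real.sin ψ),
          0, Complex.I * q.2 * -Real.sin θ],
        ![Complex.I * q.2 * (Real.sin θ * -Real.sin ψ), Complex.I * q.2 * (Real.sin θ * Real.cos ψ),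
          0, 0]] = Complex.I / 2 * Real.sin θ * (q.2 * q'.1) := by
  have hψ : (Real.sin ψ : ℂ) ^ 2 + (Real.cos ψ : ℂ) ^ 2 = 1 := by
    exact_mod_cast Real.sin_sq_add_cos_sq ψ
  have hθ' : (Real.cos θ : ℂ) ≠ 0 := by exact_mod_cast hθ
  rw [Omega, ContinuousAlternatingMap.smul_apply, wedge_three_apply]
  simp only [fibreSphere, Matrix.cons_val, smul_eq_mul]
  generalize (Real.cos θ : ℂ) = c₁ at *
  generalize (Real.sin θ : ℂ) = s₁ at *
  generalize (Real.cos ψ : ℂ) = c₂ at *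
  generalize (Real.sin ψ : ℂ) = s₂ at *
  field_simp
  linear_combination (c₁ * s₁ * q.2 * q'.1) * hψ

namespace MarkedCurve

variable {g : ℕ} {C : MarkedCurve g}

theorem fibreSphere_mem_Xdef {q : ℂ × ℂ} (hq : q ∈ C.affine) (θ ψ : ℝ) :
    fibreSphere q θ ψ ∈ C.Xdef := by
  have hψ : (Real.sin ψ : ℂ) ^ 2 + (Real.cos ψ : ℂ) ^ 2 = 1 := by
    exact_mod_cast Real.sin_sq_add_cos_sq ψ
  have hθ : (Real.sin θ : ℂ) ^ 2 + (Real.cos θ : ℂ) ^ 2 = 1 := by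
    exact_mod_cast Real.sin_sq_add_cos_sq θ
  have hq' : q.2 ^ 2 = C.ySq.eval q.1 := hq
  change C.ySq.eval (fibreSphere q θ ψ 2) + fibreSphere q θ ψ 0 ^ 2 + fibreSphere q θ ψ 1 ^ 2
    + fibreSphere q θ ψ 3 ^ 2 = 0
  simp only [fibreSphere, Matrix.cons_val]
  rw [← hq']
  linear_combination (q.2 ^ 2 * (Real.sin θ : ℂ) ^ 2 * Complex.I ^ 2) * hψ
    + q.2 ^ 2 * Complex.I ^ 2 * hθ + q.2 ^ 2 * Complex.I_sq

/-- On vectors tangent to the quadric v² + w² + z² = const, z times the radial two-form equals (v² +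
w² + z²) dv ∧ dw. -/
theorem Phi_eq_PhiFibre (R : ℂ[X]) {p : Fin 4 → ℂ} (hp : p ∈ C.Xdef) (hz : p 3 ≠ 0)
    {a b : Fin 4 → ℂ} (ha : p 0 * a 0 + p 1 * a 1 + p 3 * a 3 = 0)
    (hb : p 0 * b 0 + p 1 * b 1 + p 3 * b 3 = 0) :
    C.Phi R p ![a, b] = C.PhiFibre R p ![a, b] := by
  have hp' : C.ySq.eval (p 2) + p 0 ^ 2 + p 1 ^ 2 + p 3 ^ 2 = 0 := hp
  simp only [Phi, PhiFibre, ContinuousAlternatingMap.smul_apply, ContinuousAlternatingMap.add_apply,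
    wedge_two_apply, smul_eq_mul, Matrix.cons_val]
  -- On a singular fibre W'² + f vanishes too, and both sides are 0 because of the division by zero.
  by_cases hN : p 0 ^ 2 + p 1 ^ 2 + p 3 ^ 2 = 0
  · have h0 : C.ySq.eval (p 2) = 0 := by linear_combination hp' - hN
    rw [h0]
    simp
  · have key : (p 0 * (a 1 * b 3 - a 3 * b 1) + p 1 * (a 3 * b 0 - a 0 * b 3)
        + p 3 * (a 0 * b 1 - a 1 * b 0)) * p 3
        = (p 0 ^ 2 + p 1 ^ 2 + p 3 ^ 2) * (a 0 * b 1 - a 1 * b 0) := by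
      linear_combination (p 1 * b 0 - p 0 * b 1) * ha + (p 0 * a 1 - p 1 * a 0) * hb
    have key' : 1 / (2 * (p 0 ^ 2 + p 1 ^ 2 + p 3 ^ 2)) * (p 0 * (a 1 * b 3 - a 3 * b 1)
        + p 1 * (a 3 * b 0 - a 0 * b 3) + p 3 * (a 0 * b 1 - a 1 * b 0))
        = 1 / (2 * p 3) * (a 0 * b 1 - a 1 * b 0) := by
      rw [div_mul_eq_mul_div, div_mul_eq_mul_div, div_eq_div_iff (mul_ne_zero two_ne_zero hN)
        (mul_ne_zero two_ne_zero hz)]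
      linear_combination 2 * key
    rw [mul_assoc, mul_assoc, key']

/-- `Φ` is a scalar multiple of a linear function of the point. -/
def contraction : (Fin 4 → ℂ) →L[ℂ] (Fin 4 → ℂ) [⋀^Fin 2]→L[ℂ] ℂ :=
  (dCoord 0).smulRight (wedge ![dCoord 1, dCoord 3])
    + (dCoord 1).smulRight (wedge ![dCoord 3, dCoord 0])
    + (dCoord 3).smulRight (wedge ![dCoord 0, dCoord 1])

theorem contraction_apply (p : Fin 4 → ℂ) (m : Fin 2 → Fin 4 → ℂ) :
    contraction p m = p 0 * (m 0 1 * m 1 3 - m 0 3 * m 1 1)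
      + p 1 * (m 0 3 * m 1 0 - m 0 0 * m 1 3) + p 3 * (m 0 0 * m 1 1 - m 0 1 * m 1 0) := by
  simp only [contraction, add_apply, ContinuousLinearMap.smulRight_apply,
    ContinuousAlternatingMap.add_apply, ContinuousAlternatingMap.smul_apply, wedge_two_apply,
    smul_eq_mul]
  rfl

/-- Φ is the scalar h/(2N) times `contraction`, which is linear in the point. The contraction thus
contributes three equal terms. The scalar is constant along the sphere tangents v and w, so its
differential is felt along u only. -/
theorem extDeriv_Phi_apply (R : ℂ[X]) {p : Fin 4 → ℂ} {h h' : ℂ}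
    (hh : HasDerivAt (fun x => (C.numerator R).eval x / C.ySq.eval x) h' (p 2))
    (hv : h = (C.numerator R).eval (p 2) / C.ySq.eval (p 2)) {N : ℂ}
    (hN : N = p 0 ^ 2 + p 1 ^ 2 + p 3 ^ 2) (hN0 : N ≠ 0) {u v w : Fin 4 → ℂ}
    (hv2 : v 2 = 0) (hvp : p 0 * v 0 + p 1 * v 1 + p 3 * v 3 = 0)
    (hw2 : w 2 = 0) (hwp : p 0 * w 0 + p 1 * w 1 + p 3 * w 3 = 0) :
    extDeriv (C.Phi R) p ![u, v, w]
      = (h' * u 2 / (2 * N) - h * (p 0 * u 0 + p 1 * u 1 + p 3 * u 3) / N ^ 2)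
          * contraction p ![v, w] + 3 * (h / (2 * N)) * contraction u ![v, w] := by
  have hpr : ∀ i : Fin 4, HasFDerivAt (fun p : Fin 4 → ℂ => p i) (dCoord i) p := fun i =>
    (dCoord i).hasFDerivAt
  have h1 : HasFDerivAt (fun p : Fin 4 → ℂ => (C.numerator R).eval (p 2) / C.ySq.eval (p 2))
      (h' • dCoord 2) p := HasDerivAt.comp_hasFDerivAt (f := fun p : Fin 4 → ℂ => p 2) p hh (hpr 2)
  have h2 : HasFDerivAt (fun p : Fin 4 → ℂ => 2 * (p 0 ^ 2 + p 1 ^ 2 + p 3 ^ 2))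
      ((4 * p 0) • dCoord 0 + (4 * p 1) • dCoord 1 + (4 * p 3) • dCoord 3) p := by
    have := ((((hpr 0).pow 2).add ((hpr 1).pow 2)).add ((hpr 3).pow 2)).const_mul 2
    refine this.congr_fderiv ?_
    ext x
    simp
    ring
  have h3 : HasFDerivAt (fun p : Fin 4 → ℂ => 1 / (2 * (p 0 ^ 2 + p 1 ^ 2 + p 3 ^ 2)))
      (-((2 * N) ^ 2)⁻¹ • ((4 * p 0) • dCoord 0 + (4 * p 1) • dCoord 1 + (4 * p 3) • dCoord 3)) p := by
    have := (hasDerivAt_inv (x := 2 * N) (mul_ne_zero two_ne_zero hN0))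
    simp only [one_div]
    rw [hN] at this ⊢
    exact this.comp_hasFDerivAt p h2
  have h4 : C.Phi R = fun p => ((C.numerator R).eval (p 2) / C.ySq.eval (p 2)
      * (1 / (2 * (p 0 ^ 2 + p 1 ^ 2 + p 3 ^ 2)))) • contraction p := by
    funext p
    ext m
    simp only [Phi, ContinuousAlternatingMap.smul_apply, ContinuousAlternatingMap.add_apply,
      contraction_apply, wedge_two_apply, smul_eq_mul]
  have h5 := HasFDerivAt.fun_smul (𝕜 := ℂ) (𝕜' := ℂ) (h1.fun_mul h3)
    (contraction.hasFDerivAt (x := p))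
  rw [← h4] at h5
  have hd : ∀ (x : Fin 4 → ℂ) (m : Fin 2 → Fin 4 → ℂ), fderiv ℂ (C.Phi R) p x m
      = h / (2 * N) * contraction x m
        + (h' * x 2 / (2 * N) - h * (p 0 * x 0 + p 1 * x 1 + p 3 * x 3) / N ^ 2)
          * contraction p m := by
    intro x m
    rw [h5.fderiv, ← hN, ← hv]
    simp only [add_apply, smul_apply, ContinuousLinearMap.smulRight_apply,
      ContinuousAlternatingMap.add_apply, ContinuousAlternatingMap.smul_apply, smul_eq_mul, dCoord,
      ContinuousLinearMap.proj_apply]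
    field_simp
    ring
  have r0 : Fin.removeNth (0 : Fin 3) ![u, v, w] = ![v, w] := by ext i; fin_cases i <;> rfl
  have r1 : Fin.removeNth (1 : Fin 3) ![u, v, w] = ![u, w] := by ext i; fin_cases i <;> rfl
  have r2 : Fin.removeNth (2 : Fin 3) ![u, v, w] = ![u, v] := by ext i; fin_cases i <;> rfl
  have hc1 : contraction v ![u, w] = -contraction u ![v, w] := by
    simp only [contraction_apply, Matrix.cons_val]
    ring
  have hc2 : contraction w ![u, v] = contraction u ![v, w] := by
    simp only [contraction_apply, Matrix.cons_val]
    ring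
  rw [extDeriv, ContinuousAlternatingMap.alternatizeUncurryFin_apply, Fin.sum_univ_three, r0, r1, r2]
  simp only [Matrix.cons_val, hd, hc1, hc2, hv2, hw2, hvp, hwp]
  simp
  ring

end MarkedCurve

namespace MarkedCurve

variable {g : ℕ} {C : MarkedCurve g}

theorem contraction_sphere (α β x' : ℂ) (θ ψ : ℝ) :
    contraction ![Complex.I * α * (Real.sin θ * Real.cos ψ), Complex.I * α * (Real.sin θ * Real.sin ψ),
        x', Complex.I * α * Real.cos θ]
      ![![Complex.I * β * (Real.cos θ * Real.cos ψ), Complex.I * β * (Real.cos θ * Real.sin ψ),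
          0, Complex.I * β * -Real.sin θ],
        ![Complex.I * β * (Real.sin θ * -Real.sin ψ), Complex.I * β * (Real.sin θ * Real.cos ψ),
          0, 0]] = -(Complex.I * α * β ^ 2 * Real.sin θ) := by
  have hψ : (Real.sin ψ : ℂ) ^ 2 + (Real.cos ψ : ℂ) ^ 2 = 1 := by
    exact_mod_cast Real.sin_sq_add_cos_sq ψ
  have hθ : (Real.sin θ : ℂ) ^ 2 + (Real.cos θ : ℂ) ^ 2 = 1 := by
    exact_mod_cast Real.sin_sq_add_cos_sq θ
  rw [contraction_apply]
  simp only [Matrix.cons_val]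
  generalize (Real.cos θ : ℂ) = c₁ at *
  generalize (Real.sin θ : ℂ) = s₁ at *
  generalize (Real.cos ψ : ℂ) = c₂ at *
  generalize (Real.sin ψ : ℂ) = s₂ at *
  linear_combination (Complex.I ^ 3 * α * β ^ 2 * s₁ * (s₁ ^ 2 + c₁ ^ 2)) * hψ
    + Complex.I ^ 3 * α * β ^ 2 * s₁ * hθ + Complex.I * α * β ^ 2 * s₁ * Complex.I_sq

theorem fderiv_phi_apply (R : ℂ[X]) {q : ℂ × ℂ} (hq : q.2 ≠ 0) (q' : ℂ × ℂ) :
    fderiv ℂ (C.phi R) q q' = (derivative (C.numerator R)).eval q.1 * q'.1 / q.2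
      - (C.numerator R).eval q.1 * q'.2 / q.2 ^ 2 := by
  have h1 : HasFDerivAt (fun q : ℂ × ℂ => (C.numerator R).eval q.1)
      ((derivative (C.numerator R)).eval q.1 • ContinuousLinearMap.fst ℂ ℂ ℂ) q :=
    HasDerivAt.comp_hasFDerivAt (f := Prod.fst) q ((C.numerator R).hasDerivAt q.1) hasFDerivAt_fst
  have h2 : HasFDerivAt (fun q : ℂ × ℂ => q.2⁻¹)
      (-(q.2 ^ 2)⁻¹ • ContinuousLinearMap.snd ℂ ℂ ℂ) q :=
    HasDerivAt.comp_hasFDerivAt (f := Prod.snd) q (hasDerivAt_inv hq) hasFDerivAt_snd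
  have h3 := h1.fun_mul h2
  have h4 : C.phi R = fun q => (C.numerator R).eval q.1 * q.2⁻¹ := by
    funext q
    rw [phi, div_eq_mul_inv]
  rw [h4, h3.fderiv]
  simp only [add_apply, smul_apply, ContinuousLinearMap.coe_fst', ContinuousLinearMap.coe_snd',
    smul_eq_mul]
  field_simp
  ring

/-- With h = P/(W'² + f) and N = -y² the terms combine to (i/2) sin θ (h'x'y + hy'), which is (i/2)
sin θ times d(hy) = dφ. The tangency hypothesis enters because h is differentiated as a function of
x alone, whereas φ = P/y depends on x and y separately. -/
theorem extDeriv_Phi_fibreSphere (R : ℂ[X]) {q q' : ℂ × ℂ} (hq : q ∈ C.affine) (hq0 : q.2 ≠ 0)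
    (htan : (derivative C.ySq).eval q.1 * q'.1 = 2 * q.2 * q'.2) (θ ψ : ℝ) :
    extDeriv (C.Phi R) (fibreSphere q θ ψ)
      ![![Complex.I * q'.2 * (Real.sin θ * Real.cos ψ), Complex.I * q'.2 * (Real.sin θ * Real.sin ψ),
          q'.1, Complex.I * q'.2 * Real.cos θ],
        ![Complex.I * q.2 * (Real.cos θ * Real.cos ψ), Complex.I * q.2 * (Real.cos θ * Real.sin ψ),
          0, Complex.I * q.2 * -Real.sin θ],
        ![Complex.I * q.2 * (Real.sin θ * -Real.sin ψ), Complex.I * q.2 * (Real.sin θ * Real.cos ψ),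
          0, 0]] = Complex.I / 2 * Real.sin θ * fderiv ℂ (C.phi R) q q' := by
  have hψ : (Real.sin ψ : ℂ) ^ 2 + (Real.cos ψ : ℂ) ^ 2 = 1 := by
    exact_mod_cast Real.sin_sq_add_cos_sq ψ
  have hθ : (Real.sin θ : ℂ) ^ 2 + (Real.cos θ : ℂ) ^ 2 = 1 := by
    exact_mod_cast Real.sin_sq_add_cos_sq θ
  have hy : C.ySq.eval q.1 = q.2 ^ 2 := (show q.2 ^ 2 = C.ySq.eval q.1 from hq).symm
  have hy0 : C.ySq.eval q.1 ≠ 0 := hy ▸ pow_ne_zero 2 hq0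
  have hI := Complex.I_sq
  have hh := ((C.numerator R).hasDerivAt q.1).div (C.ySq.hasDerivAt q.1) hy0
  rw [extDeriv_Phi_apply R (p := fibreSphere q θ ψ) (N := -q.2 ^ 2) hh rfl ?_
    (neg_ne_zero.2 (pow_ne_zero 2 hq0)) rfl ?_ rfl ?_, contraction_sphere]
  · rw [fibreSphere, contraction_sphere, fderiv_phi_apply R hq0]
    simp only [Matrix.cons_val]
    rw [show Complex.I * q.2 * (Real.sin θ * Real.cos ψ)
        * (Complex.I * q'.2 * (Real.sin θ * Real.cos ψ))
        + Complex.I * q.2 * (Real.sin θ * Real.sin ψ) * (Complex.I * q'.2 * (Real.sin θ * Real.sin ψ))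
        + Complex.I * q.2 * Real.cos θ * (Complex.I * q'.2 * Real.cos θ) = -(q.2 * q'.2) by
      linear_combination (Complex.I ^ 2 * q.2 * q'.2 * (Real.sin θ : ℂ) ^ 2) * hψ
        + Complex.I ^ 2 * q.2 * q'.2 * hθ + q.2 * q'.2 * hI, hy]
    generalize (Real.sin θ : ℂ) = s₁
    have h2 : (derivative C.ySq).eval q.1 * q'.1 - 2 * q.2 * q'.2 = 0 := by rw [htan, sub_self]
    field_simp
    linear_combination (-(s₁ * (C.numerator R).eval q.1)) * h2
  · simp only [fibreSphere, Matrix.cons_val]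
    linear_combination (-Complex.I ^ 2 * q.2 ^ 2 * (Real.sin θ : ℂ) ^ 2) * hψ
      - Complex.I ^ 2 * q.2 ^ 2 * hθ - q.2 ^ 2 * hI
  · simp only [fibreSphere, Matrix.cons_val]
    linear_combination (Complex.I ^ 2 * q.2 ^ 2 * (Real.sin θ : ℂ) * Real.cos θ) * hψ
  · simp only [fibreSphere, Matrix.cons_val]
    ring

variable {L : ℝ} {b : Path ((L : ℂ), -C.y0 L) ((L : ℂ), C.y0 L)} (hb : C.IsBetaHat L b)
include hb

theorem IsBetaHat.hasDerivAt {s : ℝ} (hs : s ∈ Set.Ioo (0 : ℝ) 1) :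
    HasDerivAt b.extend (deriv b.extend s) s :=
  ((hb.smooth.differentiableOn one_ne_zero).differentiableAt
    (Icc_mem_nhds hs.1 hs.2)).hasDerivAt

theorem IsBetaHat.extend_mem {s : ℝ} (hs : s ∈ Set.Icc (0 : ℝ) 1) : b.extend s ∈ C.affine := by
  rw [Path.extend_apply b hs]
  exact hb.mem _

theorem IsBetaHat.extend_ne_zero {s : ℝ} (hs : s ∈ Set.Icc (0 : ℝ) 1) : (b.extend s).2 ≠ 0 := by
  rw [Path.extend_apply b hs]
  exact hb.avoids _

theorem IsBetaHat.tangent {s : ℝ} (hs : s ∈ Set.Ioo (0 : ℝ) 1) :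
    (derivative C.ySq).eval (b.extend s).1 * (deriv b.extend s).1
      = 2 * (b.extend s).2 * (deriv b.extend s).2 := by
  have h := IsBetaHat.hasDerivAt hb hs
  have h1 : HasDerivAt (fun s => (b.extend s).1) (deriv b.extend s).1 s :=
    (ContinuousLinearMap.fst ℝ ℂ ℂ).hasFDerivAt.comp_hasDerivAt s h
  have h2 : HasDerivAt (fun s => (b.extend s).2) (deriv b.extend s).2 s :=
    (ContinuousLinearMap.snd ℝ ℂ ℂ).hasFDerivAt.comp_hasDerivAt s h
  have h3 : HasDerivAt (fun s => (b.extend s).2 ^ 2) (2 * (b.extend s).2 * (deriv b.extend s).2) s := by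
    simpa using h2.fun_pow 2
  have h4 := (C.ySq.hasDerivAt (b.extend s).1).comp s h1
  refine h4.unique (h3.congr_of_eventuallyEq ?_)
  filter_upwards [Icc_mem_nhds hs.1 hs.2] with r hr
  exact (IsBetaHat.extend_mem hb hr).symm

theorem integralGamma_Omega :
    integralGamma b Omega = -(Complex.I * Real.pi) * curveIntegral zeta b := by
  refine integralGamma_eq fun s hs θ ψ hθ => ?_
  rw [(hasDerivAt_fibreSphere_base θ ψ (IsBetaHat.hasDerivAt hb hs)).deriv,
    (hasDerivAt_fibreSphere_theta _ θ ψ).deriv, (hasDerivAt_fibreSphere_psi _ θ ψ).deriv,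
    Omega_fibreSphere _ _ _ (IsBetaHat.extend_ne_zero hb (Set.Ioo_subset_Icc_self hs)) hθ]
  rfl

theorem integralGamma_extDeriv_Phi (R : ℂ[X]) :
    integralGamma b (extDeriv (C.Phi R))
      = -(Complex.I * Real.pi) * curveIntegral (fderiv ℂ (C.phi R)) b := by
  refine integralGamma_eq fun s hs θ ψ _ => ?_
  rw [(hasDerivAt_fibreSphere_base θ ψ (IsBetaHat.hasDerivAt hb hs)).deriv,
    (hasDerivAt_fibreSphere_theta _ θ ψ).deriv, (hasDerivAt_fibreSphere_psi _ θ ψ).deriv,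
    extDeriv_Phi_fibreSphere R (IsBetaHat.extend_mem hb (Set.Ioo_subset_Icc_self hs))
      (IsBetaHat.extend_ne_zero hb (Set.Ioo_subset_Icc_self hs)) (IsBetaHat.tangent hb hs)]

theorem liftedPairing_eq (R : ℂ[X]) :
    C.liftedPairing b R = -(Complex.I * Real.pi) * regPairing b zeta (C.phi R) := by
  refine integralGamma_eq fun s hs θ ψ hθ => ?_
  rw [ContinuousAlternatingMap.sub_apply,
    (hasDerivAt_fibreSphere_base θ ψ (IsBetaHat.hasDerivAt hb hs)).deriv,
    (hasDerivAt_fibreSphere_theta _ θ ψ).deriv, (hasDerivAt_fibreSphere_psi _ θ ψ).deriv,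
    Omega_fibreSphere _ _ _ (IsBetaHat.extend_ne_zero hb (Set.Ioo_subset_Icc_self hs)) hθ,
    extDeriv_Phi_fibreSphere R (IsBetaHat.extend_mem hb (Set.Ioo_subset_Icc_self hs))
      (IsBetaHat.extend_ne_zero hb (Set.Ioo_subset_Icc_self hs)) (IsBetaHat.tangent hb hs),
    ← mul_sub]
  rfl

end MarkedCurve

/-! ### Asymptotics of the pairing and final assembly. -/

namespace MarkedCurve

variable {g : ℕ} {C : MarkedCurve g} (hC : C.IsValid)
include hC

/-- The asymptotics of the regularised pairing with `ζ`. -/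
theorem exists_norm_half_regPairing_sub_le {R : ℂ[X]}
    (hR : R.degree < ((g + 1 : ℕ) : WithBot ℕ)) :
    ∃ K L₁ : ℝ, 0 < L₁ ∧ ∀ L : ℝ, L₁ ≤ L →
      ∀ b : Path ((L : ℂ), -C.y0 L) ((L : ℂ), C.y0 L), C.IsBetaHat L b →
        ‖1 / 2 * regPairing b zeta (C.phi R)
          - (C.effPotential C.lastMark - C.t * Real.log (L ^ 2))‖ ≤ K / L := by
  obtain ⟨K, L₁, hL₁, hK⟩ := exists_norm_integral_y0_sub_le hC
  obtain ⟨k₁, hk₁, hk₁0, hev₁⟩ := exists_phi_atInfinity hC hR (σ := 1) (Or.inl rfl)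
  obtain ⟨k₂, hk₂, hk₂0, hev₂⟩ := exists_phi_atInfinity hC hR (σ := -1) (Or.inr rfl)
  obtain ⟨M₁, hM₁⟩ := hk₁.exists_norm_sub_le_div
  obtain ⟨M₂, hM₂⟩ := hk₂.exists_norm_sub_le_div
  obtain ⟨L₂, hL₂⟩ := eventually_atTop.1 (hM₁.and (hM₂.and
    ((tendsto_ofReal_inv_atTop_nhdsNE.eventually hev₁).and
      (tendsto_ofReal_inv_atTop_nhdsNE.eventually hev₂))))
  refine ⟨K + M₁ / 2 + M₂ / 2, max L₁ L₂, lt_max_of_lt_left hL₁, fun L hL b hb => ?_⟩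
  obtain ⟨h1, h2, h3, h4⟩ := hL₂ L ((le_max_right _ _).trans hL)
  obtain ⟨-, h5, h6⟩ := hK L ((le_max_left _ _).trans hL)
  rw [atInfinity, inv_inv, one_mul, one_mul] at h3
  rw [atInfinity, inv_inv, neg_one_mul, neg_one_mul] at h4
  rw [hk₁0, sub_zero] at h1
  rw [hk₂0, sub_zero] at h2
  rw [regPairing_eq_sub hb.smooth fun r => analyticAt_phi R (hb.avoids r), h3, h4,
    curveIntegral_zeta hC h5 hb, Real.log_pow]
  set J := ∫ s in C.lastMark..L, deriv C.path s * C.y0 (C.path s)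
  -- The end point values of φ differ by 2W(L) up to O(1/L), which cancels the polynomial growth of
  -- 2J.
  rw [show 1 / 2 * (2 * J - (C.W.eval (L : ℂ) + k₁ (L : ℂ)⁻¹
      - (-C.W.eval (L : ℂ) + k₂ (L : ℂ)⁻¹)))
      - (C.effPotential C.lastMark - C.t * ((2 : ℕ) * Real.log L : ℝ))
    = (J - (C.effPotential C.lastMark - 2 * C.t * Real.log L + C.W.eval (L : ℂ)))
      + (k₂ (L : ℂ)⁻¹ - k₁ (L : ℂ)⁻¹) / 2 by push_cast; ring]
  refine (norm_add_le _ _).trans ?_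
  have h7 : ‖(k₂ (L : ℂ)⁻¹ - k₁ (L : ℂ)⁻¹) / 2‖ ≤ (M₂ / L + M₁ / L) / 2 := by
    rw [norm_div, Complex.norm_ofNat]
    gcongr
    exact (norm_sub_le _ _).trans (add_le_add h2 h1)
  calc _ ≤ K / L + (M₂ / L + M₁ / L) / 2 := add_le_add h6 h7
    _ = (K + M₁ / 2 + M₂ / 2) / L := by ring

end MarkedCurve

end

theorem mainTheorem4 {g : ℕ} (C : MarkedCurve g) (hC : C.IsValid)
    (R : ℂ[X]) (hR : R.degree < ((g + 1 : ℕ) : WithBot ℕ)) :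
    -- simple poles at the two points at infinity, and the normalisation of the constant in `φ`
    (∀ σ : ℂ, σ = 1 ∨ σ = -1 →
      C.HasSimplePole (fun q => MarkedCurve.zeta q - fderiv ℂ (C.phi R) q) σ (σ * (2 * C.t)) ∧
      σ * (2 * C.t) ≠ 0 ∧
      ∃ k : ℂ → ℂ, AnalyticAt ℂ k 0 ∧ k 0 = 0 ∧
        ∀ᶠ u in 𝓝[≠] (0 : ℂ), C.phi R (C.atInfinity σ u) = σ * C.W.eval u⁻¹ + k u) ∧
    -- independence of the representative `ζ + dρ` of the class of `ζ`
    (∀ ρ : ℂ × ℂ → ℂ, (∀ q ∈ C.affine, AnalyticAt ℂ ρ q) →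
      (∀ σ : ℂ, σ = 1 ∨ σ = -1 →
        C.HasSimplePole (fun q => (MarkedCurve.zeta q + fderiv ℂ ρ q)
          - fderiv ℂ (fun q' => C.phi R q' + ρ q') q) σ (σ * (2 * C.t))) ∧
      (∀ (L : ℝ) (b : Path ((L : ℂ), -C.y0 L) ((L : ℂ), C.y0 L)), C.IsBetaHat L b →
        regPairing b (fun q => MarkedCurve.zeta q + fderiv ℂ ρ q) (fun q => C.phi R q + ρ q)
          = regPairing b MarkedCurve.zeta (C.phi R)) ∧
      (∀ χ : ℂ × ℂ → ℂ, {q ∈ C.affine | ¬ AnalyticAt ℂ χ q}.Finite →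
        (∀ σ : ℂ, σ = 1 ∨ σ = -1 → ∃ c : ℂ,
          C.HasSimplePole (fun q => (MarkedCurve.zeta q + fderiv ℂ ρ q) - fderiv ℂ χ q) σ c) →
        ∃ cQ cQ' : ℂ,
          Tendsto (fun u => (χ - (C.phi R + ρ)) (C.atInfinity 1 u)) (𝓝[≠] 0) (𝓝 cQ) ∧
          Tendsto (fun u => (χ - (C.phi R + ρ)) (C.atInfinity (-1) u)) (𝓝[≠] 0) (𝓝 cQ') ∧
          ∃ K L₁ : ℝ, 0 < L₁ ∧ ∀ L : ℝ, L₁ ≤ L →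
            ∀ b : Path ((L : ℂ), -C.y0 L) ((L : ℂ), C.y0 L), C.IsBetaHat L b →
              (∀ r, AnalyticAt ℂ χ (b r)) →
              ‖regPairing b (fun q => MarkedCurve.zeta q + fderiv ℂ ρ q) χ
                - (regPairing b MarkedCurve.zeta (C.phi R) - (cQ - cQ'))‖ ≤ K / L)) ∧
    -- the lift to the threefold
    ((∀ q ∈ C.affine, ∀ θ ψ : ℝ, fibreSphere q θ ψ ∈ C.Xdef) ∧
      (∀ p ∈ C.Xdef, p 3 ≠ 0 → ∀ a b : Fin 4 → ℂ,
        a 2 = 0 → p 0 * a 0 + p 1 * a 1 + p 3 * a 3 = 0 →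
        b 2 = 0 → p 0 * b 0 + p 1 * b 1 + p 3 * b 3 = 0 →
        C.Phi R p ![a, b] = C.PhiFibre R p ![a, b]) ∧
      (∀ (L : ℝ) (b : Path ((L : ℂ), -C.y0 L) ((L : ℂ), C.y0 L)), C.IsBetaHat L b →
        integralGamma b Omega = -(Complex.I * Real.pi) * curveIntegral MarkedCurve.zeta b ∧
        integralGamma b (extDeriv (C.Phi R))
          = -(Complex.I * Real.pi) * curveIntegral (fderiv ℂ (C.phi R)) b ∧
        C.liftedPairing b R
          = -(Complex.I * Real.pi) * regPairing b MarkedCurve.zeta (C.phi R))) ∧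
    -- the values of the pairings
    (∀ (F : CurveFamily g C.W) (t : ℂ) (S : Fin g → ℂ), (t, S) ∈ F.U → F.curve (t, S) = C →
      ∃ D : ℂ, HasDerivAt (fun τ : ℂ => (F.curve (τ, S)).freeEnergy) D t ∧
        ∃ K L₁ : ℝ, 0 < L₁ ∧ ∀ L : ℝ, L₁ ≤ L →
          ∀ b : Path ((L : ℂ), -C.y0 L) ((L : ℂ), C.y0 L), C.IsBetaHat L b →
            ‖1 / 2 * regPairing b MarkedCurve.zeta (C.phi R)
              - (D - t * Real.log (L ^ 2))‖ ≤ K / L ∧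
            ‖-(1 / (2 * Real.pi * Complex.I)) * C.liftedPairing b R
              - (D - t * Real.log (L ^ 2))‖ ≤ K / L) := by
  refine ⟨fun σ hσ => ⟨MarkedCurve.hasSimplePole_zeta_sub hC hR hσ, ?_,
    MarkedCurve.exists_phi_atInfinity hC hR hσ⟩, fun ρ hρ => ⟨fun σ hσ =>
      MarkedCurve.hasSimplePole_add hC hR hσ hρ, fun L b hb => MarkedCurve.regPairing_add R hρ hb,
      fun χ hχ hc => MarkedCurve.exists_norm_regPairing_sub_le hC hR hρ hχ hc⟩,
    ⟨fun q hq θ ψ => MarkedCurve.fibreSphere_mem_Xdef hq θ ψ,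
      fun p hp hz a b _ ha _ hb => MarkedCurve.Phi_eq_PhiFibre R hp hz ha hb,
      fun L b hb => ⟨MarkedCurve.integralGamma_Omega hb, MarkedCurve.integralGamma_extDeriv_Phi hb R,
        MarkedCurve.liftedPairing_eq hb R⟩⟩, fun F t S hU hFC => ?_⟩
  · have := MarkedCurve.t_ne_zero hC
    rcases hσ with rfl | rfl <;> simpa using this
  · have ht : C.t = t := by rw [← hFC]; exact F.coord_t _ hU
    have hD := F.hasDerivAt_freeEnergy hU
    rw [hFC] at hD
    obtain ⟨K, L₁, hL₁, hK⟩ := MarkedCurve.exists_norm_half_regPairing_sub_le hC hR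
    refine ⟨_, hD, K, L₁, hL₁, fun L hL b hb => ⟨?_, ?_⟩⟩
    · rw [← ht]
      exact hK L hL b hb
    -- Since -1/(2πi) times -iπ is 1/2, the estimate on the threefold is the one on the curve.
    · rw [← ht, MarkedCurve.liftedPairing_eq hb, show -(1 / (2 * Real.pi * Complex.I))
        * (-(Complex.I * Real.pi) * regPairing b MarkedCurve.zeta (C.phi R))
        = 1 / 2 * regPairing b MarkedCurve.zeta (C.phi R) by
          have hpi : (Real.pi : ℂ) ≠ 0 := Complex.ofReal_ne_zero.2 Real.pi_ne_zero
          field_simp]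
      exact hK L hL b hb
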